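/- **Setting.** Let $m>0$, $|a|\le m$, $\Sigma=r^2+a^2\cos^2\theta$, $\Delta=r^2-2mr+a^2$, $r_+=m+\sqrt{m^2-a^2}$, and let $\bar g$ be the Kerr metric (signature $-+++$) in Boyer–Lindquist coordinates $(t,r,\theta,\phi)$ on the exterior $r>r_+$, in Weyl–Papapetrou form $$\bar g=e^{-2\gamma}(-N^2dt^2+q_{ab}dx^adx^b)+e^{2\gamma}(d\phi+\mathcal A_0dt)^2 ,\qquad N=\sqrt\Delta\,\sin\theta ,$$ where $a,b,c,d\in\{r,\theta\}$, $\bar\mu_q=\sqrt{\det q}$, $\varepsilon^{r\theta}=\varepsilon_{r\theta}=1$ is the Levi-Civita symbol, and $\omega$ is the gravitational twist potential, $\partial_a\mathcal A_0+Ne^{-4\gamma}\varepsilon_{ab}\bar\mu_qq^{bc}\partial_c\omega=0$. The orbit space is $\boldsymbol\Sigma=\{r>r_+,\,0<\theta<\pi\}$, with axis $\Gamma=\{\theta=0,\pi\}$ and horizon $\mathcal H^+=\{r=r_+\}$. Let $$\ell=\tfrac1\Delta\big((r^2+a^2)\partial_t+\Delta\partial_r+a\partial_\phi\big),\quad n=\tfrac1{2\Sigma}\big((r^2+a^2)\partial_t-\Delta\partial_r+a\partial_\phi\big),\quad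 m=\tfrac{1}{\sqrt2(r+ia\cos\theta)}\big(ia\sin\theta\,\partial_t+\partial_\theta+\tfrac{i}{\sin\theta}\partial_\phi\big)$$ be the Kinnersley tetrad, with $m^*$ the conjugate of $m$. Let $F$ be a smooth axially symmetric two-form on the exterior (smooth also across the axis) with $dF=0$ and $\nabla^\mu F_{\mu\nu}=0$, whose data on $\{t=0\}$ have compact support in the open slice $\{r>r_+\}$. Put $\mathfrak E^i=\sqrt{-\det\bar g}\,F^{0i}$, $\mathfrak B^i=\frac12\varepsilon^{ijk}F_{jk}$, $u=\mathfrak B^\phi$, $v=-\mathfrak E^\phi$, and let $$\Phi_0=F(\ell,m),\qquad \Phi_1=\tfrac12\big(F(\ell,n)+F(m^*,m)\big),\qquad \Phi_2=F(m^*,n)$$ be the Maxwell scalars. With $X_{[\mu}Y_{\nu]}=X_\mu Y_\nu-X_\nu Y_\mu$ set $$\mathcal R=\mathrm{Re}\big(\Phi_0\,m^*_{[\cdot}n_{\cdot]}+\Phi_1(n_{[\cdot}\ell_{\cdot]}+m_{[\cdot}m^*_{\cdot]})+\Phi_2\,\ell_{[\cdot}m_{\cdot]}\big),$$ $\mathcal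 R_{\mu\nu}$ and $\mathcal R^{\mu\nu}$ being its components with indices down and up. In the Weyl coordinates $\bar\rho=\sqrt\Delta\sin\theta$, $\bar z=(r-m)\cos\theta$, which identify $\boldsymbol\Sigma$ with the half-plane $\bar\rho>0$ and send $\Gamma\cup\mathcal H^+$ to $\bar\rho=0$, let $$K=\tfrac1{2\pi}\log\varrho-\tfrac1{2\pi}\log\varrho',$$ with $\varrho,\varrho'$ the Euclidean distances of a point from $(\bar\rho,\bar z)$ and from the image point $(-\bar\rho,\bar z)$. For a scalar density $S$ of weight one on $\boldsymbol\Sigma$, let $S\star K$ be the convolution $x\mapsto\int_{\boldsymbol\Sigma}K(x,y)\,S(y)\,d^2y$. A twist potential of $\mathfrak E$ (of $\mathfrak B$) on a slice $\{t=\text{const}\}$ is a differentiable function $\eta$ (respectively $\lambda$) on $\boldsymbol\Sigma$ with $\mathfrak E^a=\varepsilon^{ab}\partial_b\eta$ (respectively $\mathfrak B^a=\varepsilon^{ab}\partial_b\lambda$) that tends to $0$ at $\Gamma$. **Theorem.** (1) $K$ is the Dirichlet Green's function of the half-plane: it vanishes when either point has $\bar\rho=0$ (axis and horizon), and $\int K(x,\cdot)\,\Delta_{\rm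 flat}f=f(x)$ for all $x$ in the half-plane and all test functions $f\in C_c^\infty(\{\bar\rho>0\})$. For every $t$, $\mathfrak E$ and $\mathfrak B$ have unique twist potentials $\eta$ and $\lambda$ on the slice; these are given by the (absolutely convergent) formulas $$\eta=\partial_b\big(2Ne^{-2\gamma}\bar\mu_q^2\,q^{ab}\,\varepsilon_{ca}\,\mathcal R^{0c}\big)\star K,\qquad \lambda=\partial_b\big(2\bar\mu_q\,q^{ab}\,\mathcal R_{a\phi}\big)\star K ,$$ and they also tend to $0$ at the horizon along each line $\theta=\text{const}\in(0,\pi)$. (2) For $s\in[0,1]$ let $H^{\rm NPM}_s(\Phi_0,\Phi_1,\Phi_2)$ be the nonlocal functional $$\int_{\boldsymbol\Sigma}\Big\{\tfrac12Ne^{2\gamma}\bar\mu_q^{-1}(u^2+v^2)+\tfrac12N\bar\mu_qq^{ab}e^{-2\gamma}\big(P_aP_b+Q_aQ_b\big)+2s(1-s)N\bar\mu_qq^{ab}e^{-2\gamma}\big(\partial_a\gamma\,\partial_b\gamma+\tfrac14e^{-4\gamma}\partial_a\omega\,\partial_b\omega\big)(\lambda^2+\eta^2)\Big\}d^2x,$$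 $$P_a=\partial_a\lambda-2s\lambda\,\partial_a\gamma-(1-s)\eta\,e^{-2\gamma}\partial_a\omega,\qquad Q_a=\partial_a\eta-2(1-s)\eta\,\partial_a\gamma+s\lambda\,e^{-2\gamma}\partial_a\omega,$$ in which $u=2\mathcal R_{r\theta}$, $v=-2e^{-2\gamma}N\bar\mu_q\mathcal R^{0\phi}$, $\partial_a\lambda=2\mathcal R_{a\phi}$, $\partial_a\eta=2e^{-2\gamma}N\bar\mu_q\,\varepsilon_{ca}\mathcal R^{0c}$, and $\eta,\lambda$ themselves are replaced by the formulas of (1). Then for every $s\in[0,1]$: at every time $t$ the integral converges absolutely and equals the twist-potential energy, that is, the same expression evaluated on the twist potentials $(\eta,\lambda)$ and $(u,v)$ of $F$; $H^{\rm NPM}_s\ge0$, with equality if and only if $\Phi_0=\Phi_1=\Phi_2=0$ on the slice; and $H^{\rm NPM}_s$ is conserved, i.e. independent of $t$. -/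

import Mathlib

open scoped ContDiff Topology

noncomputable section

namespace KerrMaxwell

/-! ### The Kerr metric in Boyer-Lindquist coordinates `(t, r, θ, φ)`, indexed by `0, 1, 2, 3` -/

/-- `Σ = r² + a² cos² θ`. -/
def sigma (a r θ : ℝ) : ℝ := r ^ 2 + a ^ 2 * Real.cos θ ^ 2

/-- `Δ = r² - 2 m r + a²`. -/
def delta (m a r : ℝ) : ℝ := r ^ 2 - 2 * m * r + a ^ 2

/-- The larger root `r₊` of `Δ` (the event horizon). -/
def rPlus (m a : ℝ) : ℝ := m + Real.sqrt (m ^ 2 - a ^ 2)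

/-- `(r² + a²)² - a² Δ sin² θ`. -/
def xi (m a r θ : ℝ) : ℝ := (r ^ 2 + a ^ 2) ^ 2 - a ^ 2 * delta m a r * Real.sin θ ^ 2

/-- The Kerr metric, signature `(-+++)`, as the matrix of its Boyer-Lindquist components. -/
def kerr (m a r θ : ℝ) : Matrix (Fin 4) (Fin 4) ℝ :=
  !![-(delta m a r - a ^ 2 * Real.sin θ ^ 2) / sigma a r θ, 0, 0,
        -(a * Real.sin θ ^ 2 * (r ^ 2 + a ^ 2 - delta m a r)) / sigma a r θ;
     0, sigma a r θ / delta m a r, 0, 0;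
     0, 0, sigma a r θ, 0;
     -(a * Real.sin θ ^ 2 * (r ^ 2 + a ^ 2 - delta m a r)) / sigma a r θ, 0, 0,
        xi m a r θ / sigma a r θ * Real.sin θ ^ 2]

/-- `√(-det ḡ)`. -/
def volDensity (m a r θ : ℝ) : ℝ := Real.sqrt (-(kerr m a r θ).det)

/-! ### Axially symmetric Maxwell fields

The exterior is `ℝ × {x ∈ ℝ³ : |x| > r₊}`, with the Boyer-Lindquist `(r, θ, φ)` as spherical
coordinates of `x`; the Kerr metric extends smoothly to the axis in these coordinates, so
smoothness on this set is smoothness of the field up to and including the axis. -/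

/-- The exterior region, with coordinates `(t, x, y, z)`. -/
def exterior (m a : ℝ) : Set (Fin 4 → ℝ) :=
  {p | rPlus m a ^ 2 < p 1 ^ 2 + p 2 ^ 2 + p 3 ^ 2}

/-- `(t, r, θ, φ) ↦ (t, r sin θ cos φ, r sin θ sin φ, r cos θ)`. -/
def blChart (X : Fin 4 → ℝ) : Fin 4 → ℝ :=
  ![X 0, X 1 * Real.sin (X 2) * Real.cos (X 3), X 1 * Real.sin (X 2) * Real.sin (X 3),
    X 1 * Real.cos (X 2)]

/-- Fields of two-forms on `ℝ⁴`. -/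
abbrev TwoForm : Type := (Fin 4 → ℝ) → (Fin 4 → ℝ) [⋀^Fin 2]→L[ℝ] ℝ

/-- The Boyer-Lindquist components `F_{μν} = F(∂_μ, ∂_ν)` at the point with coordinates `X`. -/
def comp (F : TwoForm) (X : Fin 4 → ℝ) (μ ν : Fin 4) : ℝ :=
  F (blChart X)
    ![fderiv ℝ blChart X (Pi.single μ 1), fderiv ℝ blChart X (Pi.single ν 1)]

/-- The components `F^{μν} = ḡ^{μα} ḡ^{νβ} F_{αβ}`. -/
def compUp (m a : ℝ) (F : TwoForm) (X : Fin 4 → ℝ) (μ ν : Fin 4) : ℝ :=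
  ∑ α, ∑ β, (kerr m a (X 1) (X 2))⁻¹ μ α * (kerr m a (X 1) (X 2))⁻¹ ν β * comp F X α β

/-- A smooth, axially symmetric solution of the Maxwell equations on the Kerr exterior. The field
equation `∇_μ F^{μν} = 0` is written, as usual for an antisymmetric tensor, as
`∂_μ (√(-det ḡ) F^{μν}) = 0`; off the axis suffices, by continuity. -/
structure IsAxisymmetricMaxwell (m a : ℝ) (F : TwoForm) : Prop where
  smooth : ContDiffOn ℝ ∞ F (exterior m a)
  bianchi : ∀ p ∈ exterior m a, extDeriv F p = 0
  maxwell : ∀ X : Fin 4 → ℝ, rPlus m a < X 1 → X 2 ∈ Set.Ioo 0 Real.pi → ∀ ν,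
    ∑ μ, fderiv ℝ (fun Y : Fin 4 → ℝ => volDensity m a (Y 1) (Y 2) * compUp m a F Y μ ν) X
      (Pi.single μ 1) = 0
  axisymmetric : ∀ X : Fin 4 → ℝ, rPlus m a < X 1 → ∀ φ : ℝ,
    comp F (Function.update X 3 φ) = comp F X

/-- The data of `F` on the slice `t = 0` vanish outside a compact subset of the (open) slice. -/
def HasCompactInitialData (m a : ℝ) (F : TwoForm) : Prop :=
  ∃ C : Set (Fin 4 → ℝ), IsCompact C ∧ C ⊆ exterior m a ∧
    ∀ p ∈ exterior m a, p 0 = 0 → p ∉ C → F p = 0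

/-- `𝔈^i = √(-det ḡ) F^{0i}` on the slice of time `t`, for `i = r, θ, φ` indexed by `0, 1, 2`. -/
def electric (m a : ℝ) (F : TwoForm) (t : ℝ) (i : Fin 3) (r θ : ℝ) : ℝ :=
  volDensity m a r θ * compUp m a F ![t, r, θ, 0] 0 i.succ

/-- `𝔅^i = ½ ε^{ijk} F_{jk}` on the slice of time `t`. -/
def magnetic (F : TwoForm) (t : ℝ) (i : Fin 3) (r θ : ℝ) : ℝ :=
  (![comp F ![t, r, θ, 0] 2 3, comp F ![t, r, θ, 0] 3 1, comp F ![t, r, θ, 0] 1 2] :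
    Fin 3 → ℝ) i

/-! ### The Kinnersley tetrad and the Maxwell scalars -/

def tetradL (m a r _θ : ℝ) (μ : Fin 4) : ℂ :=
  ((((![r ^ 2 + a ^ 2, delta m a r, 0, a] : Fin 4 → ℝ) μ) / delta m a r : ℝ) : ℂ)

def tetradN (m a r θ : ℝ) (μ : Fin 4) : ℂ :=
  ((((![r ^ 2 + a ^ 2, -delta m a r, 0, a] : Fin 4 → ℝ) μ) / (2 * sigma a r θ) : ℝ) : ℂ)

def tetradM (a r θ : ℝ) (μ : Fin 4) : ℂ :=
  (![Complex.I * a * Real.sin θ, 0, 1, Complex.I / Real.sin θ] : Fin 4 → ℂ) μ /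
    ((r + Complex.I * a * Real.cos θ) * (Real.sqrt 2 : ℝ))

/-- The complex conjugate `m*` of `tetradM`. -/
def tetradMstar (a r θ : ℝ) (μ : Fin 4) : ℂ := starRingEnd ℂ (tetradM a r θ μ)

/-- Lowering an index with the Kerr metric. -/
def lower (m a r θ : ℝ) (V : Fin 4 → ℂ) (μ : Fin 4) : ℂ := ∑ ν, (kerr m a r θ μ ν : ℂ) * V ν

/-- `X_{[μ} Y_{ν]} = X_μ Y_ν - X_ν Y_μ`, without a factor `½`. -/
def wedge (X Y : Fin 4 → ℂ) (μ ν : Fin 4) : ℂ := X μ * Y ν - X ν * Y μ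

/-- Triples `(Φ₀, Φ₁, Φ₂)` of complex functions of `(r, θ)`. -/
abbrev Scalars : Type := Fin 3 → ℝ → ℝ → ℂ

/-- The Newman-Penrose-Maxwell scalars of `F` on the slice of time `t`: `Φ₀ = F(ℓ, m)`,
`Φ₁ = ½ (F(ℓ, n) + F(m*, m))`, `Φ₂ = F(m*, n)`. -/
def npScalars (m a : ℝ) (F : TwoForm) (t : ℝ) : Scalars := fun i r θ =>
  let f : (Fin 4 → ℂ) → (Fin 4 → ℂ) → ℂ := fun V W =>
    ∑ μ, ∑ ν, (comp F ![t, r, θ, 0] μ ν : ℂ) * V μ * W ν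
  (![f (tetradL m a r θ) (tetradM a r θ),
     (1 / 2) * (f (tetradL m a r θ) (tetradN m a r θ) + f (tetradMstar a r θ) (tetradM a r θ)),
     f (tetradMstar a r θ) (tetradN m a r θ)] : Fin 3 → ℂ) i

/-- `2 Re (Φ₀ m*_{[μ} n_{ν]} + Φ₁ (n_{[μ} ℓ_{ν]} + m_{[μ} m*_{ν]}) + Φ₂ ℓ_{[μ} m_{ν]})`. -/
def scalarLow (m a : ℝ) (Φ : Scalars) (r θ : ℝ) (μ ν : Fin 4) : ℝ :=
  let l := lower m a r θ (tetradL m a r θ)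
  let n := lower m a r θ (tetradN m a r θ)
  let k := lower m a r θ (tetradM a r θ)
  let k' := lower m a r θ (tetradMstar a r θ)
  2 * (Φ 0 r θ * wedge k' n μ ν + Φ 1 r θ * (wedge n l μ ν + wedge k k' μ ν)
    + Φ 2 r θ * wedge l k μ ν).re

/-- `2 Re (Φ₀ m*^{[μ} n^{ν]} + Φ₁ (n^{[μ} ℓ^{ν]} + m^{[μ} m*^{ν]}) + Φ₂ ℓ^{[μ} m^{ν]})`. -/
def scalarUp (m a : ℝ) (Φ : Scalars) (r θ : ℝ) (μ ν : Fin 4) : ℝ :=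
  let l := tetradL m a r θ
  let n := tetradN m a r θ
  let k := tetradM a r θ
  let k' := tetradMstar a r θ
  2 * (Φ 0 r θ * wedge k' n μ ν + Φ 1 r θ * (wedge n l μ ν + wedge k k' μ ν)
    + Φ 2 r θ * wedge l k μ ν).re

/-! ### The orbit space `𝚺` with coordinates `(r, θ)`, indexed by `0, 1`, and the
Weyl-Papapetrou form `ḡ = e^{-2γ} (-N² dt² + q) + e^{2γ} (dφ + 𝒜₀ dt)²` -/

/-- The interior of the orbit space. -/
def orbit (m a : ℝ) : Set (ℝ × ℝ) := Set.Ioi (rPlus m a) ×ˢ Set.Ioo 0 Real.pi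

/-- The coordinate index of the ambient Boyer-Lindquist system. -/
def idx (b : Fin 2) : Fin 4 := (![1, 2] : Fin 2 → Fin 4) b

/-- The Levi-Civita symbol. -/
def eps (b c : Fin 2) : ℝ := (!![0, 1; -1, 0] : Matrix (Fin 2) (Fin 2) ℝ) b c

/-- `∂_b f` for a function of `(r, θ)`. -/
def pd (f : ℝ → ℝ → ℝ) (b : Fin 2) (r θ : ℝ) : ℝ :=
  (![deriv (fun x => f x θ) r, deriv (fun x => f r x) θ] : Fin 2 → ℝ) b

/-- `γ`, where `e^{2γ} = ḡ(∂_φ, ∂_φ)`. -/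
def gam (m a r θ : ℝ) : ℝ := Real.log (kerr m a r θ 3 3) / 2

/-- `𝒜₀ = ḡ_{tφ} / ḡ_{φφ}`. -/
def shiftA (m a r θ : ℝ) : ℝ := kerr m a r θ 0 3 / kerr m a r θ 3 3

/-- The lapse `N = √Δ sin θ` of `g = -N² dt² + q`. -/
def lapse (m a r θ : ℝ) : ℝ := Real.sqrt (delta m a r) * Real.sin θ

/-- The metric `q_{bc} = e^{2γ} ḡ_{bc}`. -/
def qMetric (m a r θ : ℝ) : Matrix (Fin 2) (Fin 2) ℝ :=
  Matrix.of fun b c => Real.exp (2 * gam m a r θ) * kerr m a r θ (idx b) (idx c)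

/-- `μ̄_q = √(det q)`. -/
def muq (m a r θ : ℝ) : ℝ := Real.sqrt (qMetric m a r θ).det

/-- `μ̄_q q^{bc}`. -/
def muqInv (m a r θ : ℝ) (b c : Fin 2) : ℝ := muq m a r θ * (qMetric m a r θ)⁻¹ b c

/-- The gravitational twist potential `ω` of Kerr, normalized to be odd across the equator. -/
def omega (m a r θ : ℝ) : ℝ :=
  2 * a * m * (3 * Real.cos θ - Real.cos θ ^ 3)
    + 2 * a ^ 3 * m * Real.cos θ * Real.sin θ ^ 4 / sigma a r θ

/-- On the exterior `r > 0` and `Δ > 0`. -/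
lemma rPlus_lt (m a r : ℝ) (hm : 0 < m) (ha : |a| ≤ m) (hr : rPlus m a < r) :
    0 < r ∧ 0 < delta m a r := by
  have h1 : a ^ 2 ≤ m ^ 2 := sq_le_sq' (by linarith [neg_abs_le a]) (by linarith [le_abs_self a])
  have h2 := Real.sqrt_nonneg (m ^ 2 - a ^ 2)
  have h3 := Real.sq_sqrt (show 0 ≤ m ^ 2 - a ^ 2 by linarith)
  unfold rPlus at hr
  refine ⟨by linarith, ?_⟩
  unfold delta
  nlinarith

/-- The `tt` component of the Weyl-Papapetrou form: `lapse` is the lapse of `g`. -/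
lemma weylPapapetrou_tt (m a r θ : ℝ) (hm : 0 < m) (ha : |a| ≤ m) (hr : rPlus m a < r)
    (hθ : θ ∈ Set.Ioo 0 Real.pi) :
    kerr m a r θ 0 0 = -Real.exp (-2 * gam m a r θ) * lapse m a r θ ^ 2
      + Real.exp (2 * gam m a r θ) * shiftA m a r θ ^ 2 := by
  obtain ⟨hr0, hD⟩ := rPlus_lt m a r hm ha hr
  have hs : 0 < Real.sin θ := Real.sin_pos_of_pos_of_lt_pi hθ.1 hθ.2
  have hSig : 0 < sigma a r θ := by unfold sigma; positivity
  have hXi : 0 < xi m a r θ := by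
    have : xi m a r θ = (r ^ 2 + a ^ 2) * sigma a r θ + 2 * m * r * a ^ 2 * Real.sin θ ^ 2 := by
      unfold xi delta sigma; rw [Real.sin_sq]; ring
    rw [this]; positivity
  have hX : kerr m a r θ 3 3 = xi m a r θ / sigma a r θ * Real.sin θ ^ 2 := by simp [kerr]
  have h33 : 0 < kerr m a r θ 3 3 := by rw [hX]; positivity
  have he2 : Real.exp (2 * gam m a r θ) = kerr m a r θ 3 3 := by
    rw [gam, mul_div_cancel₀ _ two_ne_zero, Real.exp_log h33]
  have he2' : Real.exp (-2 * gam m a r θ) = (kerr m a r θ 3 3)⁻¹ := by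
    rw [← he2, ← Real.exp_neg]; congr 1; ring
  have h00 : kerr m a r θ 0 0 = -(delta m a r - a ^ 2 * Real.sin θ ^ 2) / sigma a r θ := by
    simp [kerr]
  have h03 : kerr m a r θ 0 3 =
      -(a * Real.sin θ ^ 2 * (r ^ 2 + a ^ 2 - delta m a r)) / sigma a r θ := by
    simp [kerr]
  rw [he2, he2', lapse, shiftA, hX, h00, h03, mul_pow, Real.sq_sqrt hD.le]
  field_simp
  unfold xi sigma delta
  rw [Real.cos_sq']
  ring

/-- `ω` is the gravitational twist potential: `∂_b 𝒜₀ + N e^{-4γ} ε_{bc} μ̄_q q^{cd} ∂_d ω = 0`. -/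
lemma gravTwist_omega (m a r θ : ℝ) (hm : 0 < m) (ha : |a| ≤ m) (hr : rPlus m a < r)
    (hθ : θ ∈ Set.Ioo 0 Real.pi) (b : Fin 2) :
    pd (shiftA m a) b r θ + lapse m a r θ * Real.exp (-4 * gam m a r θ) *
      ∑ c, ∑ d, eps b c * muqInv m a r θ c d * pd (omega m a) d r θ = 0 := by
  obtain ⟨hr0, hD⟩ := rPlus_lt m a r hm ha hr
  have hs : 0 < Real.sin θ := Real.sin_pos_of_pos_of_lt_pi hθ.1 hθ.2
  have hS : ∀ t, 0 < r ^ 2 + a ^ 2 * Real.cos t ^ 2 := fun t => by positivity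
  have hXi : 0 < xi m a r θ := by
    have : xi m a r θ = (r ^ 2 + a ^ 2) * sigma a r θ + 2 * m * r * a ^ 2 * Real.sin θ ^ 2 := by
      unfold xi delta sigma; rw [Real.sin_sq]; ring
    rw [this]; have := hS θ; unfold sigma; positivity
  have hSig : 0 < sigma a r θ := hS θ
  have h33 : 0 < kerr m a r θ 3 3 := by
    simp only [kerr]; simp; positivity
  have hX : kerr m a r θ 3 3 = xi m a r θ / sigma a r θ * Real.sin θ ^ 2 := by simp [kerr]
  have he2 : Real.exp (2 * gam m a r θ) = kerr m a r θ 3 3 := by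
    rw [gam, mul_div_cancel₀ _ two_ne_zero, Real.exp_log h33]
  have he4 : Real.exp (-4 * gam m a r θ) = ((kerr m a r θ 3 3) ^ 2)⁻¹ := by
    rw [← he2, ← Real.exp_nat_mul, ← Real.exp_neg]; congr 1; push_cast; ring
  have hq : qMetric m a r θ = Matrix.diagonal
      ![kerr m a r θ 3 3 * (sigma a r θ / delta m a r), kerr m a r θ 3 3 * sigma a r θ] := by
    ext i j; fin_cases i <;> fin_cases j <;> simp [qMetric, idx, he2] <;> simp [kerr]
  set X := kerr m a r θ 3 3 with hXd
  have hmu : muq m a r θ = X * sigma a r θ / Real.sqrt (delta m a r) := by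
    rw [muq, hq, Matrix.det_diagonal, Fin.prod_univ_two]
    rw [show (![X * (sigma a r θ / delta m a r), X * sigma a r θ] 0 *
      ![X * (sigma a r θ / delta m a r), X * sigma a r θ] 1) = (X * sigma a r θ) ^ 2 / delta m a r by
        simp; ring]
    rw [Real.sqrt_div (by positivity), Real.sqrt_sq (by positivity)]
  have hinv : (qMetric m a r θ)⁻¹ = Matrix.diagonal
      ![(X * (sigma a r θ / delta m a r))⁻¹, (X * sigma a r θ)⁻¹] := by
    rw [hq]
    apply Matrix.inv_eq_right_inv
    rw [Matrix.diagonal_mul_diagonal, ← Matrix.diagonal_one]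
    congr 1; ext i; fin_cases i <;> simp <;> field_simp
  have hsD : 0 < Real.sqrt (delta m a r) := Real.sqrt_pos.2 hD
  have hsq : Real.sqrt (delta m a r) ^ 2 = delta m a r := Real.sq_sqrt hD.le
  have m00 : muqInv m a r θ 0 0 = Real.sqrt (delta m a r) := by
    rw [muqInv, hmu, hinv]; simp; field_simp; try rw [hsq]
  have m11 : muqInv m a r θ 1 1 = (Real.sqrt (delta m a r))⁻¹ := by
    rw [muqInv, hmu, hinv]; simp; field_simp
  have m01 : muqInv m a r θ 0 1 = 0 := by rw [muqInv, hinv]; simp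
  have m10 : muqInv m a r θ 1 0 = 0 := by rw [muqInv, hinv]; simp
  have hA : ∀ x t, 0 < x → Real.sin t ≠ 0 → shiftA m a x t = -(2 * a * m * x) / xi m a x t := by
    intro x t hx ht
    have h0 : sigma a x t ≠ 0 := by unfold sigma; positivity
    simp only [shiftA, kerr]
    simp
    by_cases h : xi m a x t = 0
    · simp [h]
    · field_simp
      unfold delta; ring
  have hDr : HasDerivAt (fun x => delta m a x) (2 * r - 2 * m) r := by
    have := ((hasDerivAt_pow 2 r).sub ((hasDerivAt_id r).const_mul (2 * m))).add_const (a ^ 2)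
    simpa [delta] using this
  have hxr : HasDerivAt (fun x => xi m a x θ)
      (4 * r * (r ^ 2 + a ^ 2) - a ^ 2 * (2 * r - 2 * m) * Real.sin θ ^ 2) r := by
    have := (((hasDerivAt_pow 2 r).add_const (a ^ 2)).pow 2).sub
      ((hDr.const_mul (a ^ 2)).mul_const (Real.sin θ ^ 2))
    refine (this.congr_deriv ?_)
    push_cast; ring
  have hxt : HasDerivAt (fun t => xi m a r t)
      (-(a ^ 2 * delta m a r * (2 * Real.sin θ * Real.cos θ))) θ := by
    have := (((Real.hasDerivAt_sin θ).pow 2).const_mul (a ^ 2 * delta m a r)).const_sub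
      ((r ^ 2 + a ^ 2) ^ 2)
    refine (this.congr_deriv ?_)
    push_cast; ring
  have hSr : HasDerivAt (fun x => sigma a x θ) (2 * r) r := by
    have := (hasDerivAt_pow 2 r).add_const (a ^ 2 * Real.cos θ ^ 2)
    simpa [sigma] using this
  have hSt : HasDerivAt (fun t => sigma a r t) (-(2 * a ^ 2 * Real.cos θ * Real.sin θ)) θ := by
    have := (((Real.hasDerivAt_cos θ).pow 2).const_mul (a ^ 2)).const_add (r ^ 2)
    refine (this.congr_deriv ?_)
    push_cast; ring
  have hAr : deriv (fun x => shiftA m a x θ) r = (-(2 * a * m) * xi m a r θ + 2 * a * m * r *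
      (4 * r * (r ^ 2 + a ^ 2) - a ^ 2 * (2 * r - 2 * m) * Real.sin θ ^ 2)) / xi m a r θ ^ 2 := by
    have h1 : HasDerivAt (fun x => -(2 * a * m * x) / xi m a x θ) _ r :=
      ((hasDerivAt_id r).const_mul (2 * a * m)).neg.div hxr hXi.ne'
    have h2 : (fun x => shiftA m a x θ) =ᶠ[𝓝 r] fun x => -(2 * a * m * x) / xi m a x θ := by
      filter_upwards [lt_mem_nhds hr0] with x hx using hA x θ hx hs.ne'
    rw [h2.deriv_eq, h1.deriv]; congr 1; simp
  have hAt : deriv (fun t => shiftA m a r t) θ =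
      -(2 * a * m * r * (a ^ 2 * delta m a r * (2 * Real.sin θ * Real.cos θ)))
        / xi m a r θ ^ 2 := by
    have h1 : HasDerivAt (fun t => -(2 * a * m * r) / xi m a r t) _ θ :=
      (hasDerivAt_const θ (-(2 * a * m * r))).div hxt hXi.ne'
    have h2 : (fun t => shiftA m a r t) =ᶠ[𝓝 θ] fun t => -(2 * a * m * r) / xi m a r t := by
      filter_upwards [Ioo_mem_nhds hθ.1 hθ.2] with t ht using
        hA r t hr0 (Real.sin_pos_of_pos_of_lt_pi ht.1 ht.2).ne'
    rw [h2.deriv_eq, h1.deriv]; congr 1; ring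
  have hwr : deriv (fun x => omega m a x θ) r =
      -(2 * a ^ 3 * m * Real.cos θ * Real.sin θ ^ 4 * (2 * r)) / sigma a r θ ^ 2 := by
    have h1 : HasDerivAt (fun x => omega m a x θ) _ r :=
      ((hasDerivAt_const r (2 * a ^ 3 * m * Real.cos θ * Real.sin θ ^ 4)).div hSr hSig.ne').const_add
        (2 * a * m * (3 * Real.cos θ - Real.cos θ ^ 3))
    rw [h1.deriv]; congr 1; ring
  have hwt : deriv (fun t => omega m a r t) θ =
      2 * a * m * (-(3 * Real.sin θ) + 3 * Real.cos θ ^ 2 * Real.sin θ) +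
      ((2 * a ^ 3 * m * (-Real.sin θ * Real.sin θ ^ 4 + Real.cos θ * (4 * Real.sin θ ^ 3 *
        Real.cos θ))) * sigma a r θ + 2 * a ^ 3 * m * Real.cos θ * Real.sin θ ^ 4 *
          (2 * a ^ 2 * Real.cos θ * Real.sin θ)) / sigma a r θ ^ 2 := by
    have h1 : HasDerivAt (fun t => omega m a r t) _ θ :=
      ((((Real.hasDerivAt_cos θ).const_mul 3).sub ((Real.hasDerivAt_cos θ).pow 3)).const_mul
        (2 * a * m)).add ((((Real.hasDerivAt_cos θ).const_mul (2 * a ^ 3 * m)).mul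
          ((Real.hasDerivAt_sin θ).pow 4)).div hSt hSig.ne')
    rw [h1.deriv]; simp only [Pi.mul_apply, Pi.pow_apply]; push_cast; congr 1
    · ring
    · congr 1; ring
  have hc2 : Real.cos θ ^ 2 = 1 - Real.sin θ ^ 2 := Real.cos_sq' θ
  rw [he4, hX]
  fin_cases b
  · simp [pd, Fin.sum_univ_two, eps, m11, m10, hAr, hwt, lapse]
    field_simp
    simp only [sigma, xi, delta]
    generalize Real.cos θ = c at *
    generalize Real.sin θ = z at *
    have h3 : c ^ 3 = c * (1 - z ^ 2) := by rw [← hc2]; ring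
    have h4 : c ^ 4 = (1 - z ^ 2) ^ 2 := by rw [← hc2]; ring
    have h6 : c ^ 6 = (1 - z ^ 2) ^ 3 := by rw [← hc2]; ring
    rw [hc2]
    ring_nf
    try rw [hc2]
    try ring_nf
  · simp [pd, Fin.sum_univ_two, eps, m00, m01, hAt, hwr, lapse]
    field_simp
    rw [hsq]
    ring

/-- `η` is the twist potential of the planar field `V`: `V^b = ε^{bc} ∂_c η`, and `η = 0` on the
axis `Γ`. -/
structure IsTwistPotential (m a : ℝ) (V : Fin 3 → ℝ → ℝ → ℝ) (η : ℝ → ℝ → ℝ) : Prop where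
  differentiable : ∀ x ∈ orbit m a, DifferentiableAt ℝ (fun p : ℝ × ℝ => η p.1 p.2) x
  curl : ∀ x ∈ orbit m a, ∀ b : Fin 2, V b.castSucc x.1 x.2 = ∑ c, eps b c * pd η c x.1 x.2
  axis : ∀ r, rPlus m a < r →
    Filter.Tendsto (η r) (𝓝[>] 0) (𝓝 0) ∧ Filter.Tendsto (η r) (𝓝[<] Real.pi) (𝓝 0)

/-! ### The Green's function and the representation formulas -/

/-- The Weyl coordinates `(ρ̄, z̄)` of an orbit. They map the orbit space conformally onto the
half-plane `ρ̄ > 0`, with axis and horizon going to `ρ̄ = 0`. -/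
def weyl (m a r θ : ℝ) : ℝ × ℝ :=
  (Real.sqrt (delta m a r) * Real.sin θ, (r - m) * Real.cos θ)

/-- `K = (1/2π) (log ϱ - log ϱ')`, with `ϱ, ϱ'` the Euclidean distances of `x` from `y` and from the
image point of `y`. -/
def green (x y : ℝ × ℝ) : ℝ :=
  1 / (2 * Real.pi) * Real.log (Real.sqrt ((x.1 - y.1) ^ 2 + (x.2 - y.2) ^ 2))
    - 1 / (2 * Real.pi) * Real.log (Real.sqrt ((x.1 + y.1) ^ 2 + (x.2 - y.2) ^ 2))

/-- The flat Laplacian of the plane. -/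
def flatLaplacian (f : ℝ × ℝ → ℝ) (y : ℝ × ℝ) : ℝ :=
  iteratedDeriv 2 (fun ρ => f (ρ, y.2)) y.1 + iteratedDeriv 2 (fun z => f (y.1, z)) y.2

/-- `K` is the fundamental solution of the flat Laplacian of the half-plane (in the sense of
distributions) with zero boundary values. -/
def IsDirichletGreen (K : ℝ × ℝ → ℝ × ℝ → ℝ) : Prop :=
  (∀ x y : ℝ × ℝ, x.1 = 0 ∨ y.1 = 0 → K x y = 0) ∧
  ∀ f : ℝ × ℝ → ℝ, ContDiff ℝ ∞ f → HasCompactSupport f → tsupport f ⊆ {y | 0 < y.1} →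
    ∀ x : ℝ × ℝ, 0 < x.1 → ∫ y in {y : ℝ × ℝ | 0 < y.1}, K x y * flatLaplacian f y = f x

/-- The integrand of `S ⋆ K` at `(r, θ)`. Here `S` is a scalar density of weight one, so that
`S dr dθ` is invariant: it equals the flat source in Weyl coordinates times `dρ̄ dz̄`. -/
def convIntegrand (m a : ℝ) (S : ℝ → ℝ → ℝ) (r θ : ℝ) (p : ℝ × ℝ) : ℝ :=
  green (weyl m a r θ) (weyl m a p.1 p.2) * S p.1 p.2

/-- The convolution `S ⋆ K` on the orbit space. -/
def conv (m a : ℝ) (S : ℝ → ℝ → ℝ) (r θ : ℝ) : ℝ :=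
  ∫ p in orbit m a, convIntegrand m a S r θ p

/-- `𝔈^i = e^{-2γ} N μ̄_q · 2 Re (…)^{0i}` in terms of the scalars. -/
def scalarE (m a : ℝ) (Φ : Scalars) (i : Fin 3) (r θ : ℝ) : ℝ :=
  Real.exp (-2 * gam m a r θ) * lapse m a r θ * muq m a r θ * scalarUp m a Φ r θ 0 i.succ

/-- `ε_{cb} 𝔈^c`, which is `∂_b η` in terms of the scalars. -/
def scalarDEta (m a : ℝ) (Φ : Scalars) (b : Fin 2) (r θ : ℝ) : ℝ :=
  ∑ c, eps c b * scalarE m a Φ c.castSucc r θ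

/-- `2 Re (…)_{b3}`, which is `∂_b λ` in terms of the scalars. -/
def scalarDLam (m a : ℝ) (Φ : Scalars) (b : Fin 2) (r θ : ℝ) : ℝ :=
  scalarLow m a Φ r θ (idx b) 3

/-- `∂_b (μ̄_q q^{bc} W_c)`. -/
def divq (m a : ℝ) (W : Fin 2 → ℝ → ℝ → ℝ) (r θ : ℝ) : ℝ :=
  ∑ b, pd (fun r' θ' => ∑ c, muqInv m a r' θ' b c * W c r' θ') b r θ

/-- `η = ∂_b (2 N e^{-2γ} μ̄_q² q^{bc} ε_{dc} Re (…)^{0d}) ⋆ K`. -/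
def etaRep (m a : ℝ) (Φ : Scalars) : ℝ → ℝ → ℝ := conv m a (divq m a (scalarDEta m a Φ))

/-- `λ = ∂_b (2 μ̄_q q^{bc} Re (…)_{c3}) ⋆ K`. -/
def lamRep (m a : ℝ) (Φ : Scalars) : ℝ → ℝ → ℝ := conv m a (divq m a (scalarDLam m a Φ))

/-! ### The energies -/

/-- The energy density with parameter `s`, as a function of the values `η`, `λ`, of their
derivatives, and of `u` and `v` at `(r, θ)`. -/
def density (m a s : ℝ) (η l : ℝ) (dη dl : Fin 2 → ℝ) (u v : ℝ) (r θ : ℝ) : ℝ :=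
  let g := gam m a r θ
  let N := lapse m a r θ
  let dg := fun b => pd (gam m a) b r θ
  let dw := fun b => pd (omega m a) b r θ
  let P := fun b => dl b - 2 * s * l * dg b - (1 - s) * η * Real.exp (-2 * g) * dw b
  let Q := fun b => dη b - 2 * (1 - s) * η * dg b + s * l * Real.exp (-2 * g) * dw b
  1 / 2 * N * Real.exp (2 * g) * (muq m a r θ)⁻¹ * (u ^ 2 + v ^ 2)
    + ∑ b, ∑ c, 1 / 2 * N * muqInv m a r θ b c * Real.exp (-2 * g) * (P b * P c + Q b * Q c)
    + ∑ b, ∑ c, 2 * s * (1 - s) * N * muqInv m a r θ b c * Real.exp (-2 * g)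
        * (dg b * dg c + 1 / 4 * Real.exp (-4 * g) * dw b * dw c) * (l ^ 2 + η ^ 2)

/-- The twist potential energy with parameter `s` on the phase space `{(λ, v), (η, u)}`. -/
def twistEnergy (m a s : ℝ) (η l u v : ℝ → ℝ → ℝ) : ℝ :=
  ∫ p in orbit m a, density m a s (η p.1 p.2) (l p.1 p.2) (fun b => pd η b p.1 p.2)
    (fun b => pd l b p.1 p.2) (u p.1 p.2) (v p.1 p.2) p.1 p.2

/-- The density of `H^{NPM}`: the scalars are substituted for `η`, `λ`, `∂η`, `∂λ`,
`u = 𝔅^φ` and `v = -𝔈^φ`. -/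
def npmDensity (m a s : ℝ) (Φ : Scalars) (p : ℝ × ℝ) : ℝ :=
  density m a s (etaRep m a Φ p.1 p.2) (lamRep m a Φ p.1 p.2)
    (fun b => scalarDEta m a Φ b p.1 p.2) (fun b => scalarDLam m a Φ b p.1 p.2)
    (scalarLow m a Φ p.1 p.2 1 2) (-scalarE m a Φ 2 p.1 p.2) p.1 p.2

/-- The nonlocal energy functional `H^{NPM}` with parameter `s`. -/
def npmEnergy (m a s : ℝ) (Φ : Scalars) : ℝ := ∫ p in orbit m a, npmDensity m a s Φ p

end KerrMaxwell

end

noncomputable section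

open MeasureTheory Filter Set

namespace KerrMaxwell

/-! ### The logarithmic kernel in the plane -/

/-! Axial symmetry turns Maxwell's equations into a first-order system for six functions of (t, r,
θ): u, v, and the planar components of the field divided by the factor sin θ that regularity on the
axis forces (`reducedMaxwell_of_isAxisymmetricMaxwell`). These reduced fields are smooth for all
real θ, so the axis contributes no boundary conditions of its own.

Everything global rests on finite speed of propagation. Radial light rays have coordinate speed at
most (r − r₊)/m, so log (r − r₊) changes at a bounded rate and the horizon is not reached in finite
coordinate time. A weighted energy estimate on the corresponding cones shows that at each time the
fields vanish near the horizon and at large radii, locally uniformly in time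
(`ReducedMaxwell.exists_vanishing_range`). Hence integrations by parts have no boundary terms at the
horizon or at infinity.

The twist potential is the integral along a meridian starting from θ = 0. Its value at θ = π is the
total flux through a sphere; this is independent of r by the divergence constraint and zero at large
r, so the potential vanishes on both axis components, and in fact is O(sin² θ) there
(`isPotential_axisIntegral`, `IsPotential.abs_le`). Uniqueness is clear, since the field fixes the
θ-derivative.

For the representation formula, Weyl coordinates are isothermal for q, so ∂_b(μ̄_q q^{ab} ∂_a λ) is
the Jacobian times the flat Laplacian of λ. The logarithm is handled by the regularization log(|y|²
+ c⁻²), whose Laplacian is 4π times an approximate identity. The extension of λ by zero vanishes at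
the image point, so the mirror term of the Green's function contributes zero (`conv_eq`). Tetrad
algebra (`scalarLow_npScalars`, `scalarUp_npScalars`) identifies the scalar expressions with the
derivatives of the potentials and with u and v.

For the energy, expand the squares P and Q. The last term of the density makes the coefficients of
λ² and η² linear in s, and the products λη ∂γ·∂ω cancel. The vacuum equation for γ
(`killing_norm_eq`) and the fact that the weighted ∂ω is a rotated gradient of 𝒜₀ then turn all
dependence on s into a divergence. What remains is the usual local energy plus an interaction of λ
with the differential rotation (`potDensity_eq`), and one integration by parts shows that this sum
is conserved (`integral_energy_eq`). Positivity is visible from the squares. If the energy is zero,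
then u = v = 0 and P = Q = 0; along θ = const this is a linear system in r for (λ, η) with zero data
near the horizon, so both potentials vanish (`vanishes_of_potDensity_eq_zero`). -/

/-- The normalized profile of the regularized fundamental solution. -/
def profile (w : ℝ × ℝ) : ℝ := 1 / Real.pi * ((1 + (w.1 ^ 2 + w.2 ^ 2)) ^ 2)⁻¹

lemma integral_Ioi_radial : ∫ r in Ioi (0 : ℝ), r * ((1 + r ^ 2) ^ 2)⁻¹ = 1 / 2 := by
  have hd : ∀ x ∈ Ici (0 : ℝ), HasDerivAt (fun r : ℝ => -(1 / 2) * (1 + r ^ 2)⁻¹)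
      (x * ((1 + x ^ 2) ^ 2)⁻¹) x := by
    intro x _
    have h0 : (1 + x ^ 2) ≠ 0 := by positivity
    have := (((hasDerivAt_pow 2 x).const_add 1).inv h0).const_mul (-(1 / 2))
    refine this.congr_deriv ?_
    field_simp
    norm_num
  have ht : Tendsto (fun r : ℝ => -(1 / 2) * (1 + r ^ 2)⁻¹) atTop (𝓝 (-(1 / 2) * 0)) := by
    refine Tendsto.const_mul _ (tendsto_inv_atTop_zero.comp ?_)
    exact tendsto_atTop_add_const_left _ _ (tendsto_pow_atTop two_ne_zero)
  rw [integral_Ioi_of_hasDerivAt_of_nonneg' hd (fun x hx => ?_) ht]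
  · norm_num
  · have : 0 < x := hx
    positivity

lemma integral_profile : ∫ w, profile w = 1 := by
  rw [← integral_comp_polarCoord_symm, show polarCoord.target = Ioi (0 : ℝ) ×ˢ Ioo (-Real.pi) Real.pi
    from rfl]
  have h : ∀ p : ℝ × ℝ, p.1 • profile (polarCoord.symm p) =
      (p.1 * ((1 + p.1 ^ 2) ^ 2)⁻¹) * (1 / Real.pi) := by
    intro p
    have : (p.1 * Real.cos p.2) ^ 2 + (p.1 * Real.sin p.2) ^ 2 = p.1 ^ 2 := by
      rw [mul_pow, mul_pow, ← mul_add, Real.cos_sq_add_sin_sq, mul_one]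
    simp only [profile, polarCoord_symm_apply, smul_eq_mul, this]
    ring
  simp_rw [h]
  rw [Measure.volume_eq_prod, setIntegral_prod_mul (fun r : ℝ => r * ((1 + r ^ 2) ^ 2)⁻¹)
    (fun _ => 1 / Real.pi), integral_Ioi_radial]
  have := Real.pi_pos
  simp
  field_simp
  rw [max_eq_left (by positivity)]
  ring

/-- This is the decay that the approximate identity theorem asks of its kernel. The norm of ℝ × ℝ is
the maximum norm, so ‖w‖² is at most the Euclidean square occurring in `profile`. -/
lemma tendsto_profile_cobounded :
    Tendsto (fun w : ℝ × ℝ => ‖w‖ ^ Module.finrank ℝ (ℝ × ℝ) * profile w)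
      (Bornology.cobounded (ℝ × ℝ)) (𝓝 0) := by
  have hfin : Module.finrank ℝ (ℝ × ℝ) = 2 := by simp
  rw [hfin]
  have h1 : ∀ w : ℝ × ℝ, ‖w‖ ^ 2 ≤ w.1 ^ 2 + w.2 ^ 2 := by
    intro w
    rw [Prod.norm_def]
    rcases max_cases ‖w.1‖ ‖w.2‖ with h | h <;> rw [h.1, Real.norm_eq_abs, sq_abs] <;> nlinarith [sq_nonneg w.1, sq_nonneg w.2]
  have h2 : Tendsto (fun w : ℝ × ℝ => 1 / Real.pi * (1 + ‖w‖ ^ 2)⁻¹) (Bornology.cobounded (ℝ × ℝ))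
      (𝓝 (1 / Real.pi * 0)) := by
    refine Tendsto.const_mul _ (tendsto_inv_atTop_zero.comp ?_)
    exact tendsto_atTop_add_const_left _ _ ((tendsto_pow_atTop two_ne_zero).comp tendsto_norm_cobounded_atTop)
  rw [mul_zero] at h2
  refine squeeze_zero (fun w => ?_) (fun w => ?_) h2
  · have := Real.pi_pos
    unfold profile; positivity
  · have hp := Real.pi_pos
    have := h1 w
    have h3 := sq_nonneg ‖w‖
    unfold profile
    rw [mul_left_comm]
    refine mul_le_mul_of_nonneg_left ?_ (by positivity)
    rw [← div_eq_mul_inv, ← one_div, div_le_div_iff₀ (by positivity) (by positivity)]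
    nlinarith

/-- The regularized fundamental solutions concentrate at the pole. -/
lemma tendsto_integral_peak {G : ℝ × ℝ → ℝ} {x : ℝ × ℝ} (hG : Integrable G)
    (hx : ContinuousAt G x) :
    Tendsto (fun c : ℝ => ∫ y : ℝ × ℝ, 4 * c ^ 2 /
      (c ^ 2 * ((y.1 - x.1) ^ 2 + (y.2 - x.2) ^ 2) + 1) ^ 2 * G y) atTop
      (𝓝 (4 * Real.pi * G x)) := by
  have h := (tendsto_integral_comp_smul_smul_of_integrable' (μ := volume)
    (fun w => by have := Real.pi_pos; unfold profile; positivity) integral_profile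
    tendsto_profile_cobounded hG hx).const_mul (4 * Real.pi)
  -- The rescaled kernel is c² `profile` (c (x − y)). Times 4π it is the Laplacian of the
  -- regularized logarithm computed in `laplacian_logReg`.
  refine h.congr fun c => ?_
  rw [← integral_const_mul]
  refine integral_congr_ae (Eventually.of_forall fun y => ?_)
  have hp := Real.pi_pos
  have hfin : Module.finrank ℝ (ℝ × ℝ) = 2 := by simp
  have h1 : 1 + ((c * (x.1 - y.1)) ^ 2 + (c * (x.2 - y.2)) ^ 2) =
    c ^ 2 * ((y.1 - x.1) ^ 2 + (y.2 - x.2) ^ 2) + 1 := by ring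
  simp only [profile, hfin, smul_eq_mul, Prod.smul_fst, Prod.smul_snd, Prod.fst_sub, Prod.snd_sub, h1]
  field_simp

/-- `log |y - x|²` is integrable on bounded boxes. -/
lemma integrableOn_log_box (x : ℝ × ℝ) (R : ℝ) :
    IntegrableOn (fun y : ℝ × ℝ => Real.log ((y.1 - x.1) ^ 2 + (y.2 - x.2) ^ 2))
      (Icc (x.1 - R) (x.1 + R) ×ˢ Icc (x.2 - R) (x.2 + R)) := by
  have h1 : IntegrableOn (fun ρ : ℝ => Real.log (ρ - x.1)) (Icc (x.1 - R) (x.1 + R)) := by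
    rcases le_total 0 R with hR | hR
    · rw [integrableOn_Icc_iff_integrableOn_Ioc, ← intervalIntegrable_iff_integrableOn_Ioc_of_le (by linarith)]
      have := IntervalIntegrable.comp_sub_right (f := Real.log) (a := -R) (b := R)
        intervalIntegral.intervalIntegrable_log' x.1
      rwa [neg_add_eq_sub, add_comm R] at this
    · rcases eq_or_lt_of_le hR with rfl | hR
      · simp
      · rw [Icc_eq_empty (by linarith)]; simp
  -- Dominating function: dropping the second coordinate bounds the logarithm below by 2 log |y₁ −
  -- x₁|, which is integrable in one variable, and the size of the box bounds it above by log (2R²).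
  have h2 : IntegrableOn (fun y : ℝ × ℝ => 2 * |Real.log (y.1 - x.1)| + |Real.log (2 * R ^ 2)|)
      (Icc (x.1 - R) (x.1 + R) ×ˢ Icc (x.2 - R) (x.2 + R)) := by
    refine Integrable.add ?_ ?_
    · have h3 : IntegrableOn (fun _ : ℝ => (1 : ℝ)) (Icc (x.2 - R) (x.2 + R)) := by
        simp
      have := (h1.abs.const_mul 2).mul_prod h3
      rw [Measure.prod_restrict, ← Measure.volume_eq_prod] at this
      simpa [IntegrableOn] using this
    · have : volume (Icc (x.1 - R) (x.1 + R) ×ˢ Icc (x.2 - R) (x.2 + R)) < ⊤ :=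
        (isCompact_Icc.prod isCompact_Icc).measure_lt_top
      exact integrableOn_const this.ne
  refine h2.mono' (Real.measurable_log.comp (by fun_prop)).aestronglyMeasurable ?_
  have hne : ∀ᵐ y : ℝ × ℝ, y.1 ≠ x.1 := by
    have : volume ({x.1} ×ˢ (univ : Set ℝ)) = 0 := by
      rw [Measure.volume_eq_prod, Measure.prod_prod]; simp
    refine measure_mono_null ?_ this
    intro y hy
    simpa using hy
  filter_upwards [ae_restrict_of_ae hne, ae_restrict_mem (measurableSet_Icc.prod measurableSet_Icc)] with y hy hb
  obtain ⟨⟨b1, b2⟩, b3, b4⟩ := hb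
  have hpos : 0 < (y.1 - x.1) ^ 2 := by
    have : y.1 - x.1 ≠ 0 := sub_ne_zero.2 hy
    positivity
  have l1 : Real.log ((y.1 - x.1) ^ 2) ≤ Real.log ((y.1 - x.1) ^ 2 + (y.2 - x.2) ^ 2) :=
    Real.log_le_log hpos (by nlinarith [sq_nonneg (y.2 - x.2)])
  have l2 : Real.log ((y.1 - x.1) ^ 2 + (y.2 - x.2) ^ 2) ≤ Real.log (2 * R ^ 2) :=
    Real.log_le_log (by positivity) (by
      have := sq_le_sq' (a := y.1 - x.1) (b := R) (by linarith) (by linarith)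
      have := sq_le_sq' (a := y.2 - x.2) (b := R) (by linarith) (by linarith)
      linarith)
  have l3 : Real.log ((y.1 - x.1) ^ 2) = 2 * Real.log (y.1 - x.1) := by simp
  rw [Real.norm_eq_abs, abs_le]
  have l4 := neg_abs_le (Real.log (y.1 - x.1))
  have l5 := le_abs_self (Real.log (2 * R ^ 2))
  have l6 := abs_nonneg (Real.log (2 * R ^ 2))
  have l7 := abs_nonneg (Real.log (y.1 - x.1))
  constructor <;> linarith

/-- Removing the regularization of the logarithm. -/
lemma tendsto_integral_log_add {α : Type*} [MeasurableSpace α] {μ : Measure α} {D S : α → ℝ}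
    (hD : ∀ᵐ p ∂μ, 0 < D p) (hDm : AEStronglyMeasurable D μ) (hSm : AEStronglyMeasurable S μ)
    (h1 : Integrable (fun p => Real.log (D p) * S p) μ)
    (h2 : Integrable (fun p => Real.log (D p + 1) * S p) μ) :
    Tendsto (fun c : ℝ => ∫ p, Real.log (D p + (c ^ 2)⁻¹) * S p ∂μ) atTop
      (𝓝 (∫ p, Real.log (D p) * S p ∂μ)) := by
  refine tendsto_integral_filter_of_dominated_convergence
    (fun p => |Real.log (D p) * S p| + |Real.log (D p + 1) * S p|) ?_ ?_ (h1.abs.add h2.abs) ?_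
  · refine Eventually.of_forall fun c => ?_
    exact (Real.measurable_log.comp_aemeasurable (hDm.aemeasurable.add_const _)).aestronglyMeasurable.mul hSm
  · filter_upwards [eventually_ge_atTop 1] with c hc
    filter_upwards [hD] with p hp
    have hc1 : (c ^ 2)⁻¹ ≤ 1 := inv_le_one_of_one_le₀ (by nlinarith)
    have hc2 : 0 < (c ^ 2)⁻¹ := by positivity
    have l1 := Real.log_le_log hp (show D p ≤ D p + (c ^ 2)⁻¹ by linarith)
    have l2 := Real.log_le_log (show 0 < D p + (c ^ 2)⁻¹ by linarith) (show D p + (c ^ 2)⁻¹ ≤ D p + 1 by linarith)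
    rw [Real.norm_eq_abs, abs_mul, abs_mul, abs_mul, ← add_mul]
    refine mul_le_mul_of_nonneg_right ?_ (abs_nonneg _)
    rw [abs_le]
    have := neg_abs_le (Real.log (D p))
    have := abs_nonneg (Real.log (D p))
    have := le_abs_self (Real.log (D p + 1))
    have := abs_nonneg (Real.log (D p + 1))
    constructor <;> linarith
  · filter_upwards [hD] with p hp
    refine Tendsto.mul_const _ ?_
    have h3 : Tendsto (fun c : ℝ => D p + (c ^ 2)⁻¹) atTop (𝓝 (D p + 0)) :=
      (tendsto_inv_atTop_zero.comp (tendsto_pow_atTop two_ne_zero)).const_add _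
    rw [add_zero] at h3
    exact (Real.continuousAt_log hp.ne').tendsto.comp h3

/-! ### Integration by parts against the regularized logarithm -/

lemma hasDerivAt_fst {f : ℝ × ℝ → ℝ} {y : ℝ × ℝ} (hf : DifferentiableAt ℝ f y) :
    HasDerivAt (fun ρ => f (ρ, y.2)) (fderiv ℝ f y (1, 0)) y.1 := by
  have h := hf.hasFDerivAt.comp_hasDerivAt (f := fun ρ : ℝ => (ρ, y.2)) y.1
    ((hasDerivAt_id y.1).prodMk (hasDerivAt_const y.1 y.2))
  exact h

lemma hasDerivAt_snd {f : ℝ × ℝ → ℝ} {y : ℝ × ℝ} (hf : DifferentiableAt ℝ f y) :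
    HasDerivAt (fun z => f (y.1, z)) (fderiv ℝ f y (0, 1)) y.2 := by
  have h := hf.hasFDerivAt.comp_hasDerivAt (f := fun z : ℝ => (y.1, z)) y.2
    ((hasDerivAt_const y.2 y.1).prodMk (hasDerivAt_id y.2))
  exact h

lemma contDiff_fderiv_const {f : ℝ × ℝ → ℝ} (hf : ContDiff ℝ ∞ f) (v : ℝ × ℝ) :
    ContDiff ℝ ∞ fun y => fderiv ℝ f y v :=
  (hf.fderiv_right (m := ∞) (by simp)).clm_apply contDiff_const

/-- Two integrations by parts. Compact support of f alone makes all the products integrable, so g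
may grow like the logarithm. -/
lemma integral_mul_fderiv_fderiv {f g : ℝ × ℝ → ℝ} (hf : ContDiff ℝ ∞ f) (hg : ContDiff ℝ ∞ g)
    (hc : HasCompactSupport f) (v : ℝ × ℝ) :
    ∫ y, g y * fderiv ℝ (fun y => fderiv ℝ f y v) y v =
      ∫ y, fderiv ℝ (fun y => fderiv ℝ g y v) y v * f y := by
  have hf1 := contDiff_fderiv_const hf v
  have hg1 := contDiff_fderiv_const hg v
  have hf2 := contDiff_fderiv_const hf1 v
  have hg2 := contDiff_fderiv_const hg1 v
  have c1 : HasCompactSupport fun y => fderiv ℝ f y v := hc.fderiv_apply ℝ v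
  have c2 : HasCompactSupport fun y => fderiv ℝ (fun y => fderiv ℝ f y v) y v := c1.fderiv_apply ℝ v
  rw [integral_mul_fderiv_eq_neg_fderiv_mul_of_integrable,
    integral_mul_fderiv_eq_neg_fderiv_mul_of_integrable, neg_neg]
  · exact (hg2.continuous.mul hf.continuous).integrable_of_hasCompactSupport hc.mul_left
  · exact (hg1.continuous.mul hf1.continuous).integrable_of_hasCompactSupport c1.mul_left
  · exact (hg1.continuous.mul hf.continuous).integrable_of_hasCompactSupport hc.mul_left
  · exact fun y _ => (hg1.differentiable (by simp)).differentiableAt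
  · exact fun y _ => (hf.differentiable (by simp)).differentiableAt
  · exact (hg1.continuous.mul hf1.continuous).integrable_of_hasCompactSupport c1.mul_left
  · exact (hg.continuous.mul hf2.continuous).integrable_of_hasCompactSupport c2.mul_left
  · exact (hg.continuous.mul hf1.continuous).integrable_of_hasCompactSupport c1.mul_left
  · exact fun y _ => (hg.differentiable (by simp)).differentiableAt
  · exact fun y _ => (hf1.differentiable (by simp)).differentiableAt

lemma flatLaplacian_eq {f : ℝ × ℝ → ℝ} (hf : ContDiff ℝ ∞ f) (y : ℝ × ℝ) :
    flatLaplacian f y = fderiv ℝ (fun y => fderiv ℝ f y (1, 0)) y (1, 0) +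
      fderiv ℝ (fun y => fderiv ℝ f y (0, 1)) y (0, 1) := by
  unfold flatLaplacian
  have d : ∀ y, DifferentiableAt ℝ f y := fun y => (hf.differentiable (by simp)).differentiableAt
  have d1 : ∀ v y, DifferentiableAt ℝ (fun y => fderiv ℝ f y v) y := fun v y =>
    ((contDiff_fderiv_const hf v).differentiable (by simp)).differentiableAt
  rw [iteratedDeriv_succ, iteratedDeriv_one, iteratedDeriv_succ, iteratedDeriv_one]
  have e1 : deriv (fun ρ => f (ρ, y.2)) = fun ρ => fderiv ℝ f (ρ, y.2) (1, 0) :=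
    funext fun ρ => (hasDerivAt_fst (y := (ρ, y.2)) (d _)).deriv
  have e2 : deriv (fun z => f (y.1, z)) = fun z => fderiv ℝ f (y.1, z) (0, 1) :=
    funext fun z => (hasDerivAt_snd (y := (y.1, z)) (d _)).deriv
  rw [e1, e2, (hasDerivAt_fst (d1 (1, 0) y)).deriv, (hasDerivAt_snd (d1 (0, 1) y)).deriv]

/-- The regularized logarithmic kernel. -/
def logReg (c : ℝ) (x y : ℝ × ℝ) : ℝ :=
  Real.log (((y.1 - x.1) ^ 2 + (y.2 - x.2) ^ 2) + (c ^ 2)⁻¹)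

lemma logReg_arg_pos {c : ℝ} (hc : 0 < c) (x y : ℝ × ℝ) :
    0 < ((y.1 - x.1) ^ 2 + (y.2 - x.2) ^ 2) + (c ^ 2)⁻¹ := by positivity

lemma contDiff_logReg {c : ℝ} (hc : 0 < c) (x : ℝ × ℝ) : ContDiff ℝ ∞ (logReg c x) := by
  refine ContDiff.log (by fun_prop) fun y => (logReg_arg_pos hc x y).ne'

lemma laplacian_logReg {c : ℝ} (hc : 0 < c) (x y : ℝ × ℝ) :
    fderiv ℝ (fun y => fderiv ℝ (logReg c x) y (1, 0)) y (1, 0) +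
      fderiv ℝ (fun y => fderiv ℝ (logReg c x) y (0, 1)) y (0, 1) =
    4 * c ^ 2 / (c ^ 2 * ((y.1 - x.1) ^ 2 + (y.2 - x.2) ^ 2) + 1) ^ 2 := by
  have hg := contDiff_logReg hc x
  have d : ∀ y, DifferentiableAt ℝ (logReg c x) y := fun y => (hg.differentiable (by simp)).differentiableAt
  have d1 : ∀ v y, DifferentiableAt ℝ (fun y => fderiv ℝ (logReg c x) y v) y := fun v y =>
    ((contDiff_fderiv_const hg v).differentiable (by simp)).differentiableAt
  have s1 : ∀ y : ℝ × ℝ, HasDerivAt (fun ρ => ((ρ - x.1) ^ 2 + (y.2 - x.2) ^ 2) + (c ^ 2)⁻¹)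
      (2 * (y.1 - x.1)) y.1 := fun y => by
    have := ((((hasDerivAt_id y.1).sub_const x.1).pow 2).add_const ((y.2 - x.2) ^ 2)).add_const (c ^ 2)⁻¹
    simpa using this
  have s2 : ∀ y : ℝ × ℝ, HasDerivAt (fun z => ((y.1 - x.1) ^ 2 + (z - x.2) ^ 2) + (c ^ 2)⁻¹)
      (2 * (y.2 - x.2)) y.2 := fun y => by
    have := ((((hasDerivAt_id y.2).sub_const x.2).pow 2).const_add ((y.1 - x.1) ^ 2)).add_const (c ^ 2)⁻¹
    simpa using this
  have e1 : (fun y => fderiv ℝ (logReg c x) y (1, 0)) = fun y =>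
      2 * (y.1 - x.1) / (((y.1 - x.1) ^ 2 + (y.2 - x.2) ^ 2) + (c ^ 2)⁻¹) := funext fun y =>
    (hasDerivAt_fst (d y)).unique ((s1 y).log (logReg_arg_pos hc x y).ne')
  have e2 : (fun y => fderiv ℝ (logReg c x) y (0, 1)) = fun y =>
      2 * (y.2 - x.2) / (((y.1 - x.1) ^ 2 + (y.2 - x.2) ^ 2) + (c ^ 2)⁻¹) := funext fun y =>
    (hasDerivAt_snd (d y)).unique ((s2 y).log (logReg_arg_pos hc x y).ne')
  have d11 := d1 (1, 0) y
  have d12 := d1 (0, 1) y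
  have hne := (logReg_arg_pos hc x y).ne'
  rw [e1] at d11 ⊢
  rw [e2] at d12 ⊢
  have t1 := hasDerivAt_fst d11
  have t2 := hasDerivAt_snd d12
  rw [t1.unique ((((hasDerivAt_id y.1).sub_const x.1).const_mul 2).div (s1 y) hne),
    t2.unique ((((hasDerivAt_id y.2).sub_const x.2).const_mul 2).div (s2 y) hne)]
  have hne2 : c ^ 2 * ((y.1 - x.1) ^ 2 + (y.2 - x.2) ^ 2) + 1 ≠ 0 := by positivity
  have h3 : ((y.1 - x.1) ^ 2 + (y.2 - x.2) ^ 2) + (c ^ 2)⁻¹ =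
    (c ^ 2 * ((y.1 - x.1) ^ 2 + (y.2 - x.2) ^ 2) + 1) / c ^ 2 := by field_simp
  simp only [id]
  rw [h3]
  field_simp
  ring

lemma ae_log_arg_pos (x : ℝ × ℝ) :
    ∀ᵐ y : ℝ × ℝ, 0 < (y.1 - x.1) ^ 2 + (y.2 - x.2) ^ 2 := by
  filter_upwards [compl_mem_ae_iff.2 (measure_singleton x)] with y hy
  have hy' : y ≠ x := hy
  rcases ne_or_eq y.1 x.1 with h | h
  · have : y.1 - x.1 ≠ 0 := sub_ne_zero.2 h
    positivity
  · have : y.2 - x.2 ≠ 0 := sub_ne_zero.2 fun h2 => hy' (Prod.ext h h2)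
    positivity

lemma integrable_log_mul {f : ℝ × ℝ → ℝ} (hf : Continuous f) (hc : HasCompactSupport f)
    (x : ℝ × ℝ) :
    Integrable fun y => Real.log ((y.1 - x.1) ^ 2 + (y.2 - x.2) ^ 2) * f y := by
  obtain ⟨R, hR⟩ := hc.isCompact.isBounded.subset_closedBall x
  have hb : tsupport f ⊆ Icc (x.1 - R) (x.1 + R) ×ˢ Icc (x.2 - R) (x.2 + R) := by
    intro y hy
    have := hR hy
    rw [← Prod.mk.eta (p := x), ← closedBall_prod_same, Real.closedBall_eq_Icc, Real.closedBall_eq_Icc] at this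
    exact this
  obtain ⟨B, hB⟩ := hc.exists_bound_of_continuous hf
  have h := (integrableOn_log_box x R).mul_bdd (c := B) hf.aestronglyMeasurable
    (Eventually.of_forall hB)
  refine (integrableOn_iff_integrable_of_support_subset ?_).1 h
  intro y hy
  by_contra hn
  have : f y = 0 := image_eq_zero_of_notMem_tsupport fun h' => hn (hb h')
  simp [this] at hy

/-- The logarithm is the fundamental solution of the flat Laplacian. -/
lemma integral_log_mul_flatLaplacian {f : ℝ × ℝ → ℝ} (hf : ContDiff ℝ ∞ f)
    (hc : HasCompactSupport f) (x : ℝ × ℝ) :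
    ∫ y, Real.log ((y.1 - x.1) ^ 2 + (y.2 - x.2) ^ 2) * flatLaplacian f y =
      4 * Real.pi * f x := by
  have hL : flatLaplacian f = fun y => fderiv ℝ (fun y => fderiv ℝ f y (1, 0)) y (1, 0) +
      fderiv ℝ (fun y => fderiv ℝ f y (0, 1)) y (0, 1) := funext (flatLaplacian_eq hf)
  have k : ∀ v, Continuous fun y => fderiv ℝ (fun y => fderiv ℝ f y v) y v := fun v =>
    (contDiff_fderiv_const (contDiff_fderiv_const hf v) v).continuous
  have ks : ∀ v, HasCompactSupport fun y => fderiv ℝ (fun y => fderiv ℝ f y v) y v := fun v =>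
    (hc.fderiv_apply ℝ v).fderiv_apply ℝ v
  have hcont : Continuous (flatLaplacian f) := by rw [hL]; exact (k _).add (k _)
  have hsupp : HasCompactSupport (flatLaplacian f) := by rw [hL]; exact (ks _).add (ks _)
  have h1 := tendsto_integral_log_add (μ := volume) (ae_log_arg_pos x)
    (Continuous.aestronglyMeasurable (by fun_prop)) hcont.aestronglyMeasurable
    (integrable_log_mul hcont hsupp x)
    ((Continuous.mul (Continuous.log (by fun_prop) fun y => by positivity)
      hcont).integrable_of_hasCompactSupport hsupp.mul_left)
  have h2 := tendsto_integral_peak (hf.continuous.integrable_of_hasCompactSupport hc)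
    hf.continuous.continuousAt (x := x)
  -- For each c > 0 the two families of integrals agree, by moving the Laplacian onto the
  -- regularized logarithm. Their limits as c → ∞ are the two sides of the identity.
  refine tendsto_nhds_unique (h1.congr' ?_) h2
  filter_upwards [eventually_gt_atTop 0] with c hc0
  have hg := contDiff_logReg hc0 x
  have i1 : ∀ v, Integrable fun y => logReg c x y * fderiv ℝ (fun y => fderiv ℝ f y v) y v :=
    fun v => (hg.continuous.mul (k v)).integrable_of_hasCompactSupport (ks v).mul_left
  have i2 : ∀ v, Integrable fun y => fderiv ℝ (fun y => fderiv ℝ (logReg c x) y v) y v * f y :=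
    fun v => ((contDiff_fderiv_const (contDiff_fderiv_const hg v) v).continuous.mul
      hf.continuous).integrable_of_hasCompactSupport hc.mul_left
  calc ∫ y, Real.log (((y.1 - x.1) ^ 2 + (y.2 - x.2) ^ 2) + (c ^ 2)⁻¹) * flatLaplacian f y
      = ∫ y, (logReg c x y * fderiv ℝ (fun y => fderiv ℝ f y (1, 0)) y (1, 0) +
        logReg c x y * fderiv ℝ (fun y => fderiv ℝ f y (0, 1)) y (0, 1)) := by
        rw [hL]; simp only [mul_add]; rfl
    _ = ∫ y, (fderiv ℝ (fun y => fderiv ℝ (logReg c x) y (1, 0)) y (1, 0) * f y +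
        fderiv ℝ (fun y => fderiv ℝ (logReg c x) y (0, 1)) y (0, 1) * f y) := by
        rw [integral_add (i1 _) (i1 _), integral_add (i2 _) (i2 _),
          integral_mul_fderiv_fderiv hf hg hc, integral_mul_fderiv_fderiv hf hg hc]
    _ = _ := by simp only [← add_mul, laplacian_logReg hc0]

/-- Squared distances halve the constant, and the reflection is moved from y to x. Both terms are
then logarithms with a fixed pole, at x and at its mirror image, to which the same lemmas apply. -/
lemma green_eq (x y : ℝ × ℝ) : green x y = 1 / (4 * Real.pi) *
    (Real.log ((y.1 - x.1) ^ 2 + (y.2 - x.2) ^ 2)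
      - Real.log ((y.1 - -x.1) ^ 2 + (y.2 - x.2) ^ 2)) := by
  unfold green
  rw [Real.log_sqrt (by positivity), Real.log_sqrt (by positivity),
    show (x.1 - y.1) ^ 2 + (x.2 - y.2) ^ 2 = (y.1 - x.1) ^ 2 + (y.2 - x.2) ^ 2 by ring,
    show (x.1 + y.1) ^ 2 + (x.2 - y.2) ^ 2 = (y.1 - -x.1) ^ 2 + (y.2 - x.2) ^ 2 by ring]
  have := Real.pi_pos
  field_simp
  ring

/-- `K` is the Dirichlet Green's function of the half-plane. -/
theorem isDirichletGreen_green : IsDirichletGreen green := by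
  constructor
  · rintro x y (h | h) <;> simp [green, h]
  · intro f hf hc hs x hx
    have hL : ∀ y, y ∉ tsupport f → flatLaplacian f y = 0 := by
      intro y hy
      have e : ∀ v, fderiv ℝ (fun y => fderiv ℝ f y v) y v = 0 := by
        intro v
        refine image_eq_zero_of_notMem_tsupport (f := fun y => fderiv ℝ (fun y => fderiv ℝ f y v) y v) ?_
        exact fun h => hy (tsupport_fderiv_apply_subset ℝ v (tsupport_fderiv_apply_subset ℝ v h))
      rw [flatLaplacian_eq hf, e, e, add_zero]
    have hcont : Continuous (flatLaplacian f) := by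
      rw [show flatLaplacian f = _ from funext (flatLaplacian_eq hf)]
      exact (contDiff_fderiv_const (contDiff_fderiv_const hf _) _).continuous.add
        (contDiff_fderiv_const (contDiff_fderiv_const hf _) _).continuous
    have hsupp : HasCompactSupport (flatLaplacian f) :=
      HasCompactSupport.intro hc.isCompact hL
    rw [setIntegral_eq_integral_of_forall_compl_eq_zero]
    · have h1 := integral_log_mul_flatLaplacian hf hc x
      have h2 := integral_log_mul_flatLaplacian hf hc (-x.1, x.2)
      -- The image point lies outside the half-plane that contains the support of f, so the second
      -- logarithm contributes nothing.
      have h3 : f (-x.1, x.2) = 0 := image_eq_zero_of_notMem_tsupport fun h => by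
        have : 0 < -x.1 := hs h
        linarith
      rw [h3, mul_zero] at h2
      simp_rw [green_eq, mul_assoc, sub_mul]
      rw [integral_const_mul, integral_sub (integrable_log_mul hcont hsupp x)
        (integrable_log_mul hcont hsupp (-x.1, x.2)), h1, h2]
      have := Real.pi_pos
      field_simp
      ring
    · intro y hy
      rw [hL y fun h => hy (hs h), mul_zero]

/-! ### Integration over the orbit space -/

lemma measurableSet_orbit (m a : ℝ) : MeasurableSet (orbit m a) :=
  measurableSet_Ioi.prod measurableSet_Ioo

lemma isOpen_orbit (m a : ℝ) : IsOpen (orbit m a) := isOpen_Ioi.prod isOpen_Ioo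

lemma sin_pos_of_mem_orbit {m a : ℝ} {p : ℝ × ℝ} (hp : p ∈ orbit m a) : 0 < Real.sin p.2 :=
  Real.sin_pos_of_pos_of_lt_pi hp.2.1 hp.2.2

/-- The bounded rectangle of the orbit space below radius `r₁`. -/
def rectangle (m a r₁ : ℝ) : Set (ℝ × ℝ) := Ioc (rPlus m a) r₁ ×ˢ Ioo 0 Real.pi

lemma integrableOn_orbit_indicator (m a r₁ C : ℝ) :
    IntegrableOn ((rectangle m a r₁).indicator fun _ => C) (orbit m a) := by
  have hm : MeasurableSet (rectangle m a r₁) := measurableSet_Ioc.prod measurableSet_Ioo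
  refine Integrable.integrableOn ?_
  rw [integrable_indicator_iff hm]
  refine integrableOn_const ?_
  have : volume (Icc (rPlus m a) r₁ ×ˢ Icc 0 Real.pi) < ⊤ :=
    (isCompact_Icc.prod isCompact_Icc).measure_lt_top
  exact ((measure_mono (Set.prod_mono Ioc_subset_Icc_self Ioo_subset_Icc_self)).trans_lt this).ne

lemma norm_le_indicator {m a r₁ C : ℝ} {f : ℝ × ℝ → ℝ}
    (hs : ∀ p ∈ orbit m a, r₁ < p.1 → f p = 0) (hb : ∀ p ∈ orbit m a, |f p| ≤ C) :
    ∀ p ∈ orbit m a, ‖f p‖ ≤ (rectangle m a r₁).indicator (fun _ => C) p := by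
  intro p hp
  by_cases h : p.1 ≤ r₁
  · rw [indicator_of_mem (show p ∈ rectangle m a r₁ from ⟨⟨hp.1, h⟩, hp.2⟩)]
    exact hb p hp
  · rw [hs p hp (not_le.1 h), norm_zero]
    exact indicator_nonneg (fun _ _ => (abs_nonneg _).trans (hb p hp)) p

lemma integrableOn_orbit {m a r₁ C : ℝ} {f : ℝ × ℝ → ℝ} (hc : ContinuousOn f (orbit m a))
    (hs : ∀ p ∈ orbit m a, r₁ < p.1 → f p = 0) (hb : ∀ p ∈ orbit m a, |f p| ≤ C) :
    IntegrableOn f (orbit m a) := by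
  refine (integrableOn_orbit_indicator m a r₁ C).mono'
    (hc.aestronglyMeasurable (measurableSet_orbit m a)) ?_
  filter_upwards [ae_restrict_mem (measurableSet_orbit m a)] with p hp
  exact norm_le_indicator hs hb p hp

/-- The integral of a divergence over the orbit space vanishes if the flux is compactly supported
in `r` and vanishes on the axis. -/
lemma integral_orbit_divergence {m a r₀ r₁ : ℝ} (h0 : rPlus m a < r₀) {A B A' B' : ℝ × ℝ → ℝ}
    (hA : ∀ p ∈ orbit m a, HasDerivAt (fun r => A (r, p.2)) (A' p) p.1)
    (hB : ∀ p ∈ orbit m a, HasDerivAt (fun θ => B (p.1, θ)) (B' p) p.2)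
    (hA' : IntegrableOn A' (orbit m a)) (hB' : IntegrableOn B' (orbit m a))
    (hs : ∀ p ∈ orbit m a, p.1 < r₀ ∨ r₁ < p.1 → A p = 0)
    (hB0 : ∀ r, rPlus m a < r → Tendsto (fun θ => B (r, θ)) (𝓝[>] 0) (𝓝 0))
    (hB1 : ∀ r, rPlus m a < r → Tendsto (fun θ => B (r, θ)) (𝓝[<] Real.pi) (𝓝 0)) :
    ∫ p in orbit m a, (A' p + B' p) = 0 := by
  rw [integral_add hA' hB']
  have hvol : (volume : Measure (ℝ × ℝ)).restrict (orbit m a) =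
      (volume.restrict (Ioi (rPlus m a))).prod (volume.restrict (Ioo 0 Real.pi)) := by
    rw [Measure.prod_restrict, ← Measure.volume_eq_prod]; rfl
  have iA : ∫ p in orbit m a, A' p = 0 := by
    unfold IntegrableOn at hA'
    rw [hvol] at hA' ⊢
    rw [integral_prod_symm _ hA']
    refine integral_eq_zero_of_ae ?_
    filter_upwards [hA'.prod_left_ae, ae_restrict_mem measurableSet_Ioo] with θ hi hθ
    have hlim0 : Tendsto (fun r => A (r, θ)) (𝓝[>] (rPlus m a)) (𝓝 0) := by
      refine Tendsto.congr' ?_ tendsto_const_nhds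
      filter_upwards [Ioo_mem_nhdsGT h0] with r hr
      exact (hs (r, θ) ⟨hr.1, hθ⟩ (Or.inl hr.2)).symm
    have hlim1 : Tendsto (fun r => A (r, θ)) atTop (𝓝 0) := by
      refine Tendsto.congr' ?_ tendsto_const_nhds
      filter_upwards [eventually_gt_atTop r₁, eventually_gt_atTop (rPlus m a)] with r hr hr'
      exact (hs (r, θ) ⟨hr', hθ⟩ (Or.inr hr)).symm
    -- Nothing is known about A on the horizon itself. Redefining it there by its limit 0 makes it
    -- continuous on the closed half-line.
    have := integral_Ioi_of_hasDerivAt_of_tendsto (f := fun r => if r = rPlus m a then 0 else A (r, θ))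
      (f' := fun r => A' (r, θ)) (a := rPlus m a) (m := 0) ?_ ?_ hi ?_
    · simpa using this
    · rw [← Ioi_insert, continuousWithinAt_insert_self]
      simp only [ContinuousWithinAt, if_true]
      refine hlim0.congr' ?_
      filter_upwards [self_mem_nhdsWithin] with r hr
      rw [if_neg (ne_of_gt hr)]
    · intro r hr
      refine (hA (r, θ) ⟨hr, hθ⟩).congr_of_eventuallyEq ?_
      filter_upwards [lt_mem_nhds (show rPlus m a < r from hr)] with x hx
      rw [if_neg (ne_of_gt hx)]
    · refine hlim1.congr' ?_
      filter_upwards [eventually_gt_atTop (rPlus m a)] with r hr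
      rw [if_neg (ne_of_gt hr)]
  have iB : ∫ p in orbit m a, B' p = 0 := by
    unfold IntegrableOn at hB'
    rw [hvol] at hB' ⊢
    rw [integral_prod _ hB']
    refine integral_eq_zero_of_ae ?_
    filter_upwards [hB'.prod_right_ae, ae_restrict_mem measurableSet_Ioi] with r hi hr
    have := intervalIntegral.integral_eq_sub_of_hasDerivAt_of_tendsto (f := fun θ => B (r, θ))
      (f' := fun θ => B' (r, θ)) Real.pi_pos (fun θ hθ => hB (r, θ) ⟨hr, hθ⟩) ?_
      (hB0 r hr) (hB1 r hr)
    · rw [intervalIntegral.integral_of_le Real.pi_pos.le, sub_zero, integral_Ioc_eq_integral_Ioo] at this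
      exact this
    · rw [intervalIntegrable_iff_integrableOn_Ioo_of_le Real.pi_pos.le]
      exact hi
  rw [iA, iB, add_zero]

/-- The time derivatives vanish beyond the radius r₁, so a constant on the bounded rectangle below
r₁ is an integrable dominating function. -/
lemma hasDerivAt_integral_orbit {m a r₁ C t₀ δ : ℝ} (hδ : 0 < δ) {f f' : ℝ → ℝ × ℝ → ℝ}
    (hf : ∀ t ∈ Metric.ball t₀ δ, ∀ p ∈ orbit m a, HasDerivAt (fun t => f t p) (f' t p) t)
    (hc : ∀ t ∈ Metric.ball t₀ δ, ContinuousOn (f t) (orbit m a))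
    (hc' : ContinuousOn (f' t₀) (orbit m a))
    (hi : IntegrableOn (f t₀) (orbit m a))
    (hs : ∀ t ∈ Metric.ball t₀ δ, ∀ p ∈ orbit m a, r₁ < p.1 → f' t p = 0)
    (hb : ∀ t ∈ Metric.ball t₀ δ, ∀ p ∈ orbit m a, |f' t p| ≤ C) :
    HasDerivAt (fun t => ∫ p in orbit m a, f t p) (∫ p in orbit m a, f' t₀ p) t₀ := by
  refine (hasDerivAt_integral_of_dominated_loc_of_deriv_le
    (bound := (rectangle m a r₁).indicator fun _ => C) (Metric.ball_mem_nhds t₀ hδ) ?_ hi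
    (hc'.aestronglyMeasurable (measurableSet_orbit m a)) ?_
    (integrableOn_orbit_indicator m a r₁ C) ?_).2
  · filter_upwards [Metric.ball_mem_nhds t₀ hδ] with t ht
    exact (hc t ht).aestronglyMeasurable (measurableSet_orbit m a)
  · filter_upwards [ae_restrict_mem (measurableSet_orbit m a)] with p hp t ht
    exact norm_le_indicator (hs t ht) (hb t ht) p hp
  · filter_upwards [ae_restrict_mem (measurableSet_orbit m a)] with p hp t ht
    exact hf t ht p hp

/-- A nonnegative continuous function on the orbit space with zero integral vanishes. -/
lemma eq_zero_of_integral_orbit_eq_zero {m a : ℝ} {f : ℝ × ℝ → ℝ}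
    (hc : ContinuousOn f (orbit m a)) (hi : IntegrableOn f (orbit m a))
    (h0 : ∀ p ∈ orbit m a, 0 ≤ f p) (hz : ∫ p in orbit m a, f p = 0) :
    ∀ p ∈ orbit m a, f p = 0 := by
  have h1 : f =ᵐ[volume.restrict (orbit m a)] 0 := by
    refine (setIntegral_eq_zero_iff_of_nonneg_ae ?_ hi).1 hz
    filter_upwards [ae_restrict_mem (measurableSet_orbit m a)] with p hp using h0 p hp
  exact Measure.eqOn_open_of_ae_eq h1 (isOpen_orbit m a) hc continuousOn_const

/-! ### Functions of `(t, r, θ)` -/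

/-- The domain of the variables `(t, r, θ)`; the angle is unrestricted. -/
def domain (m a : ℝ) : Set (ℝ × ℝ × ℝ) := {x | rPlus m a < x.2.1}

lemma isOpen_domain (m a : ℝ) : IsOpen (domain m a) := isOpen_lt continuous_const (by fun_prop)

/-- `∂_t`. -/
def dT (f : ℝ × ℝ × ℝ → ℝ) (x : ℝ × ℝ × ℝ) : ℝ := fderiv ℝ f x (1, 0, 0)
/-- `∂_r`. -/
def dR (f : ℝ × ℝ × ℝ → ℝ) (x : ℝ × ℝ × ℝ) : ℝ := fderiv ℝ f x (0, 1, 0)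
/-- `∂_θ`. -/
def dA (f : ℝ × ℝ × ℝ → ℝ) (x : ℝ × ℝ × ℝ) : ℝ := fderiv ℝ f x (0, 0, 1)

/-- Smoothness on the domain. -/
def Smooth (m a : ℝ) (f : ℝ × ℝ × ℝ → ℝ) : Prop := ContDiffOn ℝ ∞ f (domain m a)

section
variable {m a : ℝ} {f : ℝ × ℝ × ℝ → ℝ}

lemma Smooth.differentiableAt (hf : Smooth m a f) {x : ℝ × ℝ × ℝ} (hx : x ∈ domain m a) :
    DifferentiableAt ℝ f x :=
  (hf.differentiableOn (by simp)).differentiableAt ((isOpen_domain m a).mem_nhds hx)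

lemma Smooth.fderiv_apply (hf : Smooth m a f) (v : ℝ × ℝ × ℝ) :
    Smooth m a fun x => fderiv ℝ f x v :=
  (hf.fderiv_of_isOpen (isOpen_domain m a) (m := ∞) (by simp)).clm_apply contDiffOn_const

lemma Smooth.dT (hf : Smooth m a f) : Smooth m a (dT f) := hf.fderiv_apply _
lemma Smooth.dR (hf : Smooth m a f) : Smooth m a (dR f) := hf.fderiv_apply _
lemma Smooth.dA (hf : Smooth m a f) : Smooth m a (dA f) := hf.fderiv_apply _

lemma hasDerivAt_dT {t r θ : ℝ} (hf : DifferentiableAt ℝ f (t, r, θ)) :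
    HasDerivAt (fun t => f (t, r, θ)) (dT f (t, r, θ)) t :=
  hf.hasFDerivAt.comp_hasDerivAt (f := fun t : ℝ => (t, r, θ)) t
    ((hasDerivAt_id t).prodMk ((hasDerivAt_const t r).prodMk (hasDerivAt_const t θ)))

lemma hasDerivAt_dR {t r θ : ℝ} (hf : DifferentiableAt ℝ f (t, r, θ)) :
    HasDerivAt (fun r => f (t, r, θ)) (dR f (t, r, θ)) r :=
  hf.hasFDerivAt.comp_hasDerivAt (f := fun r : ℝ => (t, r, θ)) r
    ((hasDerivAt_const r t).prodMk ((hasDerivAt_id r).prodMk (hasDerivAt_const r θ)))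

lemma hasDerivAt_dA {t r θ : ℝ} (hf : DifferentiableAt ℝ f (t, r, θ)) :
    HasDerivAt (fun θ => f (t, r, θ)) (dA f (t, r, θ)) θ :=
  hf.hasFDerivAt.comp_hasDerivAt (f := fun θ : ℝ => (t, r, θ)) θ
    ((hasDerivAt_const θ t).prodMk ((hasDerivAt_const θ r).prodMk (hasDerivAt_id θ)))

lemma Smooth.hasDerivAt_dT (hf : Smooth m a f) {t r : ℝ} (hr : rPlus m a < r) (θ : ℝ) :
    HasDerivAt (fun t => f (t, r, θ)) (KerrMaxwell.dT f (t, r, θ)) t :=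
  KerrMaxwell.hasDerivAt_dT (hf.differentiableAt hr)

lemma Smooth.hasDerivAt_dR (hf : Smooth m a f) (t : ℝ) {r : ℝ} (hr : rPlus m a < r) (θ : ℝ) :
    HasDerivAt (fun r => f (t, r, θ)) (KerrMaxwell.dR f (t, r, θ)) r :=
  KerrMaxwell.hasDerivAt_dR (hf.differentiableAt hr)

lemma Smooth.hasDerivAt_dA (hf : Smooth m a f) (t : ℝ) {r : ℝ} (hr : rPlus m a < r) (θ : ℝ) :
    HasDerivAt (fun θ => f (t, r, θ)) (KerrMaxwell.dA f (t, r, θ)) θ :=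
  KerrMaxwell.hasDerivAt_dA (hf.differentiableAt hr)

/-- Functions on the domain are bounded on bounded sets away from the horizon. -/
lemma exists_bound_of_continuousOn (hf : ContinuousOn f (domain m a)) (T : ℝ) {r₀ r₁ : ℝ}
    (h0 : rPlus m a < r₀) :
    ∃ C, 0 ≤ C ∧ ∀ t r θ, |t| ≤ T → r₀ ≤ r → r ≤ r₁ → θ ∈ Icc 0 Real.pi → |f (t, r, θ)| ≤ C := by
  have hk : IsCompact (Icc (-T) T ×ˢ Icc r₀ r₁ ×ˢ Icc 0 Real.pi) :=
    isCompact_Icc.prod (isCompact_Icc.prod isCompact_Icc)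
  have hsub : Icc (-T) T ×ˢ Icc r₀ r₁ ×ˢ Icc 0 Real.pi ⊆ domain m a := by
    rintro ⟨t, r, θ⟩ ⟨_, ⟨hr, _⟩, _⟩
    exact lt_of_lt_of_le h0 hr
  obtain ⟨C, hC⟩ := hk.exists_bound_of_continuousOn (hf.mono hsub)
  exact ⟨max C 0, le_max_right _ _, fun t r θ ht hr0 hr1 hθ =>
    (hC (t, r, θ) ⟨abs_le.1 ht, ⟨hr0, hr1⟩, hθ⟩).trans (le_max_left _ _)⟩

end

/-! ### The background -/

/-- `e^{-2γ} sin² θ = Σ / Ξ`. -/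
def bgY (m a : ℝ) (x : ℝ × ℝ × ℝ) : ℝ := sigma a x.2.1 x.2.2 / xi m a x.2.1 x.2.2
/-- `Δ / Σ`. -/
def bgK (m a : ℝ) (x : ℝ × ℝ × ℝ) : ℝ := delta m a x.2.1 / sigma a x.2.1 x.2.2
/-- The shift `𝒜₀ = - 2 a m r / Ξ`. -/
def bgA (m a : ℝ) (x : ℝ × ℝ × ℝ) : ℝ := -(2 * a * m * x.2.1) / xi m a x.2.1 x.2.2
/-- `Δ` as a function of `(t, r, θ)`. -/
def bgD (m a : ℝ) (x : ℝ × ℝ × ℝ) : ℝ := delta m a x.2.1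

section
variable {m a : ℝ}

lemma sigma_pos {r : ℝ} (hr : 0 < r) (a θ : ℝ) : 0 < sigma a r θ := by unfold sigma; positivity

/-- Eliminating sin² from part of the expression writes Ξ as r⁴ plus manifestly nonnegative terms.
The lower bound r⁴, and not just positivity, enters the estimate of the light speed in
`radialSpeed_le`. -/
lemma xi_ge (hm : 0 < m) {r : ℝ} (hr : 0 < r) (θ : ℝ) : r ^ 4 ≤ xi m a r θ := by
  have : xi m a r θ = r ^ 4 + (a ^ 2 * r ^ 2 + (r ^ 2 + a ^ 2) * (a ^ 2 * Real.cos θ ^ 2)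
      + 2 * m * r * a ^ 2 * Real.sin θ ^ 2) := by
    unfold xi delta; rw [Real.sin_sq]; ring
  rw [this]
  have : 0 ≤ (a ^ 2 * r ^ 2 + (r ^ 2 + a ^ 2) * (a ^ 2 * Real.cos θ ^ 2)
      + 2 * m * r * a ^ 2 * Real.sin θ ^ 2) := by positivity
  linarith

lemma xi_pos (hm : 0 < m) {r : ℝ} (hr : 0 < r) (θ : ℝ) : 0 < xi m a r θ :=
  lt_of_lt_of_le (by positivity) (xi_ge hm hr θ)

variable (hm : 0 < m) (ha : |a| ≤ m)
include hm ha

lemma smooth_bgY : Smooth m a (bgY m a) := by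
  refine ContDiffOn.div ?_ ?_ fun x hx => (xi_pos hm (rPlus_lt m a _ hm ha hx).1 _).ne'
  · unfold sigma; fun_prop
  · unfold xi delta; fun_prop

lemma smooth_bgA : Smooth m a (bgA m a) := by
  refine ContDiffOn.div ?_ ?_ fun x hx => (xi_pos hm (rPlus_lt m a _ hm ha hx).1 _).ne'
  · fun_prop
  · unfold xi delta; fun_prop

lemma smooth_bgK : Smooth m a (bgK m a) := by
  refine ContDiffOn.div ?_ ?_ fun x hx => (sigma_pos (rPlus_lt m a _ hm ha hx).1 _ _).ne'
  · unfold delta; fun_prop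
  · unfold sigma; fun_prop

lemma bgY_pos {x : ℝ × ℝ × ℝ} (hx : x ∈ domain m a) : 0 < bgY m a x :=
  have h := rPlus_lt m a _ hm ha hx
  div_pos (sigma_pos h.1 _ _) (xi_pos hm h.1 _)

lemma bgK_pos {x : ℝ × ℝ × ℝ} (hx : x ∈ domain m a) : 0 < bgK m a x :=
  have h := rPlus_lt m a _ hm ha hx
  div_pos h.2 (sigma_pos h.1 _ _)

lemma bgD_pos {x : ℝ × ℝ × ℝ} (hx : x ∈ domain m a) : 0 < bgD m a x :=
  (rPlus_lt m a _ hm ha hx).2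

end

lemma smooth_bgD (m a : ℝ) : Smooth m a (bgD m a) := by
  unfold bgD delta
  exact ContDiff.contDiffOn (by fun_prop)

/-! ### Boyer-Lindquist components in terms of Cartesian components -/

lemma contDiff_blChart : ContDiff ℝ ∞ blChart := by
  rw [contDiff_pi]
  intro i
  fin_cases i <;> simp [blChart] <;> fun_prop

lemma fderiv_blChart (t r θ : ℝ) (μ : Fin 4) :
    fderiv ℝ blChart ![t, r, θ, 0] (Pi.single μ 1) =
      (![![1, 0, 0, 0], ![0, Real.sin θ, 0, Real.cos θ],
        ![0, r * Real.cos θ, 0, -(r * Real.sin θ)], ![0, 0, r * Real.sin θ, 0]] :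
        Fin 4 → Fin 4 → ℝ) μ := by
  have h : HasFDerivAt blChart (fderiv ℝ blChart ![t, r, θ, 0]) ![t, r, θ, 0] :=
    ((contDiff_blChart.differentiable (by simp)) ![t, r, θ, 0]).hasFDerivAt
  have h1 : HasDerivAt (fun z => blChart (Function.update ![t, r, θ, 0] μ z))
      (fderiv ℝ blChart ![t, r, θ, 0] (Pi.single μ 1)) ((![t, r, θ, 0] : Fin 4 → ℝ) μ) := by
    have h' : HasFDerivAt blChart (fderiv ℝ blChart ![t, r, θ, 0])
        (Function.update ![t, r, θ, 0] μ ((![t, r, θ, 0] : Fin 4 → ℝ) μ)) := by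
      rwa [Function.update_eq_self]
    exact h'.comp_hasDerivAt _ (hasDerivAt_update _ _ _)
  refine h1.unique ?_
  rw [hasDerivAt_pi]
  intro i
  fin_cases μ
  · fin_cases i <;> simp [blChart, hasDerivAt_id', hasDerivAt_const]
  · fin_cases i
    · simp [blChart, hasDerivAt_const]
    · simpa [blChart] using (hasDerivAt_id r).mul_const (Real.sin θ)
    · simp [blChart, hasDerivAt_const]
    · simpa [blChart] using (hasDerivAt_id r).mul_const (Real.cos θ)
  · fin_cases i
    · simp [blChart, hasDerivAt_const]
    · simpa [blChart] using (Real.hasDerivAt_sin θ).const_mul r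
    · simp [blChart, hasDerivAt_const]
    · simpa [blChart] using (Real.hasDerivAt_cos θ).const_mul r
  · fin_cases i
    · simp [blChart, hasDerivAt_const]
    · simpa [blChart] using (Real.hasDerivAt_cos 0).const_mul (r * Real.sin θ)
    · simpa [blChart] using (Real.hasDerivAt_sin 0).const_mul (r * Real.sin θ)
    · simp [blChart, hasDerivAt_const]

/-- The Cartesian components of `F` in the half-plane `φ = 0`. -/
def cart (F : TwoForm) (i j : Fin 4) (x : ℝ × ℝ × ℝ) : ℝ :=
  F (blChart ![x.1, x.2.1, x.2.2, 0]) ![Pi.single i 1, Pi.single j 1]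

lemma blChart_mem_exterior {m a : ℝ} (hm : 0 < m) {X : Fin 4 → ℝ} (hx : rPlus m a < X 1) :
    blChart X ∈ exterior m a := by
  have h0 : 0 < rPlus m a := by unfold rPlus; positivity
  have h : (X 1 * Real.sin (X 2) * Real.cos (X 3)) ^ 2 + (X 1 * Real.sin (X 2) * Real.sin (X 3)) ^ 2
      + (X 1 * Real.cos (X 2)) ^ 2 = X 1 ^ 2 := by
    have h1 := Real.sin_sq_add_cos_sq (X 2)
    have h2 := Real.sin_sq_add_cos_sq (X 3)
    linear_combination X 1 ^ 2 * h1 + X 1 ^ 2 * Real.sin (X 2) ^ 2 * h2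
  simp only [exterior, blChart, mem_ofPred_eq]
  simp
  rw [h]
  exact pow_lt_pow_left₀ hx h0.le two_ne_zero

lemma isOpen_exterior (m a : ℝ) : IsOpen (exterior m a) :=
  isOpen_lt continuous_const (by fun_prop)

lemma smooth_cart {m a : ℝ} (hm : 0 < m) {F : TwoForm} (hF : ContDiffOn ℝ ∞ F (exterior m a))
    (i j : Fin 4) : Smooth m a (cart F i j) := by
  have h1 : ContDiff ℝ ∞ fun x : ℝ × ℝ × ℝ => blChart ![x.1, x.2.1, x.2.2, 0] := by
    refine contDiff_blChart.comp (contDiff_pi.2 fun k => ?_)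
    fin_cases k <;> simp <;> fun_prop
  have h2 : ContDiffOn ℝ ∞ (fun x : ℝ × ℝ × ℝ => F (blChart ![x.1, x.2.1, x.2.2, 0])) (domain m a) :=
    hF.comp h1.contDiffOn fun x hx => blChart_mem_exterior hm (by simpa using! hx)
  exact (ContinuousAlternatingMap.apply ℝ (Fin 4 → ℝ) ℝ ![Pi.single i 1, Pi.single j 1]).contDiff.comp_contDiffOn h2

lemma cart_swap (F : TwoForm) (i j : Fin 4) (x : ℝ × ℝ × ℝ) : cart F j i x = -cart F i j x := by
  unfold cart
  have := (F (blChart ![x.1, x.2.1, x.2.2, 0])).map_swap ![Pi.single i 1, Pi.single j 1]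
    (show (0 : Fin 2) ≠ 1 by decide)
  refine Eq.trans ?_ this
  change F _ _ = F _ _
  congr 1
  ext k; fin_cases k <;> simp

lemma alt_expand (α : (Fin 4 → ℝ) [⋀^Fin 2]→L[ℝ] ℝ) (v w : Fin 4 → ℝ) :
    α ![v, w] = ∑ i, ∑ j, v i * w j * α ![Pi.single i 1, Pi.single j 1] := by
  have h1 : ∀ v w : Fin 4 → ℝ, α ![v, w] = ∑ i, v i * α ![Pi.single i 1, w] := by
    intro v w
    let L : (Fin 4 → ℝ) →ₗ[ℝ] ℝ := α.toMultilinearMap.toLinearMap ![0, w] 0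
    have hL : ∀ z, L z = α ![z, w] := by
      intro z
      simp only [L, MultilinearMap.toLinearMap_apply]
      change α _ = _
      congr 1
      ext k; fin_cases k <;> simp
    rw [← hL, LinearMap.pi_apply_eq_sum_univ L v]
    refine Finset.sum_congr rfl fun i _ => ?_
    rw [smul_eq_mul, hL]
    congr 3
    ext j
    simp [Pi.single_apply, eq_comm]
  have h2 : ∀ v w : Fin 4 → ℝ, α ![v, w] = ∑ j, w j * α ![v, Pi.single j 1] := by
    intro v w
    let L : (Fin 4 → ℝ) →ₗ[ℝ] ℝ := α.toMultilinearMap.toLinearMap ![v, 0] 1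
    have hL : ∀ z, L z = α ![v, z] := by
      intro z
      simp only [L, MultilinearMap.toLinearMap_apply]
      change α _ = _
      congr 1
      ext k; fin_cases k <;> simp
    rw [← hL, LinearMap.pi_apply_eq_sum_univ L w]
    refine Finset.sum_congr rfl fun i _ => ?_
    rw [smul_eq_mul, hL]
    congr 3
    ext j
    simp [Pi.single_apply, eq_comm]
  rw [h1]
  refine Finset.sum_congr rfl fun i _ => ?_
  rw [h2, Finset.mul_sum]
  exact Finset.sum_congr rfl fun j _ => by ring

/-! ### The reduced fields -/

/-- `u = F_{rθ}`. -/
def redU (F : TwoForm) (x : ℝ × ℝ × ℝ) : ℝ := -x.2.1 * cart F 1 3 x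
/-- `v = -𝔈^φ`. -/
def redV (m a : ℝ) (F : TwoForm) (x : ℝ × ℝ × ℝ) : ℝ := x.2.1 * cart F 0 2 x / bgK m a x
/-- `F_{rφ} / sin θ`. -/
def redP1 (F : TwoForm) (x : ℝ × ℝ × ℝ) : ℝ :=
  x.2.1 * (Real.sin x.2.2 * cart F 1 2 x - Real.cos x.2.2 * cart F 2 3 x)
/-- `F_{θφ} / sin θ`. -/
def redP2 (F : TwoForm) (x : ℝ × ℝ × ℝ) : ℝ :=
  x.2.1 ^ 2 * (Real.cos x.2.2 * cart F 1 2 x + Real.sin x.2.2 * cart F 2 3 x)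
/-- `F_{tr}`. -/
def redTR (F : TwoForm) (x : ℝ × ℝ × ℝ) : ℝ :=
  Real.sin x.2.2 * cart F 0 1 x + Real.cos x.2.2 * cart F 0 3 x
/-- `F_{tθ}`. -/
def redTA (F : TwoForm) (x : ℝ × ℝ × ℝ) : ℝ :=
  x.2.1 * (Real.cos x.2.2 * cart F 0 1 x - Real.sin x.2.2 * cart F 0 3 x)
/-- `-𝔈^θ / sin θ`. -/
def redQ1 (m a : ℝ) (F : TwoForm) (x : ℝ × ℝ × ℝ) : ℝ :=
  (redTA F x + bgA m a x * Real.sin x.2.2 * redP2 F x) / (bgY m a x * bgD m a x)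
/-- `𝔈^r / sin θ`. -/
def redQ2 (m a : ℝ) (F : TwoForm) (x : ℝ × ℝ × ℝ) : ℝ :=
  -(redTR F x + bgA m a x * Real.sin x.2.2 * redP1 F x) / bgY m a x

/-- The Boyer-Lindquist components `F_{μν}`. -/
def blComp (F : TwoForm) (x : ℝ × ℝ × ℝ) : Fin 4 → Fin 4 → ℝ :=
  let s := Real.sin x.2.2
  ![![0, redTR F x, redTA F x, s * (x.2.1 * cart F 0 2 x)],
    ![-redTR F x, 0, redU F x, s * redP1 F x],
    ![-redTA F x, -redU F x, 0, s * redP2 F x],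
    ![-(s * (x.2.1 * cart F 0 2 x)), -(s * redP1 F x), -(s * redP2 F x), 0]]

/-- The densitized Boyer-Lindquist components `√(-det ḡ) F^{μν}`. -/
def blUp (m a : ℝ) (F : TwoForm) (x : ℝ × ℝ × ℝ) : Fin 4 → Fin 4 → ℝ :=
  let s := Real.sin x.2.2
  let ru := s * (bgK m a x * redU F x)
  let rf := bgD m a x * bgY m a x * redP1 F x + s * (bgA m a x * redQ2 m a F x)
  let af := bgY m a x * redP2 F x - s * (bgA m a x * redQ1 m a F x)
  ![![0, s * redQ2 m a F x, -(s * redQ1 m a F x), -redV m a F x],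
    ![-(s * redQ2 m a F x), 0, ru, rf],
    ![s * redQ1 m a F x, -ru, 0, af],
    ![redV m a F x, -rf, -af, 0]]

lemma cart_self (F : TwoForm) (i : Fin 4) (x : ℝ × ℝ × ℝ) : cart F i i x = 0 := by
  have := cart_swap F i i x
  linarith

lemma comp_zero_eq (F : TwoForm) (t r θ : ℝ) (μ ν : Fin 4) :
    comp F ![t, r, θ, 0] μ ν = blComp F (t, r, θ) μ ν := by
  have h : comp F ![t, r, θ, 0] μ ν = ∑ i, ∑ j,
      (fderiv ℝ blChart ![t, r, θ, 0] (Pi.single μ 1)) i *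
      (fderiv ℝ blChart ![t, r, θ, 0] (Pi.single ν 1)) j * cart F i j (t, r, θ) := by
    unfold comp
    rw [alt_expand]
    rfl
  rw [h, fderiv_blChart, fderiv_blChart]
  have c10 := cart_swap F 0 1 (t, r, θ)
  have c20 := cart_swap F 0 2 (t, r, θ)
  have c30 := cart_swap F 0 3 (t, r, θ)
  have c21 := cart_swap F 1 2 (t, r, θ)
  have c31 := cart_swap F 1 3 (t, r, θ)
  have c32 := cart_swap F 2 3 (t, r, θ)
  have hs := Real.sin_sq_add_cos_sq θ
  fin_cases μ <;> fin_cases ν <;>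
    simp [Fin.sum_univ_four, blComp, redTR, redTA, redU, redP1, redP2, cart_self, c10, c20, c30,
      c21, c31, c32] <;> first | ring1 | linear_combination (-(r * cart F 1 3 (t, r, θ))) * hs | linear_combination ((r * cart F 1 3 (t, r, θ))) * hs

/-- Axial symmetry moves every point to the half-plane φ = 0, where the components were computed in
`comp_zero_eq`. -/
lemma comp_eq {m a : ℝ} {F : TwoForm} (hF : IsAxisymmetricMaxwell m a F) {X : Fin 4 → ℝ}
    (hX : rPlus m a < X 1) : comp F X = blComp F (X 0, X 1, X 2) := by
  rw [← hF.axisymmetric X hX 0]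
  have : Function.update X 3 0 = ![X 0, X 1, X 2, 0] := by
    ext i; fin_cases i <;> simp
  rw [this]
  ext μ ν
  exact comp_zero_eq F _ _ _ μ ν

section
variable {m a : ℝ}

/-- This is g_{tt} g_{φφ} − g_{tφ}² = −Δ sin² θ with denominators cleared. It is the one nontrivial
identity behind the inverse, the determinant and the densitized components of the Kerr metric. -/
lemma sigma_xi_identity (m a r θ : ℝ) : delta m a r * sigma a r θ ^ 2 =
    4 * a ^ 2 * m ^ 2 * r ^ 2 * Real.sin θ ^ 2
      + xi m a r θ * (delta m a r - a ^ 2 * Real.sin θ ^ 2) := by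
  unfold xi sigma delta
  rw [Real.cos_sq']
  ring

variable (hm : 0 < m) (ha : |a| ≤ m)
include hm ha

lemma kerr_inv {r θ : ℝ} (hr : rPlus m a < r) (hθ : Real.sin θ ≠ 0) :
    (kerr m a r θ)⁻¹ =
      !![-xi m a r θ / (sigma a r θ * delta m a r), 0, 0,
          -(2 * a * m * r) / (sigma a r θ * delta m a r);
        0, delta m a r / sigma a r θ, 0, 0;
        0, 0, 1 / sigma a r θ, 0;
        -(2 * a * m * r) / (sigma a r θ * delta m a r), 0, 0,
          (delta m a r - a ^ 2 * Real.sin θ ^ 2) /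
            (sigma a r θ * delta m a r * Real.sin θ ^ 2)] := by
  obtain ⟨h0, hD⟩ := rPlus_lt m a r hm ha hr
  have hS := (sigma_pos h0 a θ).ne'
  have hD' := hD.ne'
  have key := sigma_xi_identity m a r θ
  have hd : r ^ 2 + a ^ 2 - delta m a r = 2 * m * r := by unfold delta; ring
  apply Matrix.inv_eq_right_inv
  ext i j
  fin_cases i <;> fin_cases j <;>
    simp [kerr, Matrix.mul_apply, Fin.sum_univ_four, hd] <;> field_simp <;>
    first | ring1 | linear_combination key | linear_combination -key

lemma volDensity_eq {r θ : ℝ} (hr : rPlus m a < r) (hθ : 0 < Real.sin θ) :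
    volDensity m a r θ = sigma a r θ * Real.sin θ := by
  obtain ⟨h0, hD⟩ := rPlus_lt m a r hm ha hr
  have hS := sigma_pos h0 a θ
  have hS' := hS.ne'
  have hD' := hD.ne'
  have key := sigma_xi_identity m a r θ
  have hd : r ^ 2 + a ^ 2 - delta m a r = 2 * m * r := by unfold delta; ring
  have hdet : (kerr m a r θ).det = -(sigma a r θ * Real.sin θ) ^ 2 := by
    simp [kerr, Matrix.det_succ_row_zero, Fin.sum_univ_succ, hd, Fin.succAbove]
    field_simp
    linear_combination key
  rw [volDensity, hdet, neg_neg, Real.sqrt_sq (by positivity)]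

lemma densitized_compUp_eq {F : TwoForm} (hF : IsAxisymmetricMaxwell m a F) {X : Fin 4 → ℝ}
    (hX : rPlus m a < X 1) (hθ : 0 < Real.sin (X 2)) (μ ν : Fin 4) :
    volDensity m a (X 1) (X 2) * compUp m a F X μ ν = blUp m a F (X 0, X 1, X 2) μ ν := by
  obtain ⟨h0, hD⟩ := rPlus_lt m a _ hm ha hX
  have hS' := (sigma_pos h0 a (X 2)).ne'
  have hX' := (xi_pos (a := a) hm h0 (X 2)).ne'
  have hD' := hD.ne'
  have key := sigma_xi_identity m a (X 1) (X 2)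
  rw [volDensity_eq hm ha hX hθ, compUp, comp_eq hF hX, kerr_inv hm ha hX hθ.ne']
  generalize X 0 = t at *
  generalize X 1 = r at *
  generalize X 2 = θ at *
  simp only [Fin.sum_univ_four]
  fin_cases μ <;> fin_cases ν <;>
    simp [blComp, blUp, redQ1, redQ2, redV, bgY, bgA, bgD, bgK]
  all_goals
    generalize redTR F (t, r, θ) = TR
    generalize redTA F (t, r, θ) = TA
    generalize redU F (t, r, θ) = U
    generalize redP1 F (t, r, θ) = P1
    generalize redP2 F (t, r, θ) = P2
    generalize cart F 0 2 (t, r, θ) = C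
    generalize Real.sin θ = s at *
    generalize sigma a r θ = S at *
    generalize xi m a r θ = Xi at *
    generalize delta m a r = D at *
    field_simp
    all_goals first
      | ring1
      | (right; ring1)
      | linear_combination C * key
      | linear_combination (-C) * key
      | linear_combination P1 * key
      | linear_combination (-P1) * key
      | linear_combination P2 * key
      | linear_combination (-P2) * key

omit ha in
lemma smooth_redU {F : TwoForm} (hF : ContDiffOn ℝ ∞ F (exterior m a)) : Smooth m a (redU F) := by
  have := smooth_cart hm hF 1 3
  unfold Smooth redU at *
  generalize cart F 1 3 = f at *
  clear hF
  fun_prop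

omit ha in
lemma smooth_redP1 {F : TwoForm} (hF : ContDiffOn ℝ ∞ F (exterior m a)) :
    Smooth m a (redP1 F) := by
  have h1 := smooth_cart hm hF 1 2
  have h2 := smooth_cart hm hF 2 3
  unfold Smooth redP1 at *
  generalize cart F 1 2 = f at *
  generalize cart F 2 3 = g at *
  clear hF
  fun_prop

omit ha in
lemma smooth_redP2 {F : TwoForm} (hF : ContDiffOn ℝ ∞ F (exterior m a)) :
    Smooth m a (redP2 F) := by
  have h1 := smooth_cart hm hF 1 2
  have h2 := smooth_cart hm hF 2 3
  unfold Smooth redP2 at *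
  generalize cart F 1 2 = f at *
  generalize cart F 2 3 = g at *
  clear hF
  fun_prop

omit ha in
lemma smooth_redTR {F : TwoForm} (hF : ContDiffOn ℝ ∞ F (exterior m a)) :
    Smooth m a (redTR F) := by
  have h1 := smooth_cart hm hF 0 1
  have h2 := smooth_cart hm hF 0 3
  unfold Smooth redTR at *
  generalize cart F 0 1 = f at *
  generalize cart F 0 3 = g at *
  clear hF
  fun_prop

omit ha in
lemma smooth_redTA {F : TwoForm} (hF : ContDiffOn ℝ ∞ F (exterior m a)) :
    Smooth m a (redTA F) := by
  have h1 := smooth_cart hm hF 0 1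
  have h2 := smooth_cart hm hF 0 3
  unfold Smooth redTA at *
  generalize cart F 0 1 = f at *
  generalize cart F 0 3 = g at *
  clear hF
  fun_prop

lemma smooth_redV {F : TwoForm} (hF : ContDiffOn ℝ ∞ F (exterior m a)) :
    Smooth m a (redV m a F) := by
  have h1 := smooth_cart hm hF 0 2
  have h2 := smooth_bgK hm ha
  unfold Smooth redV at *
  generalize cart F 0 2 = f at *
  clear hF
  exact ContDiffOn.div (by fun_prop) h2 fun x hx => (bgK_pos hm ha hx).ne'

lemma smooth_redQ1 {F : TwoForm} (hF : ContDiffOn ℝ ∞ F (exterior m a)) :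
    Smooth m a (redQ1 m a F) := by
  have h1 := smooth_redTA hm hF
  have h2 := smooth_redP2 hm hF
  have h3 := smooth_bgY hm ha
  have h4 := smooth_bgA hm ha
  have h5 := smooth_bgD m a
  unfold Smooth redQ1 at *
  generalize redTA F = f at *
  generalize redP2 F = g at *
  clear hF
  exact ContDiffOn.div (by fun_prop) (by fun_prop) fun x hx =>
    (mul_pos (bgY_pos hm ha hx) (bgD_pos hm ha hx)).ne'

lemma smooth_redQ2 {F : TwoForm} (hF : ContDiffOn ℝ ∞ F (exterior m a)) :
    Smooth m a (redQ2 m a F) := by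
  have h1 := smooth_redTR hm hF
  have h2 := smooth_redP1 hm hF
  have h3 := smooth_bgY hm ha
  have h4 := smooth_bgA hm ha
  unfold Smooth redQ2 at *
  generalize redTR F = f at *
  generalize redP1 F = g at *
  clear hF
  exact ContDiffOn.div (by fun_prop) (by fun_prop) fun x hx => (bgY_pos hm ha hx).ne'

end

/-! ### Maxwell's equations for the reduced fields -/

/-- The projection to the variables `(t, r, θ)`. -/
def projTRA : (Fin 4 → ℝ) →L[ℝ] ℝ × ℝ × ℝ :=
  (ContinuousLinearMap.proj 0).prod
    ((ContinuousLinearMap.proj 1).prod (ContinuousLinearMap.proj 2))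

/-- The Boyer-Lindquist components depend locally on (t, r, θ) only; the last entry 0 is the
φ-derivative that axial symmetry removes from every equation. -/
lemma fderiv_comp_projTRA {f : (Fin 4 → ℝ) → ℝ} {g : ℝ × ℝ × ℝ → ℝ} {X : Fin 4 → ℝ}
    (hg : DifferentiableAt ℝ g (X 0, X 1, X 2))
    (h : f =ᶠ[𝓝 X] fun Y => g (Y 0, Y 1, Y 2)) (μ : Fin 4) :
    fderiv ℝ f X (Pi.single μ 1) =
      (![dT g (X 0, X 1, X 2), dR g (X 0, X 1, X 2), dA g (X 0, X 1, X 2), 0] : Fin 4 → ℝ) μ := by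
  have h1 : HasFDerivAt (fun Y => g (Y 0, Y 1, Y 2))
      ((fderiv ℝ g (X 0, X 1, X 2)).comp projTRA) X :=
    HasFDerivAt.comp (f := projTRA) X hg.hasFDerivAt projTRA.hasFDerivAt
  rw [h.fderiv_eq, h1.fderiv]
  fin_cases μ <;> simp [projTRA, dT, dR, dA]
  exact map_zero _

/-- The exterior derivative commutes with the pullback by `blChart`, and on constant coordinate
fields it is the cyclic sum of derivatives of components. The chart need not be invertible for this,
so the identity holds on the axis as well. -/
lemma bianchi_comp {m a : ℝ} (hm : 0 < m) {F : TwoForm} (hF : IsAxisymmetricMaxwell m a F)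
    {X : Fin 4 → ℝ} (hX : rPlus m a < X 1) (i j k : Fin 4) :
    fderiv ℝ (fun Y => comp F Y j k) X (Pi.single i 1)
      - fderiv ℝ (fun Y => comp F Y i k) X (Pi.single j 1)
      + fderiv ℝ (fun Y => comp F Y i j) X (Pi.single k 1) = 0 := by
  have hmem := blChart_mem_exterior (a := a) hm hX
  have hd : DifferentiableAt ℝ F (blChart X) :=
    (hF.smooth.differentiableOn (by simp)).differentiableAt ((isOpen_exterior m a).mem_nhds hmem)
  have hb : ContDiffAt ℝ ∞ blChart X := contDiff_blChart.contDiffAt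
  have h1 := extDeriv_pullback hd hb (by
    rw [minSmoothness_of_isRCLikeNormedField]
    exact WithTop.coe_le_coe.2 (le_top : (2 : ℕ∞) ≤ ⊤))
  rw [hF.bianchi _ hmem] at h1
  have hdiff : DifferentiableAt ℝ
      (fun Y => (F (blChart Y)).compContinuousLinearMap (fderiv ℝ blChart Y)) X := by
    refine DifferentiableAt.continuousAlternatingMapCompContinuousLinearMap ?_ ?_
    · exact hd.comp X (hb.differentiableAt (by simp))
    · exact (((contDiff_blChart.fderiv_right (m := ∞) (by simp)).differentiable (by simp)) X)
  have h2 := extDeriv_apply hdiff ![Pi.single i 1, Pi.single j 1, Pi.single k 1]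
  rw [h1] at h2
  have e : ∀ (Y : Fin 4 → ℝ) (μ ν : Fin 4) (w : Fin 2 → Fin 4 → ℝ),
      w = ![Pi.single μ 1, Pi.single ν 1] →
      (F (blChart Y)).compContinuousLinearMap (fderiv ℝ blChart Y) w = comp F Y μ ν := by
    rintro Y μ ν w rfl
    unfold comp
    rw [ContinuousAlternatingMap.compContinuousLinearMap_apply]
    congr 1
    ext l; fin_cases l <;> simp
  have e0 : ∀ Y, (F (blChart Y)).compContinuousLinearMap (fderiv ℝ blChart Y)
      ((0 : Fin 3).removeNth ![Pi.single i 1, Pi.single j 1, Pi.single k 1]) = comp F Y j k :=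
    fun Y => e Y j k _ (by ext l : 1; fin_cases l <;> rfl)
  have e1 : ∀ Y, (F (blChart Y)).compContinuousLinearMap (fderiv ℝ blChart Y)
      ((1 : Fin 3).removeNth ![Pi.single i 1, Pi.single j 1, Pi.single k 1]) = comp F Y i k :=
    fun Y => e Y i k _ (by ext l : 1; fin_cases l <;> rfl)
  have e2 : ∀ Y, (F (blChart Y)).compContinuousLinearMap (fderiv ℝ blChart Y)
      ((2 : Fin 3).removeNth ![Pi.single i 1, Pi.single j 1, Pi.single k 1]) = comp F Y i j :=
    fun Y => e Y i j _ (by ext l : 1; fin_cases l <;> rfl)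
  rw [Fin.sum_univ_three] at h2
  simp only [e0, e1, e2] at h2
  simp at h2
  linarith

section
variable {f g : ℝ × ℝ × ℝ → ℝ} {x : ℝ × ℝ × ℝ}

lemma dT_mul (hf : DifferentiableAt ℝ f x) (hg : DifferentiableAt ℝ g x) :
    dT (fun x => f x * g x) x = dT f x * g x + f x * dT g x := by
  simp [dT, fderiv_fun_mul hf hg]; ring

lemma dR_mul (hf : DifferentiableAt ℝ f x) (hg : DifferentiableAt ℝ g x) :
    dR (fun x => f x * g x) x = dR f x * g x + f x * dR g x := by
  simp [dR, fderiv_fun_mul hf hg]; ring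

lemma dA_mul (hf : DifferentiableAt ℝ f x) (hg : DifferentiableAt ℝ g x) :
    dA (fun x => f x * g x) x = dA f x * g x + f x * dA g x := by
  simp [dA, fderiv_fun_mul hf hg]; ring

lemma dR_add (hf : DifferentiableAt ℝ f x) (hg : DifferentiableAt ℝ g x) :
    dR (fun x => f x + g x) x = dR f x + dR g x := by
  simp [dR, fderiv_fun_add hf hg]

lemma dA_add (hf : DifferentiableAt ℝ f x) (hg : DifferentiableAt ℝ g x) :
    dA (fun x => f x + g x) x = dA f x + dA g x := by
  simp [dA, fderiv_fun_add hf hg]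

lemma dA_sub (hf : DifferentiableAt ℝ f x) (hg : DifferentiableAt ℝ g x) :
    dA (fun x => f x - g x) x = dA f x - dA g x := by
  simp [dA, fderiv_fun_sub hf hg]

lemma dT_neg : dT (fun x => -f x) x = -dT f x := by simp [dT, fderiv_fun_neg]
lemma dR_neg : dR (fun x => -f x) x = -dR f x := by simp [dR, fderiv_fun_neg]
lemma dA_neg : dA (fun x => -f x) x = -dA f x := by simp [dA, fderiv_fun_neg]

/-- `sin θ` as a function of `(t, r, θ)`. -/
def sinA (x : ℝ × ℝ × ℝ) : ℝ := Real.sin x.2.2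

lemma differentiableAt_sinA : DifferentiableAt ℝ sinA x := by unfold sinA; fun_prop

lemma dT_sinA : dT sinA x = 0 :=
  (hasDerivAt_dT (t := x.1) (r := x.2.1) (θ := x.2.2) differentiableAt_sinA).unique (hasDerivAt_const x.1 (Real.sin x.2.2))
lemma dR_sinA : dR sinA x = 0 :=
  (hasDerivAt_dR (t := x.1) (r := x.2.1) (θ := x.2.2) differentiableAt_sinA).unique (hasDerivAt_const x.2.1 (Real.sin x.2.2))
lemma dA_sinA : dA sinA x = Real.cos x.2.2 :=
  (hasDerivAt_dA (t := x.1) (r := x.2.1) (θ := x.2.2) differentiableAt_sinA).unique (Real.hasDerivAt_sin x.2.2)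

lemma dT_sin_mul (hf : DifferentiableAt ℝ f x) :
    dT (fun x => sinA x * f x) x = Real.sin x.2.2 * dT f x := by
  rw [dT_mul differentiableAt_sinA hf, dT_sinA, zero_mul, zero_add]; rfl

lemma dR_sin_mul (hf : DifferentiableAt ℝ f x) :
    dR (fun x => sinA x * f x) x = Real.sin x.2.2 * dR f x := by
  rw [dR_mul differentiableAt_sinA hf, dR_sinA, zero_mul, zero_add]; rfl

lemma dA_sin_mul (hf : DifferentiableAt ℝ f x) :
    dA (fun x => sinA x * f x) x = Real.cos x.2.2 * f x + Real.sin x.2.2 * dA f x := by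
  rw [dA_mul differentiableAt_sinA hf, dA_sinA]; rfl

end

/-- The Maxwell equations in terms of the reduced fields, written as a first-order system. -/
structure ReducedMaxwell (m a : ℝ) (u v p₁ p₂ q₁ q₂ : ℝ × ℝ × ℝ → ℝ) : Prop where
  smooth_u : Smooth m a u
  smooth_v : Smooth m a v
  smooth_p₁ : Smooth m a p₁
  smooth_p₂ : Smooth m a p₂
  smooth_q₁ : Smooth m a q₁
  smooth_q₂ : Smooth m a q₂
  dT_p₁ : ∀ x ∈ domain m a, x.2.2 ∈ Ioo 0 Real.pi →
    dT p₁ x = dR (bgK m a) x * v x + bgK m a x * dR v x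
  dT_p₂ : ∀ x ∈ domain m a, x.2.2 ∈ Ioo 0 Real.pi →
    Real.sin x.2.2 * dT p₂ x = Real.cos x.2.2 * (bgK m a x * v x)
      + Real.sin x.2.2 * (dA (bgK m a) x * v x + bgK m a x * dA v x)
  dT_q₁ : ∀ x ∈ domain m a, x.2.2 ∈ Ioo 0 Real.pi →
    dT q₁ x = dR (bgK m a) x * u x + bgK m a x * dR u x
  dT_q₂ : ∀ x ∈ domain m a, x.2.2 ∈ Ioo 0 Real.pi →
    Real.sin x.2.2 * dT q₂ x = Real.cos x.2.2 * (bgK m a x * u x)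
      + Real.sin x.2.2 * (dA (bgK m a) x * u x + bgK m a x * dA u x)
  dT_v : ∀ x ∈ domain m a, x.2.2 ∈ Ioo 0 Real.pi →
    dT v x = (dR (bgD m a) x * bgY m a x + bgD m a x * dR (bgY m a) x) * p₁ x
      + bgD m a x * bgY m a x * dR p₁ x + dA (bgY m a) x * p₂ x + bgY m a x * dA p₂ x
      - Real.sin x.2.2 * (dA (bgA m a) x * q₁ x - dR (bgA m a) x * q₂ x)
  dT_u : ∀ x ∈ domain m a, x.2.2 ∈ Ioo 0 Real.pi →
    dT u x = (dR (bgD m a) x * bgY m a x + bgD m a x * dR (bgY m a) x) * q₁ x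
      + bgD m a x * bgY m a x * dR q₁ x + dA (bgY m a) x * q₂ x + bgY m a x * dA q₂ x
      + Real.sin x.2.2 * (dA (bgA m a) x * p₁ x - dR (bgA m a) x * p₂ x)
  curl_p : ∀ x ∈ domain m a, x.2.2 ∈ Ioo 0 Real.pi →
    Real.sin x.2.2 * dR p₂ x = Real.cos x.2.2 * p₁ x + Real.sin x.2.2 * dA p₁ x
  curl_q : ∀ x ∈ domain m a, x.2.2 ∈ Ioo 0 Real.pi →
    Real.sin x.2.2 * dR q₂ x = Real.cos x.2.2 * q₁ x + Real.sin x.2.2 * dA q₁ x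

section
variable {m a : ℝ}

lemma fderiv_comp_eq {F : TwoForm} (hF : IsAxisymmetricMaxwell m a F) {g : ℝ × ℝ × ℝ → ℝ}
    {x : ℝ × ℝ × ℝ} (hx : x ∈ domain m a) (hg : DifferentiableAt ℝ g x) {μ ν : Fin 4}
    (h : ∀ y ∈ domain m a, blComp F y μ ν = g y) (k : Fin 4) :
    fderiv ℝ (fun Y => comp F Y μ ν) ![x.1, x.2.1, x.2.2, 0] (Pi.single k 1) =
      (![dT g x, dR g x, dA g x, 0] : Fin 4 → ℝ) k := by
  have hx' : rPlus m a < x.2.1 := hx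
  have := fderiv_comp_projTRA (f := fun Y => comp F Y μ ν) (g := g) (X := ![x.1, x.2.1, x.2.2, 0])
    (by simpa using hg) ?_ k
  · simpa using this
  · have ho : IsOpen {Y : Fin 4 → ℝ | rPlus m a < Y 1} := isOpen_lt continuous_const (by fun_prop)
    filter_upwards [ho.mem_nhds (show rPlus m a < _ by simpa using hx')] with Y hY
    rw [comp_eq hF hY, h (Y 0, Y 1, Y 2) hY]

variable (hm : 0 < m) (ha : |a| ≤ m)
include hm ha

lemma fderiv_up_eq {F : TwoForm} (hF : IsAxisymmetricMaxwell m a F) {g : ℝ × ℝ × ℝ → ℝ}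
    {x : ℝ × ℝ × ℝ} (hx : x ∈ domain m a) (hθ : x.2.2 ∈ Ioo 0 Real.pi)
    (hg : DifferentiableAt ℝ g x) {μ ν : Fin 4} (h : ∀ y ∈ domain m a, blUp m a F y μ ν = g y) (k : Fin 4) :
    fderiv ℝ (fun Y : Fin 4 → ℝ => volDensity m a (Y 1) (Y 2) * compUp m a F Y μ ν)
      ![x.1, x.2.1, x.2.2, 0] (Pi.single k 1) = (![dT g x, dR g x, dA g x, 0] : Fin 4 → ℝ) k := by
  have hx' : rPlus m a < x.2.1 := hx
  have := fderiv_comp_projTRA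
    (f := fun Y : Fin 4 → ℝ => volDensity m a (Y 1) (Y 2) * compUp m a F Y μ ν) (g := g)
    (X := ![x.1, x.2.1, x.2.2, 0]) (by simpa using hg) ?_ k
  · simpa using this
  · have ho : IsOpen {Y : Fin 4 → ℝ | rPlus m a < Y 1} := isOpen_lt continuous_const (by fun_prop)
    have ho2 : IsOpen {Y : Fin 4 → ℝ | Y 2 ∈ Ioo 0 Real.pi} := isOpen_Ioo.preimage (by fun_prop)
    filter_upwards [ho.mem_nhds (show rPlus m a < _ by simpa using hx'),
      ho2.mem_nhds (show _ ∈ Ioo _ _ by simpa using hθ)] with Y hY hY2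
    rw [densitized_compUp_eq hm ha hF hY (Real.sin_pos_of_pos_of_lt_pi hY2.1 hY2.2),
      h (Y 0, Y 1, Y 2) hY]

theorem reducedMaxwell_of_isAxisymmetricMaxwell {F : TwoForm}
    (hF : IsAxisymmetricMaxwell m a F) :
    ReducedMaxwell m a (redU F) (redV m a F) (redP1 F) (redP2 F) (redQ1 m a F) (redQ2 m a F) := by
  have su := smooth_redU hm hF.smooth
  have sv := smooth_redV hm ha hF.smooth
  have sp1 := smooth_redP1 hm hF.smooth
  have sp2 := smooth_redP2 hm hF.smooth
  have sq1 := smooth_redQ1 hm ha hF.smooth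
  have sq2 := smooth_redQ2 hm ha hF.smooth
  have sY := smooth_bgY hm ha
  have sK := smooth_bgK hm ha
  have sA := smooth_bgA hm ha
  have sD := smooth_bgD m a
  have stf : ∀ x ∈ domain m a, x.2.1 * cart F 0 2 x = bgK m a x * redV m a F x := by
    intro x hx
    have := (bgK_pos hm ha hx).ne'
    unfold redV
    field_simp
  have hpos : ∀ x : ℝ × ℝ × ℝ, x.2.2 ∈ Ioo 0 Real.pi → Real.sin x.2.2 ≠ 0 := fun x h =>
    (Real.sin_pos_of_pos_of_lt_pi h.1 h.2).ne'
  have hX : ∀ x ∈ domain m a, rPlus m a < (![x.1, x.2.1, x.2.2, 0] : Fin 4 → ℝ) 1 :=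
    fun x hx => by simpa using! hx
  have max : ∀ x ∈ domain m a, x.2.2 ∈ Ioo 0 Real.pi → ∀ ν, _ := fun x hx hθ =>
    hF.maxwell ![x.1, x.2.1, x.2.2, 0] (hX x hx) (by simpa using hθ)
  have dKV : ∀ x ∈ domain m a, DifferentiableAt ℝ (fun x => bgK m a x * redV m a F x) x :=
    fun x hx => (sK.differentiableAt hx).fun_mul (sv.differentiableAt hx)
  have dKU : ∀ x ∈ domain m a, DifferentiableAt ℝ (fun x => bgK m a x * redU F x) x :=
    fun x hx => (sK.differentiableAt hx).fun_mul (su.differentiableAt hx)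
  have dS : ∀ {f : ℝ × ℝ × ℝ → ℝ} {x : ℝ × ℝ × ℝ}, DifferentiableAt ℝ f x →
      DifferentiableAt ℝ (fun x => sinA x * f x) x := fun h => differentiableAt_sinA.fun_mul h
  -- derivatives of the covariant components
  have c13 := fun (x : ℝ × ℝ × ℝ) (hx : x ∈ domain m a) => fderiv_comp_eq hF (μ := 1) (ν := 3) hx (dS (sp1.differentiableAt hx))
    fun y _ => rfl
  have c23 := fun (x : ℝ × ℝ × ℝ) (hx : x ∈ domain m a) => fderiv_comp_eq hF (μ := 2) (ν := 3) hx (dS (sp2.differentiableAt hx))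
    fun y _ => rfl
  have c03 := fun (x : ℝ × ℝ × ℝ) (hx : x ∈ domain m a) => fderiv_comp_eq hF (μ := 0) (ν := 3) hx (dS (dKV x hx))
    fun y hy => by rw [← stf y hy]; rfl
  have c12 := fun (x : ℝ × ℝ × ℝ) (hx : x ∈ domain m a) => fderiv_comp_eq hF (μ := 1) (ν := 2) hx (su.differentiableAt hx)
    fun y _ => rfl
  -- The definitions of `redQ2` and `redQ1` are solved for F_{tr} and F_{tθ}, so that the Bianchi
  -- identity with indices t, r, θ becomes an evolution equation for u in terms of the p's and q's.
  have dTR : ∀ x ∈ domain m a, DifferentiableAt ℝ (fun x => -(bgA m a x * (sinA x * redP1 F x)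
      + bgY m a x * redQ2 m a F x)) x := fun x hx =>
    (((sA.differentiableAt hx).fun_mul (dS (sp1.differentiableAt hx))).fun_add
      ((sY.differentiableAt hx).fun_mul (sq2.differentiableAt hx))).fun_neg
  have dTA : ∀ x ∈ domain m a, DifferentiableAt ℝ (fun x => bgD m a x * bgY m a x * redQ1 m a F x
      + -(bgA m a x * (sinA x * redP2 F x))) x := fun x hx =>
    (((sD.differentiableAt hx).fun_mul (sY.differentiableAt hx)).fun_mul (sq1.differentiableAt hx)).fun_add
      ((sA.differentiableAt hx).fun_mul (dS (sp2.differentiableAt hx))).fun_neg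
  have c01 := fun (x : ℝ × ℝ × ℝ) (hx : x ∈ domain m a) => fderiv_comp_eq hF (μ := 0) (ν := 1) hx (dTR x hx)
    fun y hy => by
      have := (bgY_pos hm ha hy).ne'
      change redTR F y = _
      unfold redQ2 sinA
      field_simp
      ring
  have c02 := fun (x : ℝ × ℝ × ℝ) (hx : x ∈ domain m a) => fderiv_comp_eq hF (μ := 0) (ν := 2) hx (dTA x hx)
    fun y hy => by
      have := (bgY_pos hm ha hy).ne'
      have := (bgD_pos hm ha hy).ne'
      change redTA F y = _
      unfold redQ1 sinA
      field_simp
      ring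
  have b013 : ∀ x ∈ domain m a, Real.sin x.2.2 * dT (redP1 F) x =
      Real.sin x.2.2 * (dR (bgK m a) x * redV m a F x + bgK m a x * dR (redV m a F) x) := by
    intro x hx
    have := bianchi_comp hm hF (hX x hx) 0 1 3
    rw [c13 x hx, c03 x hx, c01 x hx, dR_sin_mul (dKV x hx), dT_sin_mul (sp1.differentiableAt hx),
      dR_mul (sK.differentiableAt hx) (sv.differentiableAt hx)] at this
    simp at this
    linarith
  have b023 : ∀ x ∈ domain m a, Real.sin x.2.2 * dT (redP2 F) x =
      Real.cos x.2.2 * (bgK m a x * redV m a F x) +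
      Real.sin x.2.2 * (dA (bgK m a) x * redV m a F x + bgK m a x * dA (redV m a F) x) := by
    intro x hx
    have := bianchi_comp hm hF (hX x hx) 0 2 3
    rw [c23 x hx, c03 x hx, c02 x hx, dA_sin_mul (dKV x hx), dT_sin_mul (sp2.differentiableAt hx),
      dA_mul (sK.differentiableAt hx) (sv.differentiableAt hx)] at this
    simp at this
    linarith
  have b123 : ∀ x ∈ domain m a, Real.sin x.2.2 * dR (redP2 F) x =
      Real.cos x.2.2 * redP1 F x + Real.sin x.2.2 * dA (redP1 F) x := by
    intro x hx
    have := bianchi_comp hm hF (hX x hx) 1 2 3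
    rw [c23 x hx, c13 x hx, c12 x hx, dA_sin_mul (sp1.differentiableAt hx),
      dR_sin_mul (sp2.differentiableAt hx)] at this
    simp at this
    linarith
  -- derivatives of the contravariant components
  have u01 := fun (x : ℝ × ℝ × ℝ) (hx : x ∈ domain m a)
    (hθ : x.2.2 ∈ Ioo 0 Real.pi) => fderiv_up_eq hm ha hF (μ := 0) (ν := 1) hx hθ
    (dS (sq2.differentiableAt hx)) fun y _ => rfl
  have u10 := fun (x : ℝ × ℝ × ℝ) (hx : x ∈ domain m a)
    (hθ : x.2.2 ∈ Ioo 0 Real.pi) => fderiv_up_eq hm ha hF (μ := 1) (ν := 0) hx hθ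
    (dS (sq2.differentiableAt hx)).fun_neg fun y _ => rfl
  have u02 := fun (x : ℝ × ℝ × ℝ) (hx : x ∈ domain m a)
    (hθ : x.2.2 ∈ Ioo 0 Real.pi) => fderiv_up_eq hm ha hF (μ := 0) (ν := 2) hx hθ
    (dS (sq1.differentiableAt hx)).fun_neg fun y _ => rfl
  have u20 := fun (x : ℝ × ℝ × ℝ) (hx : x ∈ domain m a)
    (hθ : x.2.2 ∈ Ioo 0 Real.pi) => fderiv_up_eq hm ha hF (μ := 2) (ν := 0) hx hθ
    (dS (sq1.differentiableAt hx)) fun y _ => rfl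
  have u03 := fun (x : ℝ × ℝ × ℝ) (hx : x ∈ domain m a)
    (hθ : x.2.2 ∈ Ioo 0 Real.pi) => fderiv_up_eq hm ha hF (μ := 0) (ν := 3) hx hθ
    (sv.differentiableAt hx).fun_neg fun y _ => rfl
  have u12 := fun (x : ℝ × ℝ × ℝ) (hx : x ∈ domain m a)
    (hθ : x.2.2 ∈ Ioo 0 Real.pi) => fderiv_up_eq hm ha hF (μ := 1) (ν := 2) hx hθ
    (dS (dKU x hx)) fun y _ => rfl
  have u21 := fun (x : ℝ × ℝ × ℝ) (hx : x ∈ domain m a)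
    (hθ : x.2.2 ∈ Ioo 0 Real.pi) => fderiv_up_eq hm ha hF (μ := 2) (ν := 1) hx hθ
    (dS (dKU x hx)).fun_neg fun y _ => rfl
  have d13 : ∀ x ∈ domain m a, DifferentiableAt ℝ (fun x => bgD m a x * bgY m a x * redP1 F x
      + sinA x * (bgA m a x * redQ2 m a F x)) x := fun x hx =>
    (((sD.differentiableAt hx).fun_mul (sY.differentiableAt hx)).fun_mul (sp1.differentiableAt hx)).fun_add
      (dS ((sA.differentiableAt hx).fun_mul (sq2.differentiableAt hx)))
  have d23 : ∀ x ∈ domain m a, DifferentiableAt ℝ (fun x => bgY m a x * redP2 F x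
      - sinA x * (bgA m a x * redQ1 m a F x)) x := fun x hx =>
    ((sY.differentiableAt hx).fun_mul (sp2.differentiableAt hx)).fun_sub
      (dS ((sA.differentiableAt hx).fun_mul (sq1.differentiableAt hx)))
  have u13 := fun (x : ℝ × ℝ × ℝ) (hx : x ∈ domain m a)
    (hθ : x.2.2 ∈ Ioo 0 Real.pi) => fderiv_up_eq hm ha hF (μ := 1) (ν := 3) hx hθ (d13 x hx) fun y _ => rfl
  have u23 := fun (x : ℝ × ℝ × ℝ) (hx : x ∈ domain m a)
    (hθ : x.2.2 ∈ Ioo 0 Real.pi) => fderiv_up_eq hm ha hF (μ := 2) (ν := 3) hx hθ (d23 x hx) fun y _ => rfl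
  have u00 := fun (x : ℝ × ℝ × ℝ) (hx : x ∈ domain m a)
    (hθ : x.2.2 ∈ Ioo 0 Real.pi) => fderiv_up_eq hm ha hF (μ := 0) (ν := 0) (x := x) (g := fun _ => 0) hx hθ
    (differentiableAt_const _) fun y _ => rfl
  have u11 := fun (x : ℝ × ℝ × ℝ) (hx : x ∈ domain m a)
    (hθ : x.2.2 ∈ Ioo 0 Real.pi) => fderiv_up_eq hm ha hF (μ := 1) (ν := 1) (x := x) (g := fun _ => 0) hx hθ
    (differentiableAt_const _) fun y _ => rfl
  have u22 := fun (x : ℝ × ℝ × ℝ) (hx : x ∈ domain m a)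
    (hθ : x.2.2 ∈ Ioo 0 Real.pi) => fderiv_up_eq hm ha hF (μ := 2) (ν := 2) (x := x) (g := fun _ => 0) hx hθ
    (differentiableAt_const _) fun y _ => rfl
  have u3 : ∀ x, ∀ hx : x ∈ domain m a, ∀ hθ : x.2.2 ∈ Ioo 0 Real.pi, ∀ ν,
      fderiv ℝ (fun Y : Fin 4 → ℝ => volDensity m a (Y 1) (Y 2) * compUp m a F Y 3 ν)
      ![x.1, x.2.1, x.2.2, 0] (Pi.single 3 1) = 0 := by
    intro x hx hθ ν
    have d : DifferentiableAt ℝ (fun y => blUp m a F y 3 ν) x := by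
      fin_cases ν
      · exact sv.differentiableAt hx
      · exact (d13 x hx).fun_neg
      · exact (d23 x hx).fun_neg
      · exact differentiableAt_const _
    rw [fderiv_up_eq hm ha hF hx hθ d fun y _ => rfl]
    rfl
  -- The Gauss constraint: the pair (sin θ q₁, sin θ q₂) is closed. This is what gives the electric
  -- field a twist potential.
  have m0 : ∀ x ∈ domain m a, x.2.2 ∈ Ioo 0 Real.pi → Real.sin x.2.2 * dR (redQ2 m a F) x =
      Real.cos x.2.2 * redQ1 m a F x + Real.sin x.2.2 * dA (redQ1 m a F) x := by
    intro x hx hθ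
    have := max x hx hθ 0
    rw [Fin.sum_univ_four, u00 x hx hθ, u10 x hx hθ, u20 x hx hθ, u3 x hx hθ, dR_neg,
      dR_sin_mul (sq2.differentiableAt hx), dA_sin_mul (sq1.differentiableAt hx)] at this
    simp [dT] at this
    linarith
  have m1 : ∀ x ∈ domain m a, x.2.2 ∈ Ioo 0 Real.pi → Real.sin x.2.2 * dT (redQ2 m a F) x =
      Real.cos x.2.2 * (bgK m a x * redU F x) + Real.sin x.2.2 *
        (dA (bgK m a) x * redU F x + bgK m a x * dA (redU F) x) := by
    intro x hx hθ
    have := max x hx hθ 1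
    rw [Fin.sum_univ_four, u01 x hx hθ, u11 x hx hθ, u21 x hx hθ, u3 x hx hθ, dA_neg,
      dT_sin_mul (sq2.differentiableAt hx), dA_sin_mul (dKU x hx),
      dA_mul (sK.differentiableAt hx) (su.differentiableAt hx)] at this
    simp [dR] at this
    linarith
  have m2 : ∀ x ∈ domain m a, x.2.2 ∈ Ioo 0 Real.pi → Real.sin x.2.2 * dT (redQ1 m a F) x =
      Real.sin x.2.2 * (dR (bgK m a) x * redU F x + bgK m a x * dR (redU F) x) := by
    intro x hx hθ
    have := max x hx hθ 2
    rw [Fin.sum_univ_four, u02 x hx hθ, u12 x hx hθ, u22 x hx hθ, u3 x hx hθ, dT_neg,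
      dT_sin_mul (sq1.differentiableAt hx), dR_sin_mul (dKU x hx),
      dR_mul (sK.differentiableAt hx) (su.differentiableAt hx)] at this
    simp [dA] at this
    linarith
  refine ⟨su, sv, sp1, sp2, sq1, sq2, fun x hx hθ => mul_left_cancel₀ (hpos x hθ) (b013 x hx),
    fun x hx hθ => b023 x hx, fun x hx hθ => mul_left_cancel₀ (hpos x hθ) (m2 x hx hθ),
    m1, ?_, ?_, fun x hx hθ => b123 x hx, m0⟩
  · intro x hx hθ
    have := max x hx hθ 3
    have h0 := m0 x hx hθ
    rw [Fin.sum_univ_four, u03 x hx hθ, u13 x hx hθ, u23 x hx hθ, u3 x hx hθ, dT_neg,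
      dR_add (((sD.differentiableAt hx).fun_mul (sY.differentiableAt hx)).fun_mul (sp1.differentiableAt hx))
        (dS ((sA.differentiableAt hx).fun_mul (sq2.differentiableAt hx))),
      dA_sub ((sY.differentiableAt hx).fun_mul (sp2.differentiableAt hx))
        (dS ((sA.differentiableAt hx).fun_mul (sq1.differentiableAt hx))),
      dR_mul ((sD.differentiableAt hx).fun_mul (sY.differentiableAt hx)) (sp1.differentiableAt hx),
      dR_mul (sD.differentiableAt hx) (sY.differentiableAt hx),
      dR_sin_mul ((sA.differentiableAt hx).fun_mul (sq2.differentiableAt hx)),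
      dA_sin_mul ((sA.differentiableAt hx).fun_mul (sq1.differentiableAt hx)),
      dR_mul (sA.differentiableAt hx) (sq2.differentiableAt hx),
      dA_mul (sA.differentiableAt hx) (sq1.differentiableAt hx),
      dA_mul (sY.differentiableAt hx) (sp2.differentiableAt hx)] at this
    simp at this
    -- The undifferentiated shift multiplies exactly the Gauss constraint, so only the derivatives
    -- of the shift survive.
    linear_combination (-1) * this + bgA m a x * h0
  · intro x hx hθ
    have := bianchi_comp hm hF (hX x hx) 0 1 2
    have h0 := b123 x hx
    rw [c12 x hx, c02 x hx, c01 x hx, dA_neg, dR_add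
        (((sD.differentiableAt hx).fun_mul (sY.differentiableAt hx)).fun_mul (sq1.differentiableAt hx))
        ((sA.differentiableAt hx).fun_mul (dS (sp2.differentiableAt hx))).fun_neg, dR_neg,
      dA_add ((sA.differentiableAt hx).fun_mul (dS (sp1.differentiableAt hx)))
        ((sY.differentiableAt hx).fun_mul (sq2.differentiableAt hx)),
      dR_mul ((sD.differentiableAt hx).fun_mul (sY.differentiableAt hx)) (sq1.differentiableAt hx),
      dR_mul (sD.differentiableAt hx) (sY.differentiableAt hx),
      dR_mul (sA.differentiableAt hx) (dS (sp2.differentiableAt hx)),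
      dA_mul (sA.differentiableAt hx) (dS (sp1.differentiableAt hx)),
      dR_sin_mul (sp2.differentiableAt hx), dA_sin_mul (sp1.differentiableAt hx),
      dA_mul (sY.differentiableAt hx) (sq2.differentiableAt hx)] at this
    simp [sinA] at this
    -- Here the undifferentiated shift multiplies the magnetic divergence constraint.
    linear_combination this - bgA m a x * h0

end

/-! ### Integrals over the slices of constant time -/

section
variable {m a : ℝ} {f g : ℝ × ℝ × ℝ → ℝ}

lemma continuousOn_slice (hf : ContinuousOn f (domain m a)) (t : ℝ) :
    ContinuousOn (fun p : ℝ × ℝ => f (t, p.1, p.2)) (orbit m a) :=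
  hf.comp (by fun_prop) fun p hp => hp.1

lemma exists_bound_slice (hf : ContinuousOn f (domain m a)) {T r₀ r₁ : ℝ} (h0 : rPlus m a < r₀)
    (hs : ∀ t, |t| ≤ T → ∀ p ∈ orbit m a, p.1 < r₀ ∨ r₁ < p.1 → f (t, p.1, p.2) = 0) :
    ∃ C, ∀ t, |t| ≤ T → ∀ p ∈ orbit m a, |f (t, p.1, p.2)| ≤ C := by
  obtain ⟨C, hC0, hC⟩ := exists_bound_of_continuousOn hf T (r₁ := r₁) h0
  refine ⟨C, fun t ht p hp => ?_⟩
  by_cases h : p.1 < r₀ ∨ r₁ < p.1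
  · rw [hs t ht p hp h, abs_zero]; exact hC0
  · push Not at h
    exact hC t p.1 p.2 ht h.1 h.2 ⟨hp.2.1.le, hp.2.2.le⟩

lemma integrableOn_slice (hf : ContinuousOn f (domain m a)) {t r₀ r₁ : ℝ} (h0 : rPlus m a < r₀)
    (hs : ∀ p ∈ orbit m a, p.1 < r₀ ∨ r₁ < p.1 → f (t, p.1, p.2) = 0) :
    IntegrableOn (fun p : ℝ × ℝ => f (t, p.1, p.2)) (orbit m a) := by
  have hf' : ContinuousOn (fun x : ℝ × ℝ × ℝ => f (t, x.2.1, x.2.2)) (domain m a) :=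
    hf.comp (by fun_prop) fun x hx => hx
  obtain ⟨C, hC⟩ := exists_bound_slice hf' (T := 0) (r₁ := r₁) h0 fun _ _ => hs
  exact integrableOn_orbit (continuousOn_slice hf t) (fun p hp h => hs p hp (Or.inr h))
    (hC 0 (by simp))

lemma hasDerivAt_integral_slice (hf : ContinuousOn f (domain m a))
    (hg : ContinuousOn g (domain m a)) {t₀ r₀ r₁ : ℝ} (h0 : rPlus m a < r₀)
    (hd : ∀ t, |t - t₀| < 1 → ∀ p ∈ orbit m a,
      HasDerivAt (fun t => f (t, p.1, p.2)) (g (t, p.1, p.2)) t)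
    (hsf : ∀ p ∈ orbit m a, p.1 < r₀ ∨ r₁ < p.1 → f (t₀, p.1, p.2) = 0)
    (hsg : ∀ t, |t - t₀| < 1 → ∀ p ∈ orbit m a, p.1 < r₀ ∨ r₁ < p.1 → g (t, p.1, p.2) = 0) :
    HasDerivAt (fun t => ∫ p in orbit m a, f (t, p.1, p.2))
      (∫ p in orbit m a, g (t₀, p.1, p.2)) t₀ := by
  obtain ⟨C, hC0, hC⟩ := exists_bound_of_continuousOn hg (|t₀| + 1) (r₁ := r₁) h0
  refine hasDerivAt_integral_orbit (f := fun t p => f (t, p.1, p.2))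
    (f' := fun t p => g (t, p.1, p.2)) (C := C) (r₁ := r₁) one_pos ?_
    (fun t _ => continuousOn_slice hf t) (continuousOn_slice hg t₀)
    (integrableOn_slice hf h0 hsf) ?_ ?_
  · intro t ht p hp
    exact hd t (by simpa [Real.dist_eq] using ht) p hp
  · intro t ht p hp h
    exact hsg t (by simpa [Real.dist_eq] using ht) p hp (Or.inr h)
  · intro t ht p hp
    have ht' : |t - t₀| < 1 := by simpa [Real.dist_eq] using ht
    by_cases h : p.1 < r₀ ∨ r₁ < p.1
    · rw [hsg t ht' p hp h, abs_zero]; exact hC0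
    · push Not at h
      refine hC t p.1 p.2 ?_ h.1 h.2 ⟨hp.2.1.le, hp.2.2.le⟩
      have := abs_sub_abs_le_abs_sub t t₀
      linarith

lemma integral_slice_divergence {A B A' B' : ℝ × ℝ × ℝ → ℝ} {t r₀ r₁ : ℝ} (h0 : rPlus m a < r₀)
    (hA : ∀ p ∈ orbit m a, HasDerivAt (fun r => A (t, r, p.2)) (A' (t, p.1, p.2)) p.1)
    (hB : ∀ p ∈ orbit m a, HasDerivAt (fun θ => B (t, p.1, θ)) (B' (t, p.1, p.2)) p.2)
    (cA : ContinuousOn A' (domain m a)) (cB : ContinuousOn B (domain m a))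
    (cB' : ContinuousOn B' (domain m a))
    (hs : ∀ p ∈ orbit m a, p.1 < r₀ ∨ r₁ < p.1 →
      A (t, p.1, p.2) = 0 ∧ A' (t, p.1, p.2) = 0 ∧ B' (t, p.1, p.2) = 0)
    (hB0 : ∀ r, rPlus m a < r → B (t, r, 0) = 0 ∧ B (t, r, Real.pi) = 0) :
    ∫ p in orbit m a, (A' (t, p.1, p.2) + B' (t, p.1, p.2)) = 0 := by
  have hcont : ∀ r, rPlus m a < r → Continuous fun θ => B (t, r, θ) := fun r hr =>
    cB.comp_continuous (f := fun θ : ℝ => (t, r, θ)) (by fun_prop) fun _ => hr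
  refine integral_orbit_divergence (A := fun p => A (t, p.1, p.2)) (B := fun p => B (t, p.1, p.2))
    (A' := fun p => A' (t, p.1, p.2)) (B' := fun p => B' (t, p.1, p.2)) h0 hA hB
    (integrableOn_slice cA h0 fun p hp h => (hs p hp h).2.1)
    (integrableOn_slice cB' h0 fun p hp h => (hs p hp h).2.2)
    (fun p hp h => (hs p hp h).1) (fun r hr => ?_) (fun r hr => ?_)
  · have := (hcont r hr).tendsto 0
    rw [(hB0 r hr).1] at this
    exact this.mono_left nhdsWithin_le_nhds
  · have := (hcont r hr).tendsto Real.pi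
    rw [(hB0 r hr).2] at this
    exact this.mono_left nhdsWithin_le_nhds

end

/-! ### Finite speed of propagation -/

/-- The square of the positive part. -/
def posSq (x : ℝ) : ℝ := max x 0 ^ 2

/-- At 0 the function is O(h²). The cutoffs of the energy argument are differentiated only once, so
this much regularity suffices and no smooth bump function is required. -/
lemma hasDerivAt_posSq (x : ℝ) : HasDerivAt posSq (2 * max x 0) x := by
  rcases lt_trichotomy x 0 with h | rfl | h
  · have : posSq =ᶠ[𝓝 x] fun _ => 0 := by
      filter_upwards [gt_mem_nhds h] with y hy
      simp [posSq, max_eq_right hy.le]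
    rw [max_eq_right h.le, mul_zero]
    exact (hasDerivAt_const x 0).congr_of_eventuallyEq this
  · rw [max_self, mul_zero, hasDerivAt_iff_isLittleO_nhds_zero]
    have h1 : (fun h : ℝ => posSq (0 + h) - posSq 0 - h • (0 : ℝ)) =O[𝓝 0] fun h : ℝ => h ^ 2 := by
      refine Asymptotics.IsBigO.of_bound 1 (Eventually.of_forall fun h => ?_)
      simp only [posSq, zero_add, max_self, smul_zero, sub_zero, one_mul]
      simp only [ne_eq, OfNat.ofNat_ne_zero, not_false_eq_true, zero_pow, sub_zero, norm_pow]
      refine pow_le_pow_left₀ (norm_nonneg _) ?_ 2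
      rcases le_total h 0 with h' | h'
      · rw [max_eq_right h', norm_zero]; exact norm_nonneg _
      · rw [max_eq_left h']
    refine h1.trans_isLittleO ?_
    simpa using Asymptotics.isLittleO_pow_pow (𝕜 := ℝ) (show 1 < 2 by norm_num)
  · have : posSq =ᶠ[𝓝 x] fun y => y ^ 2 := by
      filter_upwards [lt_mem_nhds h] with y hy
      simp [posSq, max_eq_left hy.le]
    rw [max_eq_left h.le]
    refine HasDerivAt.congr_of_eventuallyEq ?_ this
    simpa using hasDerivAt_pow 2 x

lemma posSq_nonneg (x : ℝ) : 0 ≤ posSq x := sq_nonneg _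
lemma posSq_of_nonpos {x : ℝ} (h : x ≤ 0) : posSq x = 0 := by simp [posSq, max_eq_right h]

/-- The energy density relative to observers at rest with respect to the slicing. -/
def localEnergy (m a : ℝ) (u v p₁ p₂ q₁ q₂ : ℝ × ℝ × ℝ → ℝ) (x : ℝ × ℝ × ℝ) : ℝ :=
  1 / 2 * (Real.sin x.2.2 * (bgK m a x * (u x ^ 2 + v x ^ 2) +
    bgY m a x * (bgD m a x * (p₁ x ^ 2 + q₁ x ^ 2) + (p₂ x ^ 2 + q₂ x ^ 2))))

/-- The radial flux of `localEnergy`. -/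
def fluxR (m a : ℝ) (u v p₁ q₁ : ℝ × ℝ × ℝ → ℝ) (x : ℝ × ℝ × ℝ) : ℝ :=
  Real.sin x.2.2 * (bgK m a x * bgD m a x * bgY m a x * (v x * p₁ x + u x * q₁ x))

/-- The polar flux of `localEnergy`. -/
def fluxA (m a : ℝ) (u v p₂ q₂ : ℝ × ℝ × ℝ → ℝ) (x : ℝ × ℝ × ℝ) : ℝ :=
  Real.sin x.2.2 * (bgK m a x * bgY m a x * (v x * p₂ x + u x * q₂ x))

/-- The source of `localEnergy`. -/
def sourceE (m a : ℝ) (u v p₁ p₂ q₁ q₂ : ℝ × ℝ × ℝ → ℝ) (x : ℝ × ℝ × ℝ) : ℝ :=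
  Real.sin x.2.2 ^ 2 * bgK m a x * (u x * (dA (bgA m a) x * p₁ x - dR (bgA m a) x * p₂ x)
    - v x * (dA (bgA m a) x * q₁ x - dR (bgA m a) x * q₂ x))

namespace ReducedMaxwell

variable {m a : ℝ} {u v p₁ p₂ q₁ q₂ : ℝ × ℝ × ℝ → ℝ}

lemma smooth_localEnergy (hm : 0 < m) (ha : |a| ≤ m) (h : ReducedMaxwell m a u v p₁ p₂ q₁ q₂) :
    Smooth m a (localEnergy m a u v p₁ p₂ q₁ q₂) := by
  obtain ⟨h1, h2, h3, h4, h5, h6⟩ := h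
  have k1 := smooth_bgK hm ha
  have k2 := smooth_bgY hm ha
  have k3 := smooth_bgD m a
  unfold Smooth localEnergy at *
  fun_prop

lemma smooth_fluxR (hm : 0 < m) (ha : |a| ≤ m) (h : ReducedMaxwell m a u v p₁ p₂ q₁ q₂) :
    Smooth m a (fluxR m a u v p₁ q₁) := by
  obtain ⟨h1, h2, h3, h4, h5, h6⟩ := h
  have k1 := smooth_bgK hm ha
  have k2 := smooth_bgY hm ha
  have k3 := smooth_bgD m a
  unfold Smooth fluxR at *
  fun_prop

lemma smooth_fluxA (hm : 0 < m) (ha : |a| ≤ m) (h : ReducedMaxwell m a u v p₁ p₂ q₁ q₂) :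
    Smooth m a (fluxA m a u v p₂ q₂) := by
  obtain ⟨h1, h2, h3, h4, h5, h6⟩ := h
  have k1 := smooth_bgK hm ha
  have k2 := smooth_bgY hm ha
  unfold Smooth fluxA at *
  fun_prop

/-- The evolution equations are multiplied by the fields with the weights of `localEnergy`. The
principal terms combine into the divergence of the two fluxes, because K multiplies u, v in the
equations for p, q and Y multiplies p, q in those for u, v. The derivatives of the shift, that is
the dragging of the slicing, are the only source. -/
lemma localEnergy_identity (hm : 0 < m) (ha : |a| ≤ m)
    (h : ReducedMaxwell m a u v p₁ p₂ q₁ q₂) {t r θ : ℝ} (hr : rPlus m a < r)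
    (hθ : θ ∈ Ioo 0 Real.pi) :
    dT (localEnergy m a u v p₁ p₂ q₁ q₂) (t, r, θ) = dR (fluxR m a u v p₁ q₁) (t, r, θ)
      + dA (fluxA m a u v p₂ q₂) (t, r, θ) + sourceE m a u v p₁ p₂ q₁ q₂ (t, r, θ) := by
  have hx : (t, r, θ) ∈ domain m a := hr
  have e1 := ((h.smooth_localEnergy hm ha).hasDerivAt_dT hr θ (t := t)).unique
    ((((((h.smooth_u.hasDerivAt_dT hr θ).pow 2).add ((h.smooth_v.hasDerivAt_dT hr θ).pow 2)).const_mul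
      (bgK m a (t, r, θ))).add
      (((((h.smooth_p₁.hasDerivAt_dT hr θ).pow 2).add
        ((h.smooth_q₁.hasDerivAt_dT hr θ).pow 2)).const_mul (bgD m a (t, r, θ))).add
        (((h.smooth_p₂.hasDerivAt_dT hr θ).pow 2).add
        ((h.smooth_q₂.hasDerivAt_dT hr θ).pow 2)) |>.const_mul (bgY m a (t, r, θ)))
      |>.const_mul (Real.sin θ)).const_mul (1 / 2))
  have e2 := ((h.smooth_fluxR hm ha).hasDerivAt_dR t hr θ).unique
    ((((((smooth_bgK hm ha).hasDerivAt_dR t hr θ).mul ((smooth_bgD m a).hasDerivAt_dR t hr θ)).mul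
      ((smooth_bgY hm ha).hasDerivAt_dR t hr θ)).mul
      (((h.smooth_v.hasDerivAt_dR t hr θ).mul (h.smooth_p₁.hasDerivAt_dR t hr θ)).add
      ((h.smooth_u.hasDerivAt_dR t hr θ).mul (h.smooth_q₁.hasDerivAt_dR t hr θ)))).const_mul
      (Real.sin θ))
  have e3 := ((h.smooth_fluxA hm ha).hasDerivAt_dA t hr θ).unique
    ((Real.hasDerivAt_sin θ).mul ((((smooth_bgK hm ha).hasDerivAt_dA t hr θ).mul
      ((smooth_bgY hm ha).hasDerivAt_dA t hr θ)).mul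
      (((h.smooth_v.hasDerivAt_dA t hr θ).mul (h.smooth_p₂.hasDerivAt_dA t hr θ)).add
      ((h.smooth_u.hasDerivAt_dA t hr θ).mul (h.smooth_q₂.hasDerivAt_dA t hr θ)))))
  rw [e1, e2, e3, sourceE]
  have r1 := h.dT_p₁ _ hx hθ
  have r2 := h.dT_p₂ _ hx hθ
  have r3 := h.dT_q₁ _ hx hθ
  have r4 := h.dT_q₂ _ hx hθ
  have r5 := h.dT_v _ hx hθ
  have r6 := h.dT_u _ hx hθ
  simp only [Pi.mul_apply, Pi.add_apply] at *
  push_cast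
  linear_combination Real.sin θ * bgK m a (t, r, θ) * u (t, r, θ) * r6
    + Real.sin θ * bgK m a (t, r, θ) * v (t, r, θ) * r5
    + Real.sin θ * bgY m a (t, r, θ) * bgD m a (t, r, θ) * p₁ (t, r, θ) * r1
    + Real.sin θ * bgY m a (t, r, θ) * bgD m a (t, r, θ) * q₁ (t, r, θ) * r3
    + bgY m a (t, r, θ) * p₂ (t, r, θ) * r2 + bgY m a (t, r, θ) * q₂ (t, r, θ) * r4

end ReducedMaxwell

/-! ### Light cones in the variable log (r − r₊) -/

section
variable {m a : ℝ}

/-- The speed of radial light rays is at most `(r - r₊) / m`. -/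
lemma radialSpeed_le (hm : 0 < m) (ha : |a| ≤ m) {r : ℝ} (hr : rPlus m a < r) (t θ : ℝ) :
    bgK m a (t, r, θ) * bgD m a (t, r, θ) * bgY m a (t, r, θ) ≤ ((r - rPlus m a) / m) ^ 2 := by
  obtain ⟨h0, hD⟩ := rPlus_lt m a r hm ha hr
  have hS := sigma_pos h0 a θ
  have hX := xi_ge (a := a) hm h0 θ
  have hX' := xi_pos (a := a) hm h0 θ
  have h1 : a ^ 2 ≤ m ^ 2 := sq_le_sq' (by linarith [neg_abs_le a]) (by linarith [le_abs_self a])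
  have h2 := Real.sqrt_nonneg (m ^ 2 - a ^ 2)
  have h3 := Real.sq_sqrt (show 0 ≤ m ^ 2 - a ^ 2 by linarith)
  have h4 : Real.sqrt (m ^ 2 - a ^ 2) ≤ m := by
    rw [Real.sqrt_le_left hm.le]; nlinarith [sq_nonneg a]
  have hrm : m ≤ r := by unfold rPlus at hr; linarith
  -- Δ = (r − r₊)(r − r₋), and r₋ = m − √(m² − a²) is nonnegative.
  have hD1 : delta m a r ≤ (r - rPlus m a) * r := by
    have : delta m a r = (r - rPlus m a) * (r - (m - Real.sqrt (m ^ 2 - a ^ 2))) := by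
      unfold delta rPlus; nlinarith
    rw [this]
    exact mul_le_mul_of_nonneg_left (by linarith) (by linarith)
  have e : bgK m a (t, r, θ) * bgD m a (t, r, θ) * bgY m a (t, r, θ) =
      delta m a r ^ 2 / xi m a r θ := by
    simp only [bgK, bgD, bgY]
    field_simp
  -- Since r ≥ m, Δ/r² ≤ (r − r₊)/r ≤ (r − r₊)/m. No simple zero of Δ is required, so the extreme
  -- case |a| = m is covered.
  have h5 : delta m a r / r ^ 2 ≤ (r - rPlus m a) / m := by
    rw [div_le_div_iff₀ (by positivity) hm]
    have : 0 ≤ (r - rPlus m a) * r := mul_nonneg (by linarith) h0.le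
    nlinarith [mul_le_mul_of_nonneg_left hrm this, mul_le_mul_of_nonneg_right hD1 hm.le]
  calc _ = delta m a r ^ 2 / xi m a r θ := e
    _ ≤ delta m a r ^ 2 / r ^ 4 := div_le_div_of_nonneg_left (by positivity) (by positivity) hX
    _ = (delta m a r / r ^ 2) ^ 2 := by rw [div_pow]; ring
    _ ≤ _ := pow_le_pow_left₀ (by positivity) h5 2

/-- The cutoff following the light cone with vertex over `log (r - r₊) = c`. -/
def coneCutoff (m a c L : ℝ) (x : ℝ × ℝ × ℝ) : ℝ :=
  posSq (L - (Real.log (x.2.1 - rPlus m a) - c) - x.1 / m) *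
    posSq (L + (Real.log (x.2.1 - rPlus m a) - c) - x.1 / m)

/-- `-m ∂_t` of the cutoff. -/
def coneCutoffT (m a c L : ℝ) (x : ℝ × ℝ × ℝ) : ℝ :=
  2 * max (L - (Real.log (x.2.1 - rPlus m a) - c) - x.1 / m) 0 *
      posSq (L + (Real.log (x.2.1 - rPlus m a) - c) - x.1 / m) +
    posSq (L - (Real.log (x.2.1 - rPlus m a) - c) - x.1 / m) *
      (2 * max (L + (Real.log (x.2.1 - rPlus m a) - c) - x.1 / m) 0)

/-- `(r - r₊) ∂_r` of the cutoff. -/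
def coneCutoffR (m a c L : ℝ) (x : ℝ × ℝ × ℝ) : ℝ :=
  -(2 * max (L - (Real.log (x.2.1 - rPlus m a) - c) - x.1 / m) 0 *
      posSq (L + (Real.log (x.2.1 - rPlus m a) - c) - x.1 / m)) +
    posSq (L - (Real.log (x.2.1 - rPlus m a) - c) - x.1 / m) *
      (2 * max (L + (Real.log (x.2.1 - rPlus m a) - c) - x.1 / m) 0)

variable (c L : ℝ)

lemma continuousOn_logRadius :
    ContinuousOn (fun x : ℝ × ℝ × ℝ => Real.log (x.2.1 - rPlus m a)) (domain m a) :=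
  ContinuousOn.log (by fun_prop) fun x hx => (sub_pos.2 (show rPlus m a < x.2.1 from hx)).ne'

lemma continuousOn_coneCutoff : ContinuousOn (coneCutoff m a c L) (domain m a) := by
  have := continuousOn_logRadius (m := m) (a := a)
  unfold coneCutoff posSq
  fun_prop

lemma continuousOn_coneCutoffT : ContinuousOn (coneCutoffT m a c L) (domain m a) := by
  have := continuousOn_logRadius (m := m) (a := a)
  unfold coneCutoffT posSq
  fun_prop

lemma continuousOn_coneCutoffR : ContinuousOn (coneCutoffR m a c L) (domain m a) := by
  have := continuousOn_logRadius (m := m) (a := a)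
  unfold coneCutoffR posSq
  fun_prop

lemma hasDerivAt_coneCutoff_t (t r θ : ℝ) :
    HasDerivAt (fun t => coneCutoff m a c L (t, r, θ)) (-(1 / m) * coneCutoffT m a c L (t, r, θ)) t := by
  have h1 : HasDerivAt (fun t => L - (Real.log (r - rPlus m a) - c) - t / m) (-(1 / m)) t :=
    ((hasDerivAt_id t).div_const m).const_sub _
  have h2 : HasDerivAt (fun t => L + (Real.log (r - rPlus m a) - c) - t / m) (-(1 / m)) t :=
    ((hasDerivAt_id t).div_const m).const_sub _
  refine (((hasDerivAt_posSq _).comp t h1).mul ((hasDerivAt_posSq _).comp t h2)).congr_deriv ?_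
  simp only [coneCutoffT, Function.comp]
  ring

lemma hasDerivAt_coneCutoff_r {r : ℝ} (hr : rPlus m a < r) (t θ : ℝ) :
    HasDerivAt (fun r => coneCutoff m a c L (t, r, θ))
      ((r - rPlus m a)⁻¹ * coneCutoffR m a c L (t, r, θ)) r := by
  have h0 : HasDerivAt (fun r => Real.log (r - rPlus m a) - c) (1 / (r - rPlus m a)) r :=
    (((hasDerivAt_id r).sub_const _).log (sub_pos.2 hr).ne').sub_const c
  refine (((hasDerivAt_posSq _).comp r ((h0.const_sub L).sub_const (t / m))).mul
    ((hasDerivAt_posSq _).comp r ((h0.const_add L).sub_const (t / m)))).congr_deriv ?_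
  simp only [coneCutoffR, Function.comp]
  ring

lemma coneCutoff_nonneg (x : ℝ × ℝ × ℝ) : 0 ≤ coneCutoff m a c L x :=
  mul_nonneg (posSq_nonneg _) (posSq_nonneg _)

/-- The two nonnegative products enter `coneCutoffT` with equal signs and `coneCutoffR` with
opposite signs. The edge of the cutoff thus moves inward at speed 1/m in log (r − r₊), which is
exactly what absorbs the flux bounded in `abs_fluxR_le`. -/
lemma abs_coneCutoffR_le (x : ℝ × ℝ × ℝ) : |coneCutoffR m a c L x| ≤ coneCutoffT m a c L x := by
  unfold coneCutoffR coneCutoffT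
  have h1 := le_max_right (L - (Real.log (x.2.1 - rPlus m a) - c) - x.1 / m) 0
  have h2 := le_max_right (L + (Real.log (x.2.1 - rPlus m a) - c) - x.1 / m) 0
  have h3 := posSq_nonneg (L - (Real.log (x.2.1 - rPlus m a) - c) - x.1 / m)
  have h4 := posSq_nonneg (L + (Real.log (x.2.1 - rPlus m a) - c) - x.1 / m)
  have h5 := mul_nonneg h1 h4
  have h6 := mul_nonneg h3 h2
  rw [abs_le]
  constructor <;> nlinarith

/-- The cutoff and its derivatives vanish away from the cone. -/
lemma coneCutoff_eq_zero (hm : 0 < m) {x : ℝ × ℝ × ℝ} (hx : x ∈ domain m a) (ht : -1 ≤ x.1)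
    (h : x.2.1 < rPlus m a + Real.exp (c - L - 1 / m) ∨
      rPlus m a + Real.exp (c + L + 1 / m) < x.2.1) :
    coneCutoff m a c L x = 0 ∧ coneCutoffT m a c L x = 0 ∧ coneCutoffR m a c L x = 0 := by
  have hx' : 0 < x.2.1 - rPlus m a := sub_pos.2 hx
  -- Times down to −1 are admitted because differentiating the cone energy at t = 0 involves an
  -- interval around 0. This widens the support by 1/m on each side in log (r − r₊).
  have ht' : -(1 / m) ≤ x.1 / m := by rw [← neg_div]; exact div_le_div_of_nonneg_right ht hm.le
  rcases h with h | h
  · have h1 : Real.log (x.2.1 - rPlus m a) < c - L - 1 / m := by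
      rw [Real.log_lt_iff_lt_exp hx']; linarith
    have h2 : L + (Real.log (x.2.1 - rPlus m a) - c) - x.1 / m ≤ 0 := by linarith
    simp [coneCutoff, coneCutoffT, coneCutoffR, posSq_of_nonpos h2, max_eq_right h2]
  · have h1 : c + L + 1 / m < Real.log (x.2.1 - rPlus m a) := by
      rw [Real.lt_log_iff_exp_lt hx']; linarith
    have h2 : L - (Real.log (x.2.1 - rPlus m a) - c) - x.1 / m ≤ 0 := by linarith
    simp [coneCutoff, coneCutoffT, coneCutoffR, posSq_of_nonpos h2, max_eq_right h2]

end

/-- A nonnegative function with `I' ≤ C I` and `I 0 = 0` vanishes. -/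
lemma eq_zero_of_deriv_le {I I' : ℝ → ℝ} {C : ℝ} (hd : ∀ t, 0 ≤ t → HasDerivAt I (I' t) t)
    (hle : ∀ t, 0 ≤ t → I' t ≤ C * I t) (h0 : I 0 = 0) (hI : ∀ t, 0 ≤ I t) :
    ∀ t, 0 ≤ t → I t = 0 := by
  intro t ht
  have hd' : ∀ s, 0 ≤ s → HasDerivAt (fun s => Real.exp (-C * s) * I s)
      (Real.exp (-C * s) * (I' s - C * I s)) s := by
    intro s hs
    have h1 : HasDerivAt (fun s => Real.exp (-C * s)) (Real.exp (-C * s) * (-C)) s := by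
      simpa using ((hasDerivAt_id s).const_mul (-C)).exp
    refine (h1.mul (hd s hs)).congr_deriv ?_
    ring
  have hanti : AntitoneOn (fun s => Real.exp (-C * s) * I s) (Ici 0) := by
    refine antitoneOn_of_deriv_nonpos (convex_Ici 0)
      (fun s hs => (hd' s hs).continuousAt.continuousWithinAt)
      (fun s hs => (hd' s (interior_subset hs)).differentiableAt.differentiableWithinAt) fun s hs => ?_
    have hs' : 0 ≤ s := interior_subset hs
    rw [(hd' s hs').deriv]
    exact mul_nonpos_of_nonneg_of_nonpos (Real.exp_pos _).le (by linarith [hle s hs'])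
  have := hanti (self_mem_Ici) ht ht
  simp only [h0, mul_zero] at this
  have h2 := hI t
  have h3 := Real.exp_pos (-C * t)
  nlinarith

namespace ReducedMaxwell

variable {m a : ℝ} {u v p₁ p₂ q₁ q₂ : ℝ × ℝ × ℝ → ℝ}

lemma localEnergy_nonneg (hm : 0 < m) (ha : |a| ≤ m) {x : ℝ × ℝ × ℝ} (hx : x ∈ domain m a)
    (hs : 0 ≤ Real.sin x.2.2) : 0 ≤ localEnergy m a u v p₁ p₂ q₁ q₂ x := by
  have := (bgK_pos hm ha hx).le
  have := (bgY_pos hm ha hx).le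
  have := (bgD_pos hm ha hx).le
  unfold localEnergy
  positivity

/-- All six reduced fields vanish at a point. -/
def Vanishes (u v p₁ p₂ q₁ q₂ : ℝ × ℝ × ℝ → ℝ) (x : ℝ × ℝ × ℝ) : Prop :=
  u x = 0 ∧ v x = 0 ∧ p₁ x = 0 ∧ p₂ x = 0 ∧ q₁ x = 0 ∧ q₂ x = 0

lemma localEnergy_eq_zero_iff (hm : 0 < m) (ha : |a| ≤ m) {x : ℝ × ℝ × ℝ} (hx : x ∈ domain m a)
    (hs : 0 < Real.sin x.2.2) :
    localEnergy m a u v p₁ p₂ q₁ q₂ x = 0 ↔ Vanishes u v p₁ p₂ q₁ q₂ x := by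
  have hK := bgK_pos hm ha hx
  have hY := bgY_pos hm ha hx
  have hD := bgD_pos hm ha hx
  constructor
  · intro h
    unfold localEnergy at h
    have h1 : bgK m a x * (u x ^ 2 + v x ^ 2) + bgY m a x * (bgD m a x * (p₁ x ^ 2 + q₁ x ^ 2)
        + (p₂ x ^ 2 + q₂ x ^ 2)) = 0 := by
      rcases mul_eq_zero.1 h with h | h
      · norm_num at h
      · exact (mul_eq_zero.1 h).resolve_left hs.ne'
    have a1 : 0 ≤ bgK m a x * (u x ^ 2 + v x ^ 2) := by positivity
    have a2 : 0 ≤ bgD m a x * (p₁ x ^ 2 + q₁ x ^ 2) := by positivity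
    have a3 : 0 ≤ p₂ x ^ 2 + q₂ x ^ 2 := by positivity
    have a4 := mul_nonneg hY.le (add_nonneg a2 a3)
    have b1 : u x ^ 2 + v x ^ 2 = 0 :=
      (mul_eq_zero.1 (show bgK m a x * (u x ^ 2 + v x ^ 2) = 0 by linarith)).resolve_left hK.ne'
    have b2 := (mul_eq_zero.1 (show bgY m a x * (bgD m a x * (p₁ x ^ 2 + q₁ x ^ 2)
        + (p₂ x ^ 2 + q₂ x ^ 2)) = 0 by linarith)).resolve_left hY.ne'
    have b3 : p₁ x ^ 2 + q₁ x ^ 2 = 0 :=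
      (mul_eq_zero.1 (show bgD m a x * (p₁ x ^ 2 + q₁ x ^ 2) = 0 by linarith)).resolve_left hD.ne'
    have b4 : p₂ x ^ 2 + q₂ x ^ 2 = 0 := by linarith
    have c1 := (add_eq_zero_iff_of_nonneg (sq_nonneg _) (sq_nonneg _)).1 b1
    have c3 := (add_eq_zero_iff_of_nonneg (sq_nonneg _) (sq_nonneg _)).1 b3
    have c4 := (add_eq_zero_iff_of_nonneg (sq_nonneg _) (sq_nonneg _)).1 b4
    simp only [pow_eq_zero_iff, ne_eq, OfNat.ofNat_ne_zero, not_false_eq_true] at c1 c3 c4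
    exact ⟨c1.1, c1.2, c3.1, c4.1, c3.2, c4.2⟩
  · rintro ⟨h1, h2, h3, h4, h5, h6⟩
    simp [localEnergy, h1, h2, h3, h4, h5, h6]

/-- The geometric mean of X and Z is at most their arithmetic mean. Here w is the square of a
propagation speed bounded by c, so a flux is at most c times an energy density. -/
lemma abs_mul_le_of_sq {w X Z c x z : ℝ} (hc : 0 ≤ c) (hwc : w ≤ c ^ 2)
    (hX : 0 ≤ X) (hZ : 0 ≤ Z) (h : (x * z) ^ 2 = w * (X * Z)) : |x * z| ≤ c * (1 / 2 * (X + Z)) := by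
  refine abs_le_of_sq_le_sq ?_ (by positivity)
  rw [h, mul_pow]
  have : X * Z ≤ (1 / 2 * (X + Z)) ^ 2 := by nlinarith [sq_nonneg (X - Z)]
  exact mul_le_mul hwc this (by positivity) (by positivity)

/-- The factor K Δ Y is the square of the radial light speed, so `abs_mul_le_of_sq` bounds v p₁ and
u q₁ each by their share of the energy density. The terms in p₂ and q₂ are slack. -/
lemma abs_fluxR_le (hm : 0 < m) (ha : |a| ≤ m) {x : ℝ × ℝ × ℝ} (hx : x ∈ domain m a)
    (hs : 0 ≤ Real.sin x.2.2) : |fluxR m a u v p₁ q₁ x| ≤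
      (x.2.1 - rPlus m a) / m * localEnergy m a u v p₁ p₂ q₁ q₂ x := by
  have hK := (bgK_pos hm ha hx).le
  have hY := (bgY_pos hm ha hx).le
  have hD := (bgD_pos hm ha hx).le
  have hx' : rPlus m a < x.2.1 := hx
  have hc : 0 ≤ (x.2.1 - rPlus m a) / m := div_nonneg (by linarith) hm.le
  have hw := radialSpeed_le hm ha hx' x.1 x.2.2
  have hw' : bgK m a x * bgD m a x * bgY m a x ≤ ((x.2.1 - rPlus m a) / m) ^ 2 := hw
  have k1 := abs_mul_le_of_sq (w := bgK m a x * bgD m a x * bgY m a x)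
    (X := bgK m a x * v x ^ 2) (Z := bgD m a x * bgY m a x * p₁ x ^ 2)
    (x := bgK m a x * bgD m a x * bgY m a x) (z := v x * p₁ x) hc hw'
    (by positivity) (by positivity) (by ring)
  have k2 := abs_mul_le_of_sq (w := bgK m a x * bgD m a x * bgY m a x)
    (X := bgK m a x * u x ^ 2) (Z := bgD m a x * bgY m a x * q₁ x ^ 2)
    (x := bgK m a x * bgD m a x * bgY m a x) (z := u x * q₁ x) hc hw'
    (by positivity) (by positivity) (by ring)
  have k3 : 0 ≤ bgY m a x * (p₂ x ^ 2 + q₂ x ^ 2) := by positivity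
  have k4 := mul_nonneg hc k3
  unfold fluxR localEnergy
  rw [abs_mul, abs_of_nonneg hs, mul_add]
  have k5 := abs_add_le (bgK m a x * bgD m a x * bgY m a x * (v x * p₁ x))
    (bgK m a x * bgD m a x * bgY m a x * (u x * q₁ x))
  refine (mul_le_mul_of_nonneg_left (k5.trans (add_le_add k1 k2)) hs).trans ?_
  have : (x.2.1 - rPlus m a) / m * (1 / 2 * (Real.sin x.2.2 * (bgK m a x * (u x ^ 2 + v x ^ 2) +
      bgY m a x * (bgD m a x * (p₁ x ^ 2 + q₁ x ^ 2) + (p₂ x ^ 2 + q₂ x ^ 2))))) =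
      Real.sin x.2.2 * ((x.2.1 - rPlus m a) / m * (1 / 2 * (bgK m a x * v x ^ 2 +
      bgD m a x * bgY m a x * p₁ x ^ 2)) + (x.2.1 - rPlus m a) / m * (1 / 2 * (bgK m a x * u x ^ 2 +
      bgD m a x * bgY m a x * q₁ x ^ 2)) + 1 / 2 * ((x.2.1 - rPlus m a) / m *
      (bgY m a x * (p₂ x ^ 2 + q₂ x ^ 2)))) := by ring
  rw [this]
  exact mul_le_mul_of_nonneg_left (by linarith) hs

/-- Completing squares bounds each product of u or v with a p or q by squares. The surplus factor
sin θ ≤ 1 is discarded, and C₁, C₂ convert the squared derivatives of the shift into the energy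
weights. They will be the bounds of continuous background functions on a compact radial range. -/
lemma sourceE_le (hm : 0 < m) (ha : |a| ≤ m) {x : ℝ × ℝ × ℝ} (hx : x ∈ domain m a)
    (hs : 0 ≤ Real.sin x.2.2) {C₁ C₂ : ℝ}
    (h1 : |bgK m a x * dA (bgA m a) x ^ 2 / (bgD m a x * bgY m a x)| ≤ C₁)
    (h2 : |bgK m a x * dR (bgA m a) x ^ 2 / bgY m a x| ≤ C₂) :
    sourceE m a u v p₁ p₂ q₁ q₂ x ≤ (2 + C₁ + C₂) * localEnergy m a u v p₁ p₂ q₁ q₂ x := by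
  have hK := bgK_pos hm ha hx
  have hY := bgY_pos hm ha hx
  have hD := bgD_pos hm ha hx
  have hDY := mul_pos hD hY
  have k1 := (le_abs_self _).trans h1
  have k2 := (le_abs_self _).trans h2
  rw [div_le_iff₀ hDY] at k1
  rw [div_le_iff₀ hY] at k2
  have hC1 : 0 ≤ C₁ := (abs_nonneg _).trans h1
  have hC2 : 0 ≤ C₂ := (abs_nonneg _).trans h2
  unfold sourceE localEnergy
  generalize dA (bgA m a) x = A at *
  generalize dR (bgA m a) x = B at *
  generalize bgK m a x = K at *
  generalize bgY m a x = Y at *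
  generalize bgD m a x = D at *
  generalize u x = U at *
  generalize v x = V at *
  generalize p₁ x = P at *
  generalize p₂ x = P' at *
  generalize q₁ x = Q at *
  generalize q₂ x = Q' at *
  have hs1 : Real.sin x.2.2 ^ 2 ≤ Real.sin x.2.2 := by
    nlinarith [Real.sin_le_one x.2.2]
  generalize Real.sin x.2.2 = s at *
  have key : K * (U * (A * P - B * P') - V * (A * Q - B * Q')) ≤ K * (U ^ 2 + V ^ 2)
      + 1 / 2 * (K * A ^ 2 * (P ^ 2 + Q ^ 2)) + 1 / 2 * (K * B ^ 2 * (P' ^ 2 + Q' ^ 2)) := by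
    have : K * (U ^ 2 + V ^ 2) + 1 / 2 * (K * A ^ 2 * (P ^ 2 + Q ^ 2))
        + 1 / 2 * (K * B ^ 2 * (P' ^ 2 + Q' ^ 2)) - K * (U * (A * P - B * P') - V * (A * Q - B * Q'))
        = 1 / 2 * (K * ((U - A * P) ^ 2 + (U + B * P') ^ 2 + (V + A * Q) ^ 2 + (V - B * Q') ^ 2)) := by
      ring
    have h : 0 ≤ 1 / 2 * (K * ((U - A * P) ^ 2 + (U + B * P') ^ 2 + (V + A * Q) ^ 2 + (V - B * Q') ^ 2)) := by
      positivity
    linarith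
  have e1 : K * A ^ 2 * (P ^ 2 + Q ^ 2) ≤ C₁ * (D * Y) * (P ^ 2 + Q ^ 2) :=
    mul_le_mul_of_nonneg_right k1 (by positivity)
  have e2 : K * B ^ 2 * (P' ^ 2 + Q' ^ 2) ≤ C₂ * Y * (P' ^ 2 + Q' ^ 2) :=
    mul_le_mul_of_nonneg_right k2 (by positivity)
  have f1 : 0 ≤ K * (U ^ 2 + V ^ 2) := by positivity
  have f2 : 0 ≤ Y * (D * (P ^ 2 + Q ^ 2)) := by positivity
  have f3 : 0 ≤ Y * (P' ^ 2 + Q' ^ 2) := by positivity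
  have R0 : 0 ≤ K * (U ^ 2 + V ^ 2) + 1 / 2 * (C₁ * (D * Y) * (P ^ 2 + Q ^ 2))
      + 1 / 2 * (C₂ * Y * (P' ^ 2 + Q' ^ 2)) := by positivity
  have R1 : K * (U ^ 2 + V ^ 2) + 1 / 2 * (C₁ * (D * Y) * (P ^ 2 + Q ^ 2))
      + 1 / 2 * (C₂ * Y * (P' ^ 2 + Q' ^ 2)) ≤ (2 + C₁ + C₂) * (1 / 2 * (K * (U ^ 2 + V ^ 2) +
        Y * (D * (P ^ 2 + Q ^ 2) + (P' ^ 2 + Q' ^ 2)))) := by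
    nlinarith [mul_nonneg hC1 f1, mul_nonneg hC2 f1, mul_nonneg hC2 f2, mul_nonneg hC1 f3]
  calc s ^ 2 * K * (U * (A * P - B * P') - V * (A * Q - B * Q'))
      = s ^ 2 * (K * (U * (A * P - B * P') - V * (A * Q - B * Q'))) := by ring
    _ ≤ s ^ 2 * (K * (U ^ 2 + V ^ 2) + 1 / 2 * (C₁ * (D * Y) * (P ^ 2 + Q ^ 2))
      + 1 / 2 * (C₂ * Y * (P' ^ 2 + Q' ^ 2))) := mul_le_mul_of_nonneg_left (by linarith) (sq_nonneg s)
    _ ≤ s * (K * (U ^ 2 + V ^ 2) + 1 / 2 * (C₁ * (D * Y) * (P ^ 2 + Q ^ 2))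
      + 1 / 2 * (C₂ * Y * (P' ^ 2 + Q' ^ 2))) := mul_le_mul_of_nonneg_right hs1 R0
    _ ≤ s * _ := mul_le_mul_of_nonneg_left R1 hs
    _ = _ := by ring

end ReducedMaxwell
-- Domain of dependence
namespace ReducedMaxwell

variable {m a : ℝ} {u v p₁ p₂ q₁ q₂ : ℝ × ℝ × ℝ → ℝ}

/-- If the initial data vanish near the base of a light cone, the field vanishes at its vertex. -/
theorem vanishes_at_vertex (hm : 0 < m) (ha : |a| ≤ m) (h : ReducedMaxwell m a u v p₁ p₂ q₁ q₂)
    {c L : ℝ} (h0 : ∀ r, rPlus m a < r → |Real.log (r - rPlus m a) - c| < L →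
      ∀ θ ∈ Ioo 0 Real.pi, Vanishes u v p₁ p₂ q₁ q₂ (0, r, θ)) {t : ℝ} (ht : 0 ≤ t)
    (htL : t < m * L) {θ : ℝ} (hθ : θ ∈ Ioo 0 Real.pi) :
    Vanishes u v p₁ p₂ q₁ q₂ (t, rPlus m a + Real.exp c, θ) := by
  set e := localEnergy m a u v p₁ p₂ q₁ q₂ with he
  have se := h.smooth_localEnergy hm ha
  have sF := h.smooth_fluxR hm ha
  have sG := h.smooth_fluxA hm ha
  have sA := smooth_bgA hm ha
  set ra := rPlus m a + Real.exp (c - L - 1 / m) with hra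
  set rb := rPlus m a + Real.exp (c + L + 1 / m) with hrb
  have hra' : rPlus m a < ra := by have := Real.exp_pos (c - L - 1 / m); linarith
  have hsup : ∀ t, -1 ≤ t → ∀ p ∈ orbit m a, p.1 < ra ∨ rb < p.1 →
      coneCutoff m a c L (t, p.1, p.2) = 0 ∧ coneCutoffT m a c L (t, p.1, p.2) = 0 ∧
        coneCutoffR m a c L (t, p.1, p.2) = 0 := fun t ht p hp hr =>
    coneCutoff_eq_zero c L hm (x := (t, p.1, p.2)) hp.1 ht hr
  have cχ := continuousOn_coneCutoff (m := m) (a := a) c L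
  have cχT := continuousOn_coneCutoffT (m := m) (a := a) c L
  have cχR := continuousOn_coneCutoffR (m := m) (a := a) c L
  have cinv : ContinuousOn (fun x : ℝ × ℝ × ℝ => (x.2.1 - rPlus m a)⁻¹) (domain m a) :=
    ContinuousOn.inv₀ (by fun_prop) fun x hx => (sub_pos.2 (show rPlus m a < x.2.1 from hx)).ne'
  have ce := se.continuousOn
  have ceT := se.dT.continuousOn
  have cF := sF.continuousOn
  have cFR := sF.dR.continuousOn
  have cG := sG.continuousOn
  have cGA := sG.dA.continuousOn
  -- bounds for the background
  obtain ⟨C₁, hC1, hb1⟩ := exists_bound_of_continuousOn (m := m) (a := a)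
    (f := fun x => bgK m a x * dA (bgA m a) x ^ 2 / (bgD m a x * bgY m a x))
    (((smooth_bgK hm ha).continuousOn.mul (sA.dA.continuousOn.pow 2)).div
      ((smooth_bgD m a).continuousOn.mul (smooth_bgY hm ha).continuousOn)
      fun x hx => (mul_pos (bgD_pos hm ha hx) (bgY_pos hm ha hx)).ne') 0 (r₁ := rb) hra'
  obtain ⟨C₂, hC2, hb2⟩ := exists_bound_of_continuousOn (m := m) (a := a)
    (f := fun x => bgK m a x * dR (bgA m a) x ^ 2 / bgY m a x)
    (((smooth_bgK hm ha).continuousOn.mul (sA.dR.continuousOn.pow 2)).div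
      (smooth_bgY hm ha).continuousOn fun x hx => (bgY_pos hm ha hx).ne') 0 (r₁ := rb) hra'
  have hI : ∀ t, 0 ≤ t → HasDerivAt (fun t => ∫ p in orbit m a,
      coneCutoff m a c L (t, p.1, p.2) * e (t, p.1, p.2))
      (∫ p in orbit m a, (-(1 / m) * coneCutoffT m a c L (t, p.1, p.2) * e (t, p.1, p.2) +
        coneCutoff m a c L (t, p.1, p.2) * dT e (t, p.1, p.2))) t := by
    intro t ht
    refine hasDerivAt_integral_slice (f := fun x => coneCutoff m a c L x * e x)
      (g := fun x => -(1 / m) * coneCutoffT m a c L x * e x + coneCutoff m a c L x * dT e x)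
      (cχ.mul ce) (((continuousOn_const.mul cχT).mul ce).add (cχ.mul ceT)) (r₁ := rb) hra'
      (fun s _ p hp => (hasDerivAt_coneCutoff_t c L s p.1 p.2).mul (se.hasDerivAt_dT hp.1 p.2))
      (fun p hp hr => ?_) (fun s hs p hp hr => ?_)
    · simp [(hsup t (by linarith) p hp hr).1]
    · have hs' : -1 ≤ s := by have := (abs_lt.1 hs).1; linarith
      simp [(hsup s hs' p hp hr).1, (hsup s hs' p hp hr).2.1]
  have hle : ∀ t, 0 ≤ t → (∫ p in orbit m a,
      (-(1 / m) * coneCutoffT m a c L (t, p.1, p.2) * e (t, p.1, p.2) +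
        coneCutoff m a c L (t, p.1, p.2) * dT e (t, p.1, p.2))) ≤ (2 + C₁ + C₂) *
      ∫ p in orbit m a, coneCutoff m a c L (t, p.1, p.2) * e (t, p.1, p.2) := by
    intro t ht
    have ht' : -1 ≤ t := by linarith
    have hdiv := integral_slice_divergence (m := m) (a := a) (t := t) (r₁ := rb) hra'
      (A := fun x => coneCutoff m a c L x * fluxR m a u v p₁ q₁ x)
      (A' := fun x => (x.2.1 - rPlus m a)⁻¹ * coneCutoffR m a c L x * fluxR m a u v p₁ q₁ x +
        coneCutoff m a c L x * dR (fluxR m a u v p₁ q₁) x)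
      (B := fun x => coneCutoff m a c L x * fluxA m a u v p₂ q₂ x)
      (B' := fun x => coneCutoff m a c L x * dA (fluxA m a u v p₂ q₂) x)
      (fun p hp => (hasDerivAt_coneCutoff_r c L hp.1 t p.2).mul (sF.hasDerivAt_dR t hp.1 p.2))
      (fun p hp => (sG.hasDerivAt_dA t hp.1 p.2).const_mul (coneCutoff m a c L (t, p.1, p.2)))
      (((cinv.mul cχR).mul cF).add (cχ.mul cFR)) (cχ.mul cG) (cχ.mul cGA)
      (fun p hp hr => by
        obtain ⟨z1, _, z3⟩ := hsup t ht' p hp hr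
        simp [z1, z3])
      (fun r _ => by simp [fluxA])
    have i1 : IntegrableOn (fun p : ℝ × ℝ =>
        -(1 / m) * coneCutoffT m a c L (t, p.1, p.2) * e (t, p.1, p.2) +
        coneCutoff m a c L (t, p.1, p.2) * dT e (t, p.1, p.2)) (orbit m a) :=
      integrableOn_slice (f := fun x => -(1 / m) * coneCutoffT m a c L x * e x
        + coneCutoff m a c L x * dT e x)
        (((continuousOn_const.mul cχT).mul ce).add (cχ.mul ceT)) (r₁ := rb) hra'
        fun p hp hr => by simp [(hsup t ht' p hp hr).1, (hsup t ht' p hp hr).2.1]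
    have i2 : IntegrableOn (fun p : ℝ × ℝ =>
        ((p.1 - rPlus m a)⁻¹ * coneCutoffR m a c L (t, p.1, p.2) * fluxR m a u v p₁ q₁ (t, p.1, p.2) +
        coneCutoff m a c L (t, p.1, p.2) * dR (fluxR m a u v p₁ q₁) (t, p.1, p.2)) +
        coneCutoff m a c L (t, p.1, p.2) * dA (fluxA m a u v p₂ q₂) (t, p.1, p.2)) (orbit m a) :=
      integrableOn_slice (f := fun x => (x.2.1 - rPlus m a)⁻¹ * coneCutoffR m a c L x *
        fluxR m a u v p₁ q₁ x + coneCutoff m a c L x * dR (fluxR m a u v p₁ q₁) x +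
        coneCutoff m a c L x * dA (fluxA m a u v p₂ q₂) x)
        ((((cinv.mul cχR).mul cF).add (cχ.mul cFR)).add (cχ.mul cGA)) (r₁ := rb) hra'
        fun p hp hr => by simp [(hsup t ht' p hp hr).1, (hsup t ht' p hp hr).2.2]
    have i3 : IntegrableOn (fun p : ℝ × ℝ => coneCutoff m a c L (t, p.1, p.2) * e (t, p.1, p.2))
        (orbit m a) :=
      integrableOn_slice (f := fun x => coneCutoff m a c L x * e x) (cχ.mul ce) (r₁ := rb) hra'
        fun p hp hr => by simp [(hsup t ht' p hp hr).1]
    -- Subtracting the vanishing integral of the divergence of cutoff times flux leaves a pointwise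
    -- inequality: the flux is absorbed by the shrinking of the cutoff, and the source is bounded by
    -- the Grönwall constant times the energy.
    rw [← sub_zero (∫ p in orbit m a, _ + _), ← hdiv, ← integral_sub i1 i2, ← integral_const_mul]
    refine setIntegral_mono_on (i1.sub i2) (i3.const_mul _) (measurableSet_orbit m a) fun p hp => ?_
    have hx : (t, p.1, p.2) ∈ domain m a := hp.1
    have hs := (sin_pos_of_mem_orbit hp).le
    rw [he, h.localEnergy_identity hm ha hp.1 hp.2]
    by_cases hr : p.1 < ra ∨ rb < p.1
    · obtain ⟨z1, z2, z3⟩ := hsup t ht' p hp hr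
      simp [z1, z2, z3]
    push Not at hr
    have hpa : dA (bgA m a) (t, p.1, p.2) = dA (bgA m a) (0, p.1, p.2) :=
      (sA.hasDerivAt_dA t hp.1 p.2).unique (sA.hasDerivAt_dA 0 hp.1 p.2)
    have hpr : dR (bgA m a) (t, p.1, p.2) = dR (bgA m a) (0, p.1, p.2) :=
      (sA.hasDerivAt_dR t hp.1 p.2).unique (sA.hasDerivAt_dR 0 hp.1 p.2)
    have hsrc := sourceE_le (u := u) (v := v) (p₁ := p₁) (p₂ := p₂) (q₁ := q₁) (q₂ := q₂) hm ha hx hs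
      (C₁ := C₁) (C₂ := C₂)
      (by rw [hpa]; exact hb1 0 p.1 p.2 (by simp) hr.1 hr.2 ⟨hp.2.1.le, hp.2.2.le⟩)
      (by rw [hpr]; exact hb2 0 p.1 p.2 (by simp) hr.1 hr.2 ⟨hp.2.1.le, hp.2.2.le⟩)
    have hflux := abs_fluxR_le (u := u) (v := v) (p₁ := p₁) (p₂ := p₂) (q₁ := q₁) (q₂ := q₂) hm ha hx hs
    have hχ := coneCutoff_nonneg (m := m) (a := a) c L (t, p.1, p.2)
    have hRT := abs_coneCutoffR_le (m := m) (a := a) c L (t, p.1, p.2)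
    have hen := localEnergy_nonneg (u := u) (v := v) (p₁ := p₁) (p₂ := p₂) (q₁ := q₁) (q₂ := q₂) hm ha hx hs
    have hd : 0 < p.1 - rPlus m a := sub_pos.2 hp.1
    have k1 : -((p.1 - rPlus m a)⁻¹ * coneCutoffR m a c L (t, p.1, p.2) *
        fluxR m a u v p₁ q₁ (t, p.1, p.2)) ≤ 1 / m * coneCutoffT m a c L (t, p.1, p.2) *
          localEnergy m a u v p₁ p₂ q₁ q₂ (t, p.1, p.2) := by
      refine (neg_le_abs _).trans ?_
      rw [abs_mul, abs_mul, abs_of_pos (inv_pos.2 hd)]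
      calc _ ≤ (p.1 - rPlus m a)⁻¹ * coneCutoffT m a c L (t, p.1, p.2) * ((p.1 - rPlus m a) / m *
            localEnergy m a u v p₁ p₂ q₁ q₂ (t, p.1, p.2)) := by
            gcongr
            exact mul_nonneg (inv_pos.2 hd).le ((abs_nonneg _).trans hRT)
        _ = _ := by field_simp
    have k2 := mul_le_mul_of_nonneg_left hsrc hχ
    linarith
  have hnn : ∀ t, ∀ p ∈ orbit m a, 0 ≤ coneCutoff m a c L (t, p.1, p.2) * e (t, p.1, p.2) :=
    fun t p hp => mul_nonneg (coneCutoff_nonneg c L _)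
      (localEnergy_nonneg hm ha (x := (t, p.1, p.2)) hp.1 (sin_pos_of_mem_orbit hp).le)
  have hzero := eq_zero_of_deriv_le hI hle ?_
    (fun t => setIntegral_nonneg (measurableSet_orbit m a) (hnn t)) t ht
  · have := eq_zero_of_integral_orbit_eq_zero
      (continuousOn_slice (f := fun x => coneCutoff m a c L x * e x) (cχ.mul ce) t)
      (integrableOn_slice (f := fun x => coneCutoff m a c L x * e x) (cχ.mul ce) (r₁ := rb) hra'
        fun p hp hr => by simp [(hsup t (by linarith) p hp hr).1]) (hnn t) hzero
      (rPlus m a + Real.exp c, θ) ⟨by simp [Real.exp_pos], hθ⟩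
    -- At the vertex the logarithm equals c, so both factors are (L − t/m)², positive because t <
    -- mL.
    have hχ : coneCutoff m a c L (t, rPlus m a + Real.exp c, θ) ≠ 0 := by
      have : 0 < L - t / m := by
        rw [sub_pos, div_lt_iff₀ hm]; linarith
      simp only [coneCutoff, posSq, add_sub_cancel_left, Real.log_exp, sub_self, sub_zero, add_zero,
        max_eq_left this.le]
      positivity
    exact (localEnergy_eq_zero_iff hm ha (x := (t, rPlus m a + Real.exp c, θ))
      (by simp [domain, Real.exp_pos]) (Real.sin_pos_of_pos_of_lt_pi hθ.1 hθ.2)).1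
      ((mul_eq_zero.1 this).resolve_left hχ)
  · refine setIntegral_eq_zero_of_forall_eq_zero fun p hp => ?_
    by_cases hr : |Real.log (p.1 - rPlus m a) - c| < L
    · rw [he, (localEnergy_eq_zero_iff hm ha (x := (0, p.1, p.2)) hp.1 (sin_pos_of_mem_orbit hp)).2
        (h0 p.1 hp.1 hr p.2 hp.2), mul_zero]
    · rw [abs_lt, not_and_or, not_lt, not_lt] at hr
      rcases hr with hr | hr
      · have : L + (Real.log (p.1 - rPlus m a) - c) ≤ 0 := by linarith
        simp [coneCutoff, posSq_of_nonpos this]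
      · have : L - (Real.log (p.1 - rPlus m a) - c) ≤ 0 := by linarith
        simp [coneCutoff, posSq_of_nonpos this]

/-- Reflection in time. -/
def reflect (x : ℝ × ℝ × ℝ) : ℝ × ℝ × ℝ := (-x.1, x.2)

lemma smooth_comp_reflect {f : ℝ × ℝ × ℝ → ℝ} (hf : Smooth m a f) :
    Smooth m a fun x => f (reflect x) := by
  have h : ContDiff ℝ ∞ reflect := by unfold reflect; fun_prop
  exact ContDiffOn.comp hf h.contDiffOn fun x hx => hx

lemma fderiv_comp_reflect {f : ℝ × ℝ × ℝ → ℝ} (hf : Smooth m a f) {x : ℝ × ℝ × ℝ}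
    (hx : x ∈ domain m a) :
    dT (fun x => f (reflect x)) x = -dT f (reflect x) ∧
      dR (fun x => f (reflect x)) x = dR f (reflect x) ∧
      dA (fun x => f (reflect x)) x = dA f (reflect x) := by
  obtain ⟨t, r, θ⟩ := x
  have s := smooth_comp_reflect hf
  have hr : rPlus m a < r := hx
  refine ⟨(s.hasDerivAt_dT hr θ).unique ?_, (s.hasDerivAt_dR t hr θ).unique
    (hf.hasDerivAt_dR (-t) hr θ), (s.hasDerivAt_dA t hr θ).unique (hf.hasDerivAt_dA (-t) hr θ)⟩
  refine ((hf.hasDerivAt_dT hr θ (t := -t)).comp t (hasDerivAt_neg t)).congr_deriv ?_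
  simp [reflect]

/-- The field obtained by reversing time. -/
lemma reversed (hm : 0 < m) (ha : |a| ≤ m) (h : ReducedMaxwell m a u v p₁ p₂ q₁ q₂) :
    ReducedMaxwell m a (fun x => -u (reflect x)) (fun x => -v (reflect x))
      (fun x => p₁ (reflect x)) (fun x => p₂ (reflect x)) (fun x => q₁ (reflect x))
      (fun x => q₂ (reflect x)) := by
  have bg : ∀ {f : ℝ × ℝ × ℝ → ℝ}, Smooth m a f → (∀ x, f (reflect x) = f x) → ∀ x ∈ domain m a,
      dR f (reflect x) = dR f x ∧ dA f (reflect x) = dA f x := by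
    intro f hf hfe x hx
    have := fderiv_comp_reflect hf hx
    rw [funext hfe] at this
    exact ⟨this.2.1.symm, this.2.2.symm⟩
  have bK := bg (smooth_bgK hm ha) fun _ => rfl
  have bY := bg (smooth_bgY hm ha) fun _ => rfl
  have bA := bg (smooth_bgA hm ha) fun _ => rfl
  have bD := bg (smooth_bgD m a) fun _ => rfl
  have eK : ∀ x, bgK m a (reflect x) = bgK m a x := fun _ => rfl
  have eY : ∀ x, bgY m a (reflect x) = bgY m a x := fun _ => rfl
  have eD : ∀ x, bgD m a (reflect x) = bgD m a x := fun _ => rfl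
  have es : ∀ x, (reflect x).2.2 = x.2.2 := fun _ => rfl
  have du := fun x hx => @fderiv_comp_reflect m a u h.smooth_u x hx
  have dv := fun x hx => @fderiv_comp_reflect m a v h.smooth_v x hx
  have dp1 := fun x hx => @fderiv_comp_reflect m a p₁ h.smooth_p₁ x hx
  have dp2 := fun x hx => @fderiv_comp_reflect m a p₂ h.smooth_p₂ x hx
  have dq1 := fun x hx => @fderiv_comp_reflect m a q₁ h.smooth_q₁ x hx
  have dq2 := fun x hx => @fderiv_comp_reflect m a q₂ h.smooth_q₂ x hx
  -- The time derivatives of u and v involve only the p's and q's, and conversely. Changing the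
  -- signs of u and v therefore compensates the reversal of time, with the shift left as it is.
  refine ⟨(smooth_comp_reflect h.smooth_u).neg, (smooth_comp_reflect h.smooth_v).neg,
    smooth_comp_reflect h.smooth_p₁, smooth_comp_reflect h.smooth_p₂,
    smooth_comp_reflect h.smooth_q₁, smooth_comp_reflect h.smooth_q₂, ?_, ?_, ?_, ?_, ?_, ?_, ?_, ?_⟩ <;>
    intro x hx hθ
  · have := h.dT_p₁ (reflect x) hx hθ
    rw [(dp1 x hx).1, dR_neg, (dv x hx).2.1]
    rw [(bK x hx).1, eK] at this; linarith
  · have := h.dT_p₂ (reflect x) hx hθ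
    rw [(dp2 x hx).1, dA_neg, (dv x hx).2.2]
    rw [(bK x hx).2, eK, es] at this; linarith
  · have := h.dT_q₁ (reflect x) hx hθ
    rw [(dq1 x hx).1, dR_neg, (du x hx).2.1]
    rw [(bK x hx).1, eK] at this; linarith
  · have := h.dT_q₂ (reflect x) hx hθ
    rw [(dq2 x hx).1, dA_neg, (du x hx).2.2]
    rw [(bK x hx).2, eK, es] at this; linarith
  · have := h.dT_v (reflect x) hx hθ
    rw [dT_neg, (dv x hx).1, (dp1 x hx).2.1, (dp2 x hx).2.2, neg_neg, this, (bD x hx).1,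
      (bY x hx).1, (bY x hx).2, (bA x hx).1, (bA x hx).2, eD, eY, es]
  · have := h.dT_u (reflect x) hx hθ
    rw [dT_neg, (du x hx).1, (dq1 x hx).2.1, (dq2 x hx).2.2, neg_neg, this, (bD x hx).1,
      (bY x hx).1, (bY x hx).2, (bA x hx).1, (bA x hx).2, eD, eY, es]
  · have := h.curl_p (reflect x) hx hθ
    rw [(dp2 x hx).2.1, (dp1 x hx).2.2]; exact this
  · have := h.curl_q (reflect x) hx hθ
    rw [(dq2 x hx).2.1, (dq1 x hx).2.2]; exact this

/-- The fields stay compactly supported in the radius, locally uniformly in time. -/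
theorem exists_vanishing_range (hm : 0 < m) (ha : |a| ≤ m) (h : ReducedMaxwell m a u v p₁ p₂ q₁ q₂)
    {ra rb : ℝ} (hra : rPlus m a < ra)
    (h0 : ∀ r, rPlus m a < r → r < ra ∨ rb < r → ∀ θ ∈ Ioo 0 Real.pi,
      Vanishes u v p₁ p₂ q₁ q₂ (0, r, θ)) (T : ℝ) :
    ∃ R₀ R₁, rPlus m a < R₀ ∧ ∀ t, |t| ≤ T → ∀ p ∈ orbit m a, p.1 < R₀ ∨ R₁ < p.1 →
      Vanishes u v p₁ p₂ q₁ q₂ (t, p.1, p.2) := by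
  -- Chosen so that every |t| ≤ T satisfies |t| < mL, as the vertex argument requires.
  set L := (T + 1) / m with hL
  have hLm : m * L = T + 1 := by rw [hL]; field_simp
  -- The given outer radius rb may lie inside the horizon. The maximum keeps log (rb' − r₊)
  -- meaningful and only enlarges the range.
  set rb' := max rb ra with hrb'
  have hrb1 : rPlus m a < rb' := hra.trans_le (le_max_right _ _)
  have hea : 0 < ra - rPlus m a := sub_pos.2 hra
  have heb : 0 < rb' - rPlus m a := sub_pos.2 hrb1
  refine ⟨rPlus m a + Real.exp (Real.log (ra - rPlus m a) - L),
    rPlus m a + Real.exp (Real.log (rb' - rPlus m a) + L), by linarith [Real.exp_pos (Real.log (ra - rPlus m a) - L)], ?_⟩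
  intro t ht p hp hr
  have hd : 0 < p.1 - rPlus m a := sub_pos.2 hp.1
  have hp1 : p.1 = rPlus m a + Real.exp (Real.log (p.1 - rPlus m a)) := by
    rw [Real.exp_log hd]; ring
  have hbase : ∀ r, rPlus m a < r → |Real.log (r - rPlus m a) - Real.log (p.1 - rPlus m a)| < L →
      r < ra ∨ rb < r := by
    intro r hr1 habs
    have hd' : 0 < r - rPlus m a := sub_pos.2 hr1
    rcases hr with hr | hr
    · left
      have h1 : Real.log (p.1 - rPlus m a) < Real.log (ra - rPlus m a) - L := by
        rw [Real.log_lt_iff_lt_exp hd]; linarith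
      have h2 := (abs_lt.1 habs).2
      have := (Real.log_lt_log_iff hd' hea).1 (by linarith)
      linarith
    · right
      have h1 : Real.log (rb' - rPlus m a) + L < Real.log (p.1 - rPlus m a) := by
        rw [Real.lt_log_iff_exp_lt hd]; linarith
      have h2 := (abs_lt.1 habs).1
      have := (Real.log_lt_log_iff heb hd').1 (by linarith)
      have := le_max_left rb ra
      linarith
  rcases le_total 0 t with ht0 | ht0
  · have := h.vanishes_at_vertex hm ha (c := Real.log (p.1 - rPlus m a)) (L := L)
      (fun r hr1 habs => h0 r hr1 (hbase r hr1 habs)) ht0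
      (by rw [hLm]; have := le_abs_self t; linarith) hp.2
    rwa [← hp1] at this
  -- Negative times are treated by applying the cone argument to the time-reversed field.
  · have := (h.reversed hm ha).vanishes_at_vertex hm ha (c := Real.log (p.1 - rPlus m a)) (L := L)
      (fun r hr1 habs θ hθ => by
        have := h0 r hr1 (hbase r hr1 habs) θ hθ
        simpa [Vanishes, reflect] using this) (neg_nonneg.2 ht0)
      (by rw [hLm]; have := neg_abs_le t; linarith) hp.2
    rw [← hp1] at this
    simpa [Vanishes, reflect] using this

end ReducedMaxwell

/-! ### The Maxwell scalars -/

/-- The bilinear form with matrix `f`. -/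
def bil (f : Fin 4 → Fin 4 → ℝ) (v w : Fin 4 → ℝ) : ℝ := ∑ μ, ∑ ν, f μ ν * v μ * w ν

/-- The real antisymmetrized product. -/
def wedgeReal (v w : Fin 4 → ℝ) (μ ν : Fin 4) : ℝ := v μ * w ν - v ν * w μ

lemma sum_bil_complex (f : Fin 4 → Fin 4 → ℝ) (x y z w : Fin 4 → ℝ) (e e' : ℂ) :
    ∑ μ, ∑ ν, (f μ ν : ℂ) * ((x μ + Complex.I * y μ) * e) * ((z ν + Complex.I * w ν) * e') =
      ((bil f x z - bil f y w : ℝ) + Complex.I * (bil f x w + bil f y z : ℝ)) * (e * e') := by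
  have : ((bil f x z - bil f y w : ℝ) + Complex.I * (bil f x w + bil f y z : ℝ)) * (e * e')
      = ∑ μ, ∑ ν, (f μ ν : ℂ) * ((x μ * z ν - y μ * w ν) + Complex.I * (x μ * w ν + y μ * z ν)) *
        (e * e') := by
    simp only [bil, Fin.sum_univ_four]
    push_cast
    ring
  rw [this]
  refine Finset.sum_congr rfl fun μ _ => Finset.sum_congr rfl fun ν _ => ?_
  linear_combination (f μ ν : ℂ) * (y μ * w ν) * (e * e') * Complex.I_sq

/-- The complex null vector is split as (x + i y) e. The factor e enters only through |e|² = w, so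
the real part becomes a combination of real wedge products. The primed vectors stand either for the
tetrad or for the lowered tetrad, so that one computation serves both `scalarUp_eq` and
`scalarLow_eq`. -/
lemma re_tetrad_expansion {f : Fin 4 → Fin 4 → ℝ} (hf : ∀ μ ν, f ν μ = -f μ ν)
    (l n x y l' n' x' y' : Fin 4 → ℝ) {e : ℂ} {w : ℝ} (hw : e * starRingEnd ℂ e = w) (μ ν : Fin 4) :
    let F : (Fin 4 → ℂ) → (Fin 4 → ℂ) → ℂ := fun V W => ∑ μ, ∑ ν, (f μ ν : ℂ) * V μ * W ν
    let L : Fin 4 → ℂ := fun μ => l μ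
    let N : Fin 4 → ℂ := fun μ => n μ
    let M : Fin 4 → ℂ := fun μ => (x μ + Complex.I * y μ) * e
    let Ms : Fin 4 → ℂ := fun μ => (x μ - Complex.I * y μ) * starRingEnd ℂ e
    let L' : Fin 4 → ℂ := fun μ => l' μ
    let N' : Fin 4 → ℂ := fun μ => n' μ
    let M' : Fin 4 → ℂ := fun μ => (x' μ + Complex.I * y' μ) * e
    let Ms' : Fin 4 → ℂ := fun μ => (x' μ - Complex.I * y' μ) * starRingEnd ℂ e
    2 * (F L M * wedge Ms' N' μ ν + (1 / 2) * (F L N + F Ms M) *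
      (wedge N' L' μ ν + wedge M' Ms' μ ν) + F Ms N * wedge L' M' μ ν).re =
      2 * w * (bil f l x * wedgeReal x' n' μ ν + bil f l y * wedgeReal y' n' μ ν
        + bil f x n * wedgeReal l' x' μ ν + bil f y n * wedgeReal l' y' μ ν)
      + bil f l n * wedgeReal n' l' μ ν + 4 * w ^ 2 * bil f x y * wedgeReal x' y' μ ν := by
  intro F L N M Ms L' N' M' Ms'
  have z : ∀ v, bil f v 0 = 0 := fun v => by simp [bil]
  have z' : ∀ v, bil f 0 v = 0 := fun v => by simp [bil]
  have anti : ∀ v w, bil f w v = -bil f v w := by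
    intro v w
    have h00 := hf 0 0
    have h11 := hf 1 1
    have h22 := hf 2 2
    have h33 := hf 3 3
    simp only [bil, Fin.sum_univ_four, hf 0 1, hf 0 2, hf 0 3, hf 1 2, hf 1 3, hf 2 3]
    have e0 : f 0 0 = 0 := by linarith
    have e1 : f 1 1 = 0 := by linarith
    have e2 : f 2 2 = 0 := by linarith
    have e3 : f 3 3 = 0 := by linarith
    rw [e0, e1, e2, e3]
    ring
  have self : ∀ v, bil f v v = 0 := fun v => by linarith [anti v v]
  have negl : ∀ v w, bil f (-v) w = -bil f v w := by
    intro v w; simp [bil, Finset.sum_neg_distrib]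
  have h1 : F L M = (bil f l x + Complex.I * bil f l y) * e := by
    have := sum_bil_complex f l 0 x y 1 e
    simp only [z', Pi.zero_apply, Complex.ofReal_zero, mul_zero, add_zero, mul_one, sub_zero,
      one_mul] at this
    exact this
  have h2 : F L N = bil f l n := by
    have := sum_bil_complex f l 0 n 0 1 1
    simp only [z, z', Pi.zero_apply, Complex.ofReal_zero, mul_zero, add_zero, mul_one, sub_zero] at this
    exact this
  have h3 : F Ms M = 2 * Complex.I * bil f x y * w := by
    have := sum_bil_complex f x (-y) x y (starRingEnd ℂ e) e
    simp only [negl, self, anti x y, Pi.neg_apply, Complex.ofReal_neg, mul_neg, ← sub_eq_add_neg] at this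
    refine this.trans ?_
    rw [mul_comm (starRingEnd ℂ e), hw]
    push_cast
    ring
  have h4 : F Ms N = (bil f x n - Complex.I * bil f y n) * starRingEnd ℂ e := by
    have := sum_bil_complex f x (-y) n 0 (starRingEnd ℂ e) 1
    simp only [negl, z, Pi.zero_apply, Pi.neg_apply, Complex.ofReal_zero, Complex.ofReal_neg,
      mul_neg, ← sub_eq_add_neg, mul_zero, add_zero, mul_one] at this
    refine this.trans ?_
    push_cast
    ring
  have h5 : F L M * wedge Ms' N' μ ν + (1 / 2) * (F L N + F Ms M) *
      (wedge N' L' μ ν + wedge M' Ms' μ ν) + F Ms N * wedge L' M' μ ν =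
      (bil f l x + Complex.I * bil f l y) *
        ((x' μ - Complex.I * y' μ) * n' ν - (x' ν - Complex.I * y' ν) * n' μ) * w +
      (1 / 2) * (bil f l n + 2 * Complex.I * bil f x y * w) * ((n' μ * l' ν - n' ν * l' μ) +
        ((x' μ + Complex.I * y' μ) * (x' ν - Complex.I * y' ν) -
          (x' ν + Complex.I * y' ν) * (x' μ - Complex.I * y' μ)) * w) +
      (bil f x n - Complex.I * bil f y n) *
        (l' μ * (x' ν + Complex.I * y' ν) - l' ν * (x' μ + Complex.I * y' μ)) * w := by
    rw [h1, h2, h3, h4, ← hw]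
    simp only [wedge, L', N', M', Ms']
    ring
  rw [h5]
  simp only [wedgeReal, Complex.add_re, Complex.sub_re, Complex.mul_re, Complex.mul_im,
    Complex.add_im, Complex.sub_im, Complex.I_re, Complex.I_im, Complex.ofReal_re, Complex.ofReal_im,
    Complex.one_re, Complex.one_im, Complex.re_ofNat, Complex.im_ofNat, Complex.div_re, Complex.div_im,
    Complex.normSq_ofNat]
  ring

/-! ### Real and imaginary parts of the Kinnersley tetrad -/

section
variable {m a r θ : ℝ}

/-- The inverse of the denominator of `m`. -/
def tetradE (a r θ : ℝ) : ℂ := ((r + Complex.I * a * Real.cos θ) * (Real.sqrt 2 : ℝ))⁻¹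

def realL (m a r : ℝ) (μ : Fin 4) : ℝ := (![r ^ 2 + a ^ 2, delta m a r, 0, a] : Fin 4 → ℝ) μ / delta m a r
def realN (m a r θ : ℝ) (μ : Fin 4) : ℝ :=
  (![r ^ 2 + a ^ 2, -delta m a r, 0, a] : Fin 4 → ℝ) μ / (2 * sigma a r θ)
def realX (μ : Fin 4) : ℝ := (![0, 0, 1, 0] : Fin 4 → ℝ) μ
def realY (a θ : ℝ) (μ : Fin 4) : ℝ := (![a * Real.sin θ, 0, 0, 1 / Real.sin θ] : Fin 4 → ℝ) μ

/-- Lowering an index of a real vector. -/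
def lowerReal (m a r θ : ℝ) (v : Fin 4 → ℝ) (μ : Fin 4) : ℝ := ∑ ν, kerr m a r θ μ ν * v ν

lemma tetradM_eq (μ : Fin 4) :
    tetradM a r θ μ = (realX μ + Complex.I * realY a θ μ) * tetradE a r θ := by
  rw [tetradM, tetradE, div_eq_mul_inv]
  congr 1
  fin_cases μ <;> simp [realX, realY] <;> ring

lemma tetradMstar_eq (μ : Fin 4) :
    tetradMstar a r θ μ = (realX μ - Complex.I * realY a θ μ) * starRingEnd ℂ (tetradE a r θ) := by
  rw [tetradMstar, tetradM_eq]
  simp [sub_eq_add_neg]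

/-- |r + i a cos θ|² = Σ, and √2 supplies the factor 2. This is all that the reconstruction formulas
retain of the complex denominator of m. -/
lemma tetradE_mul_conj :
    tetradE a r θ * starRingEnd ℂ (tetradE a r θ) = ((2 * sigma a r θ)⁻¹ : ℝ) := by
  rw [Complex.mul_conj, tetradE, map_inv₀, map_mul, Complex.normSq_ofReal,
    Real.mul_self_sqrt (by norm_num)]
  congr 2
  rw [Complex.normSq_apply]
  simp [sigma, -Complex.ofReal_cos]
  ring

lemma lower_ofReal (v : Fin 4 → ℝ) (μ : Fin 4) :
    lower m a r θ (fun μ => (v μ : ℂ)) μ = (lowerReal m a r θ v μ : ℂ) := by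
  simp [lower, lowerReal]

lemma lower_tetradM (μ : Fin 4) : lower m a r θ (tetradM a r θ) μ =
    (lowerReal m a r θ realX μ + Complex.I * lowerReal m a r θ (realY a θ) μ) * tetradE a r θ := by
  simp only [lower, lowerReal, tetradM_eq, Fin.sum_univ_four]
  push_cast
  ring

lemma lower_tetradMstar (μ : Fin 4) : lower m a r θ (tetradMstar a r θ) μ =
    (lowerReal m a r θ realX μ - Complex.I * lowerReal m a r θ (realY a θ) μ) *
      starRingEnd ℂ (tetradE a r θ) := by
  simp only [lower, lowerReal, tetradMstar_eq, Fin.sum_univ_four]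
  push_cast
  ring

lemma blComp_anti (F : TwoForm) (x : ℝ × ℝ × ℝ) (μ ν : Fin 4) : blComp F x ν μ = -blComp F x μ ν := by
  fin_cases μ <;> fin_cases ν <;> simp [blComp]

lemma scalarUp_eq (F : TwoForm) (t : ℝ) (μ ν : Fin 4) :
    scalarUp m a (npScalars m a F t) r θ μ ν =
      2 * (2 * sigma a r θ)⁻¹ * (bil (blComp F (t, r, θ)) (realL m a r) realX *
          wedgeReal realX (realN m a r θ) μ ν
        + bil (blComp F (t, r, θ)) (realL m a r) (realY a θ) *
          wedgeReal (realY a θ) (realN m a r θ) μ ν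
        + bil (blComp F (t, r, θ)) realX (realN m a r θ) * wedgeReal (realL m a r) realX μ ν
        + bil (blComp F (t, r, θ)) (realY a θ) (realN m a r θ) *
          wedgeReal (realL m a r) (realY a θ) μ ν)
      + bil (blComp F (t, r, θ)) (realL m a r) (realN m a r θ) *
          wedgeReal (realN m a r θ) (realL m a r) μ ν
      + 4 * (2 * sigma a r θ)⁻¹ ^ 2 * bil (blComp F (t, r, θ)) realX (realY a θ) *
          wedgeReal realX (realY a θ) μ ν := by
  have := re_tetrad_expansion (blComp_anti F (t, r, θ)) (realL m a r) (realN m a r θ) realX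
    (realY a θ) (realL m a r) (realN m a r θ) realX (realY a θ) (tetradE_mul_conj (a := a) (r := r) (θ := θ)) μ ν
  rw [← this]
  simp only [← tetradM_eq, ← tetradMstar_eq, scalarUp, npScalars, comp_zero_eq]
  rfl

lemma scalarLow_eq (F : TwoForm) (t : ℝ) (μ ν : Fin 4) :
    scalarLow m a (npScalars m a F t) r θ μ ν =
      2 * (2 * sigma a r θ)⁻¹ * (bil (blComp F (t, r, θ)) (realL m a r) realX *
          wedgeReal (lowerReal m a r θ realX) (lowerReal m a r θ (realN m a r θ)) μ ν
        + bil (blComp F (t, r, θ)) (realL m a r) (realY a θ) *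
          wedgeReal (lowerReal m a r θ (realY a θ)) (lowerReal m a r θ (realN m a r θ)) μ ν
        + bil (blComp F (t, r, θ)) realX (realN m a r θ) *
          wedgeReal (lowerReal m a r θ (realL m a r)) (lowerReal m a r θ realX) μ ν
        + bil (blComp F (t, r, θ)) (realY a θ) (realN m a r θ) *
          wedgeReal (lowerReal m a r θ (realL m a r)) (lowerReal m a r θ (realY a θ)) μ ν)
      + bil (blComp F (t, r, θ)) (realL m a r) (realN m a r θ) *
          wedgeReal (lowerReal m a r θ (realN m a r θ)) (lowerReal m a r θ (realL m a r)) μ ν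
      + 4 * (2 * sigma a r θ)⁻¹ ^ 2 * bil (blComp F (t, r, θ)) realX (realY a θ) *
          wedgeReal (lowerReal m a r θ realX) (lowerReal m a r θ (realY a θ)) μ ν := by
  have := re_tetrad_expansion (blComp_anti F (t, r, θ)) (realL m a r) (realN m a r θ) realX
    (realY a θ) (lowerReal m a r θ (realL m a r)) (lowerReal m a r θ (realN m a r θ))
    (lowerReal m a r θ realX) (lowerReal m a r θ (realY a θ))
    (tetradE_mul_conj (a := a) (r := r) (θ := θ)) μ ν
  rw [← this]
  simp only [← lower_tetradM, ← lower_tetradMstar]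
  simp only [← lower_ofReal, ← tetradM_eq, ← tetradMstar_eq,
    scalarLow, npScalars, comp_zero_eq]
  rfl

variable (hm : 0 < m) (ha : |a| ≤ m) (hr : rPlus m a < r) (hθ : 0 < Real.sin θ)
include hm ha hr hθ

lemma lowerReal_realL (μ : Fin 4) : lowerReal m a r θ (realL m a r) μ =
    (![-1, sigma a r θ / delta m a r, 0, a * Real.sin θ ^ 2] : Fin 4 → ℝ) μ := by
  obtain ⟨h0, hD⟩ := rPlus_lt m a r hm ha hr
  have hS := (sigma_pos h0 a θ).ne'
  have hc := Real.cos_sq' θ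
  fin_cases μ <;> simp [lowerReal, Fin.sum_univ_four, kerr, realL]
  · field_simp
    unfold sigma delta
    rw [hc]
    ring
  · field_simp
  · field_simp
    unfold xi sigma delta
    rw [hc]
    ring

lemma lowerReal_realN (μ : Fin 4) : lowerReal m a r θ (realN m a r θ) μ =
    (![-(delta m a r / (2 * sigma a r θ)), -(1 / 2), 0,
      a * Real.sin θ ^ 2 * delta m a r / (2 * sigma a r θ)] : Fin 4 → ℝ) μ := by
  obtain ⟨h0, hD⟩ := rPlus_lt m a r hm ha hr
  have hS := (sigma_pos h0 a θ).ne'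
  have hc := Real.cos_sq' θ
  fin_cases μ <;> simp [lowerReal, Fin.sum_univ_four, kerr, realN]
  · field_simp
    unfold sigma delta
    rw [hc]
    ring
  · field_simp
  · field_simp
    unfold xi sigma delta
    rw [hc]
    ring

omit hm ha hr hθ in
lemma lowerReal_realX (μ : Fin 4) : lowerReal m a r θ realX μ =
    (![0, 0, sigma a r θ, 0] : Fin 4 → ℝ) μ := by
  fin_cases μ <;> simp [lowerReal, Fin.sum_univ_four, kerr, realX]

lemma lowerReal_realY (μ : Fin 4) : lowerReal m a r θ (realY a θ) μ =
    (![-(a * Real.sin θ), 0, 0, (r ^ 2 + a ^ 2) * Real.sin θ] : Fin 4 → ℝ) μ := by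
  obtain ⟨h0, hD⟩ := rPlus_lt m a r hm ha hr
  have hS := (sigma_pos h0 a θ).ne'
  have hc := Real.cos_sq' θ
  fin_cases μ <;> simp [lowerReal, Fin.sum_univ_four, kerr, realY]
  · field_simp
    unfold sigma delta
    rw [hc]
    ring
  · field_simp
    unfold xi sigma delta
    rw [hc]
    ring

/-- A real two-form is recovered from its three scalars because the null tetrad is a normalized
frame. In Boyer-Lindquist components this reduces to r² + a² = Σ + a² sin² θ. Only the purely
spatial components are used later. -/
lemma scalarLow_npScalars (F : TwoForm) (t : ℝ) {μ ν : Fin 4} (h : (μ, ν) = (1, 2) ∨ (μ, ν) = (1, 3) ∨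
    (μ, ν) = (2, 3)) :
    scalarLow m a (npScalars m a F t) r θ μ ν = comp F ![t, r, θ, 0] μ ν := by
  obtain ⟨h0, hD⟩ := rPlus_lt m a r hm ha hr
  have hS := (sigma_pos h0 a θ).ne'
  have hc : r ^ 2 + a ^ 2 = sigma a r θ + a ^ 2 * Real.sin θ ^ 2 := by
    unfold sigma; rw [Real.cos_sq']; ring
  rw [scalarLow_eq, comp_zero_eq]
  rcases h with h | h | h <;> obtain ⟨rfl, rfl⟩ := Prod.mk.inj h <;>
    simp [wedgeReal, lowerReal_realL hm ha hr hθ, lowerReal_realN hm ha hr hθ, lowerReal_realX,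
      lowerReal_realY hm ha hr hθ, bil, Fin.sum_univ_four, realL, realN, realX, realY, blComp, hc] <;>
    field_simp <;> ring1

/-- The same reconstruction with raised indices, compared with F raised by the inverse metric.
Rewriting 2amr as a(r² + a² − Δ) puts both sides in terms of Σ, Δ, a and sin θ, where they agree
identically. -/
lemma scalarUp_npScalars (F : TwoForm) (t : ℝ) (i : Fin 3) :
    volDensity m a r θ * scalarUp m a (npScalars m a F t) r θ 0 i.succ = electric m a F t i r θ := by
  obtain ⟨h0, hD⟩ := rPlus_lt m a r hm ha hr
  have hS := (sigma_pos h0 a θ).ne'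
  have hd : delta m a r - 2 * m * r = delta m a r - 2 * m * r := rfl
  rw [electric, scalarUp_eq, compUp]
  congr 1
  simp only [comp_zero_eq]
  have k := kerr_inv hm ha hr hθ.ne'
  have hXi : xi m a r θ = (r ^ 2 + a ^ 2) ^ 2 - a ^ 2 * delta m a r * Real.sin θ ^ 2 := rfl
  have h2 : 2 * a * m * r = a * (r ^ 2 + a ^ 2 - delta m a r) := by unfold delta; ring
  have hc : r ^ 2 + a ^ 2 = sigma a r θ + a ^ 2 * Real.sin θ ^ 2 := by
    unfold sigma; rw [Real.cos_sq']; ring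
  have e1 : (![t, r, θ, 0] : Fin 4 → ℝ) 1 = r := rfl
  have e2 : (![t, r, θ, 0] : Fin 4 → ℝ) 2 = θ := rfl
  rw [e1, e2, k, hXi, h2, hc]
  fin_cases i <;>
    simp [wedgeReal, bil, Fin.sum_univ_four, realL, realN, realX, realY, blComp, hc] <;>
    field_simp <;> ring1

end

/-! ### The Weyl-Papapetrou form of the metric -/

section
variable {m a r θ : ℝ}
variable (hm : 0 < m) (ha : |a| ≤ m) (hr : rPlus m a < r) (hθ : 0 < Real.sin θ)
include hm ha hr hθ

lemma exp_two_gam (t : ℝ) : Real.exp (2 * gam m a r θ) = Real.sin θ ^ 2 / bgY m a (t, r, θ) := by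
  obtain ⟨h0, hD⟩ := rPlus_lt m a r hm ha hr
  have hS := sigma_pos h0 a θ
  have hX := xi_pos (a := a) hm h0 θ
  have h : kerr m a r θ 3 3 = Real.sin θ ^ 2 / bgY m a (t, r, θ) := by
    simp [kerr, bgY]; field_simp
  have hp : 0 < kerr m a r θ 3 3 := by rw [h]; unfold bgY; positivity
  rw [gam, mul_div_cancel₀ _ two_ne_zero, Real.exp_log hp, h]

lemma exp_neg_two_gam (t : ℝ) :
    Real.exp (-2 * gam m a r θ) = bgY m a (t, r, θ) / Real.sin θ ^ 2 := by
  rw [neg_mul, Real.exp_neg, exp_two_gam hm ha hr hθ t, inv_div]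

lemma qMetric_eq (t : ℝ) : qMetric m a r θ = Matrix.diagonal
    ![Real.sin θ ^ 2 / bgY m a (t, r, θ) * (sigma a r θ / delta m a r),
      Real.sin θ ^ 2 / bgY m a (t, r, θ) * sigma a r θ] := by
  ext i j
  fin_cases i <;> fin_cases j <;> simp [qMetric, idx, exp_two_gam hm ha hr hθ t] <;> simp [kerr]

lemma muq_eq : muq m a r θ = xi m a r θ * Real.sin θ ^ 2 / Real.sqrt (delta m a r) := by
  obtain ⟨h0, hD⟩ := rPlus_lt m a r hm ha hr
  have hS := sigma_pos h0 a θ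
  have hX := xi_pos (a := a) hm h0 θ
  rw [muq, qMetric_eq hm ha hr hθ 0, Matrix.det_diagonal, Fin.prod_univ_two]
  have : (![Real.sin θ ^ 2 / bgY m a (0, r, θ) * (sigma a r θ / delta m a r),
      Real.sin θ ^ 2 / bgY m a (0, r, θ) * sigma a r θ] 0 *
      ![Real.sin θ ^ 2 / bgY m a (0, r, θ) * (sigma a r θ / delta m a r),
      Real.sin θ ^ 2 / bgY m a (0, r, θ) * sigma a r θ] 1) =
      (xi m a r θ * Real.sin θ ^ 2) ^ 2 / delta m a r := by
    simp [bgY]; field_simp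
  rw [this, Real.sqrt_div (by positivity), Real.sqrt_sq (by positivity)]

/-- In two dimensions μ̄_q q^{-1} is invariant under conformal change. Since q is a multiple of
dr²/Δ + dθ², the conformal factor, and with it γ, drops out. -/
lemma muqInv_eq (b c : Fin 2) : muqInv m a r θ b c =
    (Matrix.diagonal ![Real.sqrt (delta m a r), (Real.sqrt (delta m a r))⁻¹] : Matrix _ _ ℝ) b c := by
  obtain ⟨h0, hD⟩ := rPlus_lt m a r hm ha hr
  have hS := sigma_pos h0 a θ
  have hX := xi_pos (a := a) hm h0 θ
  have hsD : 0 < Real.sqrt (delta m a r) := Real.sqrt_pos.2 hD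
  have hsq : Real.sqrt (delta m a r) ^ 2 = delta m a r := Real.sq_sqrt hD.le
  have hinv : (qMetric m a r θ)⁻¹ = Matrix.diagonal
      ![(Real.sin θ ^ 2 / bgY m a (0, r, θ) * (sigma a r θ / delta m a r))⁻¹,
        (Real.sin θ ^ 2 / bgY m a (0, r, θ) * sigma a r θ)⁻¹] := by
    rw [qMetric_eq hm ha hr hθ 0]
    apply Matrix.inv_eq_right_inv
    rw [Matrix.diagonal_mul_diagonal, ← Matrix.diagonal_one]
    congr 1; ext i; fin_cases i <;> simp [bgY] <;> field_simp
  rw [muqInv, hinv, muq_eq hm ha hr hθ]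
  fin_cases b <;> fin_cases c <;> simp [bgY] <;> field_simp
  rw [hsq]

/-- The volume density of ḡ factors through the Weyl-Papapetrou form. This is why the prefactor in
the formulas for η and v is the one defining 𝔈 from F^{0i}. -/
lemma exp_mul_lapse_mul_muq :
    Real.exp (-2 * gam m a r θ) * lapse m a r θ * muq m a r θ = volDensity m a r θ := by
  obtain ⟨h0, hD⟩ := rPlus_lt m a r hm ha hr
  have hX := xi_pos (a := a) hm h0 θ
  have hsD : 0 < Real.sqrt (delta m a r) := Real.sqrt_pos.2 hD
  rw [exp_neg_two_gam hm ha hr hθ 0, muq_eq hm ha hr hθ, lapse, volDensity_eq hm ha hr hθ, bgY]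
  field_simp

lemma scalarE_npScalars (F : TwoForm) (t : ℝ) (i : Fin 3) :
    scalarE m a (npScalars m a F t) i r θ = electric m a F t i r θ := by
  rw [scalarE, exp_mul_lapse_mul_muq hm ha hr hθ, scalarUp_npScalars hm ha hr hθ]

end

/-! ### The planar fields in terms of the reduced fields -/

section
variable {m a r θ : ℝ}

lemma magnetic_eq (F : TwoForm) (t r θ : ℝ) (i : Fin 3) : magnetic F t i r θ =
    (![Real.sin θ * redP2 F (t, r, θ), -(Real.sin θ * redP1 F (t, r, θ)), redU F (t, r, θ)] :
      Fin 3 → ℝ) i := by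
  fin_cases i <;> simp [magnetic, comp_zero_eq, blComp]

variable (hm : 0 < m) (ha : |a| ≤ m) (hr : rPlus m a < r) (hθ : 0 < Real.sin θ)
include hm ha hr hθ

lemma electric_eq {F : TwoForm} (hF : IsAxisymmetricMaxwell m a F) (t : ℝ) (i : Fin 3) :
    electric m a F t i r θ = (![Real.sin θ * redQ2 m a F (t, r, θ),
      -(Real.sin θ * redQ1 m a F (t, r, θ)), -redV m a F (t, r, θ)] : Fin 3 → ℝ) i := by
  have := densitized_compUp_eq hm ha hF (X := ![t, r, θ, 0]) hr hθ 0 i.succ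
  refine Eq.trans this ?_
  fin_cases i <;> simp [blUp]

lemma scalarDEta_npScalars {F : TwoForm} (hF : IsAxisymmetricMaxwell m a F) (t : ℝ) (b : Fin 2) :
    scalarDEta m a (npScalars m a F t) b r θ =
      (![Real.sin θ * redQ1 m a F (t, r, θ), Real.sin θ * redQ2 m a F (t, r, θ)] : Fin 2 → ℝ) b := by
  simp only [scalarDEta, Fin.sum_univ_two, scalarE_npScalars hm ha hr hθ, electric_eq hm ha hr hθ hF]
  fin_cases b <;> simp [eps]

lemma scalarDLam_npScalars (F : TwoForm) (t : ℝ) (b : Fin 2) :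
    scalarDLam m a (npScalars m a F t) b r θ =
      (![Real.sin θ * redP1 F (t, r, θ), Real.sin θ * redP2 F (t, r, θ)] : Fin 2 → ℝ) b := by
  rw [scalarDLam]
  fin_cases b
  · change scalarLow m a (npScalars m a F t) r θ 1 3 = _
    rw [scalarLow_npScalars hm ha hr hθ F t (by simp), comp_zero_eq]
    simp [blComp]
  · change scalarLow m a (npScalars m a F t) r θ 2 3 = _
    rw [scalarLow_npScalars hm ha hr hθ F t (by simp), comp_zero_eq]
    simp [blComp]

lemma scalarLow_one_two (F : TwoForm) (t : ℝ) :
    scalarLow m a (npScalars m a F t) r θ 1 2 = redU F (t, r, θ) := by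
  rw [scalarLow_npScalars hm ha hr hθ F t (by simp), comp_zero_eq]
  simp [blComp]

/-- The Maxwell scalars vanish at a point if and only if the reduced fields do. -/
lemma npScalars_eq_zero_iff {F : TwoForm} (hF : IsAxisymmetricMaxwell m a F) (t : ℝ) :
    (∀ i, npScalars m a F t i r θ = 0) ↔ ReducedMaxwell.Vanishes (redU F) (redV m a F) (redP1 F)
      (redP2 F) (redQ1 m a F) (redQ2 m a F) (t, r, θ) := by
  constructor
  · intro h
    have hlow : ∀ μ ν, scalarLow m a (npScalars m a F t) r θ μ ν = 0 := fun μ ν => by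
      simp [scalarLow, h]
    have hE : ∀ i, scalarE m a (npScalars m a F t) i r θ = 0 := fun i => by
      simp [scalarE, scalarUp, h]
    have e := fun i => (electric_eq hm ha hr hθ hF t i).symm.trans
      ((scalarE_npScalars hm ha hr hθ F t i).symm.trans (hE i))
    have l0 := (scalarDLam_npScalars hm ha hr hθ F t 0).symm.trans (hlow _ _)
    have l1 := (scalarDLam_npScalars hm ha hr hθ F t 1).symm.trans (hlow _ _)
    have e0 := e 0
    have e1 := e 1
    have e2 := e 2
    simp [hθ.ne'] at l0 l1 e0 e1 e2
    exact ⟨(scalarLow_one_two hm ha hr hθ F t).symm.trans (hlow _ _), e2, l0, l1, e1, e0⟩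
  · rintro ⟨h1, h2, h3, h4, h5, h6⟩ i
    have hx : (t, r, θ) ∈ domain m a := hr
    have hK := (bgK_pos hm ha hx).ne'
    have hY := (bgY_pos hm ha hx).ne'
    have hD := (bgD_pos hm ha hx).ne'
    -- Once p₁ = p₂ = 0, the components F_{tφ}, F_{tr} and F_{tθ} are nonvanishing multiples of v,
    -- q₂ and q₁.
    have c02 : r * cart F 0 2 (t, r, θ) = 0 := by
      have := h2
      rw [redV, div_eq_zero_iff] at this
      exact this.resolve_right hK
    have tr : redTR F (t, r, θ) = 0 := by
      have := h6
      rw [redQ2, div_eq_zero_iff, h3] at this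
      simpa using this.resolve_right hY
    have ta : redTA F (t, r, θ) = 0 := by
      have := h5
      rw [redQ1, div_eq_zero_iff, h4] at this
      simpa using this.resolve_right (mul_ne_zero hY hD)
    have hz : ∀ μ ν, blComp F (t, r, θ) μ ν = 0 := by
      intro μ ν
      fin_cases μ <;> fin_cases ν <;> simp [blComp, h1, h3, h4, tr, ta, c02, -mul_eq_zero]
    fin_cases i <;> simp [npScalars, comp_zero_eq, hz]

end

/-- The reduced fields of compactly supported data vanish near the horizon and at large radii. -/
lemma exists_initial_range {m a : ℝ} (hm : 0 < m) {F : TwoForm} (hc : HasCompactInitialData m a F) :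
    ∃ ra rb, rPlus m a < ra ∧ ∀ r, rPlus m a < r → r < ra ∨ rb < r → ∀ θ ∈ Ioo 0 Real.pi,
      ReducedMaxwell.Vanishes (redU F) (redV m a F) (redP1 F) (redP2 F) (redQ1 m a F) (redQ2 m a F)
        (0, r, θ) := by
  obtain ⟨C, hC, hCe, hz⟩ := hc
  have hp : 0 < rPlus m a := by unfold rPlus; positivity
  have key : ∃ ra rb, rPlus m a < ra ∧ ∀ p ∈ C, ra ^ 2 ≤ p 1 ^ 2 + p 2 ^ 2 + p 3 ^ 2 ∧
      p 1 ^ 2 + p 2 ^ 2 + p 3 ^ 2 ≤ rb ^ 2 ∧ 0 ≤ rb := by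
    rcases C.eq_empty_or_nonempty with rfl | hne
    · exact ⟨rPlus m a + 1, 0, by linarith, by simp⟩
    -- On the compact set C the Euclidean radius attains a minimum, larger than r₊ because C lies in
    -- the open exterior, and a maximum.
    · have hcont : ContinuousOn (fun p : Fin 4 → ℝ => p 1 ^ 2 + p 2 ^ 2 + p 3 ^ 2) C := by fun_prop
      obtain ⟨p, hpC, hmin⟩ := hC.exists_isMinOn hne hcont
      obtain ⟨q, hqC, hmax⟩ := hC.exists_isMaxOn hne hcont
      have h1 : rPlus m a ^ 2 < p 1 ^ 2 + p 2 ^ 2 + p 3 ^ 2 := hCe hpC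
      refine ⟨Real.sqrt (p 1 ^ 2 + p 2 ^ 2 + p 3 ^ 2), Real.sqrt (q 1 ^ 2 + q 2 ^ 2 + q 3 ^ 2),
        Real.lt_sqrt_of_sq_lt h1, fun z hzC => ?_⟩
      rw [Real.sq_sqrt (by positivity), Real.sq_sqrt (by positivity)]
      exact ⟨hmin hzC, hmax hzC, Real.sqrt_nonneg _⟩
  obtain ⟨ra, rb, hra, hb⟩ := key
  refine ⟨ra, rb, hra, fun r hr hrr θ hθ => ?_⟩
  have hnot : blChart ![0, r, θ, 0] ∉ C := by
    intro hmem
    obtain ⟨b1, b2, b3⟩ := hb _ hmem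
    have e : blChart ![0, r, θ, 0] 1 ^ 2 + blChart ![0, r, θ, 0] 2 ^ 2 + blChart ![0, r, θ, 0] 3 ^ 2
        = r ^ 2 := by
      simp [blChart]
      linear_combination r ^ 2 * Real.sin_sq_add_cos_sq θ
    rw [e] at b1 b2
    rcases hrr with h | h
    · nlinarith
    · nlinarith
  have h0 := hz (blChart ![0, r, θ, 0]) (blChart_mem_exterior hm hr) (by simp [blChart]) hnot
  have hcart : ∀ i j, cart F i j (0, r, θ) = 0 := fun i j => by
    simp only [cart]
    rw [h0]
    rfl
  simp [ReducedMaxwell.Vanishes, redU, redV, redP1, redP2, redQ1, redQ2, redTA, redTR, hcart]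

/-! ### Twist potentials -/

/-- The hypothesis `heq` says that the parameter derivative of sin ϑ f is the ϑ-derivative of sin ϑ
g. Differentiating under the integral and integrating back gives sin θ g(θ), with no term at ϑ = 0
because of the sine. It is applied with parameter r and a constraint equation, and with parameter t
and an evolution equation. -/
lemma hasDerivAt_integral_sin {f f' : ℝ → ℝ → ℝ} {g g' : ℝ → ℝ} {x₀ δ : ℝ} (hδ : 0 < δ)
    (hf : ∀ x ∈ Metric.ball x₀ δ, ∀ ϑ, HasDerivAt (fun x => f x ϑ) (f' x ϑ) x)
    (hfc : ∀ x ∈ Metric.ball x₀ δ, Continuous (f x))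
    (hfc' : ContinuousOn (Function.uncurry f') (Metric.closedBall x₀ δ ×ˢ univ))
    (hg : ∀ ϑ, HasDerivAt g (g' ϑ) ϑ) (hgc : Continuous g')
    (heq : ∀ ϑ ∈ Ioo 0 Real.pi, Real.sin ϑ * f' x₀ ϑ = Real.cos ϑ * g ϑ + Real.sin ϑ * g' ϑ)
    {θ : ℝ} (hθ : θ ∈ Icc 0 Real.pi) :
    HasDerivAt (fun x => ∫ ϑ in (0 : ℝ)..θ, Real.sin ϑ * f x ϑ) (Real.sin θ * g θ) x₀ := by
  have hk : IsCompact (Metric.closedBall x₀ δ ×ˢ Icc (0 : ℝ) θ) :=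
    (isCompact_closedBall x₀ δ).prod isCompact_Icc
  obtain ⟨C, hC⟩ := hk.exists_bound_of_continuousOn
    (hfc'.mono (Set.prod_mono Subset.rfl (subset_univ _)))
  have hx₀ : Continuous (f' x₀) := by
    have := hfc'.comp_continuous (f := fun ϑ : ℝ => (x₀, ϑ)) (by fun_prop)
      fun ϑ => ⟨Metric.mem_closedBall_self hδ.le, mem_univ _⟩
    exact this
  have h := (intervalIntegral.hasDerivAt_integral_of_dominated_loc_of_deriv_le
    (F := fun x ϑ => Real.sin ϑ * f x ϑ) (F' := fun x ϑ => Real.sin ϑ * f' x ϑ) (a := 0) (b := θ)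
    (μ := volume) (bound := fun _ => C) (Metric.ball_mem_nhds x₀ hδ) ?_ ?_ ?_ ?_ ?_ ?_).2
  · refine h.congr_deriv ?_
    have hFTC : ∫ ϑ in (0 : ℝ)..θ, (Real.cos ϑ * g ϑ + Real.sin ϑ * g' ϑ) =
        Real.sin θ * g θ - Real.sin 0 * g 0 := by
      have hgc0 : Continuous g := continuous_iff_continuousAt.2 fun ϑ => (hg ϑ).continuousAt
      refine intervalIntegral.integral_eq_sub_of_hasDerivAt
        (fun ϑ _ => (Real.hasDerivAt_sin ϑ).mul (hg ϑ)) ?_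
      exact Continuous.intervalIntegrable (by fun_prop) _ _
    rw [Real.sin_zero, zero_mul, sub_zero] at hFTC
    rw [← hFTC, intervalIntegral.integral_of_le hθ.1, intervalIntegral.integral_of_le hθ.1,
      integral_Ioc_eq_integral_Ioo, integral_Ioc_eq_integral_Ioo]
    exact setIntegral_congr_fun measurableSet_Ioo fun ϑ hϑ => heq ϑ ⟨hϑ.1, hϑ.2.trans_le hθ.2⟩
  · filter_upwards [Metric.ball_mem_nhds x₀ hδ] with x hx
    exact (Real.continuous_sin.mul (hfc x hx)).aestronglyMeasurable
  · exact (Real.continuous_sin.mul (hfc x₀ (Metric.mem_ball_self hδ))).intervalIntegrable _ _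
  · exact (Real.continuous_sin.mul hx₀).aestronglyMeasurable
  · refine Eventually.of_forall fun ϑ hϑ x hx => ?_
    rw [uIoc_of_le hθ.1] at hϑ
    rw [norm_mul]
    have h1 : ‖Real.sin ϑ‖ ≤ 1 := Real.abs_sin_le_one ϑ
    have h2 : ‖f' x ϑ‖ ≤ C := hC (x, ϑ) ⟨Metric.ball_subset_closedBall hx, hϑ.1.le, hϑ.2⟩
    nlinarith [norm_nonneg (f' x ϑ), norm_nonneg (Real.sin ϑ)]
  · exact intervalIntegrable_const
  · exact Eventually.of_forall fun ϑ _ x hx => (hf x hx ϑ).const_mul _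

/-- The integral of `sin θ f` from the axis. -/
def axisIntegral (f : ℝ × ℝ × ℝ → ℝ) (x : ℝ × ℝ × ℝ) : ℝ :=
  ∫ ϑ in (0 : ℝ)..x.2.2, Real.sin ϑ * f (x.1, x.2.1, ϑ)

/-- `l` is a potential with `∂_r l = p₁ sin θ`, `∂_θ l = p₂ sin θ` and `∂_t l = w sin θ`. -/
structure IsPotential (m a : ℝ) (p₁ p₂ w l : ℝ × ℝ × ℝ → ℝ) : Prop where
  cont : ContinuousOn l (domain m a)
  dR : ∀ t r θ, rPlus m a < r → θ ∈ Icc 0 Real.pi →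
    HasDerivAt (fun r => l (t, r, θ)) (Real.sin θ * p₁ (t, r, θ)) r
  dA : ∀ t r θ, rPlus m a < r →
    HasDerivAt (fun θ => l (t, r, θ)) (Real.sin θ * p₂ (t, r, θ)) θ
  dT : ∀ t r θ, rPlus m a < r → θ ∈ Icc 0 Real.pi →
    HasDerivAt (fun t => l (t, r, θ)) (Real.sin θ * w (t, r, θ)) t
  zero : ∀ t r, rPlus m a < r → l (t, r, 0) = 0
  pi : ∀ t r, rPlus m a < r → l (t, r, Real.pi) = 0
  vanish : ∀ t r, rPlus m a < r → (∀ θ ∈ Ioo 0 Real.pi, p₂ (t, r, θ) = 0) →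
    ∀ θ ∈ Icc 0 Real.pi, l (t, r, θ) = 0

section
variable {m a : ℝ} {p₁ p₂ w : ℝ × ℝ × ℝ → ℝ}

lemma continuous_angle {f : ℝ × ℝ × ℝ → ℝ} (hf : ContinuousOn f (domain m a)) (t : ℝ) {r : ℝ}
    (hr : rPlus m a < r) : Continuous fun ϑ => f (t, r, ϑ) :=
  hf.comp_continuous (f := fun ϑ : ℝ => (t, r, ϑ)) (by fun_prop) fun _ => hr

lemma continuousOn_axisIntegral {f : ℝ × ℝ × ℝ → ℝ} (hf : ContinuousOn f (domain m a)) :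
    ContinuousOn (axisIntegral f) (domain m a) := by
  rw [continuousOn_iff_continuous_domRestrict]
  have h : Continuous (Function.uncurry fun (x : domain m a) (ϑ : ℝ) =>
      Real.sin ϑ * f (x.1.1, x.1.2.1, ϑ)) := by
    refine (by fun_prop : Continuous fun z : domain m a × ℝ => Real.sin z.2).mul ?_
    exact hf.comp_continuous (f := fun z : domain m a × ℝ => (z.1.1.1, z.1.1.2.1, z.2))
      (by fun_prop) fun z => z.1.2
  exact intervalIntegral.continuous_parametric_intervalIntegral_of_continuous (μ := volume) (a₀ := 0) h
    (s := fun x : domain m a => x.1.2.2) (by fun_prop)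

/-- The two identities `hR` and `hT` express closedness in (r, θ) and in (t, θ). The essential point
is the second axis component: the value at θ = π has r-derivative sin π · p₁ = 0, so it is
independent of r, and it is zero at large r because the field vanishes there. There is no charge,
since the support stays away from the horizon and infinity. -/
lemma isPotential_axisIntegral (h1 : Smooth m a p₁) (h2 : Smooth m a p₂) (h3 : Smooth m a w)
    (hR : ∀ x ∈ domain m a, x.2.2 ∈ Ioo 0 Real.pi →
      Real.sin x.2.2 * dR p₂ x = Real.cos x.2.2 * p₁ x + Real.sin x.2.2 * dA p₁ x)
    (hT : ∀ x ∈ domain m a, x.2.2 ∈ Ioo 0 Real.pi →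
      Real.sin x.2.2 * dT p₂ x = Real.cos x.2.2 * w x + Real.sin x.2.2 * dA w x)
    (hv : ∀ t, ∃ R, ∀ r, rPlus m a < r → R < r → ∀ θ ∈ Ioo 0 Real.pi, p₂ (t, r, θ) = 0) :
    IsPotential m a p₁ p₂ w (axisIntegral p₂) := by
  have c2 := h2.continuousOn
  have dRl : ∀ t r θ, rPlus m a < r → θ ∈ Icc 0 Real.pi →
      HasDerivAt (fun r => axisIntegral p₂ (t, r, θ)) (Real.sin θ * p₁ (t, r, θ)) r := by
    intro t r θ hr hθ
    have hball : ∀ x ∈ Metric.closedBall r ((r - rPlus m a) / 2), rPlus m a < x := by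
      intro x hx
      have := (abs_le.1 (Metric.mem_closedBall.1 hx)).1
      linarith
    refine hasDerivAt_integral_sin (f := fun r ϑ => p₂ (t, r, ϑ)) (f' := fun r ϑ => KerrMaxwell.dR p₂ (t, r, ϑ))
      (g := fun ϑ => p₁ (t, r, ϑ)) (g' := fun ϑ => KerrMaxwell.dA p₁ (t, r, ϑ))
      (half_pos (sub_pos.2 hr)) (fun x hx ϑ => h2.hasDerivAt_dR t (hball x (Metric.ball_subset_closedBall hx)) ϑ)
      (fun x hx => continuous_angle c2 t (hball x (Metric.ball_subset_closedBall hx))) ?_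
      (fun ϑ => h1.hasDerivAt_dA t hr ϑ) (continuous_angle h1.dA.continuousOn t hr)
      (fun ϑ hϑ => hR (t, r, ϑ) hr hϑ) hθ
    exact h2.dR.continuousOn.comp (f := fun z : ℝ × ℝ => (t, z.1, z.2)) (by fun_prop)
      fun z hz => hball z.1 hz.1
  have vanish : ∀ t r, rPlus m a < r → (∀ θ ∈ Ioo 0 Real.pi, p₂ (t, r, θ) = 0) →
      ∀ θ ∈ Icc 0 Real.pi, axisIntegral p₂ (t, r, θ) = 0 := by
    intro t r hr hz θ hθ
    simp only [axisIntegral]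
    rw [intervalIntegral.integral_of_le hθ.1, integral_Ioc_eq_integral_Ioo]
    refine setIntegral_eq_zero_of_forall_eq_zero fun ϑ hϑ => ?_
    rw [hz ϑ ⟨hϑ.1, hϑ.2.trans_le hθ.2⟩, mul_zero]
  refine ⟨continuousOn_axisIntegral c2, dRl, ?_, ?_, fun t r hr => by simp [axisIntegral], ?_, vanish⟩
  · intro t r θ hr
    have hc : Continuous fun ϑ => Real.sin ϑ * p₂ (t, r, ϑ) :=
      Real.continuous_sin.mul (continuous_angle c2 t hr)
    exact (hc.integral_hasStrictDerivAt 0 θ).hasDerivAt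
  · intro t r θ hr hθ
    refine hasDerivAt_integral_sin (f := fun t ϑ => p₂ (t, r, ϑ)) (f' := fun t ϑ => KerrMaxwell.dT p₂ (t, r, ϑ))
      (g := fun ϑ => w (t, r, ϑ)) (g' := fun ϑ => KerrMaxwell.dA w (t, r, ϑ))
      one_pos (fun x _ ϑ => h2.hasDerivAt_dT hr ϑ)
      (fun x _ => continuous_angle c2 x hr) ?_
      (fun ϑ => h3.hasDerivAt_dA t hr ϑ) (continuous_angle h3.dA.continuousOn t hr)
      (fun ϑ hϑ => hT (t, r, ϑ) hr hϑ) hθ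
    exact h2.dT.continuousOn.comp (f := fun z : ℝ × ℝ => (z.1, r, z.2)) (by fun_prop)
      fun z _ => hr
  · intro t r hr
    obtain ⟨R, hR⟩ := hv t
    have hpi : Real.pi ∈ Icc 0 Real.pi := right_mem_Icc.2 Real.pi_pos.le
    -- The field is known to vanish only strictly beyond R, whence R + 1.
    set R' := max r (R + 1)
    have h0 : axisIntegral p₂ (t, R', Real.pi) = 0 :=
      vanish t R' (hr.trans_le (le_max_left _ _))
        (hR R' (hr.trans_le (le_max_left _ _)) (lt_of_lt_of_le (by linarith) (le_max_right _ _))) _ hpi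
    have hc : ∀ x ∈ Icc r R', axisIntegral p₂ (t, x, Real.pi) = axisIntegral p₂ (t, r, Real.pi) := by
      refine constant_of_has_deriv_right_zero (f := fun x => axisIntegral p₂ (t, x, Real.pi)) ?_ ?_
      · exact fun x hx => (dRl t x Real.pi (hr.trans_le hx.1) hpi).continuousAt.continuousWithinAt
      · intro x hx
        have := (dRl t x Real.pi (hr.trans_le hx.1) hpi).hasDerivWithinAt (s := Ici x)
        simpa using this
    rw [← hc R' (right_mem_Icc.2 (le_max_left _ _)), h0]

namespace IsPotential
variable {l : ℝ × ℝ × ℝ → ℝ}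

/-- Potentials vanish to second order at the axis. -/
lemma abs_le (hl : IsPotential m a p₁ p₂ w l) (h2 : ContinuousOn p₂ (domain m a)) (t : ℝ)
    {r₀ r₁ : ℝ} (h0 : rPlus m a < r₀) :
    ∃ C, 0 ≤ C ∧ ∀ r θ, r₀ ≤ r → r ≤ r₁ → θ ∈ Icc 0 Real.pi →
      |l (t, r, θ)| ≤ C * Real.sin θ ^ 2 := by
  obtain ⟨C, hC0, hC⟩ := exists_bound_of_continuousOn h2 |t| (r₁ := r₁) h0
  refine ⟨C, hC0, fun r θ hr0 hr1 hθ => ?_⟩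
  have hr := h0.trans_le hr0
  have hb : ∀ ϑ ∈ Icc 0 Real.pi, |p₂ (t, r, ϑ)| ≤ C := fun ϑ hϑ => hC t r ϑ le_rfl hr0 hr1 hϑ
  -- Since ∂_θ l = p₂ sin θ with |p₂| ≤ C, the functions −C cos ϑ ± l are nondecreasing. Comparing
  -- with θ = 0 and with θ = π bounds |l| by C(1 − cos θ) and by C(1 + cos θ).
  have mono : ∀ σ : ℝ, |σ| = 1 → MonotoneOn (fun ϑ => -(C * Real.cos ϑ) + σ * l (t, r, ϑ)) (Icc 0 Real.pi) := by
    intro σ hσ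
    have hd : ∀ ϑ, HasDerivAt (fun ϑ => -(C * Real.cos ϑ) + σ * l (t, r, ϑ))
        (Real.sin ϑ * (C + σ * p₂ (t, r, ϑ))) ϑ := fun ϑ =>
      ((((Real.hasDerivAt_cos ϑ).const_mul C).neg).add ((hl.dA t r ϑ hr).const_mul σ)).congr_deriv
        (by ring)
    refine monotoneOn_of_deriv_nonneg (convex_Icc _ _)
      (fun ϑ _ => (hd ϑ).continuousAt.continuousWithinAt)
      (fun ϑ _ => (hd ϑ).differentiableAt.differentiableWithinAt) fun ϑ hϑ => ?_
    rw [interior_Icc] at hϑ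
    rw [(hd ϑ).deriv]
    have h1 : |σ * p₂ (t, r, ϑ)| ≤ C := by
      rw [abs_mul, hσ, one_mul]; exact hb ϑ ⟨hϑ.1.le, hϑ.2.le⟩
    have := (_root_.abs_le.1 h1).1
    exact mul_nonneg (Real.sin_pos_of_pos_of_lt_pi hϑ.1 hϑ.2).le (by linarith)
  have z0 := hl.zero t r hr
  have zp := hl.pi t r hr
  have m0 : (0 : ℝ) ∈ Icc 0 Real.pi := left_mem_Icc.2 Real.pi_pos.le
  have mp : Real.pi ∈ Icc 0 Real.pi := right_mem_Icc.2 Real.pi_pos.le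
  have a1 := mono 1 (by simp) m0 hθ hθ.1
  have a2 := mono (-1) (by simp) m0 hθ hθ.1
  have a3 := mono 1 (by simp) hθ mp hθ.2
  have a4 := mono (-1) (by simp) hθ mp hθ.2
  simp only [z0, zp, Real.cos_zero, Real.cos_pi] at a1 a2 a3 a4
  have hs := Real.sin_sq_add_cos_sq θ
  have hc1 := Real.cos_le_one θ
  have hc2 := Real.neg_one_le_cos θ
  have b1 : |l (t, r, θ)| ≤ C * (1 - Real.cos θ) := by
    rw [_root_.abs_le]; constructor <;> linarith
  have b2 : |l (t, r, θ)| ≤ C * (1 + Real.cos θ) := by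
    rw [_root_.abs_le]; constructor <;> linarith
  have e : C * Real.sin θ ^ 2 = C * (1 - Real.cos θ) * (1 + Real.cos θ) := by
    linear_combination C * hs
  rw [e]
  -- In each hemisphere one of the factors 1 ± cos θ is at least 1, and the bound with the other
  -- factor is used.
  rcases le_total 0 (Real.cos θ) with h | h
  · nlinarith [mul_nonneg hC0 (sub_nonneg.2 hc1)]
  · nlinarith [mul_nonneg hC0 (show 0 ≤ 1 + Real.cos θ by linarith)]

/-- A potential is known only through its partial derivatives along coordinate lines. These are
continuous on the orbit space, which gives joint differentiability. -/
lemma differentiableAt (hl : IsPotential m a p₁ p₂ w l) (h1 : ContinuousOn p₁ (domain m a))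
    (h2 : ContinuousOn p₂ (domain m a)) (t : ℝ) {x : ℝ × ℝ} (hx : x ∈ orbit m a) :
    DifferentiableAt ℝ (fun p : ℝ × ℝ => l (t, p.1, p.2)) x := by
  have ho := (isOpen_orbit m a).mem_nhds hx
  have hc : ∀ {f : ℝ × ℝ × ℝ → ℝ}, ContinuousOn f (domain m a) →
      ContinuousAt (fun p : ℝ × ℝ => ContinuousLinearMap.toSpanSingleton ℝ (Real.sin p.2 * f (t, p.1, p.2))) x := by
    intro f hf
    have : ContinuousAt (fun p : ℝ × ℝ => Real.sin p.2 * f (t, p.1, p.2)) x :=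
      ((by fun_prop : Continuous fun p : ℝ × ℝ => Real.sin p.2).continuousAt).mul
        ((continuousOn_slice hf t).continuousAt ho)
    exact (ContinuousLinearMap.toSpanSingletonCLE (𝕜 := ℝ) (E := ℝ)).continuous.continuousAt.comp this
  have := hasStrictFDerivAt_uncurry_coprod (𝕜 := ℝ) (u := x) (f := fun r θ => l (t, r, θ))
    (f₁ := fun r θ => ContinuousLinearMap.toSpanSingleton ℝ (Real.sin θ * p₁ (t, r, θ)))
    (f₂ := fun r θ => ContinuousLinearMap.toSpanSingleton ℝ (Real.sin θ * p₂ (t, r, θ)))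
    (by
      filter_upwards [ho] with p hp
      exact (hl.dR t p.1 p.2 hp.1 ⟨hp.2.1.le, hp.2.2.le⟩).hasFDerivAt)
    (by
      filter_upwards [ho] with p hp
      exact (hl.dA t p.1 p.2 hp.1).hasFDerivAt) (hc h1) (hc h2)
  exact this.differentiableAt

/-- A potential is a twist potential of the corresponding planar field. -/
lemma isTwistPotential (hl : IsPotential m a p₁ p₂ w l) (h1 : ContinuousOn p₁ (domain m a))
    (h2 : ContinuousOn p₂ (domain m a)) (t : ℝ) {V : Fin 3 → ℝ → ℝ → ℝ}
    (hV0 : ∀ x ∈ orbit m a, V 0 x.1 x.2 = Real.sin x.2 * p₂ (t, x.1, x.2))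
    (hV1 : ∀ x ∈ orbit m a, V 1 x.1 x.2 = -(Real.sin x.2 * p₁ (t, x.1, x.2))) :
    IsTwistPotential m a V fun r θ => l (t, r, θ) := by
  refine ⟨fun x hx => hl.differentiableAt h1 h2 t hx, fun x hx b => ?_, fun r hr => ?_⟩
  · have d1 := (hl.dR t x.1 x.2 hx.1 ⟨hx.2.1.le, hx.2.2.le⟩).deriv
    have d2 := (hl.dA t x.1 x.2 hx.1).deriv
    fin_cases b
    · simpa [Fin.sum_univ_two, eps, pd, d1, d2] using hV0 x hx
    · simpa [Fin.sum_univ_two, eps, pd, d1, d2] using hV1 x hx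
  · have hc := continuous_angle hl.cont t hr
    constructor
    · have := hc.tendsto 0
      rw [hl.zero t r hr] at this
      exact this.mono_left nhdsWithin_le_nhds
    · have := hc.tendsto Real.pi
      rw [hl.pi t r hr] at this
      exact this.mono_left nhdsWithin_le_nhds

end IsPotential

/-- Twist potentials are determined on the orbit space by the field, and only their values there
matter. -/
lemma IsTwistPotential.iff_eq {V : Fin 3 → ℝ → ℝ → ℝ} {η : ℝ → ℝ → ℝ}
    (h : IsTwistPotential m a V η) (ζ : ℝ → ℝ → ℝ) :
    IsTwistPotential m a V ζ ↔ ∀ x ∈ orbit m a, ζ x.1 x.2 = η x.1 x.2 := by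
  constructor
  · intro h' x hx
    have hslice : ∀ {η : ℝ → ℝ → ℝ}, IsTwistPotential m a V η → ∀ θ ∈ Ioo 0 Real.pi,
        HasDerivAt (fun θ => η x.1 θ) (V 0 x.1 θ) θ := by
      intro η h θ hθ
      have hd : DifferentiableAt ℝ (fun θ => η x.1 θ) θ :=
        (h.differentiable (x.1, θ) ⟨hx.1, hθ⟩).comp (f := fun θ : ℝ => (x.1, θ)) θ (by fun_prop)
      have := h.curl (x.1, θ) ⟨hx.1, hθ⟩ 0
      simp [Fin.sum_univ_two, eps, pd] at this
      rw [this]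
      exact hd.hasDerivAt
    -- The first component of the curl equation already fixes the θ-derivative. The difference of
    -- two potentials is thus constant along r = const, and its limit at θ = 0 makes it zero.
    have hd : ∀ θ ∈ Ioo 0 Real.pi, HasDerivAt (fun θ => ζ x.1 θ - η x.1 θ) 0 θ := fun θ hθ =>
      ((hslice h' θ hθ).sub (hslice h θ hθ)).congr_deriv (sub_self _)
    have hconst : ∀ θ ∈ Ioo 0 Real.pi, ζ x.1 θ - η x.1 θ = ζ x.1 x.2 - η x.1 x.2 := fun θ hθ =>
      isOpen_Ioo.is_const_of_deriv_eq_zero isPreconnected_Ioo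
        (f := fun θ => ζ x.1 θ - η x.1 θ)
        (fun ϑ hϑ => (hd ϑ hϑ).differentiableAt.differentiableWithinAt)
        (fun ϑ hϑ => (hd ϑ hϑ).deriv) hθ hx.2
    have hlim : Tendsto (fun θ => ζ x.1 θ - η x.1 θ) (𝓝[>] 0) (𝓝 0) := by
      simpa using (h'.axis x.1 hx.1).1.sub (h.axis x.1 hx.1).1
    have hlim' : Tendsto (fun θ => ζ x.1 θ - η x.1 θ) (𝓝[>] 0) (𝓝 (ζ x.1 x.2 - η x.1 x.2)) := by
      refine tendsto_const_nhds.congr' ?_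
      filter_upwards [Ioo_mem_nhdsGT Real.pi_pos] with θ hθ using (hconst θ hθ).symm
    exact sub_eq_zero.1 (tendsto_nhds_unique hlim' hlim)
  · intro he
    have hev : ∀ x ∈ orbit m a, (fun p : ℝ × ℝ => ζ p.1 p.2) =ᶠ[𝓝 x] fun p => η p.1 p.2 := fun x hx => by
      filter_upwards [(isOpen_orbit m a).mem_nhds hx] with p hp using he p hp
    refine ⟨fun x hx => (h.differentiable x hx).congr_of_eventuallyEq (hev x hx), fun x hx b => ?_,
      fun r hr => ?_⟩
    · have c0 : deriv (fun r => ζ r x.2) x.1 = deriv (fun r => η r x.2) x.1 := by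
        refine Filter.EventuallyEq.deriv_eq ?_
        filter_upwards [lt_mem_nhds (show rPlus m a < x.1 from hx.1)] with r hr using he (r, x.2) ⟨hr, hx.2⟩
      have c1 : deriv (fun θ => ζ x.1 θ) x.2 = deriv (fun θ => η x.1 θ) x.2 := by
        refine Filter.EventuallyEq.deriv_eq ?_
        filter_upwards [isOpen_Ioo.mem_nhds hx.2] with θ hθ using he (x.1, θ) ⟨hx.1, hθ⟩
      rw [h.curl x hx b]
      refine Finset.sum_congr rfl fun c _ => ?_
      congr 1
      fin_cases c
      · exact c0.symm
      · exact c1.symm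
    · constructor
      · refine (h.axis r hr).1.congr' ?_
        filter_upwards [Ioo_mem_nhdsGT Real.pi_pos] with θ hθ using (he (r, θ) ⟨hr, hθ⟩).symm
      · refine (h.axis r hr).2.congr' ?_
        filter_upwards [Ioo_mem_nhdsLT Real.pi_pos] with θ hθ using (he (r, θ) ⟨hr, hθ⟩).symm

end

/-! ### Weyl coordinates -/

/-- `√Δ`. -/
def sqrtD (m a : ℝ) (x : ℝ × ℝ × ℝ) : ℝ := Real.sqrt (delta m a x.2.1)

/-- The Jacobian `(Δ cos² θ + (r - m)² sin² θ) / √Δ` of the Weyl coordinates. -/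
def weylJ (m a : ℝ) (x : ℝ × ℝ × ℝ) : ℝ :=
  (delta m a x.2.1 * Real.cos x.2.2 ^ 2 + (x.2.1 - m) ^ 2 * Real.sin x.2.2 ^ 2) / sqrtD m a x

/-- A function of the Weyl coordinates as a function of `(t, r, θ)`. -/
def pullW (m a : ℝ) (g : ℝ × ℝ → ℝ) (x : ℝ × ℝ × ℝ) : ℝ := g (weyl m a x.2.1 x.2.2)

section
variable {m a : ℝ} (hm : 0 < m) (ha : |a| ≤ m)

lemma hasDerivAt_delta (m a r : ℝ) : HasDerivAt (delta m a) (2 * (r - m)) r := by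
  have := ((hasDerivAt_pow 2 r).sub ((hasDerivAt_id r).const_mul (2 * m))).add_const (a ^ 2)
  refine HasDerivAt.congr_deriv (f := delta m a) this ?_
  push_cast; ring

lemma m_lt {r : ℝ} (hr : rPlus m a < r) : m < r := by
  have h2 := Real.sqrt_nonneg (m ^ 2 - a ^ 2)
  unfold rPlus at hr
  linarith

include hm ha

lemma sqrtD_pos {x : ℝ × ℝ × ℝ} (hx : x ∈ domain m a) : 0 < sqrtD m a x :=
  Real.sqrt_pos.2 (bgD_pos hm ha hx)

lemma sqrtD_sq {x : ℝ × ℝ × ℝ} (hx : x ∈ domain m a) : sqrtD m a x ^ 2 = delta m a x.2.1 :=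
  Real.sq_sqrt (bgD_pos hm ha hx).le

lemma smooth_sqrtD : Smooth m a (sqrtD m a) :=
  ContDiffOn.sqrt (smooth_bgD m a) fun _ hx => (bgD_pos hm ha hx).ne'

lemma hasDerivAt_sqrt_delta {r : ℝ} (hr : rPlus m a < r) :
    HasDerivAt (fun r => Real.sqrt (delta m a r)) ((r - m) / Real.sqrt (delta m a r)) r := by
  have hD := (rPlus_lt m a r hm ha hr).2
  have := Real.sqrt_pos.2 hD
  refine ((hasDerivAt_delta m a r).sqrt hD.ne').congr_deriv ?_
  field_simp

lemma dR_sqrtD {x : ℝ × ℝ × ℝ} (hx : x ∈ domain m a) :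
    dR (sqrtD m a) x = (x.2.1 - m) / sqrtD m a x :=
  ((smooth_sqrtD hm ha).hasDerivAt_dR x.1 hx x.2.2).unique (hasDerivAt_sqrt_delta hm ha hx)

lemma smooth_weyl : ContDiffOn ℝ ∞ (fun x : ℝ × ℝ × ℝ => weyl m a x.2.1 x.2.2) (domain m a) := by
  have h := smooth_sqrtD hm ha
  have h' : ContDiffOn ℝ ∞ (fun x : ℝ × ℝ × ℝ => sqrtD m a x * Real.sin x.2.2) (domain m a) := by
    unfold Smooth at h
    fun_prop
  exact h'.prodMk (by fun_prop)

lemma smooth_pullW {g : ℝ × ℝ → ℝ} (hg : ContDiff ℝ ∞ g) : Smooth m a (pullW m a g) :=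
  hg.comp_contDiffOn (smooth_weyl hm ha)

lemma weylJ_pos {x : ℝ × ℝ × ℝ} (hx : x ∈ domain m a) : 0 < weylJ m a x := by
  have h1 := sqrtD_pos hm ha hx
  have h2 := (rPlus_lt m a _ hm ha hx).2
  have h3 : 0 < x.2.1 - m := sub_pos.2 (m_lt hx)
  refine div_pos ?_ h1
  rcases eq_or_ne (Real.sin x.2.2) 0 with h | h
  · have := Real.sin_sq_add_cos_sq x.2.2
    rw [h] at this ⊢
    have hc : Real.cos x.2.2 ^ 2 = 1 := by linarith
    rw [hc]; linarith
  · positivity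

lemma continuousOn_weylJ : ContinuousOn (weylJ m a) (domain m a) := by
  refine ContinuousOn.div ?_ (smooth_sqrtD hm ha).continuousOn fun x hx => (sqrtD_pos hm ha hx).ne'
  unfold delta
  fun_prop

lemma hasDerivAt_weyl_r {r : ℝ} (hr : rPlus m a < r) (θ : ℝ) : HasDerivAt (fun r => weyl m a r θ)
    ((r - m) / Real.sqrt (delta m a r) * Real.sin θ, Real.cos θ) r := by
  refine HasDerivAt.prodMk ((hasDerivAt_sqrt_delta hm ha hr).mul_const _) ?_
  simpa using ((hasDerivAt_id r).sub_const m).mul_const (Real.cos θ)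

omit hm ha in
lemma hasDerivAt_weyl_θ (m a r θ : ℝ) : HasDerivAt (fun θ => weyl m a r θ)
    (Real.sqrt (delta m a r) * Real.cos θ, (r - m) * -Real.sin θ) θ :=
  HasDerivAt.prodMk ((Real.hasDerivAt_sin θ).const_mul _) ((Real.hasDerivAt_cos θ).const_mul _)

omit hm ha in
lemma fderiv_pair (g : ℝ × ℝ → ℝ) (y : ℝ × ℝ) (b c : ℝ) :
    fderiv ℝ g y (b, c) = b * fderiv ℝ g y (1, 0) + c * fderiv ℝ g y (0, 1) := by
  have : ((b, c) : ℝ × ℝ) = b • ((1, 0) : ℝ × ℝ) + c • ((0, 1) : ℝ × ℝ) := by simp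
  rw [this, map_add, map_smul, map_smul, smul_eq_mul, smul_eq_mul]

lemma dR_pullW {g : ℝ × ℝ → ℝ} (hg : ContDiff ℝ ∞ g) {x : ℝ × ℝ × ℝ} (hx : x ∈ domain m a) :
    dR (pullW m a g) x =
      (x.2.1 - m) / sqrtD m a x * Real.sin x.2.2 * pullW m a (fun y => fderiv ℝ g y (1, 0)) x +
      Real.cos x.2.2 * pullW m a (fun y => fderiv ℝ g y (0, 1)) x := by
  have h1 := (smooth_pullW hm ha hg).hasDerivAt_dR x.1 hx x.2.2
  have h2 := ((hg.differentiable (by simp)) (weyl m a x.2.1 x.2.2)).hasFDerivAt.comp_hasDerivAt x.2.1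
    (hasDerivAt_weyl_r hm ha hx x.2.2)
  rw [fderiv_pair] at h2
  exact h1.unique h2

lemma dA_pullW {g : ℝ × ℝ → ℝ} (hg : ContDiff ℝ ∞ g) {x : ℝ × ℝ × ℝ} (hx : x ∈ domain m a) :
    dA (pullW m a g) x =
      sqrtD m a x * Real.cos x.2.2 * pullW m a (fun y => fderiv ℝ g y (1, 0)) x +
      (x.2.1 - m) * -Real.sin x.2.2 * pullW m a (fun y => fderiv ℝ g y (0, 1)) x := by
  have h1 := (smooth_pullW hm ha hg).hasDerivAt_dA x.1 hx x.2.2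
  have h2 := ((hg.differentiable (by simp)) (weyl m a x.2.1 x.2.2)).hasFDerivAt.comp_hasDerivAt x.2.2
    (hasDerivAt_weyl_θ m a x.2.1 x.2.2)
  rw [fderiv_pair] at h2
  exact h1.unique h2

/-- Weyl coordinates are isothermal. -/
lemma laplacian_pullW {g : ℝ × ℝ → ℝ} (hg : ContDiff ℝ ∞ g) {x : ℝ × ℝ × ℝ} (hx : x ∈ domain m a) :
    dR (sqrtD m a) x * dR (pullW m a g) x + sqrtD m a x * dR (dR (pullW m a g)) x +
      dA (dA (pullW m a g)) x / sqrtD m a x = weylJ m a x *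
      pullW m a (fun y => fderiv ℝ (fun y => fderiv ℝ g y (1, 0)) y (1, 0) +
        fderiv ℝ (fun y => fderiv ℝ g y (0, 1)) y (0, 1)) x := by
  obtain ⟨t, r, θ⟩ := x
  have hr : rPlus m a < r := hx
  set g1 := fun y => fderiv ℝ g y (1, 0) with hg1
  set g2 := fun y => fderiv ℝ g y (0, 1) with hg2
  have s1 : ContDiff ℝ ∞ g1 := contDiff_fderiv_const hg _
  have s2 : ContDiff ℝ ∞ g2 := contDiff_fderiv_const hg _
  have hD := (rPlus_lt m a r hm ha hr).2
  have hw : 0 < Real.sqrt (delta m a r) := Real.sqrt_pos.2 hD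
  have hsq : Real.sqrt (delta m a r) ^ 2 = delta m a r := Real.sq_sqrt hD.le
  have q1 := (((((hasDerivAt_id r).sub_const m).div (hasDerivAt_sqrt_delta hm ha hr) hw.ne').mul_const
      (Real.sin θ)).mul ((smooth_pullW hm ha s1).hasDerivAt_dR t hr θ)).add
      (((smooth_pullW hm ha s2).hasDerivAt_dR t hr θ).const_mul (Real.cos θ))
  have e1 := q1.congr_of_eventuallyEq (f₁ := fun r => dR (pullW m a g) (t, r, θ)) (by
    filter_upwards [lt_mem_nhds hr] with y hy using dR_pullW hm ha hg (x := (t, y, θ)) hy)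
  have q2 := (((Real.hasDerivAt_cos θ).const_mul (Real.sqrt (delta m a r))).mul
        ((smooth_pullW hm ha s1).hasDerivAt_dA t hr θ)).add
      (((Real.hasDerivAt_sin θ).neg.const_mul (r - m)).mul ((smooth_pullW hm ha s2).hasDerivAt_dA t hr θ))
  have e2 := q2.congr_of_eventuallyEq (f₁ := fun θ => dA (pullW m a g) (t, r, θ))
    (Eventually.of_forall fun y => dA_pullW hm ha hg (x := (t, r, y)) hr)
  rw [((smooth_pullW hm ha hg).dR.hasDerivAt_dR t hr θ).unique e1,
    ((smooth_pullW hm ha hg).dA.hasDerivAt_dA t hr θ).unique e2, dR_sqrtD hm ha hx,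
    dR_pullW hm ha hg hx, dR_pullW hm ha s1 hx, dR_pullW hm ha s2 hx, dA_pullW hm ha s1 hx,
    dA_pullW hm ha s2 hx]
  simp only [weylJ, sqrtD, id, Pi.div_apply, Pi.neg_apply]
  have hP : pullW m a (fun y => fderiv ℝ g1 y (1, 0) + fderiv ℝ g2 y (0, 1)) (t, r, θ) =
    pullW m a (fun y => fderiv ℝ g1 y (1, 0)) (t, r, θ) +
    pullW m a (fun y => fderiv ℝ g2 y (0, 1)) (t, r, θ) := rfl
  rw [hP, ← hg1, ← hg2]
  generalize Real.sqrt (delta m a r) = w at *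
  rw [← hsq]
  field_simp
  ring

end

/-! ### Change of variables -/

/-- The Weyl coordinates as a map of the plane. -/
def weylMap (m a : ℝ) (p : ℝ × ℝ) : ℝ × ℝ := weyl m a p.1 p.2

/-- The differential of the Weyl coordinates. -/
def weylD (m a : ℝ) (p : ℝ × ℝ) : ℝ × ℝ →L[ℝ] ℝ × ℝ :=
  (Matrix.toLin (Module.Basis.finTwoProd ℝ) (Module.Basis.finTwoProd ℝ)
    !![(p.1 - m) / Real.sqrt (delta m a p.1) * Real.sin p.2, Real.sqrt (delta m a p.1) * Real.cos p.2;
      Real.cos p.2, (p.1 - m) * -Real.sin p.2]).toContinuousLinearMap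

section
variable {m a : ℝ}

lemma continuous_weylMap (m a : ℝ) : Continuous (weylMap m a) := by
  unfold weylMap weyl delta
  fun_prop

variable (hm : 0 < m) (ha : |a| ≤ m)
include hm ha

lemma hasStrictFDerivAt_weylMap {p : ℝ × ℝ} (hp : p ∈ orbit m a) :
    HasStrictFDerivAt (weylMap m a) (weylD m a p) p := by
  have h1 : ContDiffAt ℝ ∞ (weylMap m a) p := by
    have h := (smooth_weyl hm ha).contDiffAt ((isOpen_domain m a).mem_nhds
      (show ((0 : ℝ), p.1, p.2) ∈ domain m a from hp.1))
    exact h.comp (f := fun p : ℝ × ℝ => ((0 : ℝ), p.1, p.2)) p (by fun_prop)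
  have h2 := h1.hasStrictFDerivAt (by simp)
  have e1 := h2.hasFDerivAt.comp_hasDerivAt (f := fun r : ℝ => (r, p.2)) p.1
    ((hasDerivAt_id p.1).prodMk (hasDerivAt_const p.1 p.2))
  have e2 := h2.hasFDerivAt.comp_hasDerivAt (f := fun θ : ℝ => (p.1, θ)) p.2
    ((hasDerivAt_const p.2 p.1).prodMk (hasDerivAt_id p.2))
  have f1 := e1.unique (hasDerivAt_weyl_r hm ha hp.1 p.2)
  have f2 := e2.unique (hasDerivAt_weyl_θ m a p.1 p.2)
  have hd : weylD m a p = fderiv ℝ (weylMap m a) p := by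
    rw [weylD, Matrix.toLin_finTwoProd_toContinuousLinearMap]
    ext <;> simp [f1, f2]
  rw [hd]
  exact h2

lemma abs_det_weylD {p : ℝ × ℝ} (hp : p ∈ orbit m a) (t : ℝ) :
    |(weylD m a p).det| = weylJ m a (t, p.1, p.2) := by
  have hx : (t, p.1, p.2) ∈ domain m a := hp.1
  have hw := sqrtD_pos hm ha hx
  have hsq := sqrtD_sq hm ha hx
  have hJ := weylJ_pos hm ha hx
  have : (weylD m a p).det = -weylJ m a (t, p.1, p.2) := by
    rw [weylD, ContinuousLinearMap.det, LinearMap.coe_toContinuousLinearMap, LinearMap.det_toLin,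
      Matrix.det_fin_two_of, weylJ]
    simp only [sqrtD] at *
    generalize Real.sqrt (delta m a p.1) = w at *
    rw [← hsq]
    field_simp
    ring
  rw [this, abs_neg, abs_of_pos hJ]

/-- The curves r = const are confocal half-ellipses. If two points with r-values p₁ < q₁ had the
same image, equality of ρ̄ would force sin² to drop strictly and equality of z̄ would force cos² not
to grow, against sin² + cos² = 1. For equal r, injectivity of the cosine on [0, π] decides. -/
lemma injOn_weylMap : InjOn (weylMap m a) (orbit m a) := by
  have h1 : 0 ≤ m ^ 2 - a ^ 2 := by
    have := sq_le_sq' (by linarith [neg_abs_le a]) ((le_abs_self a).trans ha)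
    linarith
  have key : ∀ p ∈ orbit m a, ∀ q ∈ orbit m a, weylMap m a p = weylMap m a q → ¬ p.1 < q.1 := by
    intro p hp q hq he hlt
    have hDp := (rPlus_lt m a p.1 hm ha hp.1).2
    have hDq := (rPlus_lt m a q.1 hm ha hq.1).2
    have hmp := m_lt hp.1
    have hsp := sin_pos_of_mem_orbit hp
    have e1 := congrArg (fun z : ℝ × ℝ => z.1 ^ 2) he
    have e2 := congrArg (fun z : ℝ × ℝ => z.2 ^ 2) he
    simp only [weylMap, weyl, mul_pow, Real.sq_sqrt hDp.le, Real.sq_sqrt hDq.le] at e1 e2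
    have hlt' : (p.1 - m) ^ 2 < (q.1 - m) ^ 2 := by nlinarith
    have hD : delta m a p.1 < delta m a q.1 := by unfold delta; nlinarith
    have c1 := Real.sin_sq_add_cos_sq p.2
    have c2 := Real.sin_sq_add_cos_sq q.2
    have k1 : Real.sin q.2 ^ 2 < Real.sin p.2 ^ 2 := by
      have : 0 < Real.sin p.2 ^ 2 := by positivity
      nlinarith
    have k2 : Real.cos q.2 ^ 2 ≤ Real.cos p.2 ^ 2 := by
      have : 0 < (p.1 - m) ^ 2 := pow_pos (by linarith) 2
      nlinarith [sq_nonneg (Real.cos q.2)]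
    linarith
  intro p hp q hq he
  have h : p.1 = q.1 := le_antisymm (not_lt.1 (key q hq p hp he.symm)) (not_lt.1 (key p hp q hq he))
  have e2 := congrArg Prod.snd he
  simp only [weylMap, weyl, h] at e2
  have hmq := m_lt hq.1
  have := mul_left_cancel₀ (sub_pos.2 hmq).ne' e2
  exact Prod.ext h (Real.injOn_cos ⟨hp.2.1.le, hp.2.2.le⟩ ⟨hq.2.1.le, hq.2.2.le⟩ this)

lemma integral_image_weylMap {s : Set (ℝ × ℝ)} (hs : MeasurableSet s) (hso : s ⊆ orbit m a)
    (t : ℝ) (f : ℝ × ℝ → ℝ) : ∫ y in weylMap m a '' s, f y =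
      ∫ p in s, weylJ m a (t, p.1, p.2) * f (weylMap m a p) := by
  rw [integral_image_eq_integral_abs_det_fderiv_smul volume hs
    (fun p hp => (hasStrictFDerivAt_weylMap hm ha (hso hp)).hasFDerivAt.hasFDerivWithinAt)
    ((injOn_weylMap hm ha).mono hso)]
  exact setIntegral_congr_fun hs fun p hp => by
    simp only [abs_det_weylD hm ha (hso hp) t, smul_eq_mul]

lemma integrableOn_image_weylMap {s : Set (ℝ × ℝ)} (hs : MeasurableSet s) (hso : s ⊆ orbit m a)
    (t : ℝ) (f : ℝ × ℝ → ℝ) : IntegrableOn f (weylMap m a '' s) ↔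
      IntegrableOn (fun p => weylJ m a (t, p.1, p.2) * f (weylMap m a p)) s := by
  rw [integrableOn_image_iff_integrableOn_abs_det_fderiv_smul volume hs
    (fun p hp => (hasStrictFDerivAt_weylMap hm ha (hso hp)).hasFDerivAt.hasFDerivWithinAt)
    ((injOn_weylMap hm ha).mono hso)]
  exact integrableOn_congr_fun (fun p hp => by
    simp only [abs_det_weylD hm ha (hso hp) t, smul_eq_mul]) hs

lemma measurableSet_image_weylMap : MeasurableSet (weylMap m a '' orbit m a) :=
  measurable_image_of_fderivWithin (measurableSet_orbit m a)
    (fun _ hp => (hasStrictFDerivAt_weylMap hm ha hp).hasFDerivAt.hasFDerivWithinAt)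
    (injOn_weylMap hm ha)

/-- The Jacobian does not vanish, so the inverse function theorem applies. This transfers continuity
to Weyl coordinates without a formula for the inverse map. -/
lemma map_nhds_weylMap {p : ℝ × ℝ} (hp : p ∈ orbit m a) :
    map (weylMap m a) (𝓝 p) = 𝓝 (weylMap m a p) := by
  have hdet : (weylD m a p).det ≠ 0 := by
    have := abs_det_weylD hm ha hp 0
    rw [← abs_ne_zero, this]
    exact (weylJ_pos hm ha (x := (0, p.1, p.2)) hp.1).ne'
  have h : HasStrictFDerivAt (weylMap m a)
      (((weylD m a p).toContinuousLinearEquivOfDetNeZero hdet : (ℝ × ℝ) ≃L[ℝ] (ℝ × ℝ)) : (ℝ × ℝ) →L[ℝ] (ℝ × ℝ)) p := by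
    have := hasStrictFDerivAt_weylMap hm ha hp
    exact this
  exact h.map_nhds_eq_of_equiv

/-- A function on the orbit space in Weyl coordinates, extended by zero. -/
def pushW (m a : ℝ) (f : ℝ × ℝ → ℝ) : ℝ × ℝ → ℝ :=
  (weylMap m a '' orbit m a).indicator fun y => f (Function.invFunOn (weylMap m a) (orbit m a) y)

lemma pushW_weylMap (f : ℝ × ℝ → ℝ) {p : ℝ × ℝ} (hp : p ∈ orbit m a) :
    pushW m a f (weylMap m a p) = f p := by
  rw [pushW, indicator_of_mem (mem_image_of_mem _ hp), (injOn_weylMap hm ha).leftInvOn_invFunOn hp]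

lemma continuousAt_pushW {f : ℝ × ℝ → ℝ} (hf : ContinuousOn f (orbit m a)) {p : ℝ × ℝ}
    (hp : p ∈ orbit m a) : ContinuousAt (pushW m a f) (weylMap m a p) := by
  have ho := (isOpen_orbit m a).mem_nhds hp
  rw [ContinuousAt, ← map_nhds_weylMap hm ha hp, tendsto_map'_iff, pushW_weylMap hm ha f hp]
  refine (hf.continuousAt ho).congr' ?_
  filter_upwards [ho] with q hq using (pushW_weylMap hm ha f hq).symm

lemma pushW_mirror (f : ℝ × ℝ → ℝ) {y : ℝ × ℝ} (hy : y.1 ≤ 0) : pushW m a f y = 0 := by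
  refine indicator_of_notMem ?_ _
  rintro ⟨p, hp, rfl⟩
  have h1 := Real.sqrt_pos.2 (rPlus_lt m a p.1 hm ha hp.1).2
  have := mul_pos h1 (sin_pos_of_mem_orbit hp)
  exact absurd hy (not_le.2 this)

lemma continuousAt_pushW_mirror (f : ℝ × ℝ → ℝ) {y : ℝ × ℝ} (hy : y.1 < 0) :
    ContinuousAt (pushW m a f) y := by
  have : pushW m a f =ᶠ[𝓝 y] fun _ => 0 := by
    filter_upwards [(isOpen_lt continuous_fst continuous_const).mem_nhds hy] with z hz using
      pushW_mirror hm ha f (le_of_lt hz)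
  exact (continuousAt_const).congr this.symm

end

/-! ### The representation formula -/

/-- `∂_b (μ̄_q q^{bc} ∂_c l)` for a potential `l`. -/
def sourceP (m a : ℝ) (p₁ p₂ : ℝ × ℝ × ℝ → ℝ) (x : ℝ × ℝ × ℝ) : ℝ :=
  dR (sqrtD m a) x * (Real.sin x.2.2 * p₁ x) + sqrtD m a x * (Real.sin x.2.2 * dR p₁ x) +
    (Real.cos x.2.2 * p₂ x + Real.sin x.2.2 * dA p₂ x) / sqrtD m a x

section
variable {m a : ℝ} (hm : 0 < m) (ha : |a| ≤ m) {p₁ p₂ w l : ℝ × ℝ × ℝ → ℝ}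

lemma deriv_vanish {f : ℝ × ℝ × ℝ → ℝ} (hf : Smooth m a f) {t R₀ R₁ : ℝ}
    (hv : ∀ p ∈ orbit m a, p.1 < R₀ ∨ R₁ < p.1 → f (t, p.1, p.2) = 0) :
    ∀ p ∈ orbit m a, p.1 < R₀ ∨ R₁ < p.1 → dR f (t, p.1, p.2) = 0 ∧ dA f (t, p.1, p.2) = 0 := by
  intro p hp hr
  constructor
  · refine (hf.hasDerivAt_dR t hp.1 p.2).unique ((hasDerivAt_const p.1 (0 : ℝ)).congr_of_eventuallyEq ?_)
    have ho : IsOpen {r : ℝ | r < R₀ ∨ R₁ < r} := isOpen_Iio.union isOpen_Ioi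
    filter_upwards [ho.mem_nhds hr, lt_mem_nhds (show rPlus m a < p.1 from hp.1)] with r hr hr'
      using hv (r, p.2) ⟨hr', hp.2⟩ hr
  · refine (hf.hasDerivAt_dA t hp.1 p.2).unique ((hasDerivAt_const p.2 (0 : ℝ)).congr_of_eventuallyEq ?_)
    filter_upwards [isOpen_Ioo.mem_nhds hp.2] with θ hθ using hv (p.1, θ) ⟨hp.1, hθ⟩ hr

include hm ha

lemma continuousOn_sourceP (h1 : Smooth m a p₁) (h2 : Smooth m a p₂) :
    ContinuousOn (sourceP m a p₁ p₂) (domain m a) := by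
  have k1 := h1.continuousOn
  have k2 := h2.continuousOn
  have k3 := h1.dR.continuousOn
  have k4 := h2.dA.continuousOn
  have k5 := (smooth_sqrtD hm ha).continuousOn
  have k6 := (smooth_sqrtD hm ha).dR.continuousOn
  unfold sourceP
  exact ContinuousOn.add (by fun_prop)
    (ContinuousOn.div (by fun_prop) k5 fun x hx => (sqrtD_pos hm ha hx).ne')

/-- Green's second identity for a potential and a function of the Weyl coordinates. -/
lemma integral_pullW_mul_sourceP (hl : IsPotential m a p₁ p₂ w l) (h1 : Smooth m a p₁)
    (h2 : Smooth m a p₂) {t R₀ R₁ : ℝ} (h0 : rPlus m a < R₀)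
    (hv : ∀ p ∈ orbit m a, p.1 < R₀ ∨ R₁ < p.1 → p₁ (t, p.1, p.2) = 0 ∧ p₂ (t, p.1, p.2) = 0)
    {g : ℝ × ℝ → ℝ} (hg : ContDiff ℝ ∞ g) :
    ∫ p in orbit m a, g (weylMap m a p) * sourceP m a p₁ p₂ (t, p.1, p.2) =
      ∫ p in orbit m a, weylJ m a (t, p.1, p.2) * (l (t, p.1, p.2) *
        (fderiv ℝ (fun y => fderiv ℝ g y (1, 0)) (weylMap m a p) (1, 0) +
        fderiv ℝ (fun y => fderiv ℝ g y (0, 1)) (weylMap m a p) (0, 1))) := by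
  set G := pullW m a g with hG
  have sG : Smooth m a G := smooth_pullW hm ha hg
  have sw := smooth_sqrtD hm ha
  have hne : ∀ x ∈ domain m a, sqrtD m a x ≠ 0 := fun x hx => (sqrtD_pos hm ha hx).ne'
  have cl := hl.cont
  have k1 := h1.continuousOn
  have k2 := h2.continuousOn
  have k3 := h1.dR.continuousOn
  have k4 := h2.dA.continuousOn
  have k5 := sw.continuousOn
  have k6 := sw.dR.continuousOn
  have k7 := sG.continuousOn
  have k8 := sG.dR.continuousOn
  have k9 := sG.dA.continuousOn
  have k10 := sG.dR.dR.continuousOn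
  have k11 := sG.dA.dA.continuousOn
  have v1 := deriv_vanish h1 fun p hp hr => (hv p hp hr).1
  have v2 := deriv_vanish h2 fun p hp hr => (hv p hp hr).2
  have vl : ∀ p ∈ orbit m a, p.1 < R₀ ∨ R₁ < p.1 → l (t, p.1, p.2) = 0 := fun p hp hr =>
    hl.vanish t p.1 hp.1 (fun θ hθ => (hv (p.1, θ) ⟨hp.1, hθ⟩ hr).2) p.2 ⟨hp.2.1.le, hp.2.2.le⟩
  -- A and B are the components of μ̄_q q^{-1}(G ∇l − l ∇G), where μ̄_q q^{-1} = diag(√Δ, 1/√Δ); A'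
  -- and B' are their derivatives along r and θ respectively.
  set A := fun x : ℝ × ℝ × ℝ => sqrtD m a x * (G x * (Real.sin x.2.2 * p₁ x) - l x * dR G x) with hA
  set A' := fun x : ℝ × ℝ × ℝ => dR (sqrtD m a) x * (G x * (Real.sin x.2.2 * p₁ x) - l x * dR G x) +
    sqrtD m a x * (dR G x * (Real.sin x.2.2 * p₁ x) + G x * (Real.sin x.2.2 * dR p₁ x) -
      (Real.sin x.2.2 * p₁ x * dR G x + l x * dR (dR G) x)) with hA'
  set B := fun x : ℝ × ℝ × ℝ => (G x * (Real.sin x.2.2 * p₂ x) - l x * dA G x) / sqrtD m a x with hB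
  set B' := fun x : ℝ × ℝ × ℝ => (dA G x * (Real.sin x.2.2 * p₂ x) +
      G x * (Real.cos x.2.2 * p₂ x + Real.sin x.2.2 * dA p₂ x) -
      (Real.sin x.2.2 * p₂ x * dA G x + l x * dA (dA G) x)) / sqrtD m a x with hB'
  have hdiv := integral_slice_divergence (m := m) (a := a) (t := t) (r₁ := R₁) h0
    (A := A) (A' := A') (B := B) (B' := B')
    (fun p hp => (sw.hasDerivAt_dR t hp.1 p.2).mul
      (((sG.hasDerivAt_dR t hp.1 p.2).mul ((h1.hasDerivAt_dR t hp.1 p.2).const_mul (Real.sin p.2))).sub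
      ((hl.dR t p.1 p.2 hp.1 ⟨hp.2.1.le, hp.2.2.le⟩).mul (sG.dR.hasDerivAt_dR t hp.1 p.2))))
    (fun p hp => (((sG.hasDerivAt_dA t hp.1 p.2).mul
      ((Real.hasDerivAt_sin p.2).mul (h2.hasDerivAt_dA t hp.1 p.2))).sub
      ((hl.dA t p.1 p.2 hp.1).mul (sG.dA.hasDerivAt_dA t hp.1 p.2))).div_const (sqrtD m a (t, p.1, p.2)))
    (by simp only [hA']; fun_prop)
    (ContinuousOn.div (by fun_prop) k5 hne)
    (ContinuousOn.div (by fun_prop) k5 hne)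
    (fun p hp hr => by
      simp [hA, hA', hB', hv p hp hr, vl p hp hr, v1 p hp hr, v2 p hp hr])
    (fun r hr => by simp [hB, hl.zero t r hr, hl.pi t r hr])
  have cS := continuousOn_sourceP hm ha h1 h2
  have cL : ContinuousOn (fun x => weylJ m a x * (l x * pullW m a (fun y =>
      fderiv ℝ (fun y => fderiv ℝ g y (1, 0)) y (1, 0) +
      fderiv ℝ (fun y => fderiv ℝ g y (0, 1)) y (0, 1)) x)) (domain m a) := by
    refine (continuousOn_weylJ hm ha).mul (cl.mul (smooth_pullW hm ha ?_).continuousOn)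
    exact (contDiff_fderiv_const (contDiff_fderiv_const hg _) _).add
      (contDiff_fderiv_const (contDiff_fderiv_const hg _) _)
  have i1 : IntegrableOn (fun p : ℝ × ℝ => g (weylMap m a p) * sourceP m a p₁ p₂ (t, p.1, p.2)) (orbit m a) :=
    integrableOn_slice (f := fun x => G x * sourceP m a p₁ p₂ x) (k7.mul cS) h0 (r₁ := R₁)
      fun p hp hr => by simp [sourceP, hv p hp hr, v1 p hp hr, v2 p hp hr]
  have i2 := integrableOn_slice cL (t := t) h0 (r₁ := R₁) fun p hp hr => by simp [vl p hp hr]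
  refine sub_eq_zero.1 ((integral_sub i1 i2).symm.trans (Eq.trans ?_ hdiv))
  refine setIntegral_congr_fun (measurableSet_orbit m a) fun p hp => ?_
  have hx : (t, p.1, p.2) ∈ domain m a := hp.1
  have lap := laplacian_pullW hm ha hg hx
  rw [← hG] at lap
  have e : G (t, p.1, p.2) = g (weylMap m a p) := rfl
  simp only [hA', hB', sourceP, ← e]
  -- In A' + B' the products of first derivatives cancel, leaving G times the source of l minus l
  -- times the Laplacian of G, which `laplacian_pullW` turns into the flat one.
  linear_combination l (t, p.1, p.2) * lap

variable (hl : IsPotential m a p₁ p₂ w l) (h1 : Smooth m a p₁)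
    (h2 : Smooth m a p₂) {t R₀ R₁ : ℝ} (h0 : rPlus m a < R₀)
    (hv : ∀ p ∈ orbit m a, p.1 < R₀ ∨ R₁ < p.1 → p₁ (t, p.1, p.2) = 0 ∧ p₂ (t, p.1, p.2) = 0)
include h1 h2 h0 hv

/-- In Weyl coordinates the integrand is the flat logarithm times source divided by Jacobian. That
quotient is bounded, because the source vanishes near the horizon and at large radii, and the image
of the bounded part of the orbit space lies in a box, where the logarithm is integrable. -/
lemma integrableOn_log_mul_sourceP (x : ℝ × ℝ) : IntegrableOn (fun p : ℝ × ℝ =>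
    Real.log (((weylMap m a p).1 - x.1) ^ 2 + ((weylMap m a p).2 - x.2) ^ 2) *
      sourceP m a p₁ p₂ (t, p.1, p.2)) (orbit m a) := by
  have cS := continuousOn_sourceP hm ha h1 h2
  have v1 := deriv_vanish h1 fun p hp hr => (hv p hp hr).1
  have v2 := deriv_vanish h2 fun p hp hr => (hv p hp hr).2
  have vS : ∀ p ∈ orbit m a, p.1 < R₀ ∨ R₁ < p.1 → sourceP m a p₁ p₂ (t, p.1, p.2) = 0 :=
    fun p hp hr => by simp [sourceP, hv p hp hr, v1 p hp hr, v2 p hp hr]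
  have cQ : ContinuousOn (fun x : ℝ × ℝ × ℝ => sourceP m a p₁ p₂ (t, x.2) / weylJ m a x) (domain m a) := by
    refine ContinuousOn.div (cS.comp (by fun_prop) fun x hx => hx) (continuousOn_weylJ hm ha)
      fun x hx => (weylJ_pos hm ha hx).ne'
  obtain ⟨C, hC⟩ := exists_bound_slice cQ (T := 0) h0 (r₁ := R₁) fun _ _ p hp hr => by
    simp only [vS p hp hr, zero_div]
  set s := orbit m a ∩ {p | p.1 ≤ R₁} with hs
  have hsm : MeasurableSet s := (measurableSet_orbit m a).inter (measurableSet_le measurable_fst measurable_const)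
  have hso : s ⊆ orbit m a := inter_subset_left
  have hbdd : ∃ R, weylMap m a '' s ⊆ Icc (x.1 - R) (x.1 + R) ×ˢ Icc (x.2 - R) (x.2 + R) := by
    have hk : IsCompact (weylMap m a '' (Icc (rPlus m a) R₁ ×ˢ Icc 0 Real.pi)) :=
      (isCompact_Icc.prod isCompact_Icc).image (continuous_weylMap m a)
    obtain ⟨R, hR⟩ := hk.isBounded.subset_closedBall x
    refine ⟨R, ?_⟩
    rw [← Prod.mk.eta (p := x), ← closedBall_prod_same, Real.closedBall_eq_Icc, Real.closedBall_eq_Icc] at hR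
    refine Subset.trans (image_mono ?_) hR
    exact fun p hp => ⟨⟨le_of_lt hp.1.1, hp.2⟩, ⟨hp.1.2.1.le, hp.1.2.2.le⟩⟩
  obtain ⟨R, hR⟩ := hbdd
  have j1 := ((integrableOn_image_weylMap hm ha hsm hso 0 _).1
    ((integrableOn_log_box x R).mono_set hR)).mul_bdd (c := C)
    (((continuousOn_slice cQ 0).mono hso).aestronglyMeasurable hsm) (by
      filter_upwards [ae_restrict_mem hsm] with p hp using hC 0 (by simp) p (hso hp))
  have j2 : IntegrableOn (fun p : ℝ × ℝ =>
      Real.log (((weylMap m a p).1 - x.1) ^ 2 + ((weylMap m a p).2 - x.2) ^ 2) *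
      sourceP m a p₁ p₂ (t, p.1, p.2)) s := by
    refine (integrableOn_congr_fun (fun p hp => ?_) hsm).1 j1
    have := (weylJ_pos hm ha (x := (0, p.1, p.2)) (hso hp).1).ne'
    field_simp
  refine j2.of_forall_sdiff_eq_zero (measurableSet_orbit m a) fun p hp => ?_
  have hr : R₁ < p.1 := not_le.1 fun h => hp.2 ⟨hp.1, h⟩
  rw [vS p hp.1 (Or.inr hr), mul_zero]

include hl

/-- The regularized logarithm is smooth, so Green's identity moves the Laplacian onto it and
produces an approximate identity acting on l in Weyl coordinates. The pole x is any point of the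
plane at which the extension of l by zero is continuous, so both the evaluation point and its mirror
image are covered. -/
lemma integral_log_mul_sourceP {x : ℝ × ℝ}
    (hx : ContinuousAt (pushW m a fun p => l (t, p.1, p.2)) x) : ∫ p in orbit m a,
    Real.log (((weylMap m a p).1 - x.1) ^ 2 + ((weylMap m a p).2 - x.2) ^ 2) *
      sourceP m a p₁ p₂ (t, p.1, p.2) = 4 * Real.pi * pushW m a (fun p => l (t, p.1, p.2)) x := by
  have cS := continuousOn_sourceP hm ha h1 h2
  have v1 := deriv_vanish h1 fun p hp hr => (hv p hp hr).1
  have v2 := deriv_vanish h2 fun p hp hr => (hv p hp hr).2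
  have vS : ∀ p ∈ orbit m a, p.1 < R₀ ∨ R₁ < p.1 → sourceP m a p₁ p₂ (t, p.1, p.2) = 0 :=
    fun p hp hr => by simp [sourceP, hv p hp hr, v1 p hp hr, v2 p hp hr]
  have vl : ∀ p ∈ orbit m a, p.1 < R₀ ∨ R₁ < p.1 → l (t, p.1, p.2) = 0 := fun p hp hr =>
    hl.vanish t p.1 hp.1 (fun θ hθ => (hv (p.1, θ) ⟨hp.1, hθ⟩ hr).2) p.2 ⟨hp.2.1.le, hp.2.2.le⟩
  have sL : ContDiff ℝ ∞ fun y : ℝ × ℝ => Real.log (((y.1 - x.1) ^ 2 + (y.2 - x.2) ^ 2) + 1) :=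
    ContDiff.log (by fun_prop) fun y => by positivity
  have cweyl : ContinuousOn (fun p => ((weylMap m a p).1 - x.1) ^ 2 + ((weylMap m a p).2 - x.2) ^ 2)
      (orbit m a) := by
    have := continuous_weylMap m a
    exact (((this.fst.sub continuous_const).pow 2).add ((this.snd.sub continuous_const).pow 2)).continuousOn
  have t1 := tendsto_integral_log_add (μ := volume.restrict (orbit m a))
    (D := fun p => ((weylMap m a p).1 - x.1) ^ 2 + ((weylMap m a p).2 - x.2) ^ 2)
    (S := fun p => sourceP m a p₁ p₂ (t, p.1, p.2)) ?_
    (cweyl.aestronglyMeasurable (measurableSet_orbit m a))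
    ((continuousOn_slice cS t).aestronglyMeasurable (measurableSet_orbit m a))
    (integrableOn_log_mul_sourceP hm ha h1 h2 h0 hv x)
    (integrableOn_slice (f := fun z => pullW m a (fun y : ℝ × ℝ =>
        Real.log (((y.1 - x.1) ^ 2 + (y.2 - x.2) ^ 2) + 1)) z * sourceP m a p₁ p₂ z)
      ((smooth_pullW hm ha sL).continuousOn.mul cS) h0 (r₁ := R₁)
      fun p hp hr => by rw [vS p hp hr, mul_zero])
  · have hpush : Integrable (pushW m a fun p => l (t, p.1, p.2)) := by
      refine (IntegrableOn.integrable_indicator ?_ (measurableSet_image_weylMap hm ha))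
      rw [integrableOn_image_weylMap hm ha (measurableSet_orbit m a) Subset.rfl t]
      refine (integrableOn_congr_fun (fun p hp => ?_) (measurableSet_orbit m a)).1
        (integrableOn_slice (f := fun z => weylJ m a z * l z) (t := t)
          ((continuousOn_weylJ hm ha).mul hl.cont) h0 (r₁ := R₁)
          fun p hp hr => by rw [vl p hp hr, mul_zero])
      simp only [(injOn_weylMap hm ha).leftInvOn_invFunOn hp]
    have t2 := tendsto_integral_peak hpush hx
    refine tendsto_nhds_unique (t1.congr' ?_) t2
    filter_upwards [eventually_gt_atTop 0] with c hc
    have e1 := integral_pullW_mul_sourceP hm ha hl h1 h2 h0 hv (contDiff_logReg hc x)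
    refine e1.trans ?_
    have e2 := integral_image_weylMap hm ha (measurableSet_orbit m a) Subset.rfl t
      (fun y => 4 * c ^ 2 / (c ^ 2 * ((y.1 - x.1) ^ 2 + (y.2 - x.2) ^ 2) + 1) ^ 2 *
        pushW m a (fun p => l (t, p.1, p.2)) y)
    -- The extension by zero vanishes off the image of the orbit space, so the integral over the
    -- plane is one over that image. Surjectivity of the Weyl map onto the half-plane does not
    -- enter.
    rw [setIntegral_eq_integral_of_forall_compl_eq_zero] at e2
    · rw [e2]
      refine setIntegral_congr_fun (measurableSet_orbit m a) fun p hp => ?_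
      simp only [laplacian_logReg hc, pushW_weylMap hm ha _ hp]
      ring
    · intro y hy
      rw [pushW, indicator_of_notMem hy, mul_zero]
  -- By injectivity at most one orbit lies over the pole, so the squared distance is positive almost
  -- everywhere.
  · have hsub : (orbit m a ∩ {p | weylMap m a p = x}).Subsingleton := fun p hp q hq =>
      injOn_weylMap hm ha hp.1 hq.1 (hp.2.trans hq.2.symm)
    have hnull : volume (orbit m a ∩ {p | weylMap m a p = x}) = 0 := hsub.measure_zero volume
    filter_upwards [ae_restrict_mem (measurableSet_orbit m a),
      ae_restrict_of_ae (compl_mem_ae_iff.2 hnull)] with p hp hp'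
    have hne : weylMap m a p ≠ x := fun h => hp' ⟨hp, h⟩
    rcases ne_or_eq (weylMap m a p).1 x.1 with h | h
    · have : (weylMap m a p).1 - x.1 ≠ 0 := sub_ne_zero.2 h
      positivity
    · have : (weylMap m a p).2 - x.2 ≠ 0 := sub_ne_zero.2 fun h2 => hne (Prod.ext h h2)
      positivity

/-- The potential is the convolution of its source with the Green's function. -/
theorem conv_eq {S : ℝ → ℝ → ℝ} (hS : ∀ p ∈ orbit m a, S p.1 p.2 = sourceP m a p₁ p₂ (t, p.1, p.2))
    {x : ℝ × ℝ} (hx : x ∈ orbit m a) :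
    IntegrableOn (convIntegrand m a S x.1 x.2) (orbit m a) ∧ conv m a S x.1 x.2 = l (t, x.1, x.2) := by
  set y := weylMap m a x with hy
  have hy0 : 0 < y.1 := mul_pos (Real.sqrt_pos.2 (rPlus_lt m a x.1 hm ha hx.1).2) (sin_pos_of_mem_orbit hx)
  have i1 := integrableOn_log_mul_sourceP hm ha h1 h2 h0 hv y
  have i2 := integrableOn_log_mul_sourceP hm ha h1 h2 h0 hv (-y.1, y.2)
  have e1 := integral_log_mul_sourceP hm ha hl h1 h2 h0 hv (x := y)
    (continuousAt_pushW hm ha (continuousOn_slice hl.cont t) hx)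
  -- The mirror pole has ρ̄ < 0, where the extension of l is zero, so the reflected logarithm
  -- integrates to zero against the source.
  have e2 := integral_log_mul_sourceP hm ha hl h1 h2 h0 hv (x := (-y.1, y.2))
    (continuousAt_pushW_mirror hm ha _ (by simpa using hy0))
  rw [pushW_weylMap hm ha _ hx] at e1
  rw [pushW_mirror hm ha _ (by simpa using hy0.le), mul_zero] at e2
  have hc : ∀ p ∈ orbit m a, convIntegrand m a S x.1 x.2 p = 1 / (4 * Real.pi) *
      (Real.log (((weylMap m a p).1 - y.1) ^ 2 + ((weylMap m a p).2 - y.2) ^ 2) *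
      sourceP m a p₁ p₂ (t, p.1, p.2) -
      Real.log (((weylMap m a p).1 - -y.1) ^ 2 + ((weylMap m a p).2 - y.2) ^ 2) *
      sourceP m a p₁ p₂ (t, p.1, p.2)) := by
    intro p hp
    rw [convIntegrand, green_eq, hS p hp]
    simp only [hy, weylMap]
    ring
  constructor
  · exact (integrableOn_congr_fun hc (measurableSet_orbit m a)).2 ((i1.sub i2).const_mul _)
  · rw [conv, setIntegral_congr_fun (measurableSet_orbit m a) hc, integral_const_mul,
      integral_sub i1 i2, e1, e2]
    have := Real.pi_pos
    field_simp
    ring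

end

/-- The divergence of a planar field given by reduced fields. -/
lemma divq_eq {m a : ℝ} (hm : 0 < m) (ha : |a| ≤ m) {p₁ p₂ : ℝ × ℝ × ℝ → ℝ} (h1 : Smooth m a p₁)
    (h2 : Smooth m a p₂) {t : ℝ} {W : Fin 2 → ℝ → ℝ → ℝ}
    (hW : ∀ p ∈ orbit m a, ∀ b, W b p.1 p.2 =
      (![Real.sin p.2 * p₁ (t, p.1, p.2), Real.sin p.2 * p₂ (t, p.1, p.2)] : Fin 2 → ℝ) b)
    {p : ℝ × ℝ} (hp : p ∈ orbit m a) : divq m a W p.1 p.2 = sourceP m a p₁ p₂ (t, p.1, p.2) := by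
  have hx : (t, p.1, p.2) ∈ domain m a := hp.1
  have hs := sin_pos_of_mem_orbit hp
  have hin : ∀ q ∈ orbit m a, ∀ b, ∑ c, muqInv m a q.1 q.2 b c * W c q.1 q.2 =
      (![sqrtD m a (t, q.1, q.2) * (Real.sin q.2 * p₁ (t, q.1, q.2)),
        Real.sin q.2 * p₂ (t, q.1, q.2) / sqrtD m a (t, q.1, q.2)] : Fin 2 → ℝ) b := by
    intro q hq b
    simp only [Fin.sum_univ_two, muqInv_eq hm ha hq.1 (sin_pos_of_mem_orbit hq), hW q hq]
    fin_cases b <;> simp [sqrtD]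
    ring
  rw [divq, Fin.sum_univ_two]
  have d1 : pd (fun r' θ' => ∑ c, muqInv m a r' θ' 0 c * W c r' θ') 0 p.1 p.2 =
      dR (sqrtD m a) (t, p.1, p.2) * (Real.sin p.2 * p₁ (t, p.1, p.2)) +
      sqrtD m a (t, p.1, p.2) * (Real.sin p.2 * dR p₁ (t, p.1, p.2)) := by
    have k := ((smooth_sqrtD hm ha).hasDerivAt_dR t hp.1 p.2).mul
      ((h1.hasDerivAt_dR t hp.1 p.2).const_mul (Real.sin p.2))
    refine Eq.trans ?_ k.deriv
    simp only [pd, Matrix.cons_val_zero]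
    refine Filter.EventuallyEq.deriv_eq ?_
    filter_upwards [lt_mem_nhds (show rPlus m a < p.1 from hp.1)] with r hr
    exact hin (r, p.2) ⟨hr, hp.2⟩ 0
  have d2 : pd (fun r' θ' => ∑ c, muqInv m a r' θ' 1 c * W c r' θ') 1 p.1 p.2 =
      (Real.cos p.2 * p₂ (t, p.1, p.2) + Real.sin p.2 * dA p₂ (t, p.1, p.2)) /
        sqrtD m a (t, p.1, p.2) := by
    have k := ((Real.hasDerivAt_sin p.2).mul (h2.hasDerivAt_dA t hp.1 p.2)).div_const
      (sqrtD m a (t, p.1, p.2))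
    refine Eq.trans ?_ k.deriv
    simp only [pd, Matrix.cons_val_one]
    refine Filter.EventuallyEq.deriv_eq ?_
    filter_upwards [isOpen_Ioo.mem_nhds hp.2] with θ hθ
    exact hin (p.1, θ) ⟨hp.1, hθ⟩ 1
  rw [d1, d2]
  rfl

/-! ### The background fields of the energy density -/

lemma Smooth.dR_dA_comm {m a : ℝ} {f : ℝ × ℝ × ℝ → ℝ} (hf : Smooth m a f) {x : ℝ × ℝ × ℝ}
    (hx : x ∈ domain m a) : KerrMaxwell.dR (KerrMaxwell.dA f) x = KerrMaxwell.dA (KerrMaxwell.dR f) x := by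
  have hn := (isOpen_domain m a).mem_nhds hx
  have hs : IsSymmSndFDerivAt ℝ f x := (hf.contDiffAt hn).isSymmSndFDerivAt (by
    simp only [minSmoothness_of_isRCLikeNormedField]; exact ENat.LEInfty.out)
  have hd : DifferentiableAt ℝ (fderiv ℝ f) x :=
    ((hf.fderiv_of_isOpen (isOpen_domain m a) (m := ∞) (by simp)).differentiableOn
      (by simp)).differentiableAt hn
  have e : ∀ v w : ℝ × ℝ × ℝ, fderiv ℝ (fun y => fderiv ℝ f y v) x w = fderiv ℝ (fderiv ℝ f) x w v := by
    intro v w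
    rw [(hd.hasFDerivAt.clm_apply (hasFDerivAt_const v x)).fderiv]
    simp
  exact (e _ _).trans ((hs _ _).trans (e _ _).symm)

section
variable {m a r θ : ℝ} (hm : 0 < m) (ha : |a| ≤ m) (hr : rPlus m a < r)

lemma hasDerivAt_sigma_r : HasDerivAt (fun r => sigma a r θ) (2 * r) r := by
  have := (hasDerivAt_pow 2 r).add_const (a ^ 2 * Real.cos θ ^ 2)
  simpa [sigma] using this

lemma hasDerivAt_sigma_θ :
    HasDerivAt (fun θ => sigma a r θ) (-(2 * a ^ 2 * Real.cos θ * Real.sin θ)) θ := by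
  have := (((Real.hasDerivAt_cos θ).pow 2).const_mul (a ^ 2)).const_add (r ^ 2)
  refine this.congr_deriv ?_
  push_cast; ring

/-- `∂_r` of `xi`. -/
def xiR (m a r θ : ℝ) : ℝ := 4 * r * (r ^ 2 + a ^ 2) - a ^ 2 * (2 * r - 2 * m) * Real.sin θ ^ 2

lemma hasDerivAt_xi_r : HasDerivAt (fun r => xi m a r θ) (xiR m a r θ) r := by
  have := (((hasDerivAt_pow 2 r).add_const (a ^ 2)).pow 2).sub
    (((hasDerivAt_delta m a r).const_mul (a ^ 2)).mul_const (Real.sin θ ^ 2))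
  refine this.congr_deriv ?_
  unfold xiR
  push_cast; ring

lemma hasDerivAt_xi_θ :
    HasDerivAt (fun θ => xi m a r θ) (-(2 * a ^ 2 * delta m a r * Real.cos θ * Real.sin θ)) θ := by
  have := (((Real.hasDerivAt_sin θ).pow 2).const_mul (a ^ 2 * delta m a r)).const_sub
    ((r ^ 2 + a ^ 2) ^ 2)
  refine this.congr_deriv ?_
  push_cast; ring

lemma hasDerivAt_xiR : HasDerivAt (fun r => xiR m a r θ)
    (12 * r ^ 2 + 4 * a ^ 2 - 2 * a ^ 2 * Real.sin θ ^ 2) r := by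
  have := (((hasDerivAt_id r).const_mul 4).mul ((hasDerivAt_pow 2 r).add_const (a ^ 2))).sub
    (((((hasDerivAt_id r).const_mul 2).sub_const (2 * m)).const_mul (a ^ 2)).mul_const (Real.sin θ ^ 2))
  refine this.congr_deriv ?_
  simp only [id]; push_cast; ring

include hr in
lemma dR_bgD (t θ : ℝ) : dR (bgD m a) (t, r, θ) = 2 * r - 2 * m :=
  (((smooth_bgD m a).hasDerivAt_dR t hr θ).unique (hasDerivAt_delta m a r)).trans (by ring)

include hm ha hr

lemma dR_bgY (t θ : ℝ) : dR (bgY m a) (t, r, θ) =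
    (2 * r * xi m a r θ - sigma a r θ * xiR m a r θ) / xi m a r θ ^ 2 :=
  ((smooth_bgY hm ha).hasDerivAt_dR t hr θ).unique
    (hasDerivAt_sigma_r.div hasDerivAt_xi_r (xi_pos hm (rPlus_lt m a r hm ha hr).1 θ).ne')

lemma dA_bgY (t θ : ℝ) : dA (bgY m a) (t, r, θ) =
    (-(2 * a ^ 2 * Real.cos θ * Real.sin θ) * xi m a r θ +
      sigma a r θ * (2 * a ^ 2 * delta m a r * Real.cos θ * Real.sin θ)) / xi m a r θ ^ 2 := by
  have := ((smooth_bgY hm ha).hasDerivAt_dA t hr θ).unique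
    (hasDerivAt_sigma_θ.div hasDerivAt_xi_θ (xi_pos hm (rPlus_lt m a r hm ha hr).1 θ).ne')
  rw [this]; ring

lemma dR_bgA (t θ : ℝ) : dR (bgA m a) (t, r, θ) =
    (-(2 * a * m) * xi m a r θ + 2 * a * m * r * xiR m a r θ) / xi m a r θ ^ 2 := by
  have := ((smooth_bgA hm ha).hasDerivAt_dR t hr θ).unique
    ((((hasDerivAt_id r).const_mul (2 * a * m)).neg).div hasDerivAt_xi_r
      (xi_pos hm (rPlus_lt m a r hm ha hr).1 θ).ne')
  rw [this]; simp only [id, Pi.neg_apply]; ring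

lemma dA_bgA (t θ : ℝ) : dA (bgA m a) (t, r, θ) =
    -(2 * a * m * r * (2 * a ^ 2 * delta m a r * Real.cos θ * Real.sin θ)) / xi m a r θ ^ 2 := by
  have := ((smooth_bgA hm ha).hasDerivAt_dA t hr θ).unique
    ((hasDerivAt_const θ (-(2 * a * m * r))).div hasDerivAt_xi_θ
      (xi_pos hm (rPlus_lt m a r hm ha hr).1 θ).ne')
  rw [this]; ring

lemma dR_dR_bgY (t θ : ℝ) : dR (dR (bgY m a)) (t, r, θ) =
    ((2 * xi m a r θ - sigma a r θ * (12 * r ^ 2 + 4 * a ^ 2 - 2 * a ^ 2 * Real.sin θ ^ 2)) *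
      xi m a r θ - (2 * r * xi m a r θ - sigma a r θ * xiR m a r θ) * (2 * xiR m a r θ)) /
      xi m a r θ ^ 3 := by
  have hX := xi_pos (a := a) hm (rPlus_lt m a r hm ha hr).1 θ
  have k := ((((hasDerivAt_id r).const_mul 2).mul (hasDerivAt_xi_r (m := m) (a := a) (θ := θ))).sub
    ((hasDerivAt_sigma_r (a := a) (θ := θ)).mul (hasDerivAt_xiR (m := m) (a := a) (θ := θ)))).div
      (hasDerivAt_xi_r.pow 2) (pow_ne_zero 2 hX.ne')
  have := ((smooth_bgY hm ha).dR.hasDerivAt_dR t hr θ).unique (k.congr_of_eventuallyEq (by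
    filter_upwards [lt_mem_nhds hr] with x hx
    exact dR_bgY hm ha hx t θ))
  rw [this]
  simp only [id, Pi.mul_apply, Pi.sub_apply, Pi.pow_apply]
  field_simp
  push_cast; ring

lemma dA_dA_bgY (t θ : ℝ) : dA (dA (bgY m a)) (t, r, θ) =
    ((2 * a ^ 2 * (Real.sin θ ^ 2 - Real.cos θ ^ 2) * (xi m a r θ - delta m a r * sigma a r θ)) *
      xi m a r θ + (-(2 * a ^ 2 * Real.cos θ * Real.sin θ) * xi m a r θ +
      sigma a r θ * (2 * a ^ 2 * delta m a r * Real.cos θ * Real.sin θ)) *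
      (4 * a ^ 2 * delta m a r * Real.cos θ * Real.sin θ)) / xi m a r θ ^ 3 := by
  have hX := xi_pos (a := a) hm (rPlus_lt m a r hm ha hr).1 θ
  have k := ((((((Real.hasDerivAt_cos θ).const_mul (2 * a ^ 2)).mul (Real.hasDerivAt_sin θ)).neg).mul
    (hasDerivAt_xi_θ (m := m) (a := a) (r := r))).add ((hasDerivAt_sigma_θ (a := a) (r := r)).mul
    (((Real.hasDerivAt_cos θ).const_mul (2 * a ^ 2 * delta m a r)).mul (Real.hasDerivAt_sin θ)))).div
      (hasDerivAt_xi_θ.pow 2) (pow_ne_zero 2 hX.ne')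
  have := ((smooth_bgY hm ha).dA.hasDerivAt_dA t hr θ).unique (k.congr_of_eventuallyEq (by
    filter_upwards with x
    exact dA_bgY hm ha hr t x))
  rw [this]
  simp only [Pi.mul_apply, Pi.add_apply, Pi.pow_apply, Pi.neg_apply]
  field_simp
  push_cast; ring

/-- The equation of the norm of the axial Killing field. -/
lemma killing_norm_eq (t : ℝ) (hθ : 0 < Real.sin θ) :
    bgY m a (t, r, θ) * (dR (bgD m a) (t, r, θ) * dR (bgY m a) (t, r, θ) +
      bgD m a (t, r, θ) * dR (dR (bgY m a)) (t, r, θ) + dA (dA (bgY m a)) (t, r, θ) +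
      dA (bgY m a) (t, r, θ) * Real.cos θ / Real.sin θ + 2 * bgY m a (t, r, θ)) =
    bgD m a (t, r, θ) * dR (bgY m a) (t, r, θ) ^ 2 + dA (bgY m a) (t, r, θ) ^ 2 +
      Real.sin θ ^ 2 * (dA (bgA m a) (t, r, θ) ^ 2 / bgD m a (t, r, θ) +
        dR (bgA m a) (t, r, θ) ^ 2) := by
  obtain ⟨h0, hD⟩ := rPlus_lt m a r hm ha hr
  have hX := xi_pos (a := a) hm h0 θ
  rw [dR_bgY hm ha hr, dA_bgY hm ha hr, dR_bgA hm ha hr, dA_bgA hm ha hr, dR_bgD hr,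
    dR_dR_bgY hm ha hr, dA_dA_bgY hm ha hr]
  simp only [bgY, bgD]
  have e : sigma a r θ = r ^ 2 + a ^ 2 * (1 - Real.sin θ ^ 2) := by rw [sigma, Real.cos_sq']
  have hx : xi m a r θ = (r ^ 2 + a ^ 2) ^ 2 - a ^ 2 * delta m a r * Real.sin θ ^ 2 := rfl
  have hc := Real.cos_sq' θ
  -- Only even powers of cos θ occur; after their elimination the identity is polynomial in r, a, m
  -- and sin θ.
  generalize Real.cos θ = c at *
  field_simp
  simp only [hc]
  rw [e]
  unfold xiR
  rw [hx]
  unfold delta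
  ring

end

/-- `∂_r γ` and `∂_θ γ`. -/
def gamGrad (m a : ℝ) (x : ℝ × ℝ × ℝ) : Fin 2 → ℝ :=
  ![-(dR (bgY m a) x / (2 * bgY m a x)),
    Real.cos x.2.2 / Real.sin x.2.2 - dA (bgY m a) x / (2 * bgY m a x)]

/-- `e^{-2γ} ∂_r ω` and `e^{-2γ} ∂_θ ω`. -/
def twistGrad (m a : ℝ) (x : ℝ × ℝ × ℝ) : Fin 2 → ℝ :=
  ![dA (bgA m a) x * Real.sin x.2.2 / (bgD m a x * bgY m a x),
    -(dR (bgA m a) x * Real.sin x.2.2 / bgY m a x)]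

/-- The norm with respect to `N e^{-2γ} μ̄_q q^{-1}`. -/
def weightSq (m a : ℝ) (x : ℝ × ℝ × ℝ) (V : Fin 2 → ℝ) : ℝ :=
  bgY m a x / Real.sin x.2.2 * (bgD m a x * V 0 ^ 2 + V 1 ^ 2)

/-! ### First derivatives of γ and ω, and the energy weights -/

section
variable {m a r θ : ℝ} (hm : 0 < m) (ha : |a| ≤ m) (hr : rPlus m a < r)
  (hθ : θ ∈ Ioo 0 Real.pi)
include hm ha hr

lemma gam_eq (t : ℝ) (hs : 0 < Real.sin θ) :
    gam m a r θ = Real.log (Real.sin θ ^ 2 / bgY m a (t, r, θ)) / 2 := by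
  rw [← exp_two_gam hm ha hr hs t, Real.log_exp]; ring

include hθ

lemma pd_gam (t : ℝ) (b : Fin 2) : pd (gam m a) b r θ = gamGrad m a (t, r, θ) b := by
  have hs := Real.sin_pos_of_mem_Ioo hθ
  have hy : 0 < bgY m a (t, r, θ) := bgY_pos hm ha hr
  have hq : Real.sin θ ^ 2 / bgY m a (t, r, θ) ≠ 0 := by positivity
  fin_cases b
  · have k := ((((hasDerivAt_const r (Real.sin θ ^ 2)).div
      ((smooth_bgY hm ha).hasDerivAt_dR t hr θ) hy.ne').log hq).div_const 2).congr_of_eventuallyEq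
      (f₁ := fun x => gam m a x θ) (by
        filter_upwards [lt_mem_nhds hr] with x hx
        exact gam_eq hm ha hx t hs)
    refine k.deriv.trans ?_
    simp only [gamGrad, Fin.zero_eta, Matrix.cons_val_zero, Pi.div_apply]
    field_simp
    ring
  · have k := (((((Real.hasDerivAt_sin θ).pow 2).div
      ((smooth_bgY hm ha).hasDerivAt_dA t hr θ) hy.ne').log hq).div_const 2).congr_of_eventuallyEq
      (f₁ := fun x => gam m a r x) (by
        filter_upwards [isOpen_Ioo.mem_nhds hθ] with x hx
        exact gam_eq hm ha hr t (Real.sin_pos_of_mem_Ioo hx))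
    refine k.deriv.trans ?_
    simp only [gamGrad, Fin.mk_one, Matrix.cons_val_one, Matrix.cons_val_fin_one, Pi.div_apply, Pi.pow_apply]
    field_simp
    push_cast
    ring

lemma pd_shiftA (t : ℝ) (b : Fin 2) : pd (shiftA m a) b r θ =
    (![dR (bgA m a) (t, r, θ), dA (bgA m a) (t, r, θ)] : Fin 2 → ℝ) b := by
  have hA : ∀ x ϑ, rPlus m a < x → 0 < Real.sin ϑ → shiftA m a x ϑ = bgA m a (t, x, ϑ) := by
    intro x ϑ hx hϑ
    have h0 := (rPlus_lt m a x hm ha hx).1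
    have h1 := sigma_pos h0 a ϑ
    have h2 := xi_pos (a := a) hm h0 ϑ
    simp only [shiftA, kerr, bgA]
    simp
    field_simp
    unfold delta; ring
  fin_cases b
  · refine Eq.trans (Filter.EventuallyEq.deriv_eq ?_) ((smooth_bgA hm ha).hasDerivAt_dR t hr θ).deriv
    filter_upwards [lt_mem_nhds hr] with x hx
    exact hA x θ hx (Real.sin_pos_of_mem_Ioo hθ)
  · refine Eq.trans (Filter.EventuallyEq.deriv_eq ?_) ((smooth_bgA hm ha).hasDerivAt_dA t hr θ).deriv
    filter_upwards [isOpen_Ioo.mem_nhds hθ] with x hx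
    exact hA r x hr (Real.sin_pos_of_mem_Ioo hx)

lemma exp_neg_four_gam (t : ℝ) :
    Real.exp (-4 * gam m a r θ) = (bgY m a (t, r, θ) / Real.sin θ ^ 2) ^ 2 := by
  rw [← exp_neg_two_gam hm ha hr (Real.sin_pos_of_mem_Ioo hθ) t, ← Real.exp_nat_mul]
  congr 1; push_cast; ring

/-- Only the twist equation enters, not the explicit formula for ω: inverting ε expresses e^{-2γ} ∂ω
through the derivatives of the shift, with the two components interchanged. -/
lemma pd_omega (t : ℝ) (b : Fin 2) :
    Real.exp (-2 * gam m a r θ) * pd (omega m a) b r θ = twistGrad m a (t, r, θ) b := by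
  have hs := Real.sin_pos_of_mem_Ioo hθ
  have hy : 0 < bgY m a (t, r, θ) := bgY_pos hm ha hr
  have hD : 0 < bgD m a (t, r, θ) := bgD_pos hm ha hr
  have hw : 0 < Real.sqrt (delta m a r) := Real.sqrt_pos.2 hD
  have hq : Real.sqrt (delta m a r) ^ 2 = bgD m a (t, r, θ) := Real.sq_sqrt hD.le
  have e0 := gravTwist_omega m a r θ hm ha hr hθ 0
  have e1 := gravTwist_omega m a r θ hm ha hr hθ 1
  simp only [pd_shiftA hm ha hr hθ t, exp_neg_four_gam hm ha hr hθ t, Fin.sum_univ_two,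
    muqInv_eq hm ha hr hs, lapse] at e0 e1
  simp [eps] at e0 e1
  rw [exp_neg_two_gam hm ha hr hs t]
  fin_cases b
  · simp only [twistGrad, Fin.zero_eta, Matrix.cons_val_zero]
    field_simp
    field_simp at e1
    rw [hq] at e1
    linear_combination -e1
  · simp only [twistGrad, Fin.mk_one, Matrix.cons_val_one, Matrix.cons_val_fin_one]
    field_simp
    field_simp at e0
    linear_combination e0

/-- The energy density in terms of the background fields. -/
lemma density_eq (t s e l : ℝ) (de dl : Fin 2 → ℝ) (u v : ℝ) :
    density m a s e l de dl u v r θ =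
      1 / 2 * (Real.sin θ * bgK m a (t, r, θ)) * (u ^ 2 + v ^ 2) +
      1 / 2 * (weightSq m a (t, r, θ) (fun b => dl b - 2 * s * l * gamGrad m a (t, r, θ) b -
          (1 - s) * e * twistGrad m a (t, r, θ) b) +
        weightSq m a (t, r, θ) (fun b => de b - 2 * (1 - s) * e * gamGrad m a (t, r, θ) b +
          s * l * twistGrad m a (t, r, θ) b)) +
      2 * s * (1 - s) * (weightSq m a (t, r, θ) (gamGrad m a (t, r, θ)) +
        1 / 4 * weightSq m a (t, r, θ) (twistGrad m a (t, r, θ))) * (l ^ 2 + e ^ 2) := by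
  have hs := Real.sin_pos_of_mem_Ioo hθ
  have hy : 0 < bgY m a (t, r, θ) := bgY_pos hm ha hr
  obtain ⟨h0, hD⟩ := rPlus_lt m a r hm ha hr
  have hw : 0 < Real.sqrt (delta m a r) := Real.sqrt_pos.2 hD
  have hq : Real.sqrt (delta m a r) ^ 2 = delta m a r := Real.sq_sqrt hD.le
  have hX := xi_pos (a := a) hm h0 θ
  have hS := sigma_pos h0 a θ
  have e4 : Real.exp (-4 * gam m a r θ) = Real.exp (-2 * gam m a r θ) ^ 2 := by
    rw [← Real.exp_nat_mul]; congr 1; push_cast; ring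
  have hK : lapse m a r θ * Real.exp (2 * gam m a r θ) * (muq m a r θ)⁻¹ =
      Real.sin θ * bgK m a (t, r, θ) := by
    rw [exp_two_gam hm ha hr hs t, muq_eq hm ha hr hs, lapse, bgY, bgK]
    simp only
    field_simp
    rw [hq]
  have hN : lapse m a r θ * Real.sqrt (delta m a r) * Real.exp (-2 * gam m a r θ) =
      bgY m a (t, r, θ) / Real.sin θ * bgD m a (t, r, θ) := by
    rw [exp_neg_two_gam hm ha hr hs t, lapse, bgD]
    simp only
    field_simp
    rw [hq]
  have hN' : lapse m a r θ * (Real.sqrt (delta m a r))⁻¹ * Real.exp (-2 * gam m a r θ) =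
      bgY m a (t, r, θ) / Real.sin θ := by
    rw [exp_neg_two_gam hm ha hr hs t, lapse]
    field_simp
  simp only [density, Fin.sum_univ_two, muqInv_eq hm ha hr hs, pd_gam hm ha hr hθ t, e4,
    ← pd_omega hm ha hr hθ t, weightSq]
  simp
  simp only [← neg_mul]
  set E := Real.exp (-2 * gam m a r θ)
  rw [← hN']
  have hN3 : lapse m a r θ * (Real.sqrt (delta m a r))⁻¹ * E * bgD m a (t, r, θ) =
    lapse m a r θ * Real.sqrt (delta m a r) * E := by rw [hN, hN']
  generalize lapse m a r θ = N at *
  linear_combination (1 / 2 * (u ^ 2 + v ^ 2)) * hK -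
    (1 / 2 * ((dl 0 - 2 * s * l * gamGrad m a (t, r, θ) 0 - (1 - s) * e * (E * pd (omega m a) 0 r θ)) ^ 2
      + (de 0 - 2 * (1 - s) * e * gamGrad m a (t, r, θ) 0 + s * l * (E * pd (omega m a) 0 r θ)) ^ 2)
      + 2 * s * (1 - s) * (gamGrad m a (t, r, θ) 0 ^ 2 + 1 / 4 * (E * pd (omega m a) 0 r θ) ^ 2)
        * (l ^ 2 + e ^ 2)) * hN3

end

/-! ### Functions on the orbit space that are bounded near the axis -/

/-- Continuous functions on the orbit space, bounded on compact ranges of `r`. -/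
def Tame (m a : ℝ) (f : ℝ × ℝ → ℝ) : Prop :=
  ContinuousOn f (orbit m a) ∧ ∀ r₀ r₁, rPlus m a < r₀ →
    ∃ C, ∀ p ∈ orbit m a, r₀ ≤ p.1 → p.1 ≤ r₁ → |f p| ≤ C

namespace Tame
variable {m a : ℝ} {f g : ℝ × ℝ → ℝ}

lemma add (hf : Tame m a f) (hg : Tame m a g) : Tame m a fun p => f p + g p := by
  refine ⟨hf.1.add hg.1, fun r₀ r₁ h0 => ?_⟩
  obtain ⟨C, hC⟩ := hf.2 r₀ r₁ h0
  obtain ⟨K, hK⟩ := hg.2 r₀ r₁ h0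
  exact ⟨C + K, fun p hp h h' => (abs_add_le _ _).trans (add_le_add (hC p hp h h') (hK p hp h h'))⟩

lemma mul (hf : Tame m a f) (hg : Tame m a g) : Tame m a fun p => f p * g p := by
  refine ⟨hf.1.mul hg.1, fun r₀ r₁ h0 => ?_⟩
  obtain ⟨C, hC⟩ := hf.2 r₀ r₁ h0
  obtain ⟨K, hK⟩ := hg.2 r₀ r₁ h0
  exact ⟨C * K, fun p hp h h' => (abs_mul _ _).trans_le (mul_le_mul (hC p hp h h') (hK p hp h h')
    (abs_nonneg _) ((abs_nonneg _).trans (hC p hp h h')))⟩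

lemma congr (hf : Tame m a f) (h : ∀ p ∈ orbit m a, g p = f p) : Tame m a g := by
  refine ⟨hf.1.congr h, fun r₀ r₁ h0 => ?_⟩
  obtain ⟨C, hC⟩ := hf.2 r₀ r₁ h0
  exact ⟨C, fun p hp => by rw [h p hp]; exact hC p hp⟩

lemma of_continuousOn {f : ℝ × ℝ × ℝ → ℝ} (hf : ContinuousOn f (domain m a)) (t : ℝ) :
    Tame m a fun p => f (t, p.1, p.2) := by
  refine ⟨continuousOn_slice hf t, fun r₀ r₁ h0 => ?_⟩
  obtain ⟨C, -, hC⟩ := exists_bound_of_continuousOn hf |t| (r₁ := r₁) h0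
  exact ⟨C, fun p hp h h' => hC t p.1 p.2 le_rfl h h' ⟨hp.2.1.le, hp.2.2.le⟩⟩

lemma integrableOn (hf : Tame m a f) {r₀ r₁ : ℝ} (h0 : rPlus m a < r₀)
    (hs : ∀ p ∈ orbit m a, p.1 < r₀ ∨ r₁ < p.1 → f p = 0) : IntegrableOn f (orbit m a) := by
  obtain ⟨C, hC⟩ := hf.2 r₀ r₁ h0
  refine integrableOn_orbit hf.1 (fun p hp h => hs p hp (Or.inr h)) (C := max C 0) fun p hp => ?_
  by_cases h : p.1 < r₀ ∨ r₁ < p.1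
  · rw [hs p hp h, abs_zero]; exact le_max_right _ _
  · push Not at h
    exact (hC p hp h.1 h.2).trans (le_max_left _ _)

lemma tendsto_sin_mul (hf : Tame m a f) {r : ℝ} (hr : rPlus m a < r) :
    Tendsto (fun θ => Real.sin θ * f (r, θ)) (𝓝[>] 0) (𝓝 0) ∧
      Tendsto (fun θ => Real.sin θ * f (r, θ)) (𝓝[<] Real.pi) (𝓝 0) := by
  obtain ⟨C, hC⟩ := hf.2 r r hr
  have hb : ∀ θ ∈ Ioo 0 Real.pi, ‖f (r, θ)‖ ≤ C := fun θ hθ => hC (r, θ) ⟨hr, hθ⟩ le_rfl le_rfl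
  have key : ∀ (l : Filter ℝ) (x : ℝ), Real.sin x = 0 → l ≤ 𝓝 x → (∀ᶠ θ in l, θ ∈ Ioo 0 Real.pi) →
      Tendsto (fun θ => Real.sin θ * f (r, θ)) l (𝓝 0) := by
    intro l x hx hl he
    have h1 : Tendsto Real.sin l (𝓝 0) := hx ▸ (Real.continuous_sin.tendsto x).mono_left hl
    exact h1.zero_mul_isBoundedUnder_le ⟨C, Filter.eventually_map.2 (he.mono hb)⟩
  exact ⟨key _ 0 Real.sin_zero nhdsWithin_le_nhds (Ioo_mem_nhdsGT Real.pi_pos),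
    key _ Real.pi Real.sin_pi nhdsWithin_le_nhds (Ioo_mem_nhdsLT Real.pi_pos)⟩

/-- L and H stand for the potentials divided by sin² θ. The correction terms of the energy are
polynomials of this shape whose coefficients stay continuous across the axis. -/
lemma quadratic {L H : ℝ × ℝ → ℝ} (hL : Tame m a L) (hH : Tame m a H) (t : ℝ)
    {c₁ c₂ c₃ c₄ c₅ : ℝ × ℝ × ℝ → ℝ} (h1 : ContinuousOn c₁ (domain m a))
    (h2 : ContinuousOn c₂ (domain m a)) (h3 : ContinuousOn c₃ (domain m a))
    (h4 : ContinuousOn c₄ (domain m a)) (h5 : ContinuousOn c₅ (domain m a)) :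
    Tame m a fun p => c₁ (t, p.1, p.2) * (L p * L p) + c₂ (t, p.1, p.2) * (H p * H p) +
      c₃ (t, p.1, p.2) * (L p * H p) + c₄ (t, p.1, p.2) * L p + c₅ (t, p.1, p.2) * H p :=
  (((((of_continuousOn h1 t).mul (hL.mul hL)).add ((of_continuousOn h2 t).mul (hH.mul hH))).add
    ((of_continuousOn h3 t).mul (hL.mul hH))).add ((of_continuousOn h4 t).mul hL)).add
    ((of_continuousOn h5 t).mul hH)

end Tame

/-- Here the second-order vanishing of potentials at the axis is used; it makes the apparent poles
of the energy density harmless. -/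
lemma IsPotential.tame_div {m a : ℝ} {p₁ p₂ w l : ℝ × ℝ × ℝ → ℝ} (hl : IsPotential m a p₁ p₂ w l)
    (h2 : Smooth m a p₂) (t : ℝ) : Tame m a fun p => l (t, p.1, p.2) / Real.sin p.2 ^ 2 := by
  refine ⟨(continuousOn_slice hl.cont t).div (by fun_prop) fun p hp =>
    (pow_pos (sin_pos_of_mem_orbit hp) 2).ne', fun r₀ r₁ h0 => ?_⟩
  obtain ⟨C, -, hC⟩ := hl.abs_le h2.continuousOn t (r₁ := r₁) h0
  refine ⟨C, fun p hp h h' => ?_⟩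
  have hs := pow_pos (sin_pos_of_mem_orbit hp) 2
  rw [abs_div, abs_of_pos hs, div_le_iff₀ hs]
  exact hC p.1 p.2 h h' ⟨hp.2.1.le, hp.2.2.le⟩

/-! ### The energy density as a local energy up to a divergence -/

/-- The interaction energy of the potential `λ` with the rotation of the background. -/
def interaction (m a : ℝ) (l q₁ q₂ : ℝ × ℝ × ℝ → ℝ) (x : ℝ × ℝ × ℝ) : ℝ :=
  l x * (Real.sin x.2.2 * (dA (bgA m a) x * q₁ x - dR (bgA m a) x * q₂ x))

/-- Let W be the weight of `weightSq`. Then `corrR` and `corrA` are the components of the vector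
density −(sλ² + (1 − s)η²) W ∂γ − (1 − s) λη W e^{-2γ} ∂ω, whose divergence carries all the
dependence of the energy density on s. -/
def corrR (m a s : ℝ) (l e : ℝ × ℝ × ℝ → ℝ) (x : ℝ × ℝ × ℝ) : ℝ :=
  bgD m a x * dR (bgY m a) x / (2 * Real.sin x.2.2) * (s * l x ^ 2 + (1 - s) * e x ^ 2) -
    (1 - s) * (dA (bgA m a) x * (l x * e x))

def corrA (m a s : ℝ) (l e : ℝ × ℝ × ℝ → ℝ) (x : ℝ × ℝ × ℝ) : ℝ :=
  (dA (bgY m a) x / (2 * Real.sin x.2.2) - bgY m a x * Real.cos x.2.2 / Real.sin x.2.2 ^ 2) *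
      (s * l x ^ 2 + (1 - s) * e x ^ 2) + (1 - s) * (dR (bgA m a) x * (l x * e x))

/-- `∂_r` of `corrR`. -/
def corrR' (m a s : ℝ) (p₁ q₁ l e : ℝ × ℝ × ℝ → ℝ) (x : ℝ × ℝ × ℝ) : ℝ :=
  (dR (bgD m a) x * dR (bgY m a) x + bgD m a x * dR (dR (bgY m a)) x) / (2 * Real.sin x.2.2) *
      (s * l x ^ 2 + (1 - s) * e x ^ 2) +
    bgD m a x * dR (bgY m a) x * (s * l x * p₁ x + (1 - s) * e x * q₁ x) -
    (1 - s) * (dR (dA (bgA m a)) x * (l x * e x) +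
      dA (bgA m a) x * (Real.sin x.2.2 * (p₁ x * e x + l x * q₁ x)))

/-- `∂_θ` of `corrA`. -/
def corrA' (m a s : ℝ) (p₂ q₂ l e : ℝ × ℝ × ℝ → ℝ) (x : ℝ × ℝ × ℝ) : ℝ :=
  (dA (dA (bgY m a)) x / (2 * Real.sin x.2.2) -
      3 * dA (bgY m a) x * Real.cos x.2.2 / (2 * Real.sin x.2.2 ^ 2) + bgY m a x / Real.sin x.2.2 +
      2 * bgY m a x * Real.cos x.2.2 ^ 2 / Real.sin x.2.2 ^ 3) *
      (s * l x ^ 2 + (1 - s) * e x ^ 2) +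
    (dA (bgY m a) x - 2 * bgY m a x * Real.cos x.2.2 / Real.sin x.2.2) *
      (s * l x * p₂ x + (1 - s) * e x * q₂ x) +
    (1 - s) * (dA (dR (bgA m a)) x * (l x * e x) +
      dR (bgA m a) x * (Real.sin x.2.2 * (p₂ x * e x + l x * q₂ x)))

/-- The energy density evaluated on potentials with the given reduced derivatives. -/
def potDensity (m a s : ℝ) (u v p₁ p₂ q₁ q₂ l e : ℝ × ℝ × ℝ → ℝ) (x : ℝ × ℝ × ℝ) : ℝ :=
  density m a s (e x) (l x) ![Real.sin x.2.2 * q₁ x, Real.sin x.2.2 * q₂ x]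
    ![Real.sin x.2.2 * p₁ x, Real.sin x.2.2 * p₂ x] (u x) (v x) x.2.1 x.2.2

section
variable {m a : ℝ} (hm : 0 < m) (ha : |a| ≤ m) {u v p₁ p₂ q₁ q₂ w w' l e : ℝ × ℝ × ℝ → ℝ}
include hm ha

/-- On expanding the squares, s² and s(1 − s) add up to s, so λ² and η² have the coefficients s and
1 − s times 2|∂γ|² + ½ e^{-4γ}|∂ω|², and the λη ∂γ·∂ω terms of P and Q cancel. The equation for γ
makes these terms, together with those in λ∂λ·∂γ and η∂η·∂γ, a divergence. The terms with ∂ω are −(1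
− s) ∂(λη)·∂ω + λ ∂η·∂ω up to weights: the first is a divergence because the weighted ∂ω is a
rotated gradient of the shift, and the second is `interaction`, which is free of s. -/
lemma potDensity_eq (s : ℝ) {t r θ : ℝ} (hr : rPlus m a < r) (hθ : θ ∈ Ioo 0 Real.pi) :
    potDensity m a s u v p₁ p₂ q₁ q₂ l e (t, r, θ) =
      localEnergy m a u v p₁ p₂ q₁ q₂ (t, r, θ) + interaction m a l q₁ q₂ (t, r, θ) +
        (corrR' m a s p₁ q₁ l e (t, r, θ) + corrA' m a s p₂ q₂ l e (t, r, θ)) := by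
  have hs := Real.sin_pos_of_mem_Ioo hθ
  have hy : 0 < bgY m a (t, r, θ) := bgY_pos hm ha hr
  have hD : 0 < bgD m a (t, r, θ) := bgD_pos hm ha hr
  have hK := killing_norm_eq hm ha hr t hs
  rw [potDensity, density_eq hm ha hr hθ t]
  simp only [localEnergy, interaction, corrR', corrA', weightSq, gamGrad, twistGrad,
    (smooth_bgA hm ha).dR_dA_comm (show (t, r, θ) ∈ domain m a from hr), Matrix.cons_val_zero,
    Matrix.cons_val_one, Matrix.cons_val_fin_one]
  generalize u (t, r, θ) = u, v (t, r, θ) = v, p₁ (t, r, θ) = p₁, p₂ (t, r, θ) = p₂,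
    q₁ (t, r, θ) = q₁, q₂ (t, r, θ) = q₂, l (t, r, θ) = l, e (t, r, θ) = e,
    bgK m a (t, r, θ) = K, dA (dR (bgA m a)) (t, r, θ) = Ara, Real.cos θ = c at *
  generalize dR (bgD m a) (t, r, θ) = Dr, dR (dR (bgY m a)) (t, r, θ) = Yrr,
    dA (dA (bgY m a)) (t, r, θ) = Yaa, dR (bgY m a) (t, r, θ) = Yr, dA (bgY m a) (t, r, θ) = Ya,
    dR (bgA m a) (t, r, θ) = Ar, dA (bgA m a) (t, r, θ) = Aa at *
  generalize bgY m a (t, r, θ) = y, bgD m a (t, r, θ) = D, Real.sin θ = z at *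
  -- The equation for the Killing norm is solved for the second θ-derivative of Y = e^{-2γ} sin² θ;
  -- afterwards the claim is an identity of rational functions.
  have hYaa : Yaa = (D * Yr ^ 2 + Ya ^ 2 + z ^ 2 * (Aa ^ 2 / D + Ar ^ 2)) / y -
      (Dr * Yr + D * Yrr + Ya * c / z + 2 * y) := by
    rw [← hK]
    field_simp
    ring
  rw [hYaa]
  field_simp
  ring

lemma hasDerivAt_corrR (hl : IsPotential m a p₁ p₂ w l) (he : IsPotential m a q₁ q₂ w' e) (s : ℝ)
    {t r θ : ℝ} (hr : rPlus m a < r) (hθ : θ ∈ Ioo 0 Real.pi) :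
    HasDerivAt (fun r => corrR m a s l e (t, r, θ)) (corrR' m a s p₁ q₁ l e (t, r, θ)) r := by
  have hs := Real.sin_pos_of_mem_Ioo hθ
  have hθ' := Ioo_subset_Icc_self hθ
  have dl := hl.dR t r θ hr hθ'
  have de := he.dR t r θ hr hθ'
  refine (((((smooth_bgD m a).hasDerivAt_dR t hr θ).mul
    ((smooth_bgY hm ha).dR.hasDerivAt_dR t hr θ)).div_const (2 * Real.sin θ)).mul
    (((dl.pow 2).const_mul s).add ((de.pow 2).const_mul (1 - s))) |>.sub
    ((((smooth_bgA hm ha).dA.hasDerivAt_dR t hr θ).mul (dl.mul de)).const_mul (1 - s))).congr_deriv ?_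
  simp only [corrR', Pi.add_apply, Pi.mul_apply, Pi.pow_apply]
  field_simp
  push_cast
  ring

lemma hasDerivAt_corrA (hl : IsPotential m a p₁ p₂ w l) (he : IsPotential m a q₁ q₂ w' e) (s : ℝ)
    {t r θ : ℝ} (hr : rPlus m a < r) (hθ : θ ∈ Ioo 0 Real.pi) :
    HasDerivAt (fun θ => corrA m a s l e (t, r, θ)) (corrA' m a s p₂ q₂ l e (t, r, θ)) θ := by
  have hs := Real.sin_pos_of_mem_Ioo hθ
  have dl := hl.dA t r θ hr
  have de := he.dA t r θ hr
  have dy := (smooth_bgY hm ha).hasDerivAt_dA t hr θ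
  have ds := Real.hasDerivAt_sin θ
  refine ((((((smooth_bgY hm ha).dA.hasDerivAt_dA t hr θ).div (ds.const_mul 2) (by positivity)).sub
    ((dy.mul (Real.hasDerivAt_cos θ)).div (ds.pow 2) (pow_pos hs 2).ne')).mul
    (((dl.pow 2).const_mul s).add ((de.pow 2).const_mul (1 - s)))).add
    ((((smooth_bgA hm ha).dR.hasDerivAt_dA t hr θ).mul (dl.mul de)).const_mul (1 - s))).congr_deriv ?_
  simp only [corrA', Pi.add_apply, Pi.mul_apply, Pi.pow_apply, Pi.sub_apply, Pi.div_apply]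
  field_simp
  push_cast
  ring

end

/-! ### Conservation of the twist potential energy -/

section
variable {m a : ℝ} (hm : 0 < m) (ha : |a| ≤ m) {u v p₁ p₂ q₁ q₂ l e : ℝ × ℝ × ℝ → ℝ}
  (h : ReducedMaxwell m a u v p₁ p₂ q₁ q₂)
  (hl : IsPotential m a p₁ p₂ (fun x => bgK m a x * v x) l)
  (he : IsPotential m a q₁ q₂ (fun x => bgK m a x * u x) e)

lemma IsPotential.eq_zero_of_vanishes {w : ℝ × ℝ × ℝ → ℝ} {t R₀ R₁ : ℝ}
    (hv : ∀ p ∈ orbit m a, p.1 < R₀ ∨ R₁ < p.1 → p₂ (t, p.1, p.2) = 0)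
    (hl : IsPotential m a p₁ p₂ w l) :
    ∀ p ∈ orbit m a, p.1 < R₀ ∨ R₁ < p.1 → l (t, p.1, p.2) = 0 := fun p hp hr =>
  hl.vanish t p.1 hp.1 (fun θ hθ => hv (p.1, θ) ⟨hp.1, hθ⟩ hr) p.2 ⟨hp.2.1.le, hp.2.2.le⟩

include hm ha h

lemma continuousOn_interaction (cl : ContinuousOn l (domain m a)) :
    ContinuousOn (interaction m a l q₁ q₂) (domain m a) := by
  have k1 := h.smooth_q₁.continuousOn
  have k2 := h.smooth_q₂.continuousOn
  have k3 := (smooth_bgA hm ha).dR.continuousOn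
  have k4 := (smooth_bgA hm ha).dA.continuousOn
  unfold interaction
  fun_prop

include hl he

/-- Negative powers of sin θ up to the third appear, but each quadratic term contains two potentials
of order sin² θ. Written in the quotients by sin² θ, all coefficients are regular, and `corrA` keeps
a factor sin θ, so it has no flux through the axis. -/
lemma tame_corr (s t : ℝ) :
    Tame m a (fun p => corrR' m a s p₁ q₁ l e (t, p.1, p.2)) ∧
    Tame m a (fun p => corrA' m a s p₂ q₂ l e (t, p.1, p.2)) ∧
    Tame m a (fun p => corrA m a s l e (t, p.1, p.2) / Real.sin p.2) := by
  have hL := hl.tame_div h.smooth_p₂ t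
  have hH := he.tame_div h.smooth_q₂ t
  have k1 := h.smooth_p₁.continuousOn
  have k2 := h.smooth_p₂.continuousOn
  have k3 := h.smooth_q₁.continuousOn
  have k4 := h.smooth_q₂.continuousOn
  have y0 := (smooth_bgY hm ha).continuousOn
  have y1 := (smooth_bgY hm ha).dR.continuousOn
  have y2 := (smooth_bgY hm ha).dA.continuousOn
  have y3 := (smooth_bgY hm ha).dR.dR.continuousOn
  have y4 := (smooth_bgY hm ha).dA.dA.continuousOn
  have d0 := (smooth_bgD m a).continuousOn
  have d1 := (smooth_bgD m a).dR.continuousOn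
  have a1 := (smooth_bgA hm ha).dR.continuousOn
  have a2 := (smooth_bgA hm ha).dA.continuousOn
  have a3 := (smooth_bgA hm ha).dA.dR.continuousOn
  have a4 := (smooth_bgA hm ha).dR.dA.continuousOn
  refine ⟨(Tame.quadratic hL hH t
      (c₁ := fun x => s * ((dR (bgD m a) x * dR (bgY m a) x + bgD m a x * dR (dR (bgY m a)) x) *
        Real.sin x.2.2 ^ 3 / 2))
      (c₂ := fun x => (1 - s) * ((dR (bgD m a) x * dR (bgY m a) x + bgD m a x * dR (dR (bgY m a)) x) *
        Real.sin x.2.2 ^ 3 / 2))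
      (c₃ := fun x => -((1 - s) * dR (dA (bgA m a)) x * Real.sin x.2.2 ^ 4))
      (c₄ := fun x => (s * bgD m a x * dR (bgY m a) x * p₁ x -
        (1 - s) * dA (bgA m a) x * Real.sin x.2.2 * q₁ x) * Real.sin x.2.2 ^ 2)
      (c₅ := fun x => ((1 - s) * bgD m a x * dR (bgY m a) x * q₁ x -
        (1 - s) * dA (bgA m a) x * Real.sin x.2.2 * p₁ x) * Real.sin x.2.2 ^ 2)
      (by fun_prop) (by fun_prop) (by fun_prop) (by fun_prop) (by fun_prop)).congr ?_,
    (Tame.quadratic hL hH t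
      (c₁ := fun x => s * (dA (dA (bgY m a)) x * Real.sin x.2.2 ^ 3 / 2 -
        3 / 2 * dA (bgY m a) x * Real.cos x.2.2 * Real.sin x.2.2 ^ 2 +
        bgY m a x * Real.sin x.2.2 ^ 3 + 2 * bgY m a x * Real.cos x.2.2 ^ 2 * Real.sin x.2.2))
      (c₂ := fun x => (1 - s) * (dA (dA (bgY m a)) x * Real.sin x.2.2 ^ 3 / 2 -
        3 / 2 * dA (bgY m a) x * Real.cos x.2.2 * Real.sin x.2.2 ^ 2 +
        bgY m a x * Real.sin x.2.2 ^ 3 + 2 * bgY m a x * Real.cos x.2.2 ^ 2 * Real.sin x.2.2))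
      (c₃ := fun x => (1 - s) * dA (dR (bgA m a)) x * Real.sin x.2.2 ^ 4)
      (c₄ := fun x => s * (dA (bgY m a) x * Real.sin x.2.2 ^ 2 -
        2 * bgY m a x * Real.cos x.2.2 * Real.sin x.2.2) * p₂ x +
        (1 - s) * dR (bgA m a) x * Real.sin x.2.2 ^ 3 * q₂ x)
      (c₅ := fun x => (1 - s) * (dA (bgY m a) x * Real.sin x.2.2 ^ 2 -
        2 * bgY m a x * Real.cos x.2.2 * Real.sin x.2.2) * q₂ x +
        (1 - s) * dR (bgA m a) x * Real.sin x.2.2 ^ 3 * p₂ x)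
      (by fun_prop) (by fun_prop) (by fun_prop) (by fun_prop) (by fun_prop)).congr ?_,
    (Tame.quadratic hL hH t
      (c₁ := fun x => s * (dA (bgY m a) x * Real.sin x.2.2 ^ 2 / 2 -
        bgY m a x * Real.cos x.2.2 * Real.sin x.2.2))
      (c₂ := fun x => (1 - s) * (dA (bgY m a) x * Real.sin x.2.2 ^ 2 / 2 -
        bgY m a x * Real.cos x.2.2 * Real.sin x.2.2))
      (c₃ := fun x => (1 - s) * dR (bgA m a) x * Real.sin x.2.2 ^ 3)
      (c₄ := fun _ => 0) (c₅ := fun _ => 0)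
      (by fun_prop) (by fun_prop) (by fun_prop) (by fun_prop) (by fun_prop)).congr ?_⟩
  all_goals
    intro p hp
    have hs := sin_pos_of_mem_orbit hp
    simp only [corrR', corrA', corrA]
    field_simp
    ring

/-- The twist potential energy is a local energy with an interaction term. -/
lemma integral_potDensity (s : ℝ) {t R₀ R₁ : ℝ} (h0 : rPlus m a < R₀)
    (hv : ∀ p ∈ orbit m a, p.1 < R₀ ∨ R₁ < p.1 →
      ReducedMaxwell.Vanishes u v p₁ p₂ q₁ q₂ (t, p.1, p.2)) :
    IntegrableOn (fun p : ℝ × ℝ => potDensity m a s u v p₁ p₂ q₁ q₂ l e (t, p.1, p.2)) (orbit m a) ∧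
    ContinuousOn (fun p : ℝ × ℝ => potDensity m a s u v p₁ p₂ q₁ q₂ l e (t, p.1, p.2)) (orbit m a) ∧
    ∫ p in orbit m a, potDensity m a s u v p₁ p₂ q₁ q₂ l e (t, p.1, p.2) =
      ∫ p in orbit m a, (localEnergy m a u v p₁ p₂ q₁ q₂ (t, p.1, p.2) +
        interaction m a l q₁ q₂ (t, p.1, p.2)) := by
  have vl := IsPotential.eq_zero_of_vanishes (fun p hp hr => (hv p hp hr).2.2.2.1) hl
  have ve := IsPotential.eq_zero_of_vanishes (fun p hp hr => (hv p hp hr).2.2.2.2.2) he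
  obtain ⟨tR, tA, tB⟩ := tame_corr hm ha h hl he s t
  have iR := tR.integrableOn h0 (r₁ := R₁) fun p hp hr => by simp [corrR', vl p hp hr, ve p hp hr]
  have iA := tA.integrableOn h0 (r₁ := R₁) fun p hp hr => by simp [corrA', vl p hp hr, ve p hp hr]
  have cE : ContinuousOn (fun x => localEnergy m a u v p₁ p₂ q₁ q₂ x + interaction m a l q₁ q₂ x)
      (domain m a) :=
    (h.smooth_localEnergy hm ha).continuousOn.add (continuousOn_interaction hm ha h hl.cont)
  have iE := integrableOn_slice cE (t := t) h0 (r₁ := R₁) fun p hp hr => by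
    obtain ⟨z1, z2, z3, z4, z5, z6⟩ := hv p hp hr
    simp [localEnergy, interaction, z1, z2, z3, z4, z5, z6]
  have heq : ∀ p ∈ orbit m a, potDensity m a s u v p₁ p₂ q₁ q₂ l e (t, p.1, p.2) =
      localEnergy m a u v p₁ p₂ q₁ q₂ (t, p.1, p.2) + interaction m a l q₁ q₂ (t, p.1, p.2) +
        (corrR' m a s p₁ q₁ l e (t, p.1, p.2) + corrA' m a s p₂ q₂ l e (t, p.1, p.2)) :=
    fun p hp => potDensity_eq hm ha s hp.1 hp.2
  -- Off the radial support the corrections vanish with the potentials, and on the axis the polar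
  -- correction is sin θ times a bounded function.
  have hdiv := integral_orbit_divergence (A := fun p => corrR m a s l e (t, p.1, p.2))
    (B := fun p => corrA m a s l e (t, p.1, p.2)) (r₁ := R₁) h0
    (fun p hp => hasDerivAt_corrR hm ha hl he s hp.1 hp.2)
    (fun p hp => hasDerivAt_corrA hm ha hl he s hp.1 hp.2) iR iA
    (fun p hp hr => by simp [corrR, vl p hp hr, ve p hp hr])
    (fun r hr => (tB.tendsto_sin_mul hr).1.congr' (by
      filter_upwards [Ioo_mem_nhdsGT Real.pi_pos] with θ hθ
      exact mul_div_cancel₀ _ (Real.sin_pos_of_mem_Ioo hθ).ne'))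
    (fun r hr => (tB.tendsto_sin_mul hr).2.congr' (by
      filter_upwards [Ioo_mem_nhdsLT Real.pi_pos] with θ hθ
      exact mul_div_cancel₀ _ (Real.sin_pos_of_mem_Ioo hθ).ne'))
  refine ⟨(integrableOn_congr_fun heq (measurableSet_orbit m a)).2 (iE.add (iR.add iA)),
    (((continuousOn_slice cE t).add (tR.add tA).1)).congr heq, ?_⟩
  rw [setIntegral_congr_fun (measurableSet_orbit m a) heq, integral_add iE (g := fun p : ℝ × ℝ =>
      corrR' m a s p₁ q₁ l e (t, p.1, p.2) + corrA' m a s p₂ q₂ l e (t, p.1, p.2)) (iR.add iA), hdiv,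
    add_zero]

-- The time derivative of the interaction cancels the source of the local energy up to a divergence.
-- From ∂_t λ = sin θ K v comes the term that cancels the v-part of the source. The part with ∂_t q₁
-- = ∂_r(Ku) and its polar companion is integrated by parts onto λ: the mixed derivatives of the
-- shift drop out, and ∂λ reproduces the u-part of the source. Both divergences have compact radial
-- support and no flux through the axis.
omit he in
lemma integral_energy_eq (hV : ∀ T, ∃ R₀ R₁, rPlus m a < R₀ ∧ ∀ t, |t| ≤ T → ∀ p ∈ orbit m a,
    p.1 < R₀ ∨ R₁ < p.1 → ReducedMaxwell.Vanishes u v p₁ p₂ q₁ q₂ (t, p.1, p.2)) (t t' : ℝ) :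
    ∫ p in orbit m a, (localEnergy m a u v p₁ p₂ q₁ q₂ (t, p.1, p.2) +
        interaction m a l q₁ q₂ (t, p.1, p.2)) =
      ∫ p in orbit m a, (localEnergy m a u v p₁ p₂ q₁ q₂ (t', p.1, p.2) +
        interaction m a l q₁ q₂ (t', p.1, p.2)) := by
  have sE := h.smooth_localEnergy hm ha
  have sFR := h.smooth_fluxR hm ha
  have sFA := h.smooth_fluxA hm ha
  have sA := smooth_bgA hm ha
  have sK := smooth_bgK hm ha
  have cE : ContinuousOn (fun x => localEnergy m a u v p₁ p₂ q₁ q₂ x + interaction m a l q₁ q₂ x)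
      (domain m a) := sE.continuousOn.add (continuousOn_interaction hm ha h hl.cont)
  set A := fun x : ℝ × ℝ × ℝ => fluxR m a u v p₁ q₁ x +
    l x * (dA (bgA m a) x * (Real.sin x.2.2 * (bgK m a x * u x))) with hA
  set B := fun x : ℝ × ℝ × ℝ => fluxA m a u v p₂ q₂ x -
    l x * (dR (bgA m a) x * (Real.sin x.2.2 * (bgK m a x * u x))) with hB
  set A' := fun x : ℝ × ℝ × ℝ => dR (fluxR m a u v p₁ q₁) x +
    (Real.sin x.2.2 * p₁ x * (dA (bgA m a) x * (Real.sin x.2.2 * (bgK m a x * u x))) +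
    l x * (dR (dA (bgA m a)) x * (Real.sin x.2.2 * (bgK m a x * u x)) + dA (bgA m a) x *
      (Real.sin x.2.2 * (dR (bgK m a) x * u x + bgK m a x * dR u x)))) with hA'
  set B' := fun x : ℝ × ℝ × ℝ => dA (fluxA m a u v p₂ q₂) x -
    (Real.sin x.2.2 * p₂ x * (dR (bgA m a) x * (Real.sin x.2.2 * (bgK m a x * u x))) +
    l x * (dA (dR (bgA m a)) x * (Real.sin x.2.2 * (bgK m a x * u x)) + dR (bgA m a) x *
      (Real.cos x.2.2 * (bgK m a x * u x) +
        Real.sin x.2.2 * (dA (bgK m a) x * u x + bgK m a x * dA u x)))) with hB'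
  have cl := hl.cont
  have k1 := h.smooth_p₁.continuousOn
  have k2 := h.smooth_p₂.continuousOn
  have k3 := h.smooth_u.continuousOn
  have k4 := h.smooth_u.dR.continuousOn
  have k5 := h.smooth_u.dA.continuousOn
  have k6 := sK.continuousOn
  have k7 := sK.dR.continuousOn
  have k8 := sK.dA.continuousOn
  have a1 := sA.dR.continuousOn
  have a2 := sA.dA.continuousOn
  have a3 := sA.dA.dR.continuousOn
  have a4 := sA.dR.dA.continuousOn
  have f1 := sFR.dR.continuousOn
  have f2 := sFA.continuousOn
  have f3 := sFA.dA.continuousOn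
  have cA' : ContinuousOn A' (domain m a) := by simp only [hA']; fun_prop
  have cB : ContinuousOn B (domain m a) := by simp only [hB]; fun_prop
  have cB' : ContinuousOn B' (domain m a) := by simp only [hB']; fun_prop
  have key : ∀ t₀, HasDerivAt (fun t => ∫ p in orbit m a, (localEnergy m a u v p₁ p₂ q₁ q₂ (t, p.1, p.2) +
        interaction m a l q₁ q₂ (t, p.1, p.2))) 0 t₀ := by
    intro t₀
    obtain ⟨R₀, R₁, h0, hv⟩ := hV (|t₀| + 1)
    have hz : ∀ t, |t| ≤ |t₀| + 1 → ∀ p ∈ orbit m a, p.1 < R₀ ∨ R₁ < p.1 →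
        A (t, p.1, p.2) = 0 ∧ A' (t, p.1, p.2) = 0 ∧ B' (t, p.1, p.2) = 0 := by
      intro t ht p hp hr
      have vl := IsPotential.eq_zero_of_vanishes (fun p hp hr => (hv t ht p hp hr).2.2.2.1) hl
      have vR := (deriv_vanish sFR (t := t) (R₀ := R₀) (R₁ := R₁) (fun p hp hr => by
        obtain ⟨z1, z2, -⟩ := hv t ht p hp hr
        simp [fluxR, z1, z2]) p hp hr).1
      have vA := (deriv_vanish sFA (t := t) (R₀ := R₀) (R₁ := R₁) (fun p hp hr => by
        obtain ⟨z1, z2, -⟩ := hv t ht p hp hr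
        simp [fluxA, z1, z2]) p hp hr).2
      obtain ⟨z1, z2, z3, z4, -⟩ := hv t ht p hp hr
      simp [hA, hA', hB', vR, vA, vl p hp hr, fluxR, z1, z2, z3, z4]
    have hT : ∀ t, |t - t₀| < 1 → |t| ≤ |t₀| + 1 := fun t ht => by
      have := abs_sub_abs_le_abs_sub t t₀
      linarith
    have ht0 : |t₀| ≤ |t₀| + 1 := by linarith
    have hder := hasDerivAt_integral_slice cE (g := fun x => A' x + B' x) (cA'.add cB') (t₀ := t₀) h0 (r₁ := R₁) ?_ ?_ ?_
    · have hdiv := integral_slice_divergence (t := t₀) (r₁ := R₁) (A := A) (B := B) (A' := A') (B' := B')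
        h0 (fun p hp => (sFR.hasDerivAt_dR t₀ hp.1 p.2).add
          ((hl.dR t₀ p.1 p.2 hp.1 ⟨hp.2.1.le, hp.2.2.le⟩).mul ((sA.dA.hasDerivAt_dR t₀ hp.1 p.2).mul
            (((sK.hasDerivAt_dR t₀ hp.1 p.2).mul (h.smooth_u.hasDerivAt_dR t₀ hp.1 p.2)).const_mul
              (Real.sin p.2)))))
        (fun p hp => (sFA.hasDerivAt_dA t₀ hp.1 p.2).sub
          ((hl.dA t₀ p.1 p.2 hp.1).mul ((sA.dR.hasDerivAt_dA t₀ hp.1 p.2).mul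
            ((Real.hasDerivAt_sin p.2).mul
              ((sK.hasDerivAt_dA t₀ hp.1 p.2).mul (h.smooth_u.hasDerivAt_dA t₀ hp.1 p.2))))))
        cA' cB cB' (hz t₀ ht0) (fun r hr => by simp [hB, fluxA, hl.zero t₀ r hr, hl.pi t₀ r hr])
      exact hder.congr_deriv hdiv
    · intro t ht p hp
      have hx : (t, p.1, p.2) ∈ domain m a := hp.1
      have eA : ∀ τ, dA (bgA m a) (τ, p.1, p.2) = dA (bgA m a) (t, p.1, p.2) := fun τ =>
        (dA_bgA hm ha hp.1 τ p.2).trans (dA_bgA hm ha hp.1 t p.2).symm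
      have eR : ∀ τ, dR (bgA m a) (τ, p.1, p.2) = dR (bgA m a) (t, p.1, p.2) := fun τ =>
        (dR_bgA hm ha hp.1 τ p.2).trans (dR_bgA hm ha hp.1 t p.2).symm
      refine (((sE.hasDerivAt_dT hp.1 p.2).add ((hl.dT t p.1 p.2 hp.1 ⟨hp.2.1.le, hp.2.2.le⟩).mul
        ((((h.smooth_q₁.hasDerivAt_dT hp.1 p.2).const_mul (dA (bgA m a) (t, p.1, p.2))).sub
        ((h.smooth_q₂.hasDerivAt_dT hp.1 p.2).const_mul (dR (bgA m a) (t, p.1, p.2)))).const_mul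
          (Real.sin p.2)))).congr_of_eventuallyEq (Eventually.of_forall fun τ => by
            simp [interaction, eA τ, eR τ])).congr_deriv ?_
      have r0 := h.localEnergy_identity hm ha (t := t) hp.1 hp.2
      have r1 := h.dT_q₁ _ hx hp.2
      have r2 := h.dT_q₂ _ hx hp.2
      simp only [hA', hB', sourceE, sA.dR_dA_comm hx, Pi.sub_apply] at r0 r1 r2 ⊢
      linear_combination r0 + l (t, p.1, p.2) * Real.sin p.2 * dA (bgA m a) (t, p.1, p.2) * r1 -
        l (t, p.1, p.2) * dR (bgA m a) (t, p.1, p.2) * r2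
    · intro p hp hr
      obtain ⟨z1, z2, z3, z4, z5, z6⟩ := hv t₀ ht0 p hp hr
      simp [localEnergy, interaction, z1, z2, z3, z4, z5, z6]
    · intro t ht p hp hr
      obtain ⟨-, z1, z2⟩ := hz t (hT t ht) p hp hr
      simp only [z1, z2, add_zero]
  exact is_const_of_deriv_eq_zero (fun t => (key t).differentiableAt) (fun t => (key t).deriv) t t'

end

/-! ### Positivity of the energy -/

section
variable {m a : ℝ} (hm : 0 < m) (ha : |a| ≤ m) {u v p₁ p₂ q₁ q₂ w w' l e : ℝ × ℝ × ℝ → ℝ}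
include hm ha

lemma weightSq_nonneg {x : ℝ × ℝ × ℝ} (hx : x ∈ domain m a) (hs : 0 < Real.sin x.2.2) (V : Fin 2 → ℝ) :
    0 ≤ weightSq m a x V := by
  have := bgY_pos hm ha hx
  have := bgD_pos hm ha hx
  unfold weightSq; positivity

/-- Only the radial component is recorded, because the uniqueness argument runs along lines θ =
const. -/
lemma eq_zero_of_weightSq_eq_zero {x : ℝ × ℝ × ℝ} (hx : x ∈ domain m a) (hs : 0 < Real.sin x.2.2)
    {V : Fin 2 → ℝ} (hV : weightSq m a x V = 0) : V 0 = 0 := by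
  have hy := bgY_pos hm ha hx
  have hD := bgD_pos hm ha hx
  have h1 : bgD m a x * V 0 ^ 2 + V 1 ^ 2 = 0 :=
    (mul_eq_zero.1 hV).resolve_left (div_pos hy hs).ne'
  have h2 : bgD m a x * V 0 ^ 2 = 0 := by nlinarith [sq_nonneg (V 1), mul_nonneg hD.le (sq_nonneg (V 0))]
  exact pow_eq_zero_iff two_ne_zero |>.1 ((mul_eq_zero.1 h2).resolve_left hD.ne')

lemma density_nonneg {s r θ : ℝ} (h0 : s ∈ Icc 0 1) (hr : rPlus m a < r) (hθ : θ ∈ Ioo 0 Real.pi)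
    (e l : ℝ) (de dl : Fin 2 → ℝ) (u v : ℝ) : 0 ≤ density m a s e l de dl u v r θ := by
  have hx : ((0 : ℝ), r, θ) ∈ domain m a := hr
  have hs := Real.sin_pos_of_mem_Ioo hθ
  have h1 := sub_nonneg.2 h0.2
  have hK := (bgK_pos hm ha hx).le
  have W := fun V => weightSq_nonneg hm ha hx hs V
  have h2 := h0.1
  rw [density_eq hm ha hr hθ 0]
  refine add_nonneg (add_nonneg (by positivity) (mul_nonneg (by norm_num) (add_nonneg (W _) (W _)))) ?_
  exact mul_nonneg (mul_nonneg (by positivity) (add_nonneg (W _) (mul_nonneg (by norm_num) (W _))))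
    (by positivity)

/-- The nonnegative summands vanish separately. The last one carries no information at s = 0 and s =
1, so the conclusion is drawn from u² + v², P and Q alone, uniformly in s. -/
lemma density_eq_zero {s r θ : ℝ} (h0 : s ∈ Icc 0 1) (hr : rPlus m a < r) (hθ : θ ∈ Ioo 0 Real.pi)
    (t : ℝ) {e l : ℝ} {de dl : Fin 2 → ℝ} {u v : ℝ} (hz : density m a s e l de dl u v r θ = 0) :
    u = 0 ∧ v = 0 ∧
      dl 0 = 2 * s * l * gamGrad m a (t, r, θ) 0 + (1 - s) * e * twistGrad m a (t, r, θ) 0 ∧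
      de 0 = 2 * (1 - s) * e * gamGrad m a (t, r, θ) 0 - s * l * twistGrad m a (t, r, θ) 0 := by
  have hx : (t, r, θ) ∈ domain m a := hr
  have hs := Real.sin_pos_of_mem_Ioo hθ
  have h1 := sub_nonneg.2 h0.2
  have hK := bgK_pos hm ha hx
  have W := fun V => weightSq_nonneg hm ha hx hs V
  have h2 := h0.1
  rw [density_eq hm ha hr hθ t] at hz
  set P := fun b => dl b - 2 * s * l * gamGrad m a (t, r, θ) b -
          (1 - s) * e * twistGrad m a (t, r, θ) b with hP
  set Q := fun b => de b - 2 * (1 - s) * e * gamGrad m a (t, r, θ) b +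
          s * l * twistGrad m a (t, r, θ) b with hQ
  have n1 : 0 ≤ 1 / 2 * (Real.sin θ * bgK m a (t, r, θ)) * (u ^ 2 + v ^ 2) := by positivity
  have n2 := W P
  have n3 := W Q
  have n4 : 0 ≤ 2 * s * (1 - s) * (weightSq m a (t, r, θ) (gamGrad m a (t, r, θ)) +
        1 / 4 * weightSq m a (t, r, θ) (twistGrad m a (t, r, θ))) * (l ^ 2 + e ^ 2) :=
    mul_nonneg (mul_nonneg (by positivity) (add_nonneg (W _) (mul_nonneg (by norm_num) (W _))))
      (by positivity)
  have z1 : 1 / 2 * (Real.sin θ * bgK m a (t, r, θ)) * (u ^ 2 + v ^ 2) = 0 := by linarith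
  have z2 := eq_zero_of_weightSq_eq_zero hm ha hx hs (V := P) (by linarith)
  have z3 := eq_zero_of_weightSq_eq_zero hm ha hx hs (V := Q) (by linarith)
  have z4 : u ^ 2 + v ^ 2 = 0 := (mul_eq_zero.1 z1).resolve_left (by positivity)
  simp only [hP, hQ] at z2 z3
  refine ⟨?_, ?_, by linarith, by linarith⟩
  · exact pow_eq_zero_iff two_ne_zero |>.1 (by nlinarith [sq_nonneg u, sq_nonneg v] : u ^ 2 = 0)
  · exact pow_eq_zero_iff two_ne_zero |>.1 (by nlinarith [sq_nonneg u, sq_nonneg v] : v ^ 2 = 0)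

lemma potDensity_eq_zero {s t r θ : ℝ} (h0 : s ∈ Icc 0 1) (hr : rPlus m a < r)
    (hθ : θ ∈ Ioo 0 Real.pi) (hz : potDensity m a s u v p₁ p₂ q₁ q₂ l e (t, r, θ) = 0) :
    u (t, r, θ) = 0 ∧ v (t, r, θ) = 0 ∧
      Real.sin θ * p₁ (t, r, θ) = 2 * s * l (t, r, θ) * gamGrad m a (t, r, θ) 0 +
        (1 - s) * e (t, r, θ) * twistGrad m a (t, r, θ) 0 ∧
      Real.sin θ * q₁ (t, r, θ) = 2 * (1 - s) * e (t, r, θ) * gamGrad m a (t, r, θ) 0 -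
        s * l (t, r, θ) * twistGrad m a (t, r, θ) 0 := by
  unfold potDensity at hz
  simpa only [Matrix.cons_val_zero] using density_eq_zero hm ha h0 hr hθ t hz

omit hm ha in
/-- Uniqueness for a planar linear system on a half-line. -/
lemma eq_zero_of_linear_system {f g f' g' α β γ δ : ℝ → ℝ} {x₀ : ℝ}
    (hα : ContinuousOn α (Ici x₀)) (hβ : ContinuousOn β (Ici x₀)) (hγ : ContinuousOn γ (Ici x₀))
    (hδ : ContinuousOn δ (Ici x₀))
    (hf : ∀ x, x₀ ≤ x → HasDerivAt f (f' x) x) (hg : ∀ x, x₀ ≤ x → HasDerivAt g (g' x) x)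
    (ef : ∀ x, x₀ ≤ x → f' x = α x * f x + β x * g x)
    (eg : ∀ x, x₀ ≤ x → g' x = γ x * f x + δ x * g x) (f0 : f x₀ = 0) (g0 : g x₀ = 0) {x : ℝ}
    (hx : x₀ ≤ x) : f x = 0 ∧ g x = 0 := by
  have hc : ContinuousOn (fun y => |α y| + |β y| + (|γ y| + |δ y|)) (Icc x₀ x) :=
    ((hα.abs.add hβ.abs).add (hγ.abs.add hδ.abs)).mono Icc_subset_Ici_self
  obtain ⟨C, hC⟩ := isCompact_Icc.exists_bound_of_continuousOn hc
  have key := eq_zero_of_abs_deriv_le_mul_abs_self_of_eq_zero_right (K := C)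
    (f := fun y => (f y, g y)) (f' := fun y => (f' y, g' y)) (a := x₀) (b := x)
    (fun y hy => ((hf y hy.1).continuousAt.prodMk (hg y hy.1).continuousAt).continuousWithinAt)
    (fun y hy => ((hf y hy.1).prodMk (hg y hy.1)).hasDerivWithinAt) (by simp [f0, g0]) ?_
    x (right_mem_Icc.2 hx)
  · exact ⟨congrArg Prod.fst key, congrArg Prod.snd key⟩
  · intro y hy
    have h1 := hC y (Ico_subset_Icc_self hy)
    rw [Real.norm_of_nonneg (by positivity)] at h1
    have h2 : |α y| + |β y| ≤ C := by linarith [abs_nonneg (γ y), abs_nonneg (δ y)]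
    have h3 : |γ y| + |δ y| ≤ C := by linarith [abs_nonneg (α y), abs_nonneg (β y)]
    have n1 : |f y| ≤ ‖(f y, g y)‖ := norm_fst_le (f y, g y)
    have n2 : |g y| ≤ ‖(f y, g y)‖ := norm_snd_le (f y, g y)
    have bound : ∀ x z : ℝ, |x| + |z| ≤ C → |x * f y + z * g y| ≤ C * ‖(f y, g y)‖ := by
      intro x z h
      calc |x * f y + z * g y| ≤ |x| * |f y| + |z| * |g y| := by
            simpa [abs_mul] using abs_add_le (x * f y) (z * g y)
        _ ≤ |x| * ‖(f y, g y)‖ + |z| * ‖(f y, g y)‖ := by gcongr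
        _ = (|x| + |z|) * ‖(f y, g y)‖ := by ring
        _ ≤ _ := by gcongr
    refine max_le ?_ ?_
    · change |f' y| ≤ _
      rw [ef y hy.1]; exact bound _ _ h2
    · change |g' y| ≤ _
      rw [eg y hy.1]; exact bound _ _ h3

/-- If the energy density vanishes, so do the fields. -/
lemma vanishes_of_potDensity_eq_zero {s : ℝ} (h0 : s ∈ Icc 0 1) (hl : IsPotential m a p₁ p₂ w l)
    (he : IsPotential m a q₁ q₂ w' e) {t R₀ : ℝ} (hR : rPlus m a < R₀)
    (vl : ∀ p ∈ orbit m a, p.1 < R₀ → l (t, p.1, p.2) = 0)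
    (ve : ∀ p ∈ orbit m a, p.1 < R₀ → e (t, p.1, p.2) = 0)
    (hz : ∀ p ∈ orbit m a, potDensity m a s u v p₁ p₂ q₁ q₂ l e (t, p.1, p.2) = 0) :
    ∀ p ∈ orbit m a, ReducedMaxwell.Vanishes u v p₁ p₂ q₁ q₂ (t, p.1, p.2) := by
  have cont : ∀ θ ∈ Ioo 0 Real.pi, ∀ x₀, rPlus m a < x₀ →
      ContinuousOn (fun r => gamGrad m a (t, r, θ) 0) (Ici x₀) ∧
      ContinuousOn (fun r => twistGrad m a (t, r, θ) 0) (Ici x₀) := by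
    intro θ hθ x₀ hx₀
    have hs : MapsTo (fun r : ℝ => (t, r, θ)) (Ici x₀) (domain m a) := fun r hr => hx₀.trans_le hr
    have sl : ∀ f : ℝ × ℝ × ℝ → ℝ, ContinuousOn f (domain m a) →
        ContinuousOn (fun r => f (t, r, θ)) (Ici x₀) := fun f hf => hf.comp (by fun_prop) hs
    have y0 := sl _ (smooth_bgY hm ha).continuousOn
    have y1 := sl _ (smooth_bgY hm ha).dR.continuousOn
    have d0 := sl _ (smooth_bgD m a).continuousOn
    have a1 := sl _ (smooth_bgA hm ha).dA.continuousOn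
    have ny : ∀ r ∈ Ici x₀, bgY m a (t, r, θ) ≠ 0 := fun r hr => (bgY_pos hm ha (hs hr)).ne'
    have nd : ∀ r ∈ Ici x₀, bgD m a (t, r, θ) ≠ 0 := fun r hr => (bgD_pos hm ha (hs hr)).ne'
    constructor
    · exact (y1.div (y0.const_mul 2) fun r hr => mul_ne_zero two_ne_zero (ny r hr)).neg
    · exact (a1.mul (continuousOn_const (c := Real.sin θ))).div (d0.mul y0) fun r hr => mul_ne_zero (nd r hr) (ny r hr)
  have key : ∀ p ∈ orbit m a, l (t, p.1, p.2) = 0 ∧ e (t, p.1, p.2) = 0 := by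
    intro p hp
    by_cases hp0 : p.1 < R₀
    · exact ⟨vl p hp hp0, ve p hp hp0⟩
    -- The radial parts of P = Q = 0 form a linear system in r for (λ, η). It is started at x₀
    -- between r₊ and R₀, where both potentials vanish and the coefficients are continuous from x₀
    -- outward.
    obtain ⟨x₀, hx₀, hx₁⟩ := exists_between hR
    obtain ⟨cg, ct⟩ := cont p.2 hp.2 x₀ hx₀
    have hmem : ∀ x, x₀ ≤ x → (x, p.2) ∈ orbit m a := fun x hx => ⟨hx₀.trans_le hx, hp.2⟩
    have hθ' := Ioo_subset_Icc_self hp.2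
    have hd := fun x (hx : x₀ ≤ x) =>
      potDensity_eq_zero hm ha h0 (hx₀.trans_le hx) hp.2 (hz (x, p.2) (hmem x hx))
    refine eq_zero_of_linear_system (f := fun x => l (t, x, p.2)) (g := fun x => e (t, x, p.2))
      (α := fun x => 2 * s * gamGrad m a (t, x, p.2) 0)
      (β := fun x => (1 - s) * twistGrad m a (t, x, p.2) 0)
      (γ := fun x => -s * twistGrad m a (t, x, p.2) 0)
      (δ := fun x => 2 * (1 - s) * gamGrad m a (t, x, p.2) 0)
      (continuousOn_const.mul cg) (continuousOn_const.mul ct)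
      (continuousOn_const.mul ct) (continuousOn_const.mul cg)
      (fun x hx => hl.dR t x p.2 (hx₀.trans_le hx) hθ') (fun x hx => he.dR t x p.2 (hx₀.trans_le hx) hθ')
      (fun x hx => ?_) (fun x hx => ?_) (vl (x₀, p.2) (hmem x₀ le_rfl) hx₁) (ve (x₀, p.2) (hmem x₀ le_rfl) hx₁)
      (hx₁.le.trans (not_lt.1 hp0))
    · rw [(hd x hx).2.2.1]; ring
    · rw [(hd x hx).2.2.2]; ring
  have deriv0 : ∀ {f : ℝ × ℝ × ℝ → ℝ} {g₁ g₂ w : ℝ × ℝ × ℝ → ℝ}, IsPotential m a g₁ g₂ w f →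
      (∀ p ∈ orbit m a, f (t, p.1, p.2) = 0) → ∀ p ∈ orbit m a, g₁ (t, p.1, p.2) = 0 ∧ g₂ (t, p.1, p.2) = 0 := by
    intro f g₁ g₂ w hf h0 p hp
    have hs := (sin_pos_of_mem_orbit hp).ne'
    have e1 := (hf.dR t p.1 p.2 hp.1 (Ioo_subset_Icc_self hp.2)).unique
      ((hasDerivAt_const p.1 (0 : ℝ)).congr_of_eventuallyEq (by
        filter_upwards [lt_mem_nhds (show rPlus m a < p.1 from hp.1)] with r hr using h0 (r, p.2) ⟨hr, hp.2⟩))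
    have e2 := (hf.dA t p.1 p.2 hp.1).unique
      ((hasDerivAt_const p.2 (0 : ℝ)).congr_of_eventuallyEq (by
        filter_upwards [isOpen_Ioo.mem_nhds hp.2] with θ hθ using h0 (p.1, θ) ⟨hp.1, hθ⟩))
    exact ⟨(mul_eq_zero.1 e1).resolve_left hs, (mul_eq_zero.1 e2).resolve_left hs⟩
  intro p hp
  have hd := potDensity_eq_zero hm ha h0 hp.1 hp.2 (hz p hp)
  have hp' := deriv0 hl (fun p hp => (key p hp).1) p hp
  have hq' := deriv0 he (fun p hp => (key p hp).2) p hp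
  exact ⟨hd.1, hd.2.1, hp'.1, hp'.2, hq'.1, hq'.2⟩

end

/-! ### The twist potentials of a Maxwell field -/

/-- The twist potential of the magnetic field. -/
def lamPot (F : TwoForm) : ℝ × ℝ × ℝ → ℝ := axisIntegral (redP2 F)

/-- The twist potential of the electric field. -/
def etaPot (m a : ℝ) (F : TwoForm) : ℝ × ℝ × ℝ → ℝ := axisIntegral (redQ2 m a F)

/-- The twist potential energy density of a Maxwell field. -/
def maxwellDensity (m a s : ℝ) (F : TwoForm) : ℝ × ℝ × ℝ → ℝ :=
  potDensity m a s (redU F) (redV m a F) (redP1 F) (redP2 F) (redQ1 m a F) (redQ2 m a F)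
    (lamPot F) (etaPot m a F)

section
variable {m a : ℝ} (hm : 0 < m) (ha : |a| ≤ m) {F : TwoForm} (hF : IsAxisymmetricMaxwell m a F)
  (hc : HasCompactInitialData m a F)
include hm ha hF hc

lemma exists_vanishing_range_red (T : ℝ) : ∃ R₀ R₁, rPlus m a < R₀ ∧ ∀ t, |t| ≤ T →
    ∀ p ∈ orbit m a, p.1 < R₀ ∨ R₁ < p.1 → ReducedMaxwell.Vanishes (redU F) (redV m a F) (redP1 F)
      (redP2 F) (redQ1 m a F) (redQ2 m a F) (t, p.1, p.2) := by
  obtain ⟨ra, rb, hra, h0⟩ := exists_initial_range hm hc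
  exact ReducedMaxwell.exists_vanishing_range hm ha (reducedMaxwell_of_isAxisymmetricMaxwell hm ha hF)
    hra h0 T

lemma isPotential_lamPot :
    IsPotential m a (redP1 F) (redP2 F) (fun x => bgK m a x * redV m a F x) (lamPot F) := by
  have h := reducedMaxwell_of_isAxisymmetricMaxwell hm ha hF
  have sK := smooth_bgK hm ha
  refine isPotential_axisIntegral h.smooth_p₁ h.smooth_p₂ (sK.mul h.smooth_v) h.curl_p
    (fun x hx hθ => ?_) fun t => ?_
  · rw [dA_mul (sK.differentiableAt hx) (h.smooth_v.differentiableAt hx)]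
    exact h.dT_p₂ x hx hθ
  · obtain ⟨R₀, R₁, -, hv⟩ := exists_vanishing_range_red hm ha hF hc |t|
    exact ⟨R₁, fun r hr hr' θ hθ => (hv t le_rfl (r, θ) ⟨hr, hθ⟩ (Or.inr hr')).2.2.2.1⟩

lemma isPotential_etaPot :
    IsPotential m a (redQ1 m a F) (redQ2 m a F) (fun x => bgK m a x * redU F x) (etaPot m a F) := by
  have h := reducedMaxwell_of_isAxisymmetricMaxwell hm ha hF
  have sK := smooth_bgK hm ha
  refine isPotential_axisIntegral h.smooth_q₁ h.smooth_q₂ (sK.mul h.smooth_u) h.curl_q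
    (fun x hx hθ => ?_) fun t => ?_
  · rw [dA_mul (sK.differentiableAt hx) (h.smooth_u.differentiableAt hx)]
    exact h.dT_q₂ x hx hθ
  · obtain ⟨R₀, R₁, -, hv⟩ := exists_vanishing_range_red hm ha hF hc |t|
    exact ⟨R₁, fun r hr hr' θ hθ => (hv t le_rfl (r, θ) ⟨hr, hθ⟩ (Or.inr hr')).2.2.2.2.2⟩

lemma isTwistPotential_lamPot (t : ℝ) :
    IsTwistPotential m a (magnetic F t) fun r θ => lamPot F (t, r, θ) := by
  have h := reducedMaxwell_of_isAxisymmetricMaxwell hm ha hF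
  refine (isPotential_lamPot hm ha hF hc).isTwistPotential h.smooth_p₁.continuousOn
    h.smooth_p₂.continuousOn t (fun x _ => ?_) (fun x _ => ?_) <;> simp [magnetic_eq]

lemma isTwistPotential_etaPot (t : ℝ) :
    IsTwistPotential m a (electric m a F t) fun r θ => etaPot m a F (t, r, θ) := by
  have h := reducedMaxwell_of_isAxisymmetricMaxwell hm ha hF
  refine (isPotential_etaPot hm ha hF hc).isTwistPotential h.smooth_q₁.continuousOn
    h.smooth_q₂.continuousOn t (fun x hx => ?_) (fun x hx => ?_) <;>
  simp [electric_eq hm ha hx.1 (sin_pos_of_mem_orbit hx) hF]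

/-- The scalars enter only through the reconstructed F_{aφ}, which is ∂_a λ, so the convolution is
taken with the source of the known potential and `conv_eq` applies. -/
lemma lamRep_eq (t : ℝ) {x : ℝ × ℝ} (hx : x ∈ orbit m a) :
    IntegrableOn (convIntegrand m a (divq m a (scalarDLam m a (npScalars m a F t))) x.1 x.2)
      (orbit m a) ∧ lamRep m a (npScalars m a F t) x.1 x.2 = lamPot F (t, x.1, x.2) := by
  have h := reducedMaxwell_of_isAxisymmetricMaxwell hm ha hF
  obtain ⟨R₀, R₁, h0, hv⟩ := exists_vanishing_range_red hm ha hF hc |t|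
  exact conv_eq hm ha (isPotential_lamPot hm ha hF hc) h.smooth_p₁ h.smooth_p₂ h0
    (fun p hp hr => ⟨(hv t le_rfl p hp hr).2.2.1, (hv t le_rfl p hp hr).2.2.2.1⟩)
    (fun p hp => divq_eq hm ha h.smooth_p₁ h.smooth_p₂
      (fun q hq b => scalarDLam_npScalars hm ha hq.1 (sin_pos_of_mem_orbit hq) F t b) hp) hx

lemma etaRep_eq (t : ℝ) {x : ℝ × ℝ} (hx : x ∈ orbit m a) :
    IntegrableOn (convIntegrand m a (divq m a (scalarDEta m a (npScalars m a F t))) x.1 x.2)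
      (orbit m a) ∧ etaRep m a (npScalars m a F t) x.1 x.2 = etaPot m a F (t, x.1, x.2) := by
  have h := reducedMaxwell_of_isAxisymmetricMaxwell hm ha hF
  obtain ⟨R₀, R₁, h0, hv⟩ := exists_vanishing_range_red hm ha hF hc |t|
  exact conv_eq hm ha (isPotential_etaPot hm ha hF hc) h.smooth_q₁ h.smooth_q₂ h0
    (fun p hp hr => ⟨(hv t le_rfl p hp hr).2.2.2.2.1, (hv t le_rfl p hp hr).2.2.2.2.2⟩)
    (fun p hp => divq_eq hm ha h.smooth_q₁ h.smooth_q₂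
      (fun q hq b => scalarDEta_npScalars hm ha hq.1 (sin_pos_of_mem_orbit hq) hF t b) hp) hx

lemma npmDensity_eq (s t : ℝ) {p : ℝ × ℝ} (hp : p ∈ orbit m a) :
    npmDensity m a s (npScalars m a F t) p = maxwellDensity m a s F (t, p.1, p.2) := by
  have hs := sin_pos_of_mem_orbit hp
  have e2 : -electric m a F t 2 p.1 p.2 = redV m a F (t, p.1, p.2) := by
    simp [electric_eq hm ha hp.1 hs hF]
  rw [npmDensity, (etaRep_eq hm ha hF hc t hp).2, (lamRep_eq hm ha hF hc t hp).2,
    scalarLow_one_two hm ha hp.1 hs, scalarE_npScalars hm ha hp.1 hs, e2]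
  simp only [scalarDEta_npScalars hm ha hp.1 hs hF, scalarDLam_npScalars hm ha hp.1 hs]
  rfl

lemma npmEnergy_eq (s t : ℝ) : npmEnergy m a s (npScalars m a F t) =
    ∫ p in orbit m a, maxwellDensity m a s F (t, p.1, p.2) :=
  setIntegral_congr_fun (measurableSet_orbit m a) fun _ hp => npmDensity_eq hm ha hF hc s t hp

omit hm ha hF hc in
lemma pd_congr_orbit {f g : ℝ → ℝ → ℝ} (h : ∀ x ∈ orbit m a, f x.1 x.2 = g x.1 x.2) {x : ℝ × ℝ}
    (hx : x ∈ orbit m a) (b : Fin 2) : pd f b x.1 x.2 = pd g b x.1 x.2 := by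
  have e1 : deriv (fun r => f r x.2) x.1 = deriv (fun r => g r x.2) x.1 :=
    Filter.EventuallyEq.deriv_eq (by
      filter_upwards [lt_mem_nhds (show rPlus m a < x.1 from hx.1)] with r hr using h (r, x.2) ⟨hr, hx.2⟩)
  have e2 : deriv (fun θ => f x.1 θ) x.2 = deriv (fun θ => g x.1 θ) x.2 :=
    Filter.EventuallyEq.deriv_eq (by
      filter_upwards [isOpen_Ioo.mem_nhds hx.2] with θ hθ using h (x.1, θ) ⟨hx.1, hθ⟩)
  simp only [pd, e1, e2]

/-- Twist potentials are unique on the open orbit space, so their derivatives agree there with those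
of the potentials constructed by integration from the axis. -/
lemma twistEnergy_eq (s t : ℝ) {η l : ℝ → ℝ → ℝ} (hη : IsTwistPotential m a (electric m a F t) η)
    (hl : IsTwistPotential m a (magnetic F t) l) :
    twistEnergy m a s η l (magnetic F t 2) (fun r θ => -electric m a F t 2 r θ) =
      ∫ p in orbit m a, maxwellDensity m a s F (t, p.1, p.2) := by
  have iη := ((isTwistPotential_etaPot hm ha hF hc t).iff_eq η).1 hη
  have il := ((isTwistPotential_lamPot hm ha hF hc t).iff_eq l).1 hl
  refine setIntegral_congr_fun (measurableSet_orbit m a) fun p hp => ?_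
  have hs := sin_pos_of_mem_orbit hp
  have hη' := isPotential_etaPot hm ha hF hc
  have hl' := isPotential_lamPot hm ha hF hc
  have hθ := Ioo_subset_Icc_self hp.2
  have dη : (fun b => pd η b p.1 p.2) =
      ![Real.sin p.2 * redQ1 m a F (t, p.1, p.2), Real.sin p.2 * redQ2 m a F (t, p.1, p.2)] := by
    funext b
    rw [pd_congr_orbit (g := fun r θ => etaPot m a F (t, r, θ)) iη hp]
    fin_cases b
    · exact (hη'.dR t p.1 p.2 hp.1 hθ).deriv
    · exact (hη'.dA t p.1 p.2 hp.1).deriv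
  have dl : (fun b => pd l b p.1 p.2) =
      ![Real.sin p.2 * redP1 F (t, p.1, p.2), Real.sin p.2 * redP2 F (t, p.1, p.2)] := by
    funext b
    rw [pd_congr_orbit (g := fun r θ => lamPot F (t, r, θ)) il hp]
    fin_cases b
    · exact (hl'.dR t p.1 p.2 hp.1 hθ).deriv
    · exact (hl'.dA t p.1 p.2 hp.1).deriv
  have e1 : magnetic F t 2 p.1 p.2 = redU F (t, p.1, p.2) := by simp [magnetic_eq]
  have e2 : -electric m a F t 2 p.1 p.2 = redV m a F (t, p.1, p.2) := by
    simp [electric_eq hm ha hp.1 hs hF]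
  simp only [dη, dl, e1, e2, iη p hp, il p hp]
  rfl

/-- The local energy with interaction does not contain s, so one conservation law serves the whole
family of energies. -/
lemma maxwellDensity_properties (s t : ℝ) :
    IntegrableOn (fun p : ℝ × ℝ => maxwellDensity m a s F (t, p.1, p.2)) (orbit m a) ∧
    ContinuousOn (fun p : ℝ × ℝ => maxwellDensity m a s F (t, p.1, p.2)) (orbit m a) ∧
    ∀ t', ∫ p in orbit m a, maxwellDensity m a s F (t, p.1, p.2) =
      ∫ p in orbit m a, maxwellDensity m a s F (t', p.1, p.2) := by
  have h := reducedMaxwell_of_isAxisymmetricMaxwell hm ha hF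
  have hl := isPotential_lamPot hm ha hF hc
  have he := isPotential_etaPot hm ha hF hc
  have hV := exists_vanishing_range_red hm ha hF hc
  have key := fun t =>
    let ⟨_, _, h0, hv⟩ := hV |t|
    integral_potDensity hm ha h hl he s h0 (hv t le_rfl)
  exact ⟨(key t).1, (key t).2.1, fun t' => (key t).2.2.trans
    ((integral_energy_eq hm ha h hl hV t t').trans (key t').2.2.symm)⟩

lemma integral_maxwellDensity_eq_zero_iff {s : ℝ} (hs : s ∈ Icc 0 1) (t : ℝ) :
    ∫ p in orbit m a, maxwellDensity m a s F (t, p.1, p.2) = 0 ↔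
      ∀ i, ∀ x ∈ orbit m a, npScalars m a F t i x.1 x.2 = 0 := by
  have hl := isPotential_lamPot hm ha hF hc
  have he := isPotential_etaPot hm ha hF hc
  have hnp : (∀ i, ∀ x ∈ orbit m a, npScalars m a F t i x.1 x.2 = 0) ↔ ∀ x ∈ orbit m a,
      ReducedMaxwell.Vanishes (redU F) (redV m a F) (redP1 F) (redP2 F) (redQ1 m a F) (redQ2 m a F)
        (t, x.1, x.2) :=
    ⟨fun h x hx => (npScalars_eq_zero_iff hm ha hx.1 (sin_pos_of_mem_orbit hx) hF t).1 fun i => h i x hx,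
      fun h i x hx => (npScalars_eq_zero_iff hm ha hx.1 (sin_pos_of_mem_orbit hx) hF t).2 (h x hx) i⟩
  rw [hnp]
  constructor
  · intro hz
    obtain ⟨hi, hcont, -⟩ := maxwellDensity_properties hm ha hF hc s t
    obtain ⟨R₀, R₁, h0, hv⟩ := exists_vanishing_range_red hm ha hF hc |t|
    have z := eq_zero_of_integral_orbit_eq_zero hcont hi
      (fun p hp => density_nonneg hm ha hs hp.1 hp.2 _ _ _ _ _ _) hz
    exact vanishes_of_potDensity_eq_zero hm ha hs hl he h0
      (fun p hp hr => hl.eq_zero_of_vanishes (fun p hp hr => (hv t le_rfl p hp hr).2.2.2.1) p hp (Or.inl hr))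
      (fun p hp hr => he.eq_zero_of_vanishes (fun p hp hr => (hv t le_rfl p hp hr).2.2.2.2.2) p hp (Or.inl hr))
      z
  · intro h
    refine setIntegral_eq_zero_of_forall_eq_zero fun p hp => ?_
    have vl := hl.vanish t p.1 hp.1 (fun θ hθ => (h (p.1, θ) ⟨hp.1, hθ⟩).2.2.2.1) p.2
      (Ioo_subset_Icc_self hp.2)
    have ve := he.vanish t p.1 hp.1 (fun θ hθ => (h (p.1, θ) ⟨hp.1, hθ⟩).2.2.2.2.2) p.2
      (Ioo_subset_Icc_self hp.2)
    obtain ⟨z1, z2, z3, z4, z5, z6⟩ := h p hp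
    rw [maxwellDensity, potDensity, density_eq hm ha hp.1 hp.2 t]
    simp [weightSq, vl, ve, z1, z2, z3, z4, z5, z6]

/-- At a fixed time the fields vanish in a neighbourhood of the horizon, so the potentials are
identically zero there and the limits are trivial. -/
lemma tendsto_horizon (t : ℝ) {θ : ℝ} (hθ : θ ∈ Ioo 0 Real.pi) :
    Tendsto (fun r => etaRep m a (npScalars m a F t) r θ) (𝓝[>] (rPlus m a)) (𝓝 0) ∧
    Tendsto (fun r => lamRep m a (npScalars m a F t) r θ) (𝓝[>] (rPlus m a)) (𝓝 0) := by
  have hl := isPotential_lamPot hm ha hF hc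
  have he := isPotential_etaPot hm ha hF hc
  obtain ⟨R₀, R₁, h0, hv⟩ := exists_vanishing_range_red hm ha hF hc |t|
  constructor
  · refine tendsto_const_nhds.congr' ?_
    filter_upwards [Ioo_mem_nhdsGT h0] with r hr
    exact ((etaRep_eq hm ha hF hc t (x := (r, θ)) ⟨hr.1, hθ⟩).2.trans (he.eq_zero_of_vanishes
      (fun p hp hr => (hv t le_rfl p hp hr).2.2.2.2.2) (r, θ) ⟨hr.1, hθ⟩ (Or.inl hr.2))).symm
  · refine tendsto_const_nhds.congr' ?_
    filter_upwards [Ioo_mem_nhdsGT h0] with r hr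
    exact ((lamRep_eq hm ha hF hc t (x := (r, θ)) ⟨hr.1, hθ⟩).2.trans (hl.eq_zero_of_vanishes
      (fun p hp hr => (hv t le_rfl p hp hr).2.2.2.1) (r, θ) ⟨hr.1, hθ⟩ (Or.inl hr.2))).symm

end

end KerrMaxwell

end

/-! ### Representation formulas and energy, assembled -/

theorem mainTheorem2 (m a : ℝ) (hm : 0 < m) (ha : |a| ≤ m) (F : KerrMaxwell.TwoForm)
    (hF : KerrMaxwell.IsAxisymmetricMaxwell m a F)
    (hc : KerrMaxwell.HasCompactInitialData m a F) :
    KerrMaxwell.IsDirichletGreen KerrMaxwell.green ∧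
    (∀ t : ℝ,
      (∀ x ∈ KerrMaxwell.orbit m a,
        MeasureTheory.IntegrableOn (KerrMaxwell.convIntegrand m a (KerrMaxwell.divq m a
          (KerrMaxwell.scalarDEta m a (KerrMaxwell.npScalars m a F t))) x.1 x.2)
          (KerrMaxwell.orbit m a) ∧
        MeasureTheory.IntegrableOn (KerrMaxwell.convIntegrand m a (KerrMaxwell.divq m a
          (KerrMaxwell.scalarDLam m a (KerrMaxwell.npScalars m a F t))) x.1 x.2)
          (KerrMaxwell.orbit m a)) ∧
      (∀ η : ℝ → ℝ → ℝ,
        KerrMaxwell.IsTwistPotential m a (KerrMaxwell.electric m a F t) η ↔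
          ∀ x ∈ KerrMaxwell.orbit m a,
            η x.1 x.2 = KerrMaxwell.etaRep m a (KerrMaxwell.npScalars m a F t) x.1 x.2) ∧
      (∀ l : ℝ → ℝ → ℝ,
        KerrMaxwell.IsTwistPotential m a (KerrMaxwell.magnetic F t) l ↔
          ∀ x ∈ KerrMaxwell.orbit m a,
            l x.1 x.2 = KerrMaxwell.lamRep m a (KerrMaxwell.npScalars m a F t) x.1 x.2) ∧
      (∀ θ ∈ Set.Ioo 0 Real.pi,
        Filter.Tendsto (fun r => KerrMaxwell.etaRep m a (KerrMaxwell.npScalars m a F t) r θ)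
          (nhdsWithin (KerrMaxwell.rPlus m a) (Set.Ioi (KerrMaxwell.rPlus m a))) (nhds 0) ∧
        Filter.Tendsto (fun r => KerrMaxwell.lamRep m a (KerrMaxwell.npScalars m a F t) r θ)
          (nhdsWithin (KerrMaxwell.rPlus m a) (Set.Ioi (KerrMaxwell.rPlus m a))) (nhds 0))) ∧
    (∀ s ∈ Set.Icc (0 : ℝ) 1,
      (∀ t : ℝ,
        MeasureTheory.IntegrableOn
          (KerrMaxwell.npmDensity m a s (KerrMaxwell.npScalars m a F t))
          (KerrMaxwell.orbit m a) ∧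
        (∀ η l : ℝ → ℝ → ℝ,
          KerrMaxwell.IsTwistPotential m a (KerrMaxwell.electric m a F t) η →
          KerrMaxwell.IsTwistPotential m a (KerrMaxwell.magnetic F t) l →
          KerrMaxwell.npmEnergy m a s (KerrMaxwell.npScalars m a F t) =
            KerrMaxwell.twistEnergy m a s η l (KerrMaxwell.magnetic F t 2)
              (fun r θ => -KerrMaxwell.electric m a F t 2 r θ)) ∧
        0 ≤ KerrMaxwell.npmEnergy m a s (KerrMaxwell.npScalars m a F t) ∧
        (KerrMaxwell.npmEnergy m a s (KerrMaxwell.npScalars m a F t) = 0 ↔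
          ∀ i, ∀ x ∈ KerrMaxwell.orbit m a,
            KerrMaxwell.npScalars m a F t i x.1 x.2 = 0)) ∧
      ∀ t t' : ℝ, KerrMaxwell.npmEnergy m a s (KerrMaxwell.npScalars m a F t) =
        KerrMaxwell.npmEnergy m a s (KerrMaxwell.npScalars m a F t')) := by
  refine ⟨KerrMaxwell.isDirichletGreen_green, fun t => ⟨fun x hx =>
      ⟨(KerrMaxwell.etaRep_eq hm ha hF hc t hx).1, (KerrMaxwell.lamRep_eq hm ha hF hc t hx).1⟩,
    fun η => ?_, fun l => ?_, fun θ hθ => KerrMaxwell.tendsto_horizon hm ha hF hc t hθ⟩,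
    fun s hs => ⟨fun t => ⟨?_, fun η l hη hl => ?_, ?_, ?_⟩, fun t t' => ?_⟩⟩
  · rw [(KerrMaxwell.isTwistPotential_etaPot hm ha hF hc t).iff_eq η]
    exact forall₂_congr fun x hx => by rw [(KerrMaxwell.etaRep_eq hm ha hF hc t hx).2]
  · rw [(KerrMaxwell.isTwistPotential_lamPot hm ha hF hc t).iff_eq l]
    exact forall₂_congr fun x hx => by rw [(KerrMaxwell.lamRep_eq hm ha hF hc t hx).2]
  · exact (MeasureTheory.integrableOn_congr_fun
      (fun p hp => KerrMaxwell.npmDensity_eq hm ha hF hc s t hp)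
      (KerrMaxwell.measurableSet_orbit m a)).2
      (KerrMaxwell.maxwellDensity_properties hm ha hF hc s t).1
  · rw [KerrMaxwell.npmEnergy_eq hm ha hF hc, KerrMaxwell.twistEnergy_eq hm ha hF hc s t hη hl]
  · rw [KerrMaxwell.npmEnergy_eq hm ha hF hc]
    exact MeasureTheory.setIntegral_nonneg (KerrMaxwell.measurableSet_orbit m a) fun p hp =>
      KerrMaxwell.density_nonneg hm ha hs hp.1 hp.2 _ _ _ _ _ _
  · rw [KerrMaxwell.npmEnergy_eq hm ha hF hc]
    exact KerrMaxwell.integral_maxwellDensity_eq_zero_iff hm ha hF hc hs t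
  · rw [KerrMaxwell.npmEnergy_eq hm ha hF hc, KerrMaxwell.npmEnergy_eq hm ha hF hc]
    exact (KerrMaxwell.maxwellDensity_properties hm ha hF hc s t).2.2 t'
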